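/- Let $G$ be a finite group. All manifolds below are compact smooth $G$-manifolds with corners (the action is trivial on corners), and all maps are $G$-equivariant. \emph{Encased mirror cobordisms.} An encased mirror cobordism over $M$ (of dimension $n$) is given by its double: a compact smooth $(n+1)$-manifold with corners $\bar W$ with a smooth action of $G\times C_2$ and a smooth equivariant map (the encasing function) $\rho=(r,h)\colon \bar W\to M\times[-1,1]$, where $C_2$ acts on the target by reflecting $[-1,1]$, such that the fixed set of $C_2$ is $N=h^{-1}(0)$, $dh\neq 0$ along $N$, and $\rho$ restricts to a diffeomorphism from a neighbourhood of $\partial\bar W$ onto a neighbourhood of $\partial(M\times[-1,1])$ (its inverse is the collar). The cobordism is $W=h^{-1}[-1,0]$, with top $N$; it is an $h$-cobordism if moreover the inclusions of its top and of its bottom are $G$-homotopy equivalences (this is not needed in the theorem). An encased diffeomorphism $\bar W\to\bar W'$ of such objects over $M$ is a $(G\times C_2)$-equivariant diffeomorphism that commutes with the encasing functions and carries the collar germ to the collar germ. \emph{Stabilization.} A round bundle $p\colon D\to M$ is a smooth $G$-equivariant fibre bundle with fibre the closed unit ball of $\mathbb R^k$ and structure group the norm-preserving diffeomorphisms; it has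 a fibrewise norm $|\cdot|$. Let $e\colon D\to M'$ be an embedding of codimension zero. The stabilization $\mathrm{St}^{e}(\bar W)$ is the pushout of \[T=\{(y,s)\in M'\times[-1,1] : \text{if } y=e(x) \text{ then } x\in\partial D \text{ or } |x|^2+s^2\ge 1\}\] and \[\{(w,x,t)\in W\times D\times\mathbb R : r(w)=p(x),\ h(w)^2=|x|^2+t^2\},\] glued by $(w,x,t)\sim(e(x),t)$ for $w$ in the bottom or the sides of $W$. A point $(w,x,t)$ has associated point $w$. The encasing function is $(y,s)\mapsto (y,s)$, $(w,x,t)\mapsto(e(x),t)$, and $C_2$ acts by $s\mapsto -s$, $t\mapsto -t$. The smooth structure is that of $M'\times[-1,1]$, through the encasing function, on $T$ and the points associated to a collar neighbourhood; that of the fibre product where $h(w)<0$ and $w\notin \partial\bar W$; and, near a point with $h(w)=0$ and $w\notin\partial\bar W$, that of $U\times\mathbb R^k\times\mathbb R$ through $(w,x,t)\mapsto(u(w),v(x),t)$, where $v$ is the fibre coordinate of a norm-preserving trivialization of $D$ and $(u,h)\colon\bar W\to U\times\mathbb R$ is the inverse of a local bicollar of $N$, with $u$ invariant under $C_2$. An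 encased diffeomorphism $f$ induces $\mathrm{St}^e(f)$: $(w,x,t)\mapsto(f(w),x,t)$, and the identity on $T$. \textbf{Theorem.} (0) If $\bar W$ is an encased mirror cobordism over $M$, then $\mathrm{St}^e(\bar W)$ is one over $M'$, and $\mathrm{St}^e(f)$ is an encased diffeomorphism for every encased diffeomorphism $f$. (1) Let $e_{01}\colon D_{01}\to M_1$, $e_{12}\colon D_{12}\to M_2$, $e_{02}\colon D_{02}\to M_2$ be codimension zero embeddings of round bundles $D_{01}\to M_0$, $D_{12}\to M_1$, $D_{02}\to M_0$, such that $e_{02}$ identifies $D_{02}$ with the round composite $\{(x,x')\in D_{01}\times_{M_1}D_{12}: |x|^2+|x'|^2\le 1\}$ of $D_{12}|_{D_{01}}\to D_{01}\to M_0$. For every encased mirror cobordism $\bar W$ over $M_0$ (in particular for every encased mirror $h$-cobordism) there is exactly one map \[\Phi\colon \mathrm{St}^{e_{12}}\mathrm{St}^{e_{01}}(\bar W)\to \mathrm{St}^{e_{02}}(\bar W)\] that preserves the encasing functions and the associated point in $W$, when it exists. It is a homeomorphism, and it is an encased diffeomorphism; in particular it is smooth with smooth inverse. (2) $\Phi$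 is natural: for every encased diffeomorphism $f\colon\bar W\to\bar W'$ over $M_0$ one has $\Phi_{\bar W'}\circ \mathrm{St}^{e_{12}}\mathrm{St}^{e_{01}}(f)=\mathrm{St}^{e_{02}}(f)\circ\Phi_{\bar W}$. (3) $\Phi$ is associative: if $e_{02}$, $e_{13}$ are the round composites of $(e_{01},e_{12})$ and $(e_{12},e_{23})$, and $e_{03}$ is the round composite of $(e_{02},e_{23})$, then $e_{03}$ is also the round composite of $(e_{01},e_{13})$, and the two composites of canonical maps \[\mathrm{St}^{e_{23}}\mathrm{St}^{e_{12}}\mathrm{St}^{e_{01}}(\bar W)\to \mathrm{St}^{e_{03}}(\bar W),\] through $\mathrm{St}^{e_{23}}\mathrm{St}^{e_{02}}(\bar W)$ and through $\mathrm{St}^{e_{13}}\mathrm{St}^{e_{01}}(\bar W)$, agree. -/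

import Mathlib

open Set Topology
open scoped Manifold ContDiff

universe u v

namespace PolarStab

noncomputable section

/-! ### Compact G-manifolds with corners -/

/-- The local model `[0,∞)^n`. -/
abbrev Quad (n : ℕ) : Type := EuclideanQuadrant n

/-- Euclidean space of dimension `n`. -/
abbrev Eu (n : ℕ) : Type := EuclideanSpace ℝ (Fin n)

/-- `[0,∞)^n` as a model with corners. -/
abbrev quadModel (n : ℕ) : ModelWithCorners ℝ (Eu n) (Quad n) :=
  modelWithCornersEuclideanQuadrant n

/-- A compact smooth `G`-manifold with corners of dimension `n`: a compact Hausdorff smooth manifold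
modelled on `[0,∞)^n` (second countability is automatic) with a smooth action of `G` that is trivial
on corners. -/
structure GMfd (G : Type v) [Group G] (n : ℕ) where
  carrier : Type u
  [top : TopologicalSpace carrier]
  [charts : ChartedSpace (Quad n) carrier]
  [mfd : IsManifold (quadModel n) ∞ carrier]
  [compact : CompactSpace carrier]
  [t2 : T2Space carrier]
  [act : MulAction G carrier]
  smul_smooth : ∀ g : G, ContMDiff (quadModel n) (quadModel n) ∞ (fun x : carrier => g • x)
  /-- Near `x`, the local boundary components are the zero sets of those coordinates that vanish at
  `x`; the stabilizer of `x` maps each of them to itself. -/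
  trivial_on_corners : ∀ (g : G) (x : carrier), g • x = x → ∀ i : Fin n,
    (chartAt (Quad n) x x).1 i = 0 →
      ∀ᶠ y in 𝓝 x, (chartAt (Quad n) x y).1 i = 0 → (chartAt (Quad n) x (g • y)).1 i = 0

variable {G : Type v} [Group G]

instance {n : ℕ} : CoeSort (GMfd.{u} G n) (Type u) := ⟨GMfd.carrier⟩
instance {n : ℕ} (M : GMfd.{u} G n) : TopologicalSpace M := M.top
instance {n : ℕ} (M : GMfd.{u} G n) : ChartedSpace (Quad n) M := M.charts
instance {n : ℕ} (M : GMfd.{u} G n) : IsManifold (quadModel n) ∞ M := M.mfd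
instance {n : ℕ} (M : GMfd.{u} G n) : CompactSpace M := M.compact
instance {n : ℕ} (M : GMfd.{u} G n) : T2Space M := M.t2
instance {n : ℕ} (M : GMfd.{u} G n) : MulAction G M := M.act

/-- The boundary subspace: points of depth at least one. -/
def GMfd.bdry {n : ℕ} (M : GMfd.{u} G n) : Set M := (quadModel n).boundary M

theorem GMfd.smul_mem_bdry {n : ℕ} (M : GMfd.{u} G n) (g : G) (x : M) :
    g • x ∈ M.bdry ↔ x ∈ M.bdry := by
  let Φ : M ≃ₘ^∞⟮quadModel n, quadModel n⟯ M :=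
    { toEquiv := MulAction.toPerm g
      contMDiff_toFun := M.smul_smooth g
      contMDiff_invFun := M.smul_smooth g⁻¹ }
  have h := Φ.preimage_boundary (by simp)
  exact Set.ext_iff.mp h x

/-! ### Round bundles, round tubular neighbourhoods, round composites -/

/-- A norm-preserving smooth trivialization, over the open set `base`, of a map `p : D → M` with a
fibrewise norm `nrm`, the fibre being the closed unit ball of `ℝ^k`. -/
structure RoundTriv {n m : ℕ} (M : GMfd.{u} G n) (D : GMfd.{u} G m) (p : D → M) (nrm : D → ℝ)
    (k : ℕ) where
  base : Set M
  isOpen_base : IsOpen base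
  toFun : M × Eu k → D
  coord : D → Eu k
  smooth_toFun : ContMDiffOn ((quadModel n).prod 𝓘(ℝ, Eu k)) (quadModel m) ∞ toFun
    (base ×ˢ Metric.closedBall 0 1)
  smooth_coord : ContMDiffOn (quadModel m) 𝓘(ℝ, Eu k) ∞ coord (p ⁻¹' base)
  p_toFun : ∀ b ∈ base, ∀ v : Eu k, ‖v‖ ≤ 1 → p (toFun (b, v)) = b
  coord_toFun : ∀ b ∈ base, ∀ v : Eu k, ‖v‖ ≤ 1 → coord (toFun (b, v)) = v
  norm_coord : ∀ x, p x ∈ base → ‖coord x‖ = nrm x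
  norm_le : ∀ x, p x ∈ base → nrm x ≤ 1
  toFun_coord : ∀ x, p x ∈ base → toFun (p x, coord x) = x

/-- Stabilization data from `M` to `M'`: an equivariant round bundle `p : D → M` and an equivariant
codimension zero embedding `e : D → M'`.  The round structure (the class of trivializations related
by round diffeomorphisms) is recorded by the fibrewise norm: the preferred trivializations are those
that preserve the norm.  The group acts by round isomorphisms: it preserves `p` and the norm. -/
structure RoundTub {n m : ℕ} (M : GMfd.{u} G n) (M' : GMfd.{u} G m) where
  k : ℕ
  D : GMfd.{u} G m
  p : D → M
  nrm : D → ℝ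
  e : D → M'
  p_smooth : ContMDiff (quadModel m) (quadModel n) ∞ p
  p_smul : ∀ (g : G) x, p (g • x) = g • p x
  nrm_smul : ∀ (g : G) x, nrm (g • x) = nrm x
  locally_trivial : ∀ b : M, ∃ τ : RoundTriv M D p nrm k, b ∈ τ.base
  e_smul : ∀ (g : G) x, e (g • x) = g • e x
  e_smooth : ContMDiff (quadModel m) (quadModel m) ∞ e
  e_embedding : IsEmbedding e
  e_full_rank : ∀ x, Function.Bijective (mfderiv (quadModel m) (quadModel m) e x)

/-- `e₀₂` is the round composite of `e₀₁` and `e₁₂`: it identifies `D₀₂` with the set of pairs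
`(x, x')`, `x ∈ D₀₁`, `x' ∈ D₁₂` over `x`, with `|x|² + |x'|² ≤ 1`, with its projection to `M₀` and
its norm. -/
def IsRoundComposite {n₀ n₁ n₂ : ℕ} {M₀ : GMfd.{u} G n₀} {M₁ : GMfd.{u} G n₁} {M₂ : GMfd.{u} G n₂}
    (e₀₁ : RoundTub M₀ M₁) (e₁₂ : RoundTub M₁ M₂) (e₀₂ : RoundTub M₀ M₂) : Prop :=
  (∀ z : e₀₂.D, ∃ (x : e₀₁.D) (x' : e₁₂.D), e₁₂.p x' = e₀₁.e x ∧ e₀₂.e z = e₁₂.e x' ∧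
      e₀₂.p z = e₀₁.p x ∧ e₀₂.nrm z ^ 2 = e₀₁.nrm x ^ 2 + e₁₂.nrm x' ^ 2) ∧
  (∀ (x : e₀₁.D) (x' : e₁₂.D), e₁₂.p x' = e₀₁.e x → e₀₁.nrm x ^ 2 + e₁₂.nrm x' ^ 2 ≤ 1 →
      ∃ z : e₀₂.D, e₀₂.e z = e₁₂.e x')

/-! ### Encased mirror cobordisms -/

/-- The data of an encased mirror cobordism over `M`, presented by its double: `X` is the double,
`flip` the reflection, `(r, h) : X → M × [-1,1]` the (extended) encasing function, `bd` the boundary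
of `X`, and `atlas` a set of charts to `[0,∞)^(n+1)`.  The cobordism itself is the lower half
`{h ≤ 0}`, its top is `{h = 0}`.  Only the laws needed to write down stabilizations are recorded
here; the axioms are in `IsEncasedMirror`. -/
structure PreCob {n : ℕ} (M : GMfd.{u} G n) where
  X : Type u
  [top : TopologicalSpace X]
  [act : MulAction G X]
  flip : X → X
  r : X → M
  h : X → ℝ
  bd : Set X
  atlas : Set (OpenPartialHomeomorph X (Quad (n + 1)))
  r_smul : ∀ (g : G) x, r (g • x) = g • r x
  h_smul : ∀ (g : G) x, h (g • x) = h x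
  bd_smul : ∀ (g : G), ∀ x ∈ bd, g • x ∈ bd

namespace PreCob

variable {n : ℕ} {M : GMfd.{u} G n}

instance (W : PreCob M) : TopologicalSpace W.X := W.top
instance (W : PreCob M) : MulAction G W.X := W.act

/-- The encasing function. -/
def rho (W : PreCob M) (x : W.X) : M × ℝ := (W.r x, W.h x)

/-- A smooth map between (doubles of) cobordisms: continuous, and smooth in all charts. -/
def IsSmooth (W W' : PreCob M) (f : W.X → W'.X) : Prop :=
  Continuous f ∧ ∀ φ ∈ W.atlas, ∀ ψ ∈ W'.atlas,
    ContMDiffOn (quadModel (n + 1)) (quadModel (n + 1)) ∞ (ψ ∘ f ∘ φ.symm)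
      (φ.target ∩ φ.symm ⁻¹' (f ⁻¹' ψ.source))

/-- An open neighbourhood `O` of the boundary of the double on which the encasing function is a
diffeomorphism onto a (relatively) open neighbourhood of the boundary of `M × [-1,1]`.  The inverse
`c` is the lower collar, together with its reflection. -/
structure IsCollarNhd (W : PreCob M) (O : Set W.X) : Prop where
  isOpen : IsOpen O
  bd_subset : W.bd ⊆ O
  injOn : InjOn W.rho O
  image_open : ∃ V : Set (M × ℝ), IsOpen V ∧ W.rho '' O = V ∩ (univ ×ˢ Icc (-1) 1)
  image_bd : W.rho '' W.bd = {q | q.2 ∈ Icc (-1 : ℝ) 1 ∧ (q.1 ∈ M.bdry ∨ q.2 = -1 ∨ q.2 = 1)}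
  inverse : ∃ c : M × ℝ → W.X, (∀ x ∈ O, c (W.rho x) = x) ∧ ContinuousOn c (W.rho '' O) ∧
    ∀ φ ∈ W.atlas, ContMDiffOn ((quadModel n).prod 𝓘(ℝ, ℝ)) (quadModel (n + 1)) ∞ (φ ∘ c)
      (W.rho '' O ∩ c ⁻¹' φ.source)

/-- The axioms of an encased mirror cobordism over `M`. -/
structure IsEncasedMirror (W : PreCob M) : Prop where
  compact : CompactSpace W.X
  t2 : T2Space W.X
  /-- The charts cover the double and are smoothly compatible. -/
  covers : ∀ x, ∃ φ ∈ W.atlas, x ∈ φ.source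
  compatible : ∀ φ ∈ W.atlas, ∀ ψ ∈ W.atlas,
    φ.symm ≫ₕ ψ ∈ contDiffGroupoid ∞ (quadModel (n + 1))
  bd_eq : W.bd = {x | ∃ φ ∈ W.atlas, x ∈ φ.source ∧ ∃ i, (φ x).1 i = 0}
  /-- The smooth structure is `G × C₂`-equivariant. -/
  smul_smooth : ∀ g : G, W.IsSmooth W (fun x => g • x)
  flip_smooth : W.IsSmooth W W.flip
  flip_flip : ∀ x, W.flip (W.flip x) = x
  flip_smul : ∀ (g : G) x, W.flip (g • x) = g • W.flip x
  /-- The encasing function is smooth and commutes with the reflection. -/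
  r_smooth : ∀ φ ∈ W.atlas,
    ContMDiffOn (quadModel (n + 1)) (quadModel n) ∞ (W.r ∘ φ.symm) φ.target
  h_smooth : ∀ φ ∈ W.atlas,
    ContMDiffOn (quadModel (n + 1)) 𝓘(ℝ, ℝ) ∞ (W.h ∘ φ.symm) φ.target
  r_flip : ∀ x, W.r (W.flip x) = W.r x
  h_flip : ∀ x, W.h (W.flip x) = -W.h x
  h_mem : ∀ x, W.h x ∈ Icc (-1 : ℝ) 1
  /-- The two halves of the double are glued along the top, the zero set of the height function. -/
  flip_fixed : ∀ x, W.flip x = x ↔ W.h x = 0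
  /-- The height function has rank one along the top. -/
  h_rank : ∀ x, W.h x = 0 → ∀ φ ∈ W.atlas, x ∈ φ.source →
    mfderiv (quadModel (n + 1)) 𝓘(ℝ, ℝ) (W.h ∘ φ.symm) (φ x) ≠ 0
  /-- The encasing function is inverse to a collar near the boundary. -/
  collar : ∃ O, W.IsCollarNhd O

end PreCob

/-- A map of doubles of cobordisms over `M` that commutes with the encasing functions and preserves
the boundary. -/
structure PreHom {n : ℕ} {M : GMfd.{u} G n} (W W' : PreCob M) where
  toFun : W.X → W'.X
  map_r : ∀ x, W'.r (toFun x) = W.r x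
  map_h : ∀ x, W'.h (toFun x) = W.h x
  map_bd : ∀ x ∈ W.bd, toFun x ∈ W'.bd

instance {n : ℕ} {M : GMfd.{u} G n} (W W' : PreCob M) :
    CoeFun (PreHom W W') (fun _ => W.X → W'.X) := ⟨PreHom.toFun⟩

/-- An encased diffeomorphism: an equivariant diffeomorphism of the doubles, commuting with the
reflections and with the encasing functions (this is part of `PreHom`), that carries the germ of the
collar to the germ of the collar.  As the collars are inverse to the encasing functions, the last
condition says that points near the boundary go into any given collar neighbourhood. -/
structure PreHom.IsEncasedDiffeo {n : ℕ} {M : GMfd.{u} G n} {W W' : PreCob M}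
    (f : PreHom W W') : Prop where
  smul : ∀ (g : G) x, f (g • x) = g • f x
  flip : ∀ x, f (W.flip x) = W'.flip (f x)
  smooth : W.IsSmooth W' f
  inverse : ∃ f' : W'.X → W.X, Function.LeftInverse f' f ∧ Function.RightInverse f' f ∧
    W'.IsSmooth W f'
  collar : ∀ O', W'.IsCollarNhd O' → ∃ O, W.IsCollarNhd O ∧ MapsTo f O O'

/-! ### Polar stabilization: the space -/

section Stabilization

variable {n m : ℕ} {M : GMfd.{u} G n} {M' : GMfd.{u} G m} (e : RoundTub M M') (W : PreCob M)

/-- The trivial part of the stabilization: the points of `M' × [-1,1]` outside `e(int D) × [-1,1]`,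
together with the points of `D × [-1,1]` of norm at least one in `D(ν × ℝ)`. -/
def trivialPart : Set (M' × ℝ) :=
  {q | q.2 ∈ Icc (-1 : ℝ) 1 ∧ ∀ x : e.D, e.e x = q.1 → x ∈ e.D.bdry ∨ 1 ≤ e.nrm x ^ 2 + q.2 ^ 2}

/-- The nontrivial part: the fibre product over `M × [0,1]` of the lower half of the double, with
the map `(r, |h|)`, and `D(ν × ℝ)`, with the projection and the norm.  Points are triples
`(w, x, t)` with `w ∈ X`, `x ∈ D`, `t ∈ ℝ`. -/
def conePart : Set (W.X × e.D × ℝ) :=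
  {q | W.h q.1 ≤ 0 ∧ W.r q.1 = e.p q.2.1 ∧ W.h q.1 ^ 2 = e.nrm q.2.1 ^ 2 + q.2.2 ^ 2}

/-- The gluing relation: the nontrivial part is glued to the trivial part along the points `(w, x, t)`
with `w` on the bottom or the sides of the cobordism. -/
inductive Glue : trivialPart e ⊕ conePart e W → trivialPart e ⊕ conePart e W → Prop
  | glue (a : trivialPart e) (b : conePart e W) (hb : b.1.1 ∈ W.bd) (he : e.e b.1.2.1 = a.1.1)
      (ht : b.1.2.2 = a.1.2) : Glue (Sum.inl a) (Sum.inr b)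

/-- The stabilization, as a topological space: the pushout. -/
def StSpace : Type u := Quot (Glue e W)

instance : TopologicalSpace (StSpace e W) := inferInstanceAs (TopologicalSpace (Quot (Glue e W)))

variable {e W}

/-- The point of the stabilization given by a point of the trivial part. -/
def ofTrivial (a : trivialPart e) : StSpace e W := Quot.mk _ (Sum.inl a)

/-- The point of the stabilization given by a point of the nontrivial part. -/
def ofCone (b : conePart e W) : StSpace e W := Quot.mk _ (Sum.inr b)

variable (e W)

/-- `z` lies in the nontrivial region, with associated point `w` of the cobordism. -/
def Assoc (z : StSpace e W) (w : W.X) : Prop := ∃ b : conePart e W, ofCone b = z ∧ b.1.1 = w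

/-- The first component of the encasing function. -/
def stR : StSpace e W → M' :=
  Quot.lift (Sum.elim (fun a => a.1.1) (fun b => e.e b.1.2.1)) (by
    rintro _ _ ⟨a, b, hb, he, ht⟩; exact he.symm)

/-- The height function. -/
def stH : StSpace e W → ℝ :=
  Quot.lift (Sum.elim (fun a => a.1.2) (fun b => b.1.2.2)) (by
    rintro _ _ ⟨a, b, hb, he, ht⟩; exact ht.symm)

/-- The encasing function of the stabilization. -/
def stRho (z : StSpace e W) : M' × ℝ := (stR e W z, stH e W z)

/-- The reflection of the trivial part. -/
def flipTrivial (a : trivialPart e) : trivialPart e :=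
  ⟨(a.1.1, -a.1.2), ⟨neg_le_neg a.2.1.2, neg_le.mp a.2.1.1⟩, fun x hx => by
    simpa using a.2.2 x hx⟩

/-- The reflection of the nontrivial part. -/
def flipCone (b : conePart e W) : conePart e W :=
  ⟨(b.1.1, b.1.2.1, -b.1.2.2), ⟨b.2.1, b.2.2.1, by simpa using b.2.2.2⟩⟩

/-- The reflection flips the `ℝ`-direction. -/
def stFlip : StSpace e W → StSpace e W :=
  Quot.map (Sum.map (flipTrivial e) (flipCone e W)) (by
    rintro _ _ ⟨a, b, hb, he, ht⟩
    exact Glue.glue _ _ hb he (congrArg Neg.neg ht))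

/-- The action of `G` on the trivial part. -/
def smulTrivial (g : G) (a : trivialPart e) : trivialPart e :=
  ⟨(g • a.1.1, a.1.2), ⟨a.2.1, fun x hx => by
    have h := a.2.2 (g⁻¹ • x) (by rw [e.e_smul, hx, inv_smul_smul])
    rwa [GMfd.smul_mem_bdry, e.nrm_smul] at h⟩⟩

/-- The action of `G` on the nontrivial part. -/
def smulCone (g : G) (b : conePart e W) : conePart e W :=
  ⟨(g • b.1.1, g • b.1.2.1, b.1.2.2), ⟨by simpa only [W.h_smul] using b.2.1, by
    simpa only [W.r_smul, e.p_smul] using congrArg (g • ·) b.2.2.1, by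
    simpa only [W.h_smul, e.nrm_smul] using b.2.2.2⟩⟩

/-- The action of `G` on the stabilization. -/
def stSmul (g : G) : StSpace e W → StSpace e W :=
  Quot.map (Sum.map (smulTrivial e g) (smulCone e W g)) (by
    rintro _ _ ⟨a, b, hb, he, ht⟩
    exact Glue.glue _ _ (W.bd_smul g _ hb) ((e.e_smul g _).trans (congrArg (g • ·) he)) ht)

instance : MulAction G (StSpace e W) where
  smul := stSmul e W
  one_smul := by
    rintro ⟨a | b⟩
    · exact congrArg (Quot.mk _ ∘ Sum.inl) (Subtype.ext (Prod.ext (one_smul G _) rfl))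
    · exact congrArg (Quot.mk _ ∘ Sum.inr)
        (Subtype.ext (Prod.ext (one_smul G _) (Prod.ext (one_smul G _) rfl)))
  mul_smul := by
    rintro g g' ⟨a | b⟩
    · exact congrArg (Quot.mk _ ∘ Sum.inl) (Subtype.ext (Prod.ext (mul_smul g g' _) rfl))
    · exact congrArg (Quot.mk _ ∘ Sum.inr)
        (Subtype.ext (Prod.ext (mul_smul g g' _) (Prod.ext (mul_smul g g' _) rfl)))

/-- The boundary of the stabilization: the points of the trivial part on the boundary of
`M' × [-1,1]`. -/
def stBd : Set (StSpace e W) :=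
  {z | ∃ a : trivialPart e, ofTrivial a = z ∧ (a.1.1 ∈ M'.bdry ∨ a.1.2 = -1 ∨ a.1.2 = 1)}

/-! ### Polar stabilization: the smooth structure -/

/-- Mirror coordinates on the double, `w ↦ (u(w), h(w)) ∈ ℝ^n × ℝ`, with `u` invariant under the
reflection: the inverse of a bicollar of (an open subset of) the top, in coordinates on the top, on
which the height is the projection to the second factor. -/
structure IsMirrorCoord (β : OpenPartialHomeomorph W.X (Eu n × ℝ)) : Prop where
  smooth : ∀ φ ∈ W.atlas, ContMDiffOn (quadModel (n + 1)) 𝓘(ℝ, Eu n × ℝ) ∞ (β ∘ φ.symm)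
    (φ.target ∩ φ.symm ⁻¹' β.source)
  smooth_symm : ∀ φ ∈ W.atlas, ContMDiffOn 𝓘(ℝ, Eu n × ℝ) (quadModel (n + 1)) ∞ (φ ∘ β.symm)
    (β.target ∩ β.symm ⁻¹' φ.source)
  flip_mem : ∀ w ∈ β.source, W.flip w ∈ β.source
  flip_fst : ∀ w ∈ β.source, (β (W.flip w)).1 = (β w).1
  snd_eq : ∀ w ∈ β.source, (β w).2 = W.h w

end Stabilization

section SmoothCoord

variable {S : Type*} [TopologicalSpace S] {d : ℕ}
  {E H Z : Type*} [NormedAddCommGroup E] [NormedSpace ℝ E] [TopologicalSpace H]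
  [TopologicalSpace Z] [ChartedSpace H Z]

/-- On the part of its source in `Ω`, the chart `φ` is a diffeomorphism with respect to the smooth
structure that is induced on `Ω` by the injective coordinates `c : Ω → Z` into a smooth manifold `Z`:
the coordinates `c` are smooth functions of `φ`, and `φ` is a smooth function of the coordinates
`c` on the subset `c(Ω)` of `Z`. -/
def SmoothCoord (φ : OpenPartialHomeomorph S (Quad d)) (J : ModelWithCorners ℝ E H) (c : S → Z)
    (Ω : Set S) : Prop :=
  ContMDiffOn (quadModel d) J ∞ (c ∘ φ.symm) (φ.target ∩ φ.symm ⁻¹' Ω) ∧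
  ∃ F : Z → Quad d, ContMDiffOn J (quadModel d) ∞ F (c '' (φ.source ∩ Ω)) ∧
    ∀ x ∈ φ.source ∩ Ω, F (c x) = φ x

end SmoothCoord

section Stabilization

variable {n m : ℕ} {M : GMfd.{u} G n} {M' : GMfd.{u} G m} (e : RoundTub M M') (W : PreCob M)

/-- Charts on the trivial region and near the frontier: on the trivial part and on the points
associated to a collar neighbourhood of the cobordism, the smooth structure is that of
`M' × [-1,1]`, through the encasing function. -/
def SmoothAtCollar (φ : OpenPartialHomeomorph (StSpace e W) (Quad (m + 1)))
    (z : StSpace e W) : Prop :=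
  ∃ O, W.IsCollarNhd O ∧ ∃ Ω : Set (StSpace e W), IsOpen Ω ∧ z ∈ Ω ∧
    Ω ⊆ {y | (∃ a : trivialPart e, ofTrivial a = y) ∨ ∃ w ∈ O, Assoc e W y w} ∧
    SmoothCoord φ ((quadModel m).prod 𝓘(ℝ, ℝ)) (stRho e W) Ω

/-- Charts on the nontrivial region away from the cone locus and from the frontier and sides: the
smooth structure is that of the fibre product, a submanifold of the product of the cobordism, `D`
and `ℝ`. -/
def SmoothAtRegular (φ : OpenPartialHomeomorph (StSpace e W) (Quad (m + 1)))
    (z : StSpace e W) : Prop :=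
  ∃ ψ ∈ W.atlas, ∃ Ω : Set (StSpace e W), IsOpen Ω ∧ z ∈ Ω ∧
    (∀ y ∈ Ω, ∃ w, Assoc e W y w ∧ w ∈ ψ.source ∧ w ∉ W.bd ∧ W.h w < 0) ∧
    ∃ c : StSpace e W → Quad (n + 1) × (e.D × ℝ),
      (∀ b : conePart e W, ofCone b ∈ Ω → c (ofCone b) = (ψ b.1.1, b.1.2)) ∧
      SmoothCoord φ ((quadModel (n + 1)).prod ((quadModel m).prod 𝓘(ℝ, ℝ))) c Ω

/-- Charts near the cone locus, away from the sides: for mirror coordinates `β = (u, h)` on the double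
of the cobordism and a round trivialization of `D`, the smooth structure is that of
`ℝ^n × (ℝ^k × ℝ)`, through `(w, x, t) ↦ (u(w), v(x), t)`. -/
def SmoothAtCone (φ : OpenPartialHomeomorph (StSpace e W) (Quad (m + 1)))
    (z : StSpace e W) : Prop :=
  ∃ β : OpenPartialHomeomorph W.X (Eu n × ℝ), IsMirrorCoord W β ∧
    ∃ τ : RoundTriv M e.D e.p e.nrm e.k, ∃ Ω : Set (StSpace e W), IsOpen Ω ∧ z ∈ Ω ∧
    (∀ y ∈ Ω, ∃ w, Assoc e W y w ∧ w ∈ β.source ∧ w ∉ W.bd ∧ W.r w ∈ τ.base) ∧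
    ∃ c : StSpace e W → Eu n × (Eu e.k × ℝ),
      (∀ b : conePart e W, ofCone b ∈ Ω →
        c (ofCone b) = ((β b.1.1).1, (τ.coord b.1.2.1, b.1.2.2))) ∧
      SmoothCoord φ 𝓘(ℝ, Eu n × (Eu e.k × ℝ)) c Ω

/-- The smooth structure of the stabilization: a chart is smooth if it is smooth at every point of
its source for one of the three descriptions above. -/
def stAtlas : Set (OpenPartialHomeomorph (StSpace e W) (Quad (m + 1))) :=
  {φ | ∀ z ∈ φ.source, SmoothAtCollar e W φ z ∨ SmoothAtRegular e W φ z ∨ SmoothAtCone e W φ z}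

/-- The polar stabilization along `e`, over `M'`. -/
def St : PreCob M' where
  X := StSpace e W
  flip := stFlip e W
  r := stR e W
  h := stH e W
  bd := stBd e W
  atlas := stAtlas e W
  r_smul := by
    rintro g ⟨a | b⟩
    · rfl
    · exact e.e_smul g _
  h_smul := by
    rintro g ⟨a | b⟩ <;> rfl
  bd_smul := by
    rintro g _ ⟨a, rfl, h⟩
    exact ⟨smulTrivial e g a, rfl, by simpa only [smulTrivial, GMfd.smul_mem_bdry] using h⟩

variable {W} {W' : PreCob M}

/-- The map induced on the nontrivial part by a map of cobordisms. -/
def PreHom.mapCone (f : PreHom W W') (b : conePart e W) : conePart e W' :=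
  ⟨(f b.1.1, b.1.2), ⟨by simpa only [f.map_h] using b.2.1, by simpa only [f.map_r] using b.2.2.1, by
    simpa only [f.map_h] using b.2.2.2⟩⟩

/-- The map induced on stabilizations: `(w, x, t) ↦ (f w, x, t)` on the nontrivial part, and the
identity on the trivial part. -/
def PreHom.stab (f : PreHom W W') : PreHom (St e W) (St e W') where
  toFun := Quot.map (Sum.map id (f.mapCone e)) (by
    rintro _ _ ⟨a, b, hb, he, ht⟩
    exact Glue.glue _ _ (f.map_bd _ hb) he ht)
  map_r := by rintro ⟨a | b⟩ <;> rfl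
  map_h := by rintro ⟨a | b⟩ <;> rfl
  map_bd := by
    rintro _ ⟨a, rfl, h⟩
    exact ⟨a, rfl, h⟩

end Stabilization

/-! ### The canonical map -/

/-- The defining property of the canonical map from the iterated stabilization to the single one: it
preserves the encasing function, and the associated point of the original cobordism when it exists
(a point of the iterated stabilization has associated point `w` if its associated point `w₁` in the
first stabilization exists and has associated point `w`). -/
structure IsCanonical {n₀ n₁ n₂ : ℕ} {M₀ : GMfd.{u} G n₀} {M₁ : GMfd.{u} G n₁}
    {M₂ : GMfd.{u} G n₂} (e₀₁ : RoundTub M₀ M₁) (e₁₂ : RoundTub M₁ M₂) (e₀₂ : RoundTub M₀ M₂)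
    (W : PreCob M₀) (F : (St e₁₂ (St e₀₁ W)).X → (St e₀₂ W).X) : Prop where
  map_r : ∀ z, (St e₀₂ W).r (F z) = (St e₁₂ (St e₀₁ W)).r z
  map_h : ∀ z, (St e₀₂ W).h (F z) = (St e₁₂ (St e₀₁ W)).h z
  map_assoc : ∀ z w,
    Assoc e₀₂ W (F z) w ↔ ∃ w₁, Assoc e₁₂ (St e₀₁ W) z w₁ ∧ Assoc e₀₁ W w₁ w

end

end PolarStab

/-! Smoothness is handled through a single relation, `SmoothVia`: near a point, one function factors
smoothly through another. Every comparison of charts, maps and coordinates becomes a chain of such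
factorizations, and the relation can be moved along continuous maps and along maps that are open at
the point.

The analytic core is Whitney's theorem with parameters, `contDiff_comp_norm_of_even`: if f(u, h) is
smooth and even in h, then f(u, |y|) is smooth in (u, y). The height of the point w associated to
(w, x, t) is the negative radius -√(|x|² + t²), which is not smooth at the cone locus.
Reflection-invariant functions of w are even in the height, in coordinates adapted to the
reflection, so they do become smooth functions of (u, v, t).

This leads to a description of the smooth structure of the nontrivial part that does not depend on a
choice among the three kinds of charts. `CoordVia` asks that x, t and all smooth functions of w
(reflection-invariant ones if h(w) = 0) are smooth functions of the given coordinates. The three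
prescribed coordinate systems satisfy it; hence so do all charts of the stabilization, and every
such chart is a smooth function of any coordinates that satisfy it (`isCoord_of_mem_stAtlas`,
`CoordVia.smoothVia_chart`). Compatibility of charts is an immediate consequence. On the trivial
part and over a collar neighbourhood, the encasing function plays the same role, because it is
injective there with continuous inverse (`injOn_stRho_collarRegion`, `exists_collar_inverse`).
Charts exist by explicit constructions: mirror coordinates at the cone locus, a graph over a
hyperplane of the fibre elsewhere, and a product chart in the collar region.

The canonical map is unique because a point of a stabilization is determined by its encasing value
and its associated point (`st_ext`). It exists because the inner points of both sides are
parametrized by the same triples: with z = (x, x') in the round composite, (w, z, t) is matched with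
((w, x, s), x', t), where s = -√(|x'|² + t²), and |x|² + |x'|² + t² is the same sum of squares
grouped in two ways. The remaining points are matched by their encasing values. The inverse
bijection is visibly continuous, and compactness makes it a homeomorphism.

Smoothness at inner points is again a comparison of the two `CoordVia` conditions (`coordVia_split`,
`isCoord_of_split`). The critical case is s = 0, a point over the top of the first stabilization:
functions that are invariant under its reflection are even in s, and Whitney's theorem applies a
second time. Naturality, associativity and equivariance are formal, by comparing encasing values and
associated points. -/

open Filter
open scoped InnerProductSpace

namespace PolarStab

noncomputable section

/-! ### Functions that depend smoothly on given coordinates -/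

section SmoothVia

variable {S S' : Type*} [TopologicalSpace S] [TopologicalSpace S']
  {E H Z : Type*} [NormedAddCommGroup E] [NormedSpace ℝ E] [TopologicalSpace H]
  [TopologicalSpace Z] [ChartedSpace H Z] {J : ModelWithCorners ℝ E H}
  {E' H' Z' : Type*} [NormedAddCommGroup E'] [NormedSpace ℝ E'] [TopologicalSpace H']
  [TopologicalSpace Z'] [ChartedSpace H' Z'] {J' : ModelWithCorners ℝ E' H'}
  {E'' H'' Z'' : Type*} [NormedAddCommGroup E''] [NormedSpace ℝ E''] [TopologicalSpace H'']
  [TopologicalSpace Z''] [ChartedSpace H'' Z''] {J'' : ModelWithCorners ℝ E'' H''}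

/-- Near `z`, the function `g` is a smooth function of the coordinates `c`. -/
def SmoothVia (J : ModelWithCorners ℝ E H) (c : S → Z) (J' : ModelWithCorners ℝ E' H')
    (g : S → Z') (z : S) : Prop :=
  ∃ Ω ∈ 𝓝 z, ∃ T : Z → Z', ContMDiffWithinAt J J' ∞ T (c '' Ω) (c z) ∧ ∀ y ∈ Ω, T (c y) = g y

variable {c : S → Z} {g : S → Z'} {k : S → Z''} {z : S}

theorem SmoothVia.refl (J : ModelWithCorners ℝ E H) (c : S → Z) (z : S) :
    SmoothVia J c J c z :=
  ⟨univ, univ_mem, id, contMDiffWithinAt_id, fun _ _ => rfl⟩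

/-- Pulling back along a map into the domain on which the coordinates become smooth. -/
theorem SmoothVia.contMDiffWithinAt_comp (h : SmoothVia J c J' g z) {q : Z'' → S} {s : Set Z''}
    {a : Z''} (hz : q a = z) (hq : ContinuousWithinAt q s a)
    (hc : ContMDiffWithinAt J'' J ∞ (c ∘ q) s a) : ContMDiffWithinAt J'' J' ∞ (g ∘ q) s a := by
  subst hz
  obtain ⟨Ω, hΩ, T, hT, hTg⟩ := h
  have hpre : q ⁻¹' Ω ∈ 𝓝[s] a := hq hΩ
  have h1 : ContMDiffWithinAt J'' J' ∞ (T ∘ (c ∘ q)) (s ∩ q ⁻¹' Ω) a :=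
    ContMDiffWithinAt.comp a hT (hc.mono inter_subset_left)
      (fun y hy => mem_image_of_mem c hy.2)
  have h2 : ContMDiffWithinAt J'' J' ∞ (T ∘ (c ∘ q)) s a := by
    rwa [contMDiffWithinAt_inter' hpre] at h1
  refine h2.congr_of_eventuallyEq ?_ (hTg _ (mem_of_mem_nhds hΩ)).symm
  filter_upwards [hpre] with y hy using (hTg _ hy).symm

theorem SmoothVia.contMDiffAt_comp (h : SmoothVia J c J' g z) {q : Z'' → S}
    {a : Z''} (hz : q a = z) (hq : ContinuousAt q a)
    (hc : ContMDiffAt J'' J ∞ (c ∘ q) a) : ContMDiffAt J'' J' ∞ (g ∘ q) a :=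
  h.contMDiffWithinAt_comp hz hq.continuousWithinAt hc

theorem SmoothVia.comp_within (h : SmoothVia J c J' g z) {T : Z' → Z''} {s : Set Z'}
    (hT : ContMDiffWithinAt J' J'' ∞ T s (g z)) (hs : ∀ᶠ y in 𝓝 z, g y ∈ s)
    (hk : ∀ᶠ y in 𝓝 z, T (g y) = k y) : SmoothVia J c J'' k z := by
  obtain ⟨Ω, hΩ, R, hR, hRg⟩ := h
  refine ⟨Ω ∩ {y | g y ∈ s ∧ T (g y) = k y}, inter_mem hΩ (hs.and hk), T ∘ R, ?_, ?_⟩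
  · refine ContMDiffWithinAt.comp (t := s) _ ?_ (hR.mono (image_mono inter_subset_left)) ?_
    · rwa [hRg _ (mem_of_mem_nhds hΩ)]
    · rintro _ ⟨y, hy, rfl⟩
      simpa [hRg _ hy.1] using hy.2.1
  · intro y hy
    change T (R (c y)) = k y
    rw [hRg _ hy.1]; exact hy.2.2

theorem SmoothVia.comp (h : SmoothVia J c J' g z) {T : Z' → Z''}
    (hT : ContMDiffAt J' J'' ∞ T (g z)) : SmoothVia J c J'' (fun y => T (g y)) z :=
  h.comp_within (s := univ) hT (Eventually.of_forall fun _ => mem_univ _)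
    (Eventually.of_forall fun _ => rfl)

theorem SmoothVia.trans (h : SmoothVia J c J' g z) (h' : SmoothVia J' g J'' k z) :
    SmoothVia J c J'' k z := by
  obtain ⟨Ω, hΩ, T, hT, hTg⟩ := h'
  exact h.comp_within hT (by filter_upwards [hΩ] with y hy using mem_image_of_mem g hy)
    (by filter_upwards [hΩ] with y hy using hTg y hy)

theorem SmoothVia.congr {g' : S → Z'} (h : SmoothVia J c J' g z) (hg : g =ᶠ[𝓝 z] g') :
    SmoothVia J c J' g' z := by
  obtain ⟨Ω, hΩ, T, hT, hTg⟩ := h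
  exact ⟨Ω ∩ {y | g y = g' y}, inter_mem hΩ hg, T, hT.mono (image_mono inter_subset_left),
    fun y hy => (hTg y hy.1).trans hy.2⟩

theorem SmoothVia.congr_left {c' : S → Z} (h : SmoothVia J c J' g z) (hc : c =ᶠ[𝓝 z] c') :
    SmoothVia J c' J' g z :=
  ((SmoothVia.refl J c' z).congr hc.symm).trans h

theorem SmoothVia.prodMk (hg : SmoothVia J c J' g z) (hk : SmoothVia J c J'' k z) :
    SmoothVia J c (J'.prod J'') (fun y => (g y, k y)) z := by
  obtain ⟨Ω, hΩ, T, hT, hTg⟩ := hg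
  obtain ⟨Ω', hΩ', T', hT', hTk⟩ := hk
  refine ⟨Ω ∩ Ω', inter_mem hΩ hΩ', fun q => (T q, T' q), ?_, fun y hy => ?_⟩
  · exact (hT.mono (image_mono inter_subset_left)).prodMk (hT'.mono (image_mono inter_subset_right))
  · exact Prod.ext (hTg y hy.1) (hTk y hy.2)

theorem SmoothVia.fst {g : S → Z' × Z''} (h : SmoothVia J c (J'.prod J'') g z) :
    SmoothVia J c J' (fun y => (g y).1) z :=
  h.comp contMDiffAt_fst

theorem SmoothVia.snd {g : S → Z' × Z''} (h : SmoothVia J c (J'.prod J'') g z) :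
    SmoothVia J c J'' (fun y => (g y).2) z :=
  h.comp contMDiffAt_snd

/-- Smooth dependence can be pulled back along continuous maps. -/
theorem SmoothVia.comp_left {f : S' → S} {z' : S'} (h : SmoothVia J c J' g z) (hz : f z' = z)
    (hf : ContinuousAt f z') : SmoothVia J (fun y => c (f y)) J' (fun y => g (f y)) z' := by
  subst hz
  obtain ⟨Ω, hΩ, T, hT, hTg⟩ := h
  refine ⟨f ⁻¹' Ω, hf hΩ, T, hT.mono ?_, fun y hy => hTg _ hy⟩
  rintro _ ⟨y, hy, rfl⟩
  exact mem_image_of_mem c hy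

/-- Smooth dependence can be pushed forward along maps that are open at the point. -/
theorem SmoothVia.of_comp_left {f : S' → S} {z' : S'} (hf : 𝓝 (f z') ≤ map f (𝓝 z'))
    (h : SmoothVia J (fun y => c (f y)) J' (fun y => g (f y)) z') : SmoothVia J c J' g (f z') := by
  obtain ⟨Ω, hΩ, T, hT, hTg⟩ := h
  refine ⟨f '' Ω, hf (image_mem_map hΩ), T, ?_, ?_⟩
  · rwa [image_image]
  · rintro _ ⟨y, hy, rfl⟩
    exact hTg y hy

theorem SmoothVia.continuousAt (h : SmoothVia J c J' g z) (hc : ContinuousAt c z) :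
    ContinuousAt g z := by
  obtain ⟨Ω, hΩ, T, hT, hTg⟩ := h
  have h1 : Tendsto c (𝓝 z) (𝓝[c '' Ω] (c z)) :=
    tendsto_nhdsWithin_iff.2 ⟨hc, by filter_upwards [hΩ] with y hy using mem_image_of_mem c hy⟩
  have h2 := hT.continuousWithinAt.tendsto.comp h1
  rw [hTg z (mem_of_mem_nhds hΩ)] at h2
  refine h2.congr' ?_
  filter_upwards [hΩ] with y hy using hTg y hy

/-- In terms of a chart, smooth dependence is smoothness of the local representative. -/
theorem smoothVia_chart_iff {φ : OpenPartialHomeomorph S H} (hz : z ∈ φ.source) :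
    SmoothVia J φ J' g z ↔ ContMDiffAt J J' ∞ (g ∘ φ.symm) (φ z) := by
  constructor
  · intro h
    refine h.contMDiffAt_comp (φ.left_inv hz) (φ.continuousAt_symm (φ.map_source hz)) ?_
    refine contMDiffAt_id.congr_of_eventuallyEq ?_
    filter_upwards [φ.open_target.mem_nhds (φ.map_source hz)] with y hy using φ.right_inv hy
  · intro h
    refine ⟨φ.source, φ.open_source.mem_nhds hz, _, h.contMDiffWithinAt, fun y hy => ?_⟩
    simp [φ.left_inv hy]

/-- Near a point, a chart that is certified by coordinates and these coordinates are
interchangeable; in this form the definition of the atlas is used throughout. -/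
theorem SmoothVia.of_smoothCoord {d : ℕ} {φ : OpenPartialHomeomorph S (Quad d)} {Ω : Set S}
    (h : SmoothCoord φ J c Ω) (hΩ : Ω ∈ 𝓝 z) (hz : z ∈ φ.source) :
    SmoothVia (quadModel d) φ J c z ∧ SmoothVia J c (quadModel d) φ z := by
  obtain ⟨h1, F, hF, hFc⟩ := h
  have hs : φ.source ∩ Ω ∈ 𝓝 z := inter_mem (φ.open_source.mem_nhds hz) hΩ
  refine ⟨?_, φ.source ∩ Ω, hs, F, hF _ (mem_image_of_mem c (mem_of_mem_nhds hs)), hFc⟩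
  rw [smoothVia_chart_iff hz]
  refine (h1 _ ⟨φ.map_source hz, ?_⟩).contMDiffAt ?_
  · simpa [φ.left_inv hz] using mem_of_mem_nhds hΩ
  · refine inter_mem (φ.open_target.mem_nhds (φ.map_source hz)) ?_
    refine φ.continuousAt_symm (φ.map_source hz) ?_
    rwa [φ.left_inv hz]

/-- Smoothness into the quadrant is smoothness into Euclidean space. -/
theorem smoothVia_quad_iff {d : ℕ} {g : S → Quad d} :
    SmoothVia J c (quadModel d) g z ↔ SmoothVia J c 𝓘(ℝ, Eu d) (fun y => (g y).1) z := by
  constructor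
  · intro h
    exact h.comp (quadModel d).contMDiff.contMDiffAt
  · intro h
    refine h.comp_within (s := range (quadModel d)) (T := (quadModel d).symm)
      ((quadModel d).contMDiffOn_symm _ (mem_range_self (g z)))
      (Eventually.of_forall fun y => mem_range_self (g y))
      (Eventually.of_forall fun y => (quadModel d).left_inv (g y))

/-- For vector spaces the target carries the model of the product space, and not the product of the
models. -/
theorem SmoothVia.prodMk_space {F F' : Type*} [NormedAddCommGroup F] [NormedSpace ℝ F]
    [NormedAddCommGroup F'] [NormedSpace ℝ F'] {g : S → F} {k : S → F'}
    (hg : SmoothVia J c 𝓘(ℝ, F) g z) (hk : SmoothVia J c 𝓘(ℝ, F') k z) :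
    SmoothVia J c 𝓘(ℝ, F × F') (fun y => (g y, k y)) z := by
  obtain ⟨Ω, hΩ, T, hT, hTg⟩ := hg
  obtain ⟨Ω', hΩ', T', hT', hTk⟩ := hk
  refine ⟨Ω ∩ Ω', inter_mem hΩ hΩ', fun q => (T q, T' q), ?_, fun y hy => ?_⟩
  · exact (hT.mono (image_mono inter_subset_left)).prodMk_space
      (hT'.mono (image_mono inter_subset_right))
  · exact Prod.ext (hTg y hy.1) (hTk y hy.2)

theorem SmoothVia.comp_contDiffAt {F F' : Type*} [NormedAddCommGroup F] [NormedSpace ℝ F]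
    [NormedAddCommGroup F'] [NormedSpace ℝ F'] {g : S → F} (hg : SmoothVia J c 𝓘(ℝ, F) g z)
    {T : F → F'} (hT : ContDiffAt ℝ ∞ T (g z)) : SmoothVia J c 𝓘(ℝ, F') (fun y => T (g y)) z :=
  hg.comp hT.contMDiffAt

end SmoothVia

/-! ### Even functions of the height are smooth functions of the polar coordinates -/

section Even

variable {E : Type w} [NormedAddCommGroup E] [NormedSpace ℝ E] [FiniteDimensional ℝ E]

/-- Differentiation under the integral sign, by induction on the order. The target is quantified
inside the induction because the derivative takes values in a space of linear maps. -/
theorem contDiff_intervalIntegral (n : ℕ) :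
    ∀ {G : Type w} [NormedAddCommGroup G] [NormedSpace ℝ G] [CompleteSpace G] {K : E × ℝ → G},
      ContDiff ℝ n K → ContDiff ℝ n (fun x => ∫ s in (0 : ℝ)..1, K (x, s)) := by
  have : ProperSpace E := FiniteDimensional.proper_real E
  induction n with
  | zero =>
    intro G _ _ _ K hK
    rw [Nat.cast_zero, contDiff_zero] at hK ⊢
    exact intervalIntegral.continuous_parametric_intervalIntegral_of_continuous' (by
      simpa [Function.uncurry_def] using hK) 0 1
  | succ n ih =>
    intro G _ _ _ K hK
    have hK1 : ContDiff ℝ 1 K := hK.of_le (by exact_mod_cast Nat.le_add_left 1 n)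
    have hd : Differentiable ℝ K := hK1.differentiable (by simp)
    let K' : E × ℝ → E →L[ℝ] G := fun q => (fderiv ℝ K q).comp (ContinuousLinearMap.inl ℝ E ℝ)
    have hK' : ContDiff ℝ n K' := by
      refine ContDiff.clm_comp ?_ contDiff_const
      exact hK.fderiv_right (by exact_mod_cast le_rfl)
    have hder : ∀ x s, HasFDerivAt (fun x => K (x, s)) (K' (x, s)) x := by
      intro x s
      exact (hd (x, s)).hasFDerivAt.comp x (hasFDerivAt_prodMk_left x s)
    rw [Nat.cast_add, Nat.cast_one, contDiff_succ_iff_hasFDerivAt]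
    refine ⟨fun x => ∫ s in (0 : ℝ)..1, K' (x, s), ih hK', fun x => ?_⟩
    -- A bound on a compact neighbourhood provides the constant dominating function.
    have hc : IsCompact (Metric.closedBall x 1 ×ˢ Icc (0 : ℝ) 1) :=
      (isCompact_closedBall x 1).prod isCompact_Icc
    obtain ⟨C, hC⟩ := hc.exists_bound_of_continuousOn hK'.continuous.continuousOn
    have hcont : ∀ x, Continuous fun s => K (x, s) := fun x =>
      hK.continuous.comp (continuous_const.prodMk continuous_id)
    have hcont' : ∀ x, Continuous fun s => K' (x, s) := fun x =>
      hK'.continuous.comp (continuous_const.prodMk continuous_id)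
    refine (intervalIntegral.hasFDerivAt_integral_of_dominated_of_fderiv_le
      (F := fun x s => K (x, s)) (F' := fun x s => K' (x, s)) (bound := fun _ => C)
      (Metric.closedBall_mem_nhds x one_pos) ?_ ?_ ?_ ?_ ?_ ?_)
    · exact Eventually.of_forall fun x => (hcont x).aestronglyMeasurable
    · exact (hcont x).intervalIntegrable _ _
    · exact (hcont' x).aestronglyMeasurable
    · refine Eventually.of_forall fun s hs y hy => hC (y, s) ⟨hy, ?_⟩
      rw [uIoc_of_le zero_le_one] at hs
      exact ⟨hs.1.le, hs.2⟩
    · exact intervalIntegrable_const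
    · exact Eventually.of_forall fun s _ y _ => hder y s

/-- A smooth function that is odd in the last variable is divisible by that variable. -/
theorem exists_eq_smul_of_odd {G : Type w} [NormedAddCommGroup G] [NormedSpace ℝ G]
    [CompleteSpace G] {n : ℕ} {f : E × ℝ → G} (hf : ContDiff ℝ (n + 1 : ℕ) f)
    (hodd : ∀ u h, f (u, -h) = -f (u, h)) :
    ∃ g : E × ℝ → G, ContDiff ℝ n g ∧ (∀ u h, g (u, -h) = g (u, h)) ∧
      ∀ u h, f (u, h) = h • g (u, h) := by
  let d : E × ℝ → G := fun q => fderiv ℝ f q (0, 1)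
  have hd : ContDiff ℝ n d :=
    (hf.fderiv_right (m := n) (by exact_mod_cast le_rfl)).clm_apply contDiff_const
  have hdiff : Differentiable ℝ f := hf.differentiable (by simp)
  have hder : ∀ u h, HasDerivAt (fun s => f (u, s)) (d (u, h)) h := by
    intro u h
    have h1 : HasDerivAt (fun s : ℝ => (u, s)) ((0 : E), (1 : ℝ)) h :=
      (hasDerivAt_const h u).prodMk (hasDerivAt_id h)
    exact (hdiff (u, h)).hasFDerivAt.comp_hasDerivAt h h1
  have hdeven : ∀ u h, d (u, -h) = d (u, h) := by
    intro u h
    have h1 := ((hder u (-h)).scomp h (hasDerivAt_neg h))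
    have h2 : HasDerivAt (fun s => -f (u, s)) ((-1 : ℝ) • d (u, -h)) h := by
      refine h1.congr_of_eventuallyEq (Eventually.of_forall fun s => ?_)
      simp [hodd]
    have h3 := h2.unique (hder u h).neg
    simpa using h3
  have hf0 : ∀ u, f (u, 0) = 0 := by
    intro u
    have := hodd u 0
    rw [neg_zero] at this
    have h2 : (2 : ℝ) • f (u, 0) = 0 := by
      rw [two_smul]
      nth_rewrite 1 [this]
      exact neg_add_cancel _
    simpa using h2
  -- Hadamard's formula: f(u, h) = h ∫₀¹ ∂ₕf(u, sh) ds for a function that vanishes at h = 0. One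
  -- derivative is lost, and the evenness of ∂ₕf makes the quotient even.
  refine ⟨fun q => ∫ s in (0 : ℝ)..1, d (q.1, s * q.2), ?_, ?_, ?_⟩
  · refine contDiff_intervalIntegral n (K := fun p : (E × ℝ) × ℝ => d (p.1.1, p.2 * p.1.2)) ?_
    exact hd.comp (contDiff_fst.fst.prodMk (contDiff_snd.mul contDiff_fst.snd))
  · intro u h
    simp [hdeven]
  · intro u h
    have h1 : ∀ s ∈ uIcc (0 : ℝ) 1, HasDerivAt (fun s => f (u, s * h)) (h • d (u, s * h)) s := by
      intro s _
      have := (hder u (s * h)).scomp s (by simpa using (hasDerivAt_id s).mul_const h)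
      simpa [Function.comp_def] using this
    have h2 := intervalIntegral.integral_eq_sub_of_hasDerivAt h1 (by
      refine Continuous.intervalIntegrable ?_ _ _
      exact continuous_const.smul (hd.continuous.comp (by fun_prop)))
    simp only [one_mul, zero_mul, hf0, sub_zero, intervalIntegral.integral_smul] at h2
    exact h2.symm

variable {V : Type w} [NormedAddCommGroup V] [InnerProductSpace ℝ V]

/-- Whitney's argument by induction, at the cost of two derivatives for each one gained. As f is
even, ∂ₕf is odd, so ∂ₕf = h·g with g even. The derivative of f(u, |y|) is then ∂ᵤf(u, |y|) du +
g(u, |y|)⟨y, dy⟩, and its coefficients are of the same type. -/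
theorem contDiff_comp_norm_of_even (n : ℕ) :
    ∀ {G : Type w} [NormedAddCommGroup G] [NormedSpace ℝ G] [CompleteSpace G] {f : E × ℝ → G},
      ContDiff ℝ (2 * n : ℕ) f → (∀ u h, f (u, -h) = f (u, h)) →
      ContDiff ℝ n (fun x : E × V => f (x.1, ‖x.2‖)) := by
  induction n with
  | zero =>
    intro G _ _ _ f hf heven
    rw [Nat.cast_zero, contDiff_zero]
    exact hf.continuous.comp (by fun_prop)
  | succ n ih =>
    intro G _ _ _ f hf heven
    have hf2 : ContDiff ℝ (2 * n + 1 + 1 : ℕ) f := hf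
    have hdiff : Differentiable ℝ f := hf2.differentiable (by simp)
    let a : E × ℝ → E →L[ℝ] G := fun q => (fderiv ℝ f q).comp (ContinuousLinearMap.inl ℝ E ℝ)
    let b : E × ℝ → G := fun q => fderiv ℝ f q (0, 1)
    have hfd : ContDiff ℝ (2 * n + 1 : ℕ) (fderiv ℝ f) :=
      hf2.fderiv_right (by exact_mod_cast le_rfl)
    have ha : ContDiff ℝ (2 * n : ℕ) a :=
      (hfd.clm_comp contDiff_const).of_le (by exact_mod_cast Nat.le_succ _)
    have hb : ContDiff ℝ (2 * n + 1 : ℕ) b := hfd.clm_apply contDiff_const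
    let ν : E × ℝ →L[ℝ] E × ℝ :=
      (ContinuousLinearMap.fst ℝ E ℝ).prod (-(ContinuousLinearMap.snd ℝ E ℝ))
    have hν : ∀ q, fderiv ℝ f q = (fderiv ℝ f (ν q)).comp ν := by
      intro q
      have h1 : f = f ∘ ν := by
        ext ⟨u, h⟩
        exact (heven u h).symm
      conv_lhs => rw [h1]
      rw [fderiv_comp _ (hdiff _) ν.differentiableAt, ν.fderiv]
    have haeven : ∀ u h, a (u, -h) = a (u, h) := by
      intro u h
      ext du
      change fderiv ℝ f (u, -h) (du, 0) = fderiv ℝ f (u, h) (du, 0)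
      rw [hν (u, h)]
      simp [ν]
    have hbodd : ∀ u h, b (u, -h) = -b (u, h) := by
      intro u h
      change fderiv ℝ f (u, -h) (0, 1) = -fderiv ℝ f (u, h) (0, 1)
      rw [hν (u, h)]
      have : ν (0, 1) = -(0, 1) := by simp [ν]
      rw [ContinuousLinearMap.comp_apply, this, map_neg, neg_neg]
      simp [ν]
    obtain ⟨g, hg, hgeven, hbg⟩ := exists_eq_smul_of_odd hb hbodd
    have hab : ∀ q p, fderiv ℝ f q p = a q p.1 + p.2 • b q := by
      intro q p
      have : p = (p.1, 0) + p.2 • ((0 : E), (1 : ℝ)) := by ext <;> simp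
      conv_lhs => rw [this, map_add, map_smul]
      rfl
    let F' : E × V → E × V →L[ℝ] G := fun x =>
      (a (x.1, ‖x.2‖)).comp (ContinuousLinearMap.fst ℝ E V) +
        ((innerSL ℝ x.2).smulRight (g (x.1, ‖x.2‖))).comp (ContinuousLinearMap.snd ℝ E V)
    rw [Nat.cast_add, Nat.cast_one, contDiff_succ_iff_hasFDerivAt]
    refine ⟨F', ?_, ?_⟩
    · have h1 := ih ha haeven
      have h2 := ih hg hgeven
      refine ContDiff.add (h1.clm_comp contDiff_const) (ContDiff.clm_comp ?_ contDiff_const)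
      exact ContDiff.smulRight ((innerSL ℝ).contDiff.comp contDiff_snd) h2
    · rintro ⟨u, y⟩
      -- At y = 0 the norm is not differentiable. But ∂ₕf vanishes there and (u, |y|) has the same
      -- norm as (u, y), so the error estimate for f at (u, 0) is already the required one.
      by_cases hy : y = 0
      · subst hy
        have hb0 : b (u, 0) = 0 := by rw [hbg, zero_smul]
        have h1 := (hdiff (u, 0)).hasFDerivAt
        rw [hasFDerivAt_iff_isLittleO] at h1 ⊢
        have ht : Tendsto (fun x : E × V => (x.1, ‖x.2‖)) (𝓝 (u, 0)) (𝓝 (u, 0)) := by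
          have : Continuous (fun x : E × V => (x.1, ‖x.2‖)) := by fun_prop
          simpa using this.tendsto (u, (0 : V))
        have h2 := h1.comp_tendsto ht
        refine (h2.congr_left fun x => ?_).trans_isBigO (Asymptotics.isBigO_of_le _ fun x => ?_)
        · simp only [Function.comp_apply, hab, hb0, smul_zero, add_zero, norm_zero, F']
          simp
        · simp [Prod.norm_def]
      · have hn : HasFDerivAt (fun x : E × V => (x.1, ‖x.2‖))
            ((ContinuousLinearMap.fst ℝ E V).prod
              ((‖y‖⁻¹ • innerSL ℝ y).comp (ContinuousLinearMap.snd ℝ E V))) (u, y) := by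
          refine hasFDerivAt_fst.prodMk ?_
          have : HasFDerivAt (fun z : V => ‖z‖) (‖y‖⁻¹ • innerSL ℝ y) y := by
            have h1 := ((hasStrictFDerivAt_norm_sq y).hasFDerivAt).sqrt (by simpa using hy)
            simp only [Real.sqrt_sq (norm_nonneg _)] at h1
            convert h1 using 1
            ext z
            simp
            field_simp
          exact this.comp (u, y) hasFDerivAt_snd
        have h1 := ((hdiff (u, ‖y‖)).hasFDerivAt).comp (u, y) hn
        refine h1.congr_fderiv (ContinuousLinearMap.ext fun x => ?_)
        have hy' : ‖y‖ ≠ 0 := norm_ne_zero_iff.2 hy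
        simp only [ContinuousLinearMap.comp_apply, hab, hbg]
        simp [F', smul_smul, mul_comm, hy']

/-- Local form: multiplying by bump functions, the one in the height being even, gives a global even
function. The height is the negative norm because cobordisms are the lower halves of their doubles.
-/
theorem contDiffAt_comp_norm_of_even [HasContDiffBump E] {G : Type w} [NormedAddCommGroup G]
    [NormedSpace ℝ G] [CompleteSpace G] {f : E × ℝ → G} {u₀ : E} (hf : ContDiffAt ℝ ∞ f (u₀, 0))
    (heven : ∀ᶠ q in 𝓝 (u₀, (0 : ℝ)), f (q.1, -q.2) = f q) :
    ContDiffAt ℝ ∞ (fun x : E × V => f (x.1, -‖x.2‖)) (u₀, 0) := by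
  rw [contDiffAt_infty]
  intro n
  -- The neighbourhood on which f has N derivatives depends on N, so the cut-off is chosen anew for
  -- each order.
  have hfn : ∀ N : ℕ, ∃ s ∈ 𝓝 (u₀, (0 : ℝ)), ∀ y ∈ s, ContDiffAt ℝ N f y := fun N =>
    ((contDiffAt_infty.1 hf N).eventually (by simp)).exists_mem
  obtain ⟨s, hs, hfs⟩ := hfn (2 * n)
  obtain ⟨ε, hε, hball⟩ := Metric.mem_nhds_iff.1 (inter_mem hs heven)
  let χ : ContDiffBump u₀ := ⟨ε / 4, ε / 2, by positivity, by linarith⟩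
  let η : ContDiffBump (0 : ℝ) := ⟨ε / 4, ε / 2, by positivity, by linarith⟩
  let f' : E × ℝ → G := fun q => (χ q.1 * η q.2) • f q
  have hηneg : ∀ h, η (-h) = η h := fun h => ContDiffBump.neg η h
  have hin : ∀ q : E × ℝ, q ∈ Metric.ball (u₀, (0 : ℝ)) ε ↔ dist q.1 u₀ < ε ∧ |q.2| < ε := by
    intro q
    rw [Metric.mem_ball, Prod.dist_eq, max_lt_iff, Real.dist_eq, sub_zero]
  have hout : ∀ q : E × ℝ, ¬ (dist q.1 u₀ ≤ ε / 2 ∧ |q.2| ≤ ε / 2) → χ q.1 * η q.2 = 0 := by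
    intro q hq
    rw [not_and_or, not_le, not_le] at hq
    rcases hq with hq | hq
    · rw [χ.zero_of_le_dist (by exact hq.le), zero_mul]
    · rw [η.zero_of_le_dist (by rw [Real.dist_eq, sub_zero]; exact hq.le), mul_zero]
  have hf' : ContDiff ℝ (2 * n : ℕ) f' := by
    rw [contDiff_iff_contDiffAt]
    intro q
    by_cases hq : dist q.1 u₀ ≤ ε / 2 ∧ |q.2| ≤ ε / 2
    · have hqb : q ∈ Metric.ball (u₀, (0 : ℝ)) ε := (hin q).2 ⟨by linarith, by linarith⟩
      exact ((χ.contDiff.comp contDiff_fst).mul (η.contDiff.comp contDiff_snd)).contDiffAt.smul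
        (hfs _ (hball hqb).1)
    · have : f' =ᶠ[𝓝 q] fun _ => 0 := by
        have h1 : IsClosed {q : E × ℝ | dist q.1 u₀ ≤ ε / 2} :=
          isClosed_le (by fun_prop) continuous_const
        have h2 : IsClosed {q : E × ℝ | |q.2| ≤ ε / 2} :=
          isClosed_le (by fun_prop) continuous_const
        filter_upwards [(h1.inter h2).isOpen_compl.mem_nhds hq] with p hp
        change (χ p.1 * η p.2) • f p = 0
        rw [hout p hp, zero_smul]
      exact contDiffAt_const.congr_of_eventuallyEq this
  have heven' : ∀ u h, f' (u, -h) = f' (u, h) := by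
    intro u h
    by_cases hq : dist u u₀ ≤ ε / 2 ∧ |h| ≤ ε / 2
    · have hqb : (u, h) ∈ Metric.ball (u₀, (0 : ℝ)) ε := (hin _).2 ⟨by linarith, by linarith⟩
      have := (hball hqb).2
      change (χ u * η (-h)) • f (u, -h) = (χ u * η h) • f (u, h)
      rw [hηneg, this]
    · change (χ u * η (-h)) • f (u, -h) = (χ u * η h) • f (u, h)
      rw [hηneg, hout (u, h) hq, zero_smul, zero_smul]
  have hmain := contDiff_comp_norm_of_even (V := V) n hf' heven'
  refine hmain.contDiffAt.congr_of_eventuallyEq ?_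
  have h1 : ∀ᶠ x : E × V in 𝓝 (u₀, (0 : V)), x ∈ Metric.ball (u₀, (0 : V)) (ε / 4) :=
    Metric.ball_mem_nhds _ (by positivity)
  filter_upwards [h1] with x hx
  rw [Metric.mem_ball, Prod.dist_eq, max_lt_iff, dist_zero_right] at hx
  have hc : χ x.1 * η ‖x.2‖ = 1 := by
    rw [χ.one_of_mem_closedBall (by rw [Metric.mem_closedBall]; exact hx.1.le),
      η.one_of_mem_closedBall (by
        rw [Metric.mem_closedBall, dist_zero_right, norm_norm]; exact hx.2.le), mul_one]
  change _ = (χ x.1 * η ‖x.2‖) • f (x.1, ‖x.2‖)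
  rw [hc, one_smul]
  have hqb : (x.1, ‖x.2‖) ∈ Metric.ball (u₀, (0 : ℝ)) ε :=
    (hin _).2 ⟨by dsimp; linarith [hx.1], by
      rw [abs_of_nonneg (norm_nonneg _)]; linarith [hx.2]⟩
  exact (hball hqb).2

end Even

/-! ### Smoothness of inverses on arbitrary subsets -/

/-- The derivative of the inverse at y is the inverse of f′ at g(y), so each order of smoothness of
g gives the next one. Exhibiting the derivative explicitly avoids any regularity of the set `t`;
this is what allows images of boundary points, where the inverse function theorem does not apply. -/
theorem contDiffOn_of_leftInverse {E F : Type*} [NormedAddCommGroup E] [NormedSpace ℝ E]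
    [CompleteSpace E] [NormedAddCommGroup F] [NormedSpace ℝ F] {f : E → F} {g : F → E}
    {s : Set E} {t : Set F}
    (hs : UniqueDiffOn ℝ s) (hf : ContDiffOn ℝ ∞ f s)
    (hinv : ∀ x ∈ s, (fderivWithin ℝ f s x).IsInvertible) (hg : ContinuousOn g t)
    (hgs : MapsTo g t s) (hfg : ∀ y ∈ t, f (g y) = y) : ContDiffOn ℝ ∞ g t := by
  rw [contDiffOn_infty]
  have hder : ∀ y ∈ t, HasFDerivWithinAt g (fderivWithin ℝ f s (g y)).inverse t y := by
    intro y hy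
    obtain ⟨A, hA⟩ := hinv _ (hgs hy)
    have h1 : HasFDerivWithinAt f (A : E →L[ℝ] F) s (g y) := by
      rw [hA]
      exact ((hf _ (hgs hy)).differentiableWithinAt (by simp)).hasFDerivWithinAt
    rw [← hA, ContinuousLinearMap.inverse_equiv]
    refine h1.of_local_left_inverse ?_ hy (eventually_of_mem self_mem_nhdsWithin hfg)
    exact tendsto_nhdsWithin_iff.2 ⟨hg y hy, eventually_of_mem self_mem_nhdsWithin hgs⟩
  have hf' : ContDiffOn ℝ ∞ (fderivWithin ℝ f s) s := hf.fderivWithin hs (by simp)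
  intro n
  induction n with
  | zero => simpa [contDiffOn_zero] using hg
  | succ n ih =>
    rw [Nat.cast_add, Nat.cast_one, contDiffOn_succ_iff_hasFDerivWithinAt (by simp)]
    intro y hy
    rw [insert_eq_of_mem hy]
    refine ⟨t, self_mem_nhdsWithin, by simp,
      fun y => (fderivWithin ℝ f s (g y)).inverse, hder, fun y hy => ?_⟩
    have h1 : ContDiffWithinAt ℝ n (fun y => fderivWithin ℝ f s (g y)) t y :=
      ((hf' _ (hgs hy)).of_le (by exact_mod_cast le_top)).comp y (ih y hy) hgs
    exact ((hinv _ (hgs hy)).contDiffAt_map_inverse).comp_contDiffWithinAt y h1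

/-! ### Polar coordinates and interior points -/

section PolarEven

variable {S : Type*} [TopologicalSpace S]
  {E H Z : Type*} [NormedAddCommGroup E] [NormedSpace ℝ E] [TopologicalSpace H]
  [TopologicalSpace Z] [ChartedSpace H Z] {J : ModelWithCorners ℝ E H}
  {E' H' Z' : Type*} [NormedAddCommGroup E'] [NormedSpace ℝ E'] [TopologicalSpace H']
  [TopologicalSpace Z'] [ChartedSpace H' Z'] {J' : ModelWithCorners ℝ E' H'}
  {c : S → Z} {z : S}

/-- A smooth function that is even in the last variable is a smooth function of the polar
coordinates. -/
theorem contDiffAt_polar_of_even {n k : ℕ} {G : Type} [NormedAddCommGroup G] [NormedSpace ℝ G]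
    [CompleteSpace G] {f : Eu n × ℝ → G} {u₀ : Eu n} (hf : ContDiffAt ℝ ∞ f (u₀, 0))
    (heven : ∀ᶠ q in 𝓝 (u₀, (0 : ℝ)), f (q.1, -q.2) = f q) :
    ContDiffAt ℝ ∞ (fun x : Eu n × (Eu k × ℝ) => f (x.1, -√(‖x.2.1‖ ^ 2 + x.2.2 ^ 2)))
      (u₀, (0, 0)) := by
  have h1 := contDiffAt_comp_norm_of_even (V := WithLp 2 (Eu k × ℝ)) hf heven
  let L : Eu n × (Eu k × ℝ) →L[ℝ] Eu n × WithLp 2 (Eu k × ℝ) :=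
    (ContinuousLinearMap.fst ℝ _ _).prod
      (((WithLp.prodContinuousLinearEquiv 2 ℝ (Eu k) ℝ).symm : Eu k × ℝ →L[ℝ] _).comp
        (ContinuousLinearMap.snd ℝ _ _))
  have h2 : L (u₀, (0, 0)) = (u₀, 0) := by
    refine Prod.ext rfl ?_
    change (WithLp.prodContinuousLinearEquiv 2 ℝ (Eu k) ℝ).symm (0 : Eu k × ℝ) = 0
    exact map_zero _
  rw [← h2] at h1
  have h3 := h1.comp (u₀, ((0 : Eu k), (0 : ℝ))) L.contDiff.contDiffAt
  refine h3.congr_of_eventuallyEq (Eventually.of_forall fun x => ?_)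
  change _ = f (x.1, -‖(WithLp.toLp 2 x.2 : WithLp 2 (Eu k × ℝ))‖)
  rw [WithLp.prod_norm_eq_of_L2]
  simp

/-- The form of Whitney's theorem used at cone points, with u, v, t known only as smooth functions
of other coordinates. A manifold as target is reduced to a chart around the value at u, height 0. -/
theorem SmoothVia.of_even {n k : ℕ} {G : Type} [NormedAddCommGroup G] [NormedSpace ℝ G]
    [FiniteDimensional ℝ G] {HG : Type*} [TopologicalSpace HG] {JG : ModelWithCorners ℝ G HG}
    {ZG : Type*} [TopologicalSpace ZG] [ChartedSpace HG ZG]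
    {u : S → Eu n} {v : S → Eu k} {t : S → ℝ} {T : Eu n × ℝ → ZG}
    (hu : SmoothVia J c 𝓘(ℝ, Eu n) u z) (hv : SmoothVia J c 𝓘(ℝ, Eu k) v z)
    (ht : SmoothVia J c 𝓘(ℝ, ℝ) t z) (hv0 : v z = 0) (ht0 : t z = 0)
    (hT : ContMDiffAt 𝓘(ℝ, Eu n × ℝ) JG ∞ T (u z, 0))
    (heven : ∀ᶠ q in 𝓝 (u z, (0 : ℝ)), T (q.1, -q.2) = T q) :
    SmoothVia J c JG (fun y => T (u y, -√(‖v y‖ ^ 2 + t y ^ 2))) z := by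
  have : CompleteSpace G := FiniteDimensional.complete ℝ G
  have key : ContMDiffAt 𝓘(ℝ, Eu n × (Eu k × ℝ)) JG ∞
      (fun x : Eu n × (Eu k × ℝ) => T (x.1, -√(‖x.2.1‖ ^ 2 + x.2.2 ^ 2))) (u z, (0, 0)) := by
    rw [contMDiffAt_iff_target] at hT ⊢
    have hcont : ContinuousAt (fun x : Eu n × (Eu k × ℝ) =>
        (x.1, -√(‖x.2.1‖ ^ 2 + x.2.2 ^ 2))) (u z, (0, 0)) := by
      apply Continuous.continuousAt; fun_prop
    have h0 : ((u z, -√(‖(0 : Eu k)‖ ^ 2 + (0 : ℝ) ^ 2)) : Eu n × ℝ) = (u z, 0) := by simp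
    refine ⟨ContinuousAt.comp (g := T) (f := fun x : Eu n × (Eu k × ℝ) =>
      (x.1, -√(‖x.2.1‖ ^ 2 + x.2.2 ^ 2))) (by simpa using hT.1) hcont, ?_⟩
    have h1 := contDiffAt_polar_of_even (k := k) (contMDiffAt_iff_contDiffAt.1 hT.2) (by
      filter_upwards [heven] with q hq
      simp only [Function.comp_apply, hq])
    rw [contMDiffAt_iff_contDiffAt]
    simpa [Function.comp_def] using h1
  have h := hu.prodMk_space (hv.prodMk_space ht)
  refine SmoothVia.comp h (T := fun x : Eu n × (Eu k × ℝ) =>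
    T (x.1, -√(‖x.2.1‖ ^ 2 + x.2.2 ^ 2))) ?_
  rwa [hv0, ht0]

theorem SmoothVia.neg_sqrt {f : S → ℝ} (hf : SmoothVia J c 𝓘(ℝ, ℝ) f z) (h0 : f z ≠ 0) :
    SmoothVia J c 𝓘(ℝ, ℝ) (fun y => -√(f y)) z :=
  hf.comp_contDiffAt (T := fun r => -√r) (Real.contDiffAt_sqrt h0).neg

theorem SmoothVia.norm_sq_add_sq {k : ℕ} {v : S → Eu k} {t : S → ℝ}
    (hv : SmoothVia J c 𝓘(ℝ, Eu k) v z) (ht : SmoothVia J c 𝓘(ℝ, ℝ) t z) :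
    SmoothVia J c 𝓘(ℝ, ℝ) (fun y => ‖v y‖ ^ 2 + t y ^ 2) z :=
  (hv.prodMk_space ht).comp_contDiffAt (T := fun q : Eu k × ℝ => ‖q.1‖ ^ 2 + q.2 ^ 2)
    (((contDiff_fst.norm_sq ℝ).add (contDiff_snd.pow 2)).contDiffAt)

end PolarEven

/-! ### Interior points and maps with sections -/

section Interior

variable {E H : Type*} [NormedAddCommGroup E] [NormedSpace ℝ E] [TopologicalSpace H]
  {A : Type*} [TopologicalSpace A] [ChartedSpace H A] {I : ModelWithCorners ℝ E H}
  {E' H' : Type*} [NormedAddCommGroup E'] [NormedSpace ℝ E'] [TopologicalSpace H']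
  {B : Type*} [TopologicalSpace B] [ChartedSpace H' B] {I' : ModelWithCorners ℝ E' H'}

/-- The chain rule for f ∘ g = id. It supplies surjective derivatives, which detect interior points
and the rank of the height function, without computing them. -/
theorem mfderiv_comp_section {f : A → B} {g : B → A} {a : A} {b : B} (hga : g b = a)
    (hf : MDifferentiableAt I I' f a) (hg : MDifferentiableAt I' I g b)
    (hfg : ∀ᶠ y in 𝓝 b, f (g y) = y) (ξ : E') :
    mfderiv I I' f a (mfderiv I' I g b ξ : E) = ξ := by
  subst hga
  have h1 := mfderiv_comp b hf hg
  have h2 : mfderiv I' I' (f ∘ g) b = mfderiv I' I' id b :=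
    Filter.EventuallyEq.mfderiv_eq (by filter_upwards [hfg] with y hy using hy)
  rw [mfderiv_id] at h2
  have h3 := DFunLike.congr_fun (h1.symm.trans h2) ξ
  exact h3

/-- A map with a section through an interior point takes this point to an interior point. -/
theorem isInteriorPoint_of_section {f : A → B} {g : B → A} {a : A} {b : B} (hga : g b = a)
    (hf : MDifferentiableAt I I' f a) (hg : MDifferentiableAt I' I g b)
    (hfg : ∀ᶠ y in 𝓝 b, f (g y) = y) (hint : I.IsInteriorPoint a) : I'.IsInteriorPoint b := by
  have hb : f a = b := by rw [← hga]; exact hfg.self_of_nhds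
  rw [← hb]
  refine hf.isInteriorPoint_of_surjective_mfderiv (fun ξ => ?_) hint
  exact ⟨mfderiv I' I g b ξ, mfderiv_comp_section hga hf hg hfg ξ⟩

end Interior

/-! ### Charts with values in the quadrant -/

section Quad

variable {d : ℕ}

theorem isOpen_pos (d : ℕ) : IsOpen {x : Eu d | ∀ i, 0 < x i} := by
  simp only [ofPred_forall]
  exact isOpen_iInter_of_finite fun i => isOpen_lt continuous_const (by fun_prop)

theorem isInteriorPoint_quad_iff {x : Quad d} :
    (quadModel d).IsInteriorPoint x ↔ ∀ i, 0 < x.1 i := by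
  change extChartAt (quadModel d) x x ∈ interior (range (quadModel d)) ↔ _
  have h : range (quadModel d) = {y | ∀ i : Fin d, 0 ≤ y i} := Subtype.range_val
  rw [h, interior_euclideanQuadrant]
  rfl

/-- Being interior does not depend on the chart of the atlas, so the condition in the preferred
chart may be read off in any other one. -/
theorem mem_bdry_iff_chart {n : ℕ} {G : Type v} [Group G] (M : GMfd.{u} G n) {x : M}
    {φ : OpenPartialHomeomorph M (Quad n)} (hφ : φ ∈ atlas (Quad n) M) (hx : x ∈ φ.source) :
    x ∈ M.bdry ↔ ∃ i, (φ x).1 i = 0 := by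
  have h : range (quadModel n) = {y | ∀ i : Fin n, 0 ≤ y i} := Subtype.range_val
  have h1 := ModelWithCorners.mem_interior_range_iff_of_mem_atlas (I := quadModel n) (n := ∞)
    (by simp) (chart_mem_atlas (Quad n) x) hφ (mem_chart_source _ x) hx
  have h2 : x ∈ M.bdry ↔ ¬ (quadModel n).IsInteriorPoint x :=
    ModelWithCorners.isBoundaryPoint_iff_not_isInteriorPoint x
  have key : ∀ ψ : OpenPartialHomeomorph M (Quad n), x ∈ ψ.source →
      (ψ.extend (quadModel n) x ∈ interior (ψ.extend (quadModel n)).target ↔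
        ψ.extend (quadModel n) x ∈ interior (range (quadModel n))) := fun ψ hψ =>
    ⟨fun h => ψ.interior_extend_target_subset_interior_range h,
      fun h => ψ.mem_interior_extend_target (ψ.map_source hψ) h⟩
  rw [key _ (mem_chart_source _ x), key _ hx] at h1
  rw [h2, ModelWithCorners.IsInteriorPoint, extChartAt, h1, h, interior_euclideanQuadrant]
  change ¬ (∀ i, 0 < (φ x).1 i) ↔ _
  push Not
  exact exists_congr fun i => ⟨fun h => le_antisymm h ((φ x).2 i), fun h => h.le⟩

theorem notMem_bdry_iff {n : ℕ} {G : Type v} [Group G] (M : GMfd.{u} G n) {x : M} :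
    x ∉ M.bdry ↔ (quadModel n).IsInteriorPoint x :=
  (ModelWithCorners.isInteriorPoint_iff_not_isBoundaryPoint x).symm

/-- The interior of the quadrant, as an open subset of Euclidean space. -/
def quadInterior (d : ℕ) : OpenPartialHomeomorph (Quad d) (Eu d) where
  toFun := Subtype.val
  invFun := (quadModel d).symm
  source := {x | ∀ i, 0 < x.1 i}
  target := {x | ∀ i, 0 < x i}
  map_source' _ hx := hx
  map_target' x hx := by
    have : quadModel d ((quadModel d).symm x) = x := (quadModel d).right_inv
      (by rw [show range (quadModel d) = {y | ∀ i : Fin d, 0 ≤ y i} from Subtype.range_val]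
          exact fun i => (hx i).le)
    change ∀ i, 0 < (quadModel d ((quadModel d).symm x)) i
    rw [this]; exact hx
  left_inv' x _ := (quadModel d).left_inv x
  right_inv' x hx := (quadModel d).right_inv
      (by rw [show range (quadModel d) = {y | ∀ i : Fin d, 0 ≤ y i} from Subtype.range_val]
          exact fun i => (hx i).le)
  open_source := (isOpen_pos d).preimage continuous_subtype_val
  open_target := isOpen_pos d
  continuousOn_toFun := continuous_subtype_val.continuousOn
  continuousOn_invFun := (quadModel d).continuous_symm.continuousOn

theorem contMDiffOn_quadInterior_symm :
    ContMDiffOn 𝓘(ℝ, Eu d) (quadModel d) ∞ (quadInterior d).symm (quadInterior d).target :=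
  (quadModel d).contMDiffOn_symm.mono (by
    intro x hx
    rw [show range (quadModel d) = {y | ∀ i : Fin d, 0 ≤ y i} from Subtype.range_val]
    exact fun i => (hx i).le)

/-- The coordinatewise exponential. -/
def expEu (d : ℕ) : OpenPartialHomeomorph (Eu d) (Eu d) where
  toFun x := WithLp.toLp 2 fun i => Real.exp (x i)
  invFun x := WithLp.toLp 2 fun i => Real.log (x i)
  source := univ
  target := {x | ∀ i, 0 < x i}
  map_source' x _ i := Real.exp_pos _
  map_target' _ _ := mem_univ _
  left_inv' x _ := by ext i; simp
  right_inv' x hx := by ext i; simp [Real.exp_log (hx i)]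
  open_source := isOpen_univ
  open_target := isOpen_pos d
  continuousOn_toFun := by
    apply Continuous.continuousOn
    fun_prop
  continuousOn_invFun := by
    refine (PiLp.continuous_toLp 2 _).comp_continuousOn (continuousOn_pi.2 fun i => ?_)
    exact ContinuousOn.log (by fun_prop) fun x hx => (hx i).ne'

theorem contDiff_expEu : ContDiff ℝ ∞ (expEu d) := by
  rw [contDiff_euclidean]
  intro i
  exact Real.contDiff_exp.comp (contDiff_euclidean.1 contDiff_id i)

theorem contDiffOn_expEu_symm : ContDiffOn ℝ ∞ (expEu d).symm (expEu d).target := by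
  rw [contDiffOn_euclidean]
  intro i
  exact ContDiffOn.log (contDiff_euclidean.1 contDiff_id i).contDiffOn fun x hx => (hx i).ne'

/-- The exponential, as a chart of Euclidean space with values in the quadrant. -/
def expQuad (d : ℕ) : OpenPartialHomeomorph (Eu d) (Quad d) := (expEu d).trans (quadInterior d).symm

theorem expQuad_source : (expQuad d).source = univ := by
  ext x
  simp only [expQuad, OpenPartialHomeomorph.trans_source, mem_inter_iff, mem_univ, iff_true]
  exact ⟨mem_univ _, (expEu d).map_source (mem_univ x)⟩

theorem expQuad_pos (x : Eu d) (i : Fin d) : 0 < (expQuad d x).1 i :=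
  (quadInterior d).map_target ((expEu d).map_source (mem_univ x)) i

theorem contMDiff_expQuad : ContMDiff 𝓘(ℝ, Eu d) (quadModel d) ∞ (expQuad d) := by
  rw [← contMDiffOn_univ]
  exact contMDiffOn_quadInterior_symm.comp contDiff_expEu.contMDiff.contMDiffOn
    fun x _ => (expEu d).map_source (mem_univ x)

theorem contMDiffOn_expQuad_symm :
    ContMDiffOn (quadModel d) 𝓘(ℝ, Eu d) ∞ (expQuad d).symm (expQuad d).target := by
  have h : ContMDiffOn (quadModel d) 𝓘(ℝ, Eu d) ∞ (quadInterior d) univ :=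
    (quadModel d).contMDiff.contMDiffOn
  refine contDiffOn_expEu_symm.contMDiffOn.comp (h.mono (subset_univ _)) ?_
  intro x hx
  have := hx.1
  exact (quadInterior d).map_source this

end Quad

variable {G : Type v} [Group G]

/-! ### Round bundles -/

namespace RoundTriv

variable {n m k : ℕ} {M : GMfd.{u} G n} {D : GMfd.{u} G m} {p : D → M} {nrm : D → ℝ}

theorem contMDiffAt_coord (τ : RoundTriv M D p nrm k) (hp : Continuous p) {x : D}
    (hx : p x ∈ τ.base) : ContMDiffAt (quadModel m) 𝓘(ℝ, Eu k) ∞ τ.coord x :=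
  τ.smooth_coord.contMDiffAt ((τ.isOpen_base.preimage hp).mem_nhds hx)

theorem norm_coord_le (τ : RoundTriv M D p nrm k) {x : D} (hx : p x ∈ τ.base) :
    ‖τ.coord x‖ ≤ 1 := (τ.norm_coord x hx).trans_le (τ.norm_le x hx)

theorem nrm_toFun (τ : RoundTriv M D p nrm k) {b : M} (hb : b ∈ τ.base) {v : Eu k}
    (hv : ‖v‖ ≤ 1) : nrm (τ.toFun (b, v)) = ‖v‖ := by
  rw [← τ.norm_coord _ (by rwa [τ.p_toFun b hb v hv]), τ.coord_toFun b hb v hv]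

/-- The trivialization is smooth only on the closed unit ball, so the bound on v is needed near z
and not just at z. -/
theorem smoothVia_toFun {S : Type*} [TopologicalSpace S]
    {E H Z : Type*} [NormedAddCommGroup E] [NormedSpace ℝ E] [TopologicalSpace H]
    [TopologicalSpace Z] [ChartedSpace H Z] {J : ModelWithCorners ℝ E H} {c : S → Z} {z : S}
    (τ : RoundTriv M D p nrm k) {b : S → M} {v : S → Eu k}
    (hb : SmoothVia J c (quadModel n) b z) (hv : SmoothVia J c 𝓘(ℝ, Eu k) v z)
    (hbase : ∀ᶠ y in 𝓝 z, b y ∈ τ.base) (hle : ∀ᶠ y in 𝓝 z, ‖v y‖ ≤ 1) :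
    SmoothVia J c (quadModel m) (fun y => τ.toFun (b y, v y)) z := by
  refine (hb.prodMk hv).comp_within (T := τ.toFun) (s := τ.base ×ˢ Metric.closedBall 0 1)
    (τ.smooth_toFun _ ⟨hbase.self_of_nhds, by simpa using hle.self_of_nhds⟩) ?_
    (Eventually.of_forall fun _ => rfl)
  filter_upwards [hbase, hle] with y h1 h2
  exact ⟨h1, by simpa using h2⟩

theorem continuousOn_toFun (τ : RoundTriv M D p nrm k) :
    ContinuousOn τ.toFun (τ.base ×ˢ Metric.closedBall 0 1) := τ.smooth_toFun.continuousOn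

end RoundTriv

namespace RoundTub

variable {n m : ℕ} {M : GMfd.{u} G n} {M' : GMfd.{u} G m} (e : RoundTub M M')

theorem continuous_p : Continuous e.p := e.p_smooth.continuous

theorem continuous_e : Continuous e.e := e.e_embedding.continuous

theorem nrm_nonneg (x : e.D) : 0 ≤ e.nrm x := by
  obtain ⟨τ, hτ⟩ := e.locally_trivial (e.p x)
  rw [← τ.norm_coord x hτ]; exact norm_nonneg _

theorem nrm_le_one (x : e.D) : e.nrm x ≤ 1 := by
  obtain ⟨τ, hτ⟩ := e.locally_trivial (e.p x)
  exact τ.norm_le x hτ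

/-- Only the square of the fibrewise norm is smooth: in a round trivialization it is the square of
the Euclidean norm of the coordinate. -/
theorem contMDiffAt_nrm_sq (x : e.D) :
    ContMDiffAt (quadModel m) 𝓘(ℝ, ℝ) ∞ (fun x => e.nrm x ^ 2) x := by
  obtain ⟨τ, hτ⟩ := e.locally_trivial (e.p x)
  have h1 : ContMDiffAt (quadModel m) 𝓘(ℝ, ℝ) ∞ (fun x => ‖τ.coord x‖ ^ 2) x :=
    ContMDiffAt.comp (g := fun v : Eu e.k => ‖v‖ ^ 2) x
      ((contDiff_norm_sq ℝ).contMDiff.contMDiffAt) (τ.contMDiffAt_coord e.continuous_p hτ)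
  refine h1.congr_of_eventuallyEq ?_
  filter_upwards [(τ.isOpen_base.preimage e.continuous_p).mem_nhds hτ] with y hy
  rw [τ.norm_coord y hy]

theorem continuous_nrm_sq : Continuous fun x => e.nrm x ^ 2 :=
  continuous_iff_continuousAt.2 fun x => (e.contMDiffAt_nrm_sq x).continuousAt

theorem continuous_nrm : Continuous e.nrm := by
  have := Real.continuous_sqrt.comp e.continuous_nrm_sq
  exact this.congr fun x => Real.sqrt_sq (e.nrm_nonneg x)

/-- The dimension of the total space of a round bundle. -/
theorem dim_eq (x : e.D) : m = n + e.k := by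
  obtain ⟨τ, hτ⟩ := e.locally_trivial (e.p x)
  set b := e.p x with hb
  have hball : τ.base ×ˢ Metric.closedBall (0 : Eu e.k) 1 ∈ 𝓝 (b, (0 : Eu e.k)) :=
    prod_mem_nhds (τ.isOpen_base.mem_nhds hτ) (Metric.closedBall_mem_nhds _ one_pos)
  have h1 : MDifferentiableAt ((quadModel n).prod 𝓘(ℝ, Eu e.k)) (quadModel m) τ.toFun (b, 0) :=
    (τ.smooth_toFun.contMDiffAt hball).mdifferentiableAt (by simp)
  have hp0 : e.p (τ.toFun (b, 0)) = b := τ.p_toFun b hτ 0 (by simp)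
  have hc0 : τ.coord (τ.toFun (b, 0)) = 0 := τ.coord_toFun b hτ 0 (by simp)
  have h2 : MDifferentiableAt (quadModel m) ((quadModel n).prod 𝓘(ℝ, Eu e.k))
      (fun x => (e.p x, τ.coord x)) (τ.toFun (b, 0)) :=
    ((e.p_smooth _).prodMk (τ.contMDiffAt_coord e.continuous_p (by rwa [hp0]))).mdifferentiableAt
      (by simp)
  -- Along the zero section the trivialization and its inverse are defined on full neighbourhoods,
  -- so their derivatives are inverse linear isomorphisms.
  have h12 := mfderiv_comp_section (b := (b, (0 : Eu e.k))) rfl h2 h1 (by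
    filter_upwards [hball] with y hy
    have hy2 : ‖y.2‖ ≤ 1 := by simpa using hy.2
    exact Prod.ext (τ.p_toFun y.1 hy.1 y.2 hy2) (τ.coord_toFun y.1 hy.1 y.2 hy2))
  have h21 := mfderiv_comp_section (f := τ.toFun) (g := fun x => (e.p x, τ.coord x))
    (b := τ.toFun (b, 0)) (Prod.ext hp0 hc0) h1 h2 (by
    have : e.p ⁻¹' τ.base ∈ 𝓝 (τ.toFun (b, 0)) :=
      (τ.isOpen_base.preimage e.continuous_p).mem_nhds (by rw [mem_preimage, hp0]; exact hτ)
    filter_upwards [this] with y hy using τ.toFun_coord y hy)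
  let A : (Eu n × Eu e.k) →ₗ[ℝ] Eu m :=
    (mfderiv ((quadModel n).prod 𝓘(ℝ, Eu e.k)) (quadModel m) τ.toFun (b, 0)).toLinearMap
  let B : Eu m →ₗ[ℝ] (Eu n × Eu e.k) :=
    (mfderiv (quadModel m) ((quadModel n).prod 𝓘(ℝ, Eu e.k)) (fun x => (e.p x, τ.coord x))
      (τ.toFun (b, 0))).toLinearMap
  let C : (Eu n × Eu e.k) ≃ₗ[ℝ] Eu m :=
    LinearEquiv.ofLinearMap A B (LinearMap.ext fun ξ => h21 ξ) (LinearMap.ext fun ξ => h12 ξ)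
  have := C.finrank_eq
  simpa using this.symm

/-- The boundary of a round bundle consists of the parts over the boundary and of the unit
vectors. -/
theorem mem_bdry_iff (x : e.D) : x ∈ e.D.bdry ↔ e.p x ∈ M.bdry ∨ e.nrm x = 1 := by
  obtain ⟨τ, hτ⟩ := e.locally_trivial (e.p x)
  have hcle := τ.norm_coord_le hτ
  constructor
  · intro hx
    by_contra hcon
    push Not at hcon
    obtain ⟨h1, h2⟩ := hcon
    have hlt : ‖τ.coord x‖ < 1 := by
      rw [τ.norm_coord x hτ]; exact lt_of_le_of_ne (e.nrm_le_one x) h2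
    have hball : τ.base ×ˢ Metric.closedBall (0 : Eu e.k) 1 ∈ 𝓝 (e.p x, τ.coord x) :=
      prod_mem_nhds (τ.isOpen_base.mem_nhds hτ)
        (Metric.closedBall_mem_nhds_of_mem (by simpa using hlt))
    refine (notMem_bdry_iff e.D).2 ?_ hx
    refine isInteriorPoint_of_section (I := (quadModel n).prod 𝓘(ℝ, Eu e.k))
      (f := τ.toFun) (g := fun x => (e.p x, τ.coord x)) rfl ?_ ?_ ?_ ?_
    · exact (τ.smooth_toFun.contMDiffAt hball).mdifferentiableAt (by simp)
    · exact ((e.p_smooth _).prodMk (τ.contMDiffAt_coord e.continuous_p hτ)).mdifferentiableAt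
        (by simp)
    · filter_upwards [(τ.isOpen_base.preimage e.continuous_p).mem_nhds hτ] with y hy
        using τ.toFun_coord y hy
    · have : (e.p x, τ.coord x) ∈ ((quadModel n).prod 𝓘(ℝ, Eu e.k)).interior (M × Eu e.k) := by
        rw [ModelWithCorners.interior_prod]
        exact ⟨(notMem_bdry_iff M).1 h1, BoundarylessManifold.isInteriorPoint⟩
      exact this
  · rintro (h | h) <;> by_contra hx <;> have hint := (notMem_bdry_iff e.D).1 hx
    · refine (notMem_bdry_iff M).2 ?_ h
      -- Keeping the fibre coordinate constant gives a section of p through x, so an interior point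
      -- x would lie over an interior point.
      have hsec : ContMDiffAt (quadModel n) (quadModel m) ∞ (fun b => τ.toFun (b, τ.coord x))
          (e.p x) := by
        have h1 : ContMDiffOn (quadModel n) (quadModel m) ∞ (fun b => τ.toFun (b, τ.coord x))
            τ.base := τ.smooth_toFun.comp (contMDiffOn_id.prodMk contMDiffOn_const)
          fun b hb => ⟨hb, by simpa using hcle⟩
        exact h1.contMDiffAt (τ.isOpen_base.mem_nhds hτ)
      refine isInteriorPoint_of_section (f := e.p) (g := fun b => τ.toFun (b, τ.coord x))
        (τ.toFun_coord x hτ) ((e.p_smooth x).mdifferentiableAt (by simp))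
        (hsec.mdifferentiableAt (by simp)) ?_ hint
      filter_upwards [τ.isOpen_base.mem_nhds hτ] with b hb using τ.p_toFun b hb _ hcle
    · let F : e.D → Eu 1 := fun y => WithLp.toLp 2 fun _ => 1 - e.nrm y ^ 2
      have hrange : range (quadModel 1) = {y | ∀ i : Fin 1, 0 ≤ y i} := Subtype.range_val
      have hF : ContMDiff (quadModel m) (quadModel 1) ∞ fun y => (quadModel 1).symm (F y) := by
        have h1 : ContMDiff (quadModel m) 𝓘(ℝ, Eu 1) ∞ F := by
          intro y
          have h2 : ContDiff ℝ ∞ (fun r : ℝ => (WithLp.toLp 2 fun _ => 1 - r : Eu 1)) := by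
            rw [contDiff_euclidean]
            exact fun i => contDiff_const.sub contDiff_id
          exact ContMDiffAt.comp (g := fun r : ℝ => (WithLp.toLp 2 fun _ => 1 - r : Eu 1))
            (f := fun x => e.nrm x ^ 2) y h2.contMDiff.contMDiffAt (e.contMDiffAt_nrm_sq y)
        refine (quadModel 1).contMDiffOn_symm.comp_contMDiff h1 fun y => ?_
        rw [hrange]
        intro i
        have := e.nrm_le_one y
        have := e.nrm_nonneg y
        change 0 ≤ 1 - e.nrm y ^ 2
        nlinarith
      have hv : ‖τ.coord x‖ = 1 := (τ.norm_coord x hτ).trans h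
      let g : Quad 1 → e.D := fun s => τ.toFun (e.p x, √(1 - s.1 0) • τ.coord x)
      have hgle : ∀ s : Quad 1, ‖√(1 - s.1 0) • τ.coord x‖ ≤ 1 := by
        intro s
        rw [norm_smul, hv, mul_one, Real.norm_eq_abs, abs_of_nonneg (Real.sqrt_nonneg _)]
        refine Real.sqrt_le_one.2 ?_
        linarith [s.2 0]
      have hg : ContMDiffAt (quadModel 1) (quadModel m) ∞ g 0 := by
        have h1 : ContMDiffAt (quadModel 1) 𝓘(ℝ, Eu e.k) ∞
            (fun s : Quad 1 => √(1 - s.1 0) • τ.coord x) 0 := by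
          have h2 : ContDiffAt ℝ ∞ (fun y : Eu 1 => √(1 - y 0) • τ.coord x) 0 := by
            refine ContDiffAt.smul (ContDiffAt.sqrt ?_ (by simp)) contDiffAt_const
            exact contDiffAt_const.sub (contDiff_euclidean.1 contDiff_id 0).contDiffAt
          exact ContMDiffAt.comp (I' := 𝓘(ℝ, Eu 1)) (g := fun y : Eu 1 => √(1 - y 0) • τ.coord x)
            (0 : Quad 1) h2.contMDiffAt (quadModel 1).contMDiff.contMDiffAt
        have h3 := τ.smooth_toFun (e.p x, √(1 - (0 : Quad 1).1 0) • τ.coord x)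
          ⟨hτ, by simpa using hgle 0⟩
        have h4 : ContMDiffWithinAt (quadModel 1) (quadModel m) ∞ g univ 0 :=
          ContMDiffWithinAt.comp (0 : Quad 1) h3
            (contMDiffAt_const.prodMk h1).contMDiffWithinAt
            fun s _ => ⟨hτ, by simpa using hgle s⟩
        exact h4.contMDiffAt univ_mem
      have hg0 : g 0 = x := by
        have h1 : √(1 - (0 : Quad 1).1 0) = 1 := by
          rw [show (0 : Quad 1).1 0 = 0 from rfl]; simp
        change τ.toFun (e.p x, √(1 - (0 : Quad 1).1 0) • τ.coord x) = x
        rw [h1, one_smul, τ.toFun_coord x hτ]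
      have hpos : (quadModel 1).IsInteriorPoint (0 : Quad 1) := by
        refine isInteriorPoint_of_section (f := fun y => (quadModel 1).symm (F y)) (g := g) hg0
          ((hF x).mdifferentiableAt (by simp)) (hg.mdifferentiableAt (by simp)) ?_ hint
        have hopen : IsOpen {s : Quad 1 | s.1 0 < 1} :=
          isOpen_lt ((PiLp.continuous_apply 2 (fun _ : Fin 1 => ℝ) 0).comp (quadModel 1).continuous)
            continuous_const
        filter_upwards [hopen.mem_nhds (show (0 : ℝ) < 1 from one_pos)] with s hs
        have h1 : F (g s) = s.1 := by
          ext i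
          rw [Subsingleton.elim i 0]
          change 1 - e.nrm (τ.toFun (e.p x, √(1 - s.1 0) • τ.coord x)) ^ 2 = s.1 0
          rw [τ.nrm_toFun hτ (hgle s), norm_smul, hv, mul_one, Real.norm_eq_abs, sq_abs,
            Real.sq_sqrt (by linarith [show s.1 0 < 1 from hs])]
          ring
        rw [h1]
        exact (quadModel 1).left_inv s
      exact lt_irrefl (0 : ℝ) (isInteriorPoint_quad_iff.1 hpos 0)

/-- A surjective derivative sends interior points to interior points. The converse is not needed:
the sphere bundle may well lie in the interior of M'. -/
theorem notMem_bdry_e {x : e.D} (hx : x ∉ e.D.bdry) : e.e x ∉ M'.bdry := by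
  rw [notMem_bdry_iff] at hx ⊢
  exact ((e.e_smooth x).mdifferentiableAt (by simp)).isInteriorPoint_of_surjective_mfderiv
    (e.e_full_rank x).2 hx

/-- In charts the derivative is a composite of three invertible maps: those of the two charts and
the derivative of the embedding, which is bijective by full rank. -/
theorem isInvertible_fderivWithin_chart (x : e.D) {ξ : Eu m}
    (hξ : ξ ∈ (extChartAt (quadModel m) x).target ∩ (extChartAt (quadModel m) x).symm ⁻¹'
      (univ ∩ e.e ⁻¹' (extChartAt (quadModel m) (e.e x)).source)) :
    (fderivWithin ℝ (extChartAt (quadModel m) (e.e x) ∘ e.e ∘ (extChartAt (quadModel m) x).symm)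
      ((extChartAt (quadModel m) x).target ∩ (extChartAt (quadModel m) x).symm ⁻¹'
      (univ ∩ e.e ⁻¹' (extChartAt (quadModel m) (e.e x)).source)) ξ).IsInvertible := by
  set X := extChartAt (quadModel m) x
  set Y := extChartAt (quadModel m) (e.e x)
  have hu : UniqueDiffOn ℝ (X.target ∩ X.symm ⁻¹' (univ ∩ e.e ⁻¹' Y.source)) :=
    uniqueMDiffOn_univ.uniqueDiffOn_inter_preimage x (e.e x) e.continuous_e.continuousOn
  have h1 : MDifferentiableWithinAt 𝓘(ℝ, Eu m) (quadModel m) X.symm (range (quadModel m)) ξ :=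
    (contMDiffWithinAt_extChartAt_symm_range (n := ∞) x hξ.1).mdifferentiableWithinAt (by simp)
  have h2 : MDifferentiableAt (quadModel m) (quadModel m) e.e (X.symm ξ) :=
    (e.e_smooth _).mdifferentiableAt (by simp)
  have h3 : MDifferentiableAt (quadModel m) 𝓘(ℝ, Eu m) Y (e.e (X.symm ξ)) :=
    mdifferentiableAt_extChartAt (by simpa [Y] using hξ.2.2)
  let P : Eu m →L[ℝ] Eu m := mfderiv (quadModel m) 𝓘(ℝ, Eu m) Y (e.e (X.symm ξ))
  let Q : Eu m →L[ℝ] Eu m := mfderiv (quadModel m) (quadModel m) e.e (X.symm ξ)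
  let R : Eu m →L[ℝ] Eu m := mfderivWithin 𝓘(ℝ, Eu m) (quadModel m) X.symm (range (quadModel m)) ξ
  have hP : P.IsInvertible := isInvertible_mfderiv_extChartAt hξ.2.2
  have hR : R.IsInvertible := isInvertible_mfderivWithin_extChartAt_symm hξ.1
  have hQ : Q.IsInvertible := by
    have hA : Function.Bijective Q := e.e_full_rank _
    exact ⟨ContinuousLinearEquiv.ofBijective Q (LinearMap.ker_eq_bot.2 hA.1)
      (LinearMap.range_eq_top.2 hA.2), ContinuousLinearEquiv.coe_ofBijective _ _ _⟩
  have hsub : X.target ∩ X.symm ⁻¹' (univ ∩ e.e ⁻¹' Y.source) ⊆ range (quadModel m) :=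
    fun y hy => extChartAt_target_subset_range x hy.1
  have h4 : HasMFDerivWithinAt 𝓘(ℝ, Eu m) 𝓘(ℝ, Eu m) (Y ∘ e.e ∘ X.symm)
      (X.target ∩ X.symm ⁻¹' (univ ∩ e.e ⁻¹' Y.source)) ξ ((P.comp Q).comp R) :=
    (h3.hasMFDerivAt.comp _ h2.hasMFDerivAt).comp_hasMFDerivWithinAt ξ
      (h1.hasMFDerivWithinAt.mono hsub)
  have h5 : HasFDerivWithinAt (Y ∘ e.e ∘ X.symm) ((P.comp Q).comp R)
      (X.target ∩ X.symm ⁻¹' (univ ∩ e.e ⁻¹' Y.source)) ξ :=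
    hasMFDerivWithinAt_iff_hasFDerivWithinAt.1 h4
  have h6 := h5.fderivWithin (hu ξ hξ)
  rw [h6]
  exact (hP.comp hQ).comp hR

/-- Points of the round bundle are smooth functions of their images under the embedding. -/
theorem smoothVia_e (x : e.D) : SmoothVia (quadModel m) e.e (quadModel m) (fun y => y) x := by
  set X := extChartAt (quadModel m) x with hX
  set Y := extChartAt (quadModel m) (e.e x) with hY
  have hne : Nonempty e.D := ⟨x⟩
  let ε : M' → e.D := Function.invFun e.e
  have hε : ∀ x, ε (e.e x) = x := Function.leftInverse_invFun e.e_embedding.injective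
  have hu : UniqueDiffOn ℝ (X.target ∩ X.symm ⁻¹' (univ ∩ e.e ⁻¹' Y.source)) :=
    uniqueMDiffOn_univ.uniqueDiffOn_inter_preimage x (e.e x) e.continuous_e.continuousOn
  have hΩ : X.source ∩ e.e ⁻¹' Y.source ∈ 𝓝 x :=
    inter_mem (extChartAt_source_mem_nhds x)
      (e.continuous_e.continuousAt (extChartAt_source_mem_nhds (e.e x)))
  have hεc : ContinuousOn ε (range e.e) := by
    rw [e.e_embedding.continuousOn_iff]
    refine continuousOn_id.congr ?_
    rintro _ ⟨y, rfl⟩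
    simp [hε]
  refine ⟨_, hΩ, ε, ?_, fun y _ => hε y⟩
  suffices h : ContMDiffOn (quadModel m) (quadModel m) ∞ ε (e.e '' (X.source ∩ e.e ⁻¹' Y.source))
    from h _ (mem_image_of_mem _ (mem_of_mem_nhds hΩ))
  rw [contMDiffOn_iff_of_subset_source' (x := e.e x) (y := x)]
  · refine contDiffOn_of_leftInverse hu ?_ (fun ξ hξ => e.isInvertible_fderivWithin_chart x hξ)
      ?_ ?_ ?_
    · have := (contMDiff_iff.1 e.e_smooth).2 x (e.e x)
      rwa [univ_inter]
    · refine (continuousOn_extChartAt x).comp (hεc.comp (t := range e.e)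
        ((continuousOn_extChartAt_symm (e.e x)).mono ?_) ?_) ?_
      · rintro _ ⟨_, ⟨y, hy, rfl⟩, rfl⟩
        exact Y.map_source hy.2
      · rintro _ ⟨_, ⟨y, hy, rfl⟩, rfl⟩
        rw [Y.left_inv hy.2]; exact mem_range_self y
      · rintro _ ⟨_, ⟨y, hy, rfl⟩, rfl⟩
        simp only [Function.comp_apply]
        rw [Y.left_inv hy.2, hε]; exact hy.1
    · rintro _ ⟨_, ⟨y, hy, rfl⟩, rfl⟩
      simp only [Function.comp_apply]
      rw [Y.left_inv hy.2, hε]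
      refine ⟨X.map_source hy.1, ?_⟩
      rw [mem_preimage, X.left_inv hy.1]
      exact ⟨mem_univ _, hy.2⟩
    · rintro _ ⟨_, ⟨y, hy, rfl⟩, rfl⟩
      simp only [Function.comp_apply]
      rw [Y.left_inv hy.2, hε, X.left_inv hy.1]
  · rintro _ ⟨y, hy, rfl⟩
    exact hy.2
  · rintro _ ⟨y, hy, rfl⟩
    rw [hε]; exact hy.1

/-- The embedding is open at interior points. -/
theorem nhds_le_map_e {x : e.D} (hx : x ∉ e.D.bdry) : 𝓝 (e.e x) ≤ map e.e (𝓝 x) := by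
  set X := extChartAt (quadModel m) x with hX
  set Y := extChartAt (quadModel m) (e.e x) with hY
  set s := X.target ∩ X.symm ⁻¹' (univ ∩ e.e ⁻¹' Y.source) with hs
  have hint : X x ∈ interior (range (quadModel m)) := (notMem_bdry_iff _).1 hx
  have htar : X.target ∈ 𝓝 (X x) :=
    mem_of_superset (isOpen_interior.mem_nhds
      ((chartAt (Quad m) x).mem_interior_extend_target (mem_chart_target _ x) hint)) interior_subset
  have hXc : ContinuousAt X.symm (X x) := continuousAt_extChartAt_symm x
  have hXs : X.symm (X x) = x := extChartAt_to_inv x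
  have hev : e.e ⁻¹' Y.source ∈ 𝓝 x :=
    e.continuous_e.continuousAt (extChartAt_source_mem_nhds (e.e x))
  have hsn : s ∈ 𝓝 (X x) := by
    refine inter_mem htar (hXc ?_)
    rw [hXs, univ_inter]; exact hev
  have hξ : X x ∈ s := mem_of_mem_nhds hsn
  have hcd : ContDiffAt ℝ ∞ (Y ∘ e.e ∘ X.symm) (X x) := by
    have := (contMDiff_iff.1 e.e_smooth).2 x (e.e x)
    refine ContDiffOn.contDiffAt (s := s) ?_ hsn
    rwa [hs, univ_inter]
  obtain ⟨A, hA⟩ := e.isInvertible_fderivWithin_chart x hξ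
  rw [fderivWithin_of_mem_nhds hsn] at hA
  -- At an interior point the chart representative is defined on a full neighbourhood, and the
  -- inverse function theorem gives openness.
  have hst : HasStrictFDerivAt (Y ∘ e.e ∘ X.symm) (A : Eu m →L[ℝ] Eu m) (X x) := by
    rw [hA]; exact hcd.hasStrictFDerivAt (by simp)
  have hmap := hst.map_nhds_eq_of_equiv
  intro Ω hΩ
  rw [mem_map] at hΩ
  have h1 : s ∩ X.symm ⁻¹' (e.e ⁻¹' Ω) ∈ 𝓝 (X x) :=
    inter_mem hsn (hXc (by rw [hXs]; exact hΩ))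
  have h2 := image_mem_map (m := Y ∘ e.e ∘ X.symm) h1
  rw [hmap] at h2
  simp only [Function.comp_apply, hXs] at h2
  filter_upwards [(continuousAt_extChartAt (I := quadModel m) (e.e x)) h2,
    extChartAt_source_mem_nhds (I := quadModel m) (e.e x)]
    with y hy hys
  obtain ⟨ξ, hξ1, hξ2⟩ := hy
  have : e.e (X.symm ξ) = y := Y.injOn hξ1.1.2.2 hys hξ2
  rw [← this]; exact hξ1.2

/-- If the image of a second bundle is a neighbourhood of `e x`, and `e x` is the image of an
interior point of that bundle, then `x` is an interior point. -/
theorem notMem_bdry_of_e_eq {n' : ℕ} {L : GMfd.{u} G n'} (e' : RoundTub L M')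
    (hsub : range e'.e ⊆ range e.e) {x : e.D} {z : e'.D} (hz : z ∉ e'.D.bdry)
    (hxz : e'.e z = e.e x) : x ∉ e.D.bdry := by
  rw [notMem_bdry_iff]
  obtain ⟨Ω, hΩ, T, hT, hTe⟩ := e.smoothVia_e x
  obtain ⟨Ω', hΩ', T', hT', hTe'⟩ := e'.smoothVia_e z
  have hopen : e'.e '' Ω' ∈ 𝓝 (e'.e z) := e'.nhds_le_map_e hz (image_mem_map hΩ')
  -- By inclusion of the ranges and the embedding property, points near z lift to points near x. So
  -- the two local inverses give mutually inverse transition maps, and interiority passes from z to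
  -- x.
  have hlift : ∀ᶠ y in 𝓝 z, e'.e y ∈ e.e '' Ω := by
    obtain ⟨U, hU, hUΩ⟩ := (e.e_embedding.isInducing.nhds_eq_comap x) ▸ hΩ
    rw [← hxz] at hU
    filter_upwards [e'.continuous_e.continuousAt hU] with y hy
    obtain ⟨w, hw⟩ := hsub (mem_range_self y)
    exact ⟨w, hUΩ (by rw [mem_preimage, hw]; exact hy), hw⟩
  have hf : ContMDiffAt (quadModel m) (quadModel m) ∞ (fun y => T (e'.e y)) z := by
    have h1 : ContMDiffWithinAt (quadModel m) (quadModel m) ∞ (T ∘ e'.e) (e'.e ⁻¹' (e.e '' Ω)) z :=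
      ContMDiffWithinAt.comp z (by rw [hxz]; exact hT) (e'.e_smooth z).contMDiffWithinAt
        fun y hy => hy
    exact h1.contMDiffAt hlift
  have hg : ContMDiffAt (quadModel m) (quadModel m) ∞ (fun y => T' (e.e y)) x := by
    have h1 := (hT'.contMDiffAt hopen)
    rw [hxz] at h1
    exact h1.comp x (e.e_smooth x)
  refine isInteriorPoint_of_section (a := z) (g := fun y => T' (e.e y)) (f := fun y => T (e'.e y))
    ?_ (hf.mdifferentiableAt (by simp)) (hg.mdifferentiableAt (by simp)) ?_ ((notMem_bdry_iff _).1 hz)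
  · rw [← hxz, hTe' z (mem_of_mem_nhds hΩ')]
  · have : e.e ⁻¹' (e'.e '' Ω') ∈ 𝓝 x := e.continuous_e.continuousAt (by rw [← hxz]; exact hopen)
    filter_upwards [this, hΩ] with y hy hyΩ
    obtain ⟨w, hw, hwy⟩ := hy
    rw [← hwy, hTe' w hw, hwy, hTe y hyΩ]

end RoundTub

/-! ### Smooth functions on encased mirror cobordisms -/

namespace PreCob

variable {n : ℕ} {M : GMfd.{u} G n} {W W' : PreCob M}
  {E' H' Z' : Type*} [NormedAddCommGroup E'] [NormedSpace ℝ E'] [TopologicalSpace H']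
  [TopologicalSpace Z'] [ChartedSpace H' Z'] {J' : ModelWithCorners ℝ E' H'}

/-- The function `g` is smooth at `w`, in all charts. -/
def SmoothAt (W : PreCob M) (J' : ModelWithCorners ℝ E' H') (g : W.X → Z') (w : W.X) : Prop :=
  ∀ ψ ∈ W.atlas, w ∈ ψ.source → SmoothVia (quadModel (n + 1)) ψ J' g w

/-- A pointwise version, which allows the source point to be treated by cases. -/
theorem isSmooth_iff {f : W.X → W'.X} :
    W.IsSmooth W' f ↔ Continuous f ∧ ∀ w, ∀ ψ ∈ W'.atlas, f w ∈ ψ.source →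
      W.SmoothAt (quadModel (n + 1)) (fun y => ψ (f y)) w := by
  constructor
  · rintro ⟨hc, h⟩
    refine ⟨hc, fun w ψ hψ hw φ hφ hwφ => (smoothVia_chart_iff hwφ).2 ?_⟩
    refine (h φ hφ ψ hψ).contMDiffAt (inter_mem (φ.open_target.mem_nhds (φ.map_source hwφ)) ?_)
    refine φ.continuousAt_symm (φ.map_source hwφ) ?_
    rw [φ.left_inv hwφ]
    exact (ψ.open_source.preimage hc).mem_nhds hw
  · rintro ⟨hc, h⟩
    refine ⟨hc, fun φ hφ ψ hψ y hy => ?_⟩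
    have h1 := h (φ.symm y) ψ hψ hy.2 φ hφ (φ.map_target hy.1)
    rw [smoothVia_chart_iff (φ.map_target hy.1), φ.right_inv hy.1] at h1
    exact h1.contMDiffWithinAt

namespace IsEncasedMirror

theorem smoothVia_chart (hW : W.IsEncasedMirror) {φ ψ : OpenPartialHomeomorph W.X (Quad (n + 1))}
    (hφ : φ ∈ W.atlas) (hψ : ψ ∈ W.atlas) {w : W.X} (hwφ : w ∈ φ.source) (hwψ : w ∈ ψ.source) :
    SmoothVia (quadModel (n + 1)) φ (quadModel (n + 1)) ψ w := by
  rw [smoothVia_chart_iff hwφ]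
  have h := contMDiffOn_of_mem_contDiffGroupoid (hW.compatible φ hφ ψ hψ)
  exact h.contMDiffAt ((φ.symm ≫ₕ ψ).open_source.mem_nhds
    (by simp [φ.left_inv hwφ, φ.map_source hwφ, hwψ]))

/-- By compatibility of the charts, one chart suffices. -/
theorem smoothAt_of_chart (hW : W.IsEncasedMirror) {ψ : OpenPartialHomeomorph W.X (Quad (n + 1))}
    (hψ : ψ ∈ W.atlas) {w : W.X} (hw : w ∈ ψ.source) {g : W.X → Z'}
    (h : SmoothVia (quadModel (n + 1)) ψ J' g w) : W.SmoothAt J' g w :=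
  fun _ hφ hwφ => (hW.smoothVia_chart hφ hψ hwφ hw).trans h

theorem smoothAt_chart (hW : W.IsEncasedMirror) {ψ : OpenPartialHomeomorph W.X (Quad (n + 1))}
    (hψ : ψ ∈ W.atlas) {w : W.X} (hw : w ∈ ψ.source) : W.SmoothAt (quadModel (n + 1)) ψ w :=
  hW.smoothAt_of_chart hψ hw (SmoothVia.refl _ _ _)

theorem smoothAt_r (hW : W.IsEncasedMirror) (w : W.X) : W.SmoothAt (quadModel n) W.r w :=
  fun ψ hψ hw => (smoothVia_chart_iff hw).2
    ((hW.r_smooth ψ hψ).contMDiffAt (ψ.open_target.mem_nhds (ψ.map_source hw)))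

theorem smoothAt_h (hW : W.IsEncasedMirror) (w : W.X) : W.SmoothAt 𝓘(ℝ, ℝ) W.h w :=
  fun ψ hψ hw => (smoothVia_chart_iff hw).2
    ((hW.h_smooth ψ hψ).contMDiffAt (ψ.open_target.mem_nhds (ψ.map_source hw)))

theorem continuousAt (hW : W.IsEncasedMirror) {g : W.X → Z'} {w : W.X}
    (h : W.SmoothAt J' g w) : ContinuousAt g w := by
  obtain ⟨ψ, hψ, hw⟩ := hW.covers w
  exact (h ψ hψ hw).continuousAt (ψ.continuousAt hw)

theorem continuous_r (hW : W.IsEncasedMirror) : Continuous W.r :=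
  continuous_iff_continuousAt.2 fun w => hW.continuousAt (hW.smoothAt_r w)

theorem continuous_h (hW : W.IsEncasedMirror) : Continuous W.h :=
  continuous_iff_continuousAt.2 fun w => hW.continuousAt (hW.smoothAt_h w)

theorem continuous_flip (hW : W.IsEncasedMirror) : Continuous W.flip := hW.flip_smooth.1

/-- The collar is continuous and carries the compact boundary of M × [-1, 1] onto the boundary,
which is therefore compact. -/
theorem isClosed_bd (hW : W.IsEncasedMirror) : IsClosed W.bd := by
  have := hW.t2
  obtain ⟨O, hO⟩ := hW.collar
  obtain ⟨c, hc, hcont, -⟩ := hO.inverse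
  have h1 : W.bd = c '' (W.rho '' W.bd) := by
    rw [image_image]
    conv_lhs => rw [← image_id W.bd]
    exact image_congr fun x hx => (hc x (hO.bd_subset hx)).symm
  rw [h1]
  refine (IsCompact.image_of_continuousOn ?_
    (hcont.mono (image_mono hO.bd_subset))).isClosed
  have h2 : {q : M × ℝ | q.2 ∈ Icc (-1 : ℝ) 1 ∧ (q.1 ∈ M.bdry ∨ q.2 = -1 ∨ q.2 = 1)} =
      (univ ×ˢ Icc (-1 : ℝ) 1) ∩ ((Prod.fst ⁻¹' M.bdry) ∪ ((Prod.snd ⁻¹' {-1}) ∪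
        (Prod.snd ⁻¹' {1}))) := by
    ext q; simp [mem_prod]
  rw [hO.image_bd, h2]
  refine (isCompact_univ.prod isCompact_Icc).inter_right ?_
  have hb : IsClosed M.bdry := ModelWithCorners.isClosed_boundary (n := ∞) (by simp)
  exact (hb.preimage continuous_fst).union ((isClosed_singleton.preimage continuous_snd).union
    (isClosed_singleton.preimage continuous_snd))

theorem bd_cases (hW : W.IsEncasedMirror) {w : W.X} (hw : w ∈ W.bd) :
    W.r w ∈ M.bdry ∨ W.h w = -1 ∨ W.h w = 1 := by
  obtain ⟨O, hO⟩ := hW.collar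
  have h : W.rho w ∈ W.rho '' W.bd := mem_image_of_mem _ hw
  rw [hO.image_bd] at h
  exact h.2

theorem rho_injOn_bd (hW : W.IsEncasedMirror) : InjOn W.rho W.bd := by
  obtain ⟨O, hO⟩ := hW.collar
  exact hO.injOn.mono hO.bd_subset

theorem exists_bd (hW : W.IsEncasedMirror) {q : M × ℝ} (hq : q.2 ∈ Icc (-1 : ℝ) 1)
    (h : q.1 ∈ M.bdry ∨ q.2 = -1 ∨ q.2 = 1) : ∃ w ∈ W.bd, W.rho w = q := by
  obtain ⟨O, hO⟩ := hW.collar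
  have : q ∈ W.rho '' W.bd := by rw [hO.image_bd]; exact ⟨hq, h⟩
  exact this

theorem smoothAt_comp (hW' : W'.IsEncasedMirror) {f : W.X → W'.X}
    (hf : W.IsSmooth W' f) {g : W'.X → Z'} {w : W.X} (hg : W'.SmoothAt J' g (f w)) :
    W.SmoothAt J' (fun y => g (f y)) w := by
  obtain ⟨ψ, hψ, hw⟩ := hW'.covers (f w)
  intro φ hφ hwφ
  exact ((isSmooth_iff.1 hf).2 w ψ hψ hw φ hφ hwφ).trans
    ((hg ψ hψ hw).comp_left rfl hf.1.continuousAt)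

end IsEncasedMirror

/-- On a collar neighbourhood the encasing function is injective, so it sees exactly which points
are boundary points. -/
theorem IsCollarNhd.mem_bd_iff {O : Set W.X} (hO : W.IsCollarNhd O) {w : W.X} (hw : w ∈ O)
    (hh : W.h w ∈ Icc (-1 : ℝ) 1) :
    w ∈ W.bd ↔ W.r w ∈ M.bdry ∨ W.h w = -1 ∨ W.h w = 1 := by
  have h : W.rho w ∈ W.rho '' W.bd ↔ W.r w ∈ M.bdry ∨ W.h w = -1 ∨ W.h w = 1 := by
    rw [hO.image_bd]
    exact ⟨fun h => h.2, fun h => ⟨hh, h⟩⟩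
  rw [← h]
  exact (hO.injOn.mem_image_iff hO.bd_subset hw).symm

end PreCob

/-! ### The topology of the stabilization -/

section Topology

variable {n m : ℕ} {M : GMfd.{u} G n} {M' : GMfd.{u} G m} {e : RoundTub M M'} {W : PreCob M}

theorem continuous_ofTrivial : Continuous (ofTrivial : trivialPart e → StSpace e W) :=
  continuous_quot_mk.comp continuous_inl

theorem continuous_ofCone : Continuous (ofCone : conePart e W → StSpace e W) :=
  continuous_quot_mk.comp continuous_inr

theorem StSpace.ind {P : StSpace e W → Prop} (ht : ∀ a, P (ofTrivial a)) (hc : ∀ b, P (ofCone b))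
    (z : StSpace e W) : P z := by
  rcases z with ⟨a | b⟩
  exacts [ht a, hc b]

theorem continuous_st_iff {Y : Type*} [TopologicalSpace Y] {f : StSpace e W → Y} :
    Continuous f ↔ Continuous (fun a => f (ofTrivial a)) ∧ Continuous (fun b => f (ofCone b)) := by
  constructor
  · exact fun h => ⟨h.comp continuous_ofTrivial, h.comp continuous_ofCone⟩
  · rintro ⟨h1, h2⟩
    refine continuous_coinduced_dom.2 (continuous_sum_dom.2 ⟨h1, h2⟩)

theorem isOpen_st_iff {s : Set (StSpace e W)} :
    IsOpen s ↔ IsOpen (ofTrivial ⁻¹' s : Set (trivialPart e)) ∧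
      IsOpen (ofCone ⁻¹' s : Set (conePart e W)) := by
  change IsOpen (Quot.mk (Glue e W) ⁻¹' s) ↔ _
  rw [isOpen_sum_iff]
  rfl

theorem continuous_stR : Continuous (stR e W) :=
  continuous_st_iff.2 ⟨continuous_fst.comp continuous_subtype_val,
    e.continuous_e.comp (continuous_fst.comp (continuous_snd.comp continuous_subtype_val))⟩

theorem continuous_stH : Continuous (stH e W) :=
  continuous_st_iff.2 ⟨continuous_snd.comp continuous_subtype_val,
    continuous_snd.comp (continuous_snd.comp continuous_subtype_val)⟩

theorem continuous_stRho : Continuous (stRho e W) :=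
  continuous_stR.prodMk continuous_stH

theorem stRho_ofTrivial (a : trivialPart e) : stRho e W (ofTrivial a) = a.1 := rfl

theorem stRho_ofCone (b : conePart e W) : stRho e W (ofCone b) = (e.e b.1.2.1, b.1.2.2) := rfl

theorem ofTrivial_injective : Function.Injective (ofTrivial : trivialPart e → StSpace e W) :=
  fun _ _ h => Subtype.ext (congrArg (stRho e W) h)

theorem conePart_h (b : conePart e W) :
    W.h b.1.1 = -√(e.nrm b.1.2.1 ^ 2 + b.1.2.2 ^ 2) := by
  rw [← b.2.2.2, Real.sqrt_sq_eq_abs, abs_of_nonpos b.2.1, neg_neg]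

open Classical in
/-- The associated point outside the boundary. -/
def innerPoint : StSpace e W → Option W.X :=
  Quot.lift (Sum.elim (fun _ => none) (fun b => if b.1.1 ∈ W.bd then none else some b.1.1)) (by
    rintro _ _ ⟨a, b, hb, he, ht⟩
    simp [hb])

/-- The gluing involves only points associated to the boundary. The associated point outside the
boundary, with a default value otherwise, is an invariant of the quotient that separates the two
parts. -/
theorem mem_bd_of_ofTrivial_eq {a : trivialPart e} {b : conePart e W}
    (h : ofTrivial a = ofCone b) : b.1.1 ∈ W.bd := by
  by_contra hb
  have h1 := congrArg innerPoint h
  simp [innerPoint, ofTrivial, ofCone, hb] at h1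

/-- The quotient could only identify two points of the nontrivial part through a common trivial
point. Both are then associated to boundary points with the same encasing value, and these agree by
the collar. -/
theorem ofCone_injective (hW : W.IsEncasedMirror) :
    Function.Injective (ofCone : conePart e W → StSpace e W) := by
  intro b b' h
  have h1 := congrArg (stRho e W) h
  rw [stRho_ofCone, stRho_ofCone, Prod.mk.injEq] at h1
  have hx := e.e_embedding.injective h1.1
  have ht := h1.2
  have hw : b.1.1 = b'.1.1 := by
    have h2 := congrArg innerPoint h
    by_cases hb : b.1.1 ∈ W.bd
    · by_cases hb' : b'.1.1 ∈ W.bd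
      · refine hW.rho_injOn_bd hb hb' (Prod.ext ?_ ?_)
        · change W.r _ = W.r _
          rw [b.2.2.1, b'.2.2.1, hx]
        · change W.h _ = W.h _
          rw [conePart_h, conePart_h, hx, ht]
      · simp [innerPoint, ofCone, hb, hb'] at h2
    · by_cases hb' : b'.1.1 ∈ W.bd
      · simp [innerPoint, ofCone, hb, hb'] at h2
      · simpa [innerPoint, ofCone, hb, hb'] using h2
  exact Subtype.ext (Prod.ext hw (Prod.ext hx ht))

theorem assoc_ofCone_iff (hW : W.IsEncasedMirror) {b : conePart e W} {w : W.X} :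
    Assoc e W (ofCone b) w ↔ b.1.1 = w := by
  constructor
  · rintro ⟨b', hb', rfl⟩
    rw [ofCone_injective hW hb']
  · exact fun h => ⟨b, rfl, h⟩

theorem conePart_norm_sq_le (hW : W.IsEncasedMirror) (b : conePart e W) :
    e.nrm b.1.2.1 ^ 2 + b.1.2.2 ^ 2 ≤ 1 := by
  rw [← b.2.2.2]
  have := hW.h_mem b.1.1
  nlinarith [this.1, this.2]

theorem conePart_t_mem (hW : W.IsEncasedMirror) (b : conePart e W) :
    b.1.2.2 ∈ Icc (-1 : ℝ) 1 := by
  have := conePart_norm_sq_le hW b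
  exact abs_le.1 (abs_le_one_iff_mul_self_le_one.2 (by nlinarith [sq_nonneg (e.nrm b.1.2.1)]))

/-- Points associated to the bottom or the sides lie in the trivial part. -/
theorem exists_ofTrivial_eq (hW : W.IsEncasedMirror) {b : conePart e W} (hb : b.1.1 ∈ W.bd) :
    ∃ a : trivialPart e, (ofTrivial a : StSpace e W) = ofCone b := by
  refine ⟨⟨(e.e b.1.2.1, b.1.2.2), conePart_t_mem hW b, fun x hx => ?_⟩, ?_⟩
  · rw [e.e_embedding.injective hx, e.mem_bdry_iff, ← b.2.2.1, ← b.2.2.2]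
    rcases hW.bd_cases hb with h | h | h
    · exact Or.inl (Or.inl h)
    · exact Or.inr (by rw [h]; norm_num)
    · exact Or.inr (by rw [h]; norm_num)
  · exact Quot.sound (Glue.glue _ _ hb rfl rfl)

theorem trivial_or_inner (hW : W.IsEncasedMirror) (z : StSpace e W) :
    (∃ a : trivialPart e, ofTrivial a = z) ∨ ∃ b : conePart e W, b.1.1 ∉ W.bd ∧ ofCone b = z := by
  induction z using StSpace.ind with
  | ht a => exact Or.inl ⟨a, rfl⟩
  | hc b =>
    by_cases hb : b.1.1 ∈ W.bd
    · exact Or.inl (exists_ofTrivial_eq hW hb)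
    · exact Or.inr ⟨b, hb, rfl⟩

/-- A point of the stabilization is determined by its image under the encasing function and its
associated point, when it exists. -/
theorem st_ext (hW : W.IsEncasedMirror) {z z' : StSpace e W} (hr : stRho e W z = stRho e W z')
    (ha : ∀ w, Assoc e W z w ↔ Assoc e W z' w) : z = z' := by
  by_cases h : ∃ w, Assoc e W z w
  · obtain ⟨w, hw⟩ := h
    obtain ⟨b', rfl, hb'⟩ := (ha w).1 hw
    obtain ⟨b, rfl, hb⟩ := hw
    rw [stRho_ofCone, stRho_ofCone, Prod.mk.injEq] at hr
    congr 1
    exact Subtype.ext (Prod.ext (hb.trans hb'.symm)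
      (Prod.ext (e.e_embedding.injective hr.1) hr.2))
  · have h' : ¬ ∃ w, Assoc e W z' w := fun ⟨w, hw⟩ => h ⟨w, (ha w).2 hw⟩
    rcases trivial_or_inner hW z with ⟨a, rfl⟩ | ⟨b, -, rfl⟩
    · rcases trivial_or_inner hW z' with ⟨a', rfl⟩ | ⟨b', -, rfl⟩
      · rw [stRho_ofTrivial, stRho_ofTrivial] at hr
        rw [Subtype.ext hr]
      · exact absurd ⟨_, b', rfl, rfl⟩ h'
    · exact absurd ⟨_, b, rfl, rfl⟩ h

/-- Away from the boundary of the cobordism nothing is glued, so these sets are saturated and miss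
the trivial part. -/
theorem isOpen_image_ofCone (hW : W.IsEncasedMirror) {N : Set (conePart e W)} (hN : IsOpen N)
    (hbd : ∀ b ∈ N, b.1.1 ∉ W.bd) : IsOpen (ofCone '' N : Set (StSpace e W)) := by
  rw [isOpen_st_iff, (ofCone_injective hW).preimage_image]
  refine ⟨?_, hN⟩
  convert isOpen_empty
  refine eq_empty_of_forall_notMem ?_
  rintro a ⟨b, hb, hba⟩
  exact hbd b hb (mem_bd_of_ofTrivial_eq hba.symm)

theorem continuous_conePart_fst : Continuous fun b : conePart e W => b.1.1 :=
  continuous_fst.comp continuous_subtype_val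

theorem continuous_conePart_x : Continuous fun b : conePart e W => b.1.2.1 :=
  continuous_fst.comp (continuous_snd.comp continuous_subtype_val)

theorem continuous_conePart_t : Continuous fun b : conePart e W => b.1.2.2 :=
  continuous_snd.comp (continuous_snd.comp continuous_subtype_val)

theorem eventually_notMem_bd (hW : W.IsEncasedMirror) {b : conePart e W} (hb : b.1.1 ∉ W.bd) :
    ∀ᶠ b' : conePart e W in 𝓝 b, b'.1.1 ∉ W.bd :=
  (hW.isClosed_bd.isOpen_compl.preimage continuous_conePart_fst).mem_nhds hb

/-- Local openness at unglued points. It allows smoothness statements near such points to be checked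
on the nontrivial part itself. -/
theorem nhds_ofCone_le (hW : W.IsEncasedMirror) {b : conePart e W} (hb : b.1.1 ∉ W.bd) :
    𝓝 (ofCone b : StSpace e W) ≤ map ofCone (𝓝 b) := by
  intro N hN
  rw [mem_map] at hN
  obtain ⟨U, hU, hUo, hbU⟩ := mem_nhds_iff.1 (inter_mem hN (eventually_notMem_bd hW hb))
  refine mem_of_superset ((isOpen_image_ofCone hW hUo fun b' hb' => (hU hb').2).mem_nhds
    (mem_image_of_mem _ hbU)) ?_
  rintro _ ⟨b', hb', rfl⟩
  exact (hU hb').1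

theorem isClosed_conePart (hW : W.IsEncasedMirror) : IsClosed (conePart e W) := by
  have := hW.continuous_h
  have := hW.continuous_r
  have := e.continuous_p
  have := e.continuous_nrm
  have h1 : IsClosed {q : W.X × e.D × ℝ | W.h q.1 ≤ 0} :=
    isClosed_le (by fun_prop) continuous_const
  have h2 : IsClosed {q : W.X × e.D × ℝ | W.r q.1 = e.p q.2.1} :=
    isClosed_eq (by fun_prop) (by fun_prop)
  have h3 : IsClosed {q : W.X × e.D × ℝ | W.h q.1 ^ 2 = e.nrm q.2.1 ^ 2 + q.2.2 ^ 2} :=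
    isClosed_eq (by fun_prop) (by fun_prop)
  exact h1.inter (h2.inter h3)

theorem compactSpace_conePart (hW : W.IsEncasedMirror) : CompactSpace (conePart e W) := by
  have := hW.compact
  refine isCompact_iff_compactSpace.1 ?_
  refine ((isCompact_univ (X := W.X)).prod ((isCompact_univ (X := e.D)).prod
    (isCompact_Icc (a := (-1 : ℝ)) (b := 1)))).of_isClosed_subset (isClosed_conePart hW) ?_
  intro q hq
  exact ⟨mem_univ _, mem_univ _, conePart_t_mem hW ⟨q, hq⟩⟩

/-- A point violates the defining condition through an interior point x of D of norm less than one;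
the embedding is open at x, so nearby points violate it too. -/
theorem isClosed_trivialPart : IsClosed (trivialPart e) := by
  have h1 : IsClosed {q : M' × ℝ | q.2 ∈ Icc (-1 : ℝ) 1} := isClosed_Icc.preimage continuous_snd
  suffices h2 : IsClosed {q : M' × ℝ | ∀ x : e.D, e.e x = q.1 →
      x ∈ e.D.bdry ∨ 1 ≤ e.nrm x ^ 2 + q.2 ^ 2} from h1.inter h2
  rw [← isOpen_compl_iff, isOpen_iff_mem_nhds]
  rintro ⟨y, s⟩ hq
  simp only [mem_compl_iff, mem_ofPred_eq, not_forall, not_or, not_le] at hq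
  obtain ⟨x, rfl, hx, hlt⟩ := hq
  have hb : IsClosed e.D.bdry := ModelWithCorners.isClosed_boundary (n := ∞) (by simp)
  have hc : Continuous fun q : e.D × ℝ => e.nrm q.1 ^ 2 + q.2 ^ 2 := by
    have := e.continuous_nrm
    fun_prop
  have hN : {q : e.D × ℝ | q.1 ∉ e.D.bdry ∧ e.nrm q.1 ^ 2 + q.2 ^ 2 < 1} ∈ 𝓝 (x, s) :=
    ((hb.isOpen_compl.preimage continuous_fst).inter
      (isOpen_lt hc continuous_const)).mem_nhds ⟨hx, hlt⟩
  have hmap : 𝓝 (e.e x, s) ≤ map (Prod.map e.e id) (𝓝 (x, s)) := by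
    rw [nhds_prod_eq, nhds_prod_eq, ← prod_map_map_eq', map_id]
    exact Filter.prod_mono (e.nhds_le_map_e hx) le_rfl
  refine mem_of_superset (hmap (image_mem_map hN)) ?_
  rintro _ ⟨q, hq, rfl⟩ hcon
  rcases hcon q.1 rfl with h | h
  · exact hq.1 h
  · exact absurd hq.2 (not_lt.2 h)

theorem compactSpace_trivialPart : CompactSpace (trivialPart e) := by
  refine isCompact_iff_compactSpace.1 ?_
  exact ((isCompact_univ (X := M')).prod (isCompact_Icc (a := (-1 : ℝ)) (b := 1))).of_isClosed_subset
    isClosed_trivialPart fun q hq => ⟨mem_univ _, hq.1⟩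

theorem compactSpace_st (hW : W.IsEncasedMirror) : CompactSpace (StSpace e W) := by
  have := compactSpace_conePart (e := e) hW
  have := compactSpace_trivialPart (e := e)
  exact Quot.compactSpace

/-- The open set of points that are trivial or associated to a point of a neighbourhood `V` of the
boundary. -/
theorem isOpen_trivial_union (hW : W.IsEncasedMirror) {V : Set W.X} (hV : IsOpen V)
    (hbd : W.bd ⊆ V) :
    IsOpen {z : StSpace e W | (∃ a : trivialPart e, ofTrivial a = z) ∨ ∃ w ∈ V, Assoc e W z w} := by
  rw [isOpen_st_iff]
  constructor
  · convert isOpen_univ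
    exact eq_univ_of_forall fun a => Or.inl ⟨a, rfl⟩
  · convert hV.preimage (continuous_conePart_fst (e := e) (W := W))
    ext b
    constructor
    · rintro (⟨a, ha⟩ | ⟨w, hw, hbw⟩)
      · exact hbd (mem_bd_of_ofTrivial_eq ha)
      · rw [assoc_ofCone_iff hW] at hbw
        rw [mem_preimage, hbw]; exact hw
    · exact fun hb => Or.inr ⟨_, hb, b, rfl, rfl⟩

/-- Points with different encasing values are separated by them. If the values agree, then at least
one point is unglued and in the nontrivial part, and neighbourhoods of the associated points in the
cobordism, or of its boundary, do the separation. -/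
theorem t2Space_st (hW : W.IsEncasedMirror) : T2Space (StSpace e W) := by
  have := hW.t2
  have := hW.compact
  have key : ∀ (b : conePart e W), b.1.1 ∉ W.bd → ∀ z : StSpace e W, ofCone b ≠ z →
      stRho e W (ofCone b) = stRho e W z →
      ∃ u v : Set (StSpace e W), IsOpen u ∧ IsOpen v ∧ ofCone b ∈ u ∧ z ∈ v ∧ Disjoint u v := by
    intro b hb z hne hr
    have hsep : ∀ V : Set W.X, IsOpen V → Disjoint V W.bd →
        IsOpen (ofCone '' {b : conePart e W | b.1.1 ∈ V} : Set (StSpace e W)) := fun V hV hd =>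
      isOpen_image_ofCone hW (hV.preimage continuous_conePart_fst)
        fun b' hb' => disjoint_left.1 hd hb'
    rcases trivial_or_inner hW z with ⟨a, rfl⟩ | ⟨b', hb', rfl⟩
    · obtain ⟨U, V, hU, hV, hwU, hbdV, hd⟩ :=
        SeparatedNhds.of_isCompact_isCompact (isCompact_singleton (x := b.1.1))
          hW.isClosed_bd.isCompact (disjoint_singleton_left.2 hb)
      refine ⟨_, _, hsep U hU (hd.mono_right hbdV), isOpen_trivial_union hW hV hbdV,
        ⟨b, hwU rfl, rfl⟩, Or.inl ⟨a, rfl⟩, disjoint_left.2 ?_⟩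
      rintro _ ⟨b', hb', rfl⟩ (⟨a', ha'⟩ | ⟨w, hw, hbw⟩)
      · exact disjoint_left.1 hd hb' (hbdV (mem_bd_of_ofTrivial_eq ha'))
      · rw [assoc_ofCone_iff hW] at hbw
        exact disjoint_left.1 hd hb' (hbw ▸ hw)
    · have hw : b.1.1 ≠ b'.1.1 := by
        intro hw
        refine hne (congrArg ofCone (Subtype.ext (Prod.ext hw ?_)))
        rw [stRho_ofCone, stRho_ofCone, Prod.mk.injEq] at hr
        exact Prod.ext (e.e_embedding.injective hr.1) hr.2
      obtain ⟨U, V, hU, hV, hwU, hwV, hd⟩ := t2_separation hw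
      refine ⟨_, _, hsep (U \ W.bd) (hU.sdiff hW.isClosed_bd) disjoint_sdiff_left,
        hsep (V \ W.bd) (hV.sdiff hW.isClosed_bd) disjoint_sdiff_left, ⟨b, ⟨hwU, hb⟩, rfl⟩,
        ⟨b', ⟨hwV, hb'⟩, rfl⟩, disjoint_left.2 ?_⟩
      rintro _ ⟨c, hc, rfl⟩ ⟨c', hc', hcc⟩
      rw [ofCone_injective hW hcc] at hc'
      exact disjoint_left.1 hd hc.1 hc'.1
  refine ⟨fun z z' hne => ?_⟩
  by_cases hr : stRho e W z = stRho e W z'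
  · rcases trivial_or_inner hW z with ⟨a, rfl⟩ | ⟨b, hb, rfl⟩
    · rcases trivial_or_inner hW z' with ⟨a', rfl⟩ | ⟨b', hb', rfl⟩
      · exact absurd (congrArg ofTrivial (Subtype.ext hr)) hne
      · obtain ⟨u, v, hu, hv, h1, h2, hd⟩ := key b' hb' _ hne.symm hr.symm
        exact ⟨v, u, hv, hu, h2, h1, hd.symm⟩
    · exact key b hb _ hne hr
  · exact separated_by_continuous continuous_stRho hr

end Topology

/-! ### The collar region -/

section CollarRegion

variable {n m : ℕ} {M : GMfd.{u} G n} {M' : GMfd.{u} G m} {e : RoundTub M M'} {W : PreCob M}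

variable (e W) in
/-- The points that are trivial or associated to a point of `O`. -/
def collarRegion (O : Set W.X) : Set (StSpace e W) :=
  {z | (∃ a : trivialPart e, ofTrivial a = z) ∨ ∃ w ∈ O, Assoc e W z w}

theorem ofTrivial_mem_collarRegion (O : Set W.X) (a : trivialPart e) :
    ofTrivial a ∈ collarRegion e W O := Or.inl ⟨a, rfl⟩

theorem ofCone_mem_collarRegion_iff (hW : W.IsEncasedMirror) {O : Set W.X} (hO : W.bd ⊆ O)
    {b : conePart e W} : ofCone b ∈ collarRegion e W O ↔ b.1.1 ∈ O := by
  constructor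
  · rintro (⟨a, ha⟩ | ⟨w, hw, hbw⟩)
    · exact hO (mem_bd_of_ofTrivial_eq ha)
    · rw [assoc_ofCone_iff hW] at hbw
      rwa [hbw]
  · exact fun h => Or.inr ⟨_, h, b, rfl, rfl⟩

theorem collarRegion_cases (hW : W.IsEncasedMirror) {O : Set W.X} (hO : W.bd ⊆ O)
    {z : StSpace e W} (hz : z ∈ collarRegion e W O) :
    (∃ a : trivialPart e, ofTrivial a = z) ∨
      ∃ b : conePart e W, b.1.1 ∉ W.bd ∧ b.1.1 ∈ O ∧ ofCone b = z := by
  rcases trivial_or_inner hW z with h | ⟨b, hb, rfl⟩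
  · exact Or.inl h
  · exact Or.inr ⟨b, hb, (ofCone_mem_collarRegion_iff hW hO).1 hz, rfl⟩

/-- A point of `D(ν × ℝ)` over the trivial part is associated to a point of the boundary. -/
theorem exists_bd_of_trivial (hW : W.IsEncasedMirror) {x : e.D} {s : ℝ}
    (hle : e.nrm x ^ 2 + s ^ 2 ≤ 1) (h : x ∈ e.D.bdry ∨ 1 ≤ e.nrm x ^ 2 + s ^ 2) :
    ∃ w ∈ W.bd, W.rho w = (e.p x, -√(e.nrm x ^ 2 + s ^ 2)) := by
  have h0 : 0 ≤ e.nrm x ^ 2 + s ^ 2 := by positivity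
  have h1 : √(e.nrm x ^ 2 + s ^ 2) ≤ 1 := Real.sqrt_le_one.2 hle
  refine hW.exists_bd ⟨by linarith, by linarith [Real.sqrt_nonneg (e.nrm x ^ 2 + s ^ 2)]⟩ ?_
  have key : 1 ≤ e.nrm x ^ 2 + s ^ 2 → -√(e.nrm x ^ 2 + s ^ 2) = -1 := by
    intro h2
    rw [le_antisymm hle h2, Real.sqrt_one]
  rcases h with h | h
  · rcases (e.mem_bdry_iff x).1 h with h | h
    · exact Or.inl h
    · exact Or.inr (Or.inl (key (by rw [h]; nlinarith [sq_nonneg s])))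
  · exact Or.inr (Or.inl (key h))

theorem conePart_rho (b : conePart e W) :
    W.rho b.1.1 = (e.p b.1.2.1, -√(e.nrm b.1.2.1 ^ 2 + b.1.2.2 ^ 2)) :=
  Prod.ext b.2.2.1 (conePart_h b)

theorem exists_conePart {w : W.X} {x : e.D} {s : ℝ}
    (h : W.rho w = (e.p x, -√(e.nrm x ^ 2 + s ^ 2))) :
    ∃ b : conePart e W, b.1 = (w, x, s) := by
  have h1 : W.r w = e.p x := congrArg Prod.fst h
  have h2 : W.h w = -√(e.nrm x ^ 2 + s ^ 2) := congrArg Prod.snd h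
  refine ⟨⟨(w, x, s), ?_, h1, ?_⟩, rfl⟩
  · change W.h w ≤ 0
    rw [h2]; exact neg_nonpos.2 (Real.sqrt_nonneg _)
  · change W.h w ^ 2 = _
    rw [h2, neg_sq, Real.sq_sqrt (by positivity)]

/-- The delicate case is a trivial point with the encasing value of an unglued point associated to w
in `O`. The trivial condition produces a boundary point with the same encasing value as w, so w is a
boundary point by injectivity on `O`. -/
theorem injOn_stRho_collarRegion (hW : W.IsEncasedMirror) {O : Set W.X} (hO : W.IsCollarNhd O) :
    InjOn (stRho e W) (collarRegion e W O) := by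
  have key : ∀ (a : trivialPart e) (b : conePart e W), b.1.1 ∉ W.bd → b.1.1 ∈ O →
      stRho e W (ofTrivial a) ≠ stRho e W (ofCone b) := by
    intro a b hb hbO h
    rw [stRho_ofTrivial, stRho_ofCone] at h
    have h1 := a.2.2 b.1.2.1 (congrArg Prod.fst h).symm
    rw [show a.1.2 = b.1.2.2 from congrArg Prod.snd h] at h1
    obtain ⟨w, hw, hwr⟩ := exists_bd_of_trivial hW (conePart_norm_sq_le hW b) h1
    rw [← conePart_rho] at hwr
    exact hb (hO.injOn (hO.bd_subset hw) hbO hwr ▸ hw)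
  intro z hz z' hz' h
  rcases collarRegion_cases hW hO.bd_subset hz with ⟨a, rfl⟩ | ⟨b, hb, hbO, rfl⟩
  · rcases collarRegion_cases hW hO.bd_subset hz' with ⟨a', rfl⟩ | ⟨b', hb', hbO', rfl⟩
    · exact congrArg ofTrivial (Subtype.ext h)
    · exact absurd h (key a b' hb' hbO')
  · rcases collarRegion_cases hW hO.bd_subset hz' with ⟨a', rfl⟩ | ⟨b', hb', hbO', rfl⟩
    · exact absurd h.symm (key a' b hb hbO)
    · rw [stRho_ofCone, stRho_ofCone, Prod.mk.injEq] at h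
      have hx := e.e_embedding.injective h.1
      refine congrArg ofCone (Subtype.ext (Prod.ext (hO.injOn hbO hbO' ?_) (Prod.ext hx h.2)))
      rw [conePart_rho, conePart_rho, hx, h.2]

/-- The points of `D(ν × ℝ)` of norm at most one. -/
def unitBall (e : RoundTub M M') : Set (e.D × ℝ) := {q | e.nrm q.1 ^ 2 + q.2 ^ 2 ≤ 1}

theorem snd_mem_of_mem_unitBall {q : e.D × ℝ} (hq : q ∈ unitBall e) : q.2 ∈ Icc (-1 : ℝ) 1 :=
  abs_le.1 (abs_le_one_iff_mul_self_le_one.2 (by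
    have : e.nrm q.1 ^ 2 + q.2 ^ 2 ≤ 1 := hq
    nlinarith [sq_nonneg (e.nrm q.1)]))

theorem isCompact_unitBall : IsCompact (unitBall e) := by
  refine ((isCompact_univ (X := e.D)).prod (isCompact_Icc (a := (-1 : ℝ)) (b := 1))).of_isClosed_subset
    ?_ fun q hq => ⟨mem_univ _, snd_mem_of_mem_unitBall hq⟩
  have := e.continuous_nrm
  exact isClosed_le (by fun_prop) continuous_const

variable (e) in
/-- The polar projection of `D(ν × ℝ)`. -/
def polarProj (q : e.D × ℝ) : M × ℝ := (e.p q.1, -√(e.nrm q.1 ^ 2 + q.2 ^ 2))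

theorem continuous_polarProj : Continuous (polarProj e) := by
  have := e.continuous_nrm
  have := e.continuous_p
  unfold polarProj
  fun_prop

theorem polarProj_mem {q : e.D × ℝ} (hq : q ∈ unitBall e) :
    polarProj e q ∈ (univ : Set M) ×ˢ Icc (-1 : ℝ) 1 := by
  have h1 : √(e.nrm q.1 ^ 2 + q.2 ^ 2) ≤ 1 := Real.sqrt_le_one.2 hq
  exact ⟨mem_univ _, by simp only [polarProj]; linarith,
    by simp only [polarProj]; linarith [Real.sqrt_nonneg (e.nrm q.1 ^ 2 + q.2 ^ 2)]⟩

/-- The image is described by its complement, which has a simple form: the points of the unit ball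
of D(ν × ℝ) whose polar projection is not in the image of `O`. -/
theorem stRho_image_collarRegion (hW : W.IsEncasedMirror) {O : Set W.X} (hO : W.IsCollarNhd O) :
    stRho e W '' collarRegion e W O = (univ ×ˢ Icc (-1 : ℝ) 1) \
      (Prod.map e.e id '' {q | q ∈ unitBall e ∧ polarProj e q ∉ W.rho '' O}) := by
  ext q
  constructor
  · rintro ⟨z, hz, rfl⟩
    rcases collarRegion_cases hW hO.bd_subset hz with ⟨a, rfl⟩ | ⟨b, hb, hbO, rfl⟩
    · refine ⟨⟨mem_univ _, a.2.1⟩, ?_⟩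
      rintro ⟨q, ⟨hq, hqO⟩, hqa⟩
      rw [stRho_ofTrivial] at hqa
      have h1 := a.2.2 q.1 (congrArg Prod.fst hqa)
      rw [← show q.2 = a.1.2 from congrArg Prod.snd hqa] at h1
      obtain ⟨w, hw, hwr⟩ := exists_bd_of_trivial hW hq h1
      exact hqO ⟨w, hO.bd_subset hw, hwr⟩
    · refine ⟨⟨mem_univ _, conePart_t_mem hW b⟩, ?_⟩
      rintro ⟨q, ⟨hq, hqO⟩, hqa⟩
      rw [stRho_ofCone] at hqa
      have hx := e.e_embedding.injective (congrArg Prod.fst hqa)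
      have ht : q.2 = b.1.2.2 := congrArg (fun r : M' × ℝ => r.2) hqa
      refine hqO ⟨_, hbO, ?_⟩
      rw [conePart_rho, polarProj, hx, ht]
  · rintro ⟨⟨-, hs⟩, hq⟩
    by_cases ht : q ∈ trivialPart e
    · exact ⟨ofTrivial ⟨q, ht⟩, ofTrivial_mem_collarRegion O _, rfl⟩
    · have h1 : ∃ x : e.D, e.e x = q.1 ∧ ¬ (x ∈ e.D.bdry ∨ 1 ≤ e.nrm x ^ 2 + q.2 ^ 2) := by
        by_contra hcon
        push Not at hcon
        exact ht ⟨hs, fun x hx => by have := hcon x hx; tauto⟩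
      obtain ⟨x, hx, hn⟩ := h1
      push Not at hn
      have h2 : polarProj e (x, q.2) ∈ W.rho '' O := by
        by_contra hcon
        exact hq ⟨(x, q.2), ⟨hn.2.le, hcon⟩, Prod.ext hx rfl⟩
      obtain ⟨w, hw, hwr⟩ := h2
      obtain ⟨b, hb⟩ := exists_conePart hwr
      refine ⟨ofCone b, (ofCone_mem_collarRegion_iff hW hO.bd_subset).2 (by rw [hb]; exact hw), ?_⟩
      rw [stRho_ofCone, hb]
      exact Prod.ext hx rfl

/-- The missing points form the image of a compact set, hence a closed set. This avoids a direct
proof of openness along the frontier of the glued parts. -/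
theorem exists_isOpen_stRho_image (hW : W.IsEncasedMirror) {O : Set W.X} (hO : W.IsCollarNhd O) :
    ∃ V : Set (M' × ℝ), IsOpen V ∧
      stRho e W '' collarRegion e W O = V ∩ (univ ×ˢ Icc (-1) 1) := by
  obtain ⟨V, hV, hVO⟩ := hO.image_open
  have hset : {q | q ∈ unitBall e ∧ polarProj e q ∉ W.rho '' O} =
      unitBall e ∩ polarProj e ⁻¹' Vᶜ := by
    ext q
    constructor
    · rintro ⟨h1, h2⟩
      exact ⟨h1, fun h => h2 (by rw [hVO]; exact ⟨h, polarProj_mem h1⟩)⟩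
    · rintro ⟨h1, h2⟩
      refine ⟨h1, fun h => h2 ?_⟩
      rw [hVO] at h
      exact h.1
  have hc : IsCompact (Prod.map e.e id '' {q | q ∈ unitBall e ∧ polarProj e q ∉ W.rho '' O}) := by
    rw [hset]
    exact (isCompact_unitBall.inter_right (hV.isClosed_compl.preimage continuous_polarProj)).image
      (e.continuous_e.prodMap continuous_id)
  refine ⟨_, hc.isClosed.isOpen_compl, ?_⟩
  rw [stRho_image_collarRegion hW hO, inter_comm]
  rfl

/-- The inverse is continuous on each of two pieces: the inclusion on the trivial part, and the
given collar composed with the polar projection on the rest. The pieces are relatively closed in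
their union, so continuity glues. -/
theorem exists_collar_inverse (hW : W.IsEncasedMirror) {O : Set W.X} (hO : W.IsCollarNhd O) :
    ∃ κ : M' × ℝ → StSpace e W, (∀ z ∈ collarRegion e W O, κ (stRho e W z) = z) ∧
      ContinuousOn κ (stRho e W '' collarRegion e W O) := by
  rcases isEmpty_or_nonempty (M' × ℝ) with hemp | hne
  · refine ⟨isEmptyElim, fun z _ => isEmptyElim (stRho e W z), fun q _ => isEmptyElim q⟩
  have hne' : Nonempty (StSpace e W) := by
    obtain ⟨q⟩ := hne
    -- Points at height 1 always lie in the trivial part, whatever the bundle is.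
    refine ⟨ofTrivial ⟨(q.1, 1), by norm_num, fun x _ => Or.inr ?_⟩⟩
    nlinarith [sq_nonneg (e.nrm x)]
  let κ := Function.invFunOn (stRho e W) (collarRegion e W O)
  have hκ : ∀ z ∈ collarRegion e W O, κ (stRho e W z) = z :=
    fun z hz => (injOn_stRho_collarRegion hW hO).leftInvOn_invFunOn hz
  refine ⟨κ, hκ, ?_⟩
  let B : Set (e.D × ℝ) := unitBall e ∩ polarProj e ⁻¹' (W.rho '' O)
  obtain ⟨c, hc, hcont, -⟩ := hO.inverse
  have hemb : IsEmbedding (Prod.map e.e id : e.D × ℝ → M' × ℝ) := e.e_embedding.prodMap .id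
  have hconeB : ∀ q ∈ B, ∃ b : conePart e W, b.1 = (c (polarProj e q), q.1, q.2) ∧ b.1.1 ∈ O := by
    rintro q ⟨hq, w, hw, hwr⟩
    have h1 : c (polarProj e q) = w := by rw [← hwr, hc w hw]
    obtain ⟨b, hb⟩ := exists_conePart (e := e) (x := q.1) (s := q.2) hwr
    exact ⟨b, by rw [hb, h1], by rw [hb]; exact hw⟩
  have hcB : ContinuousOn (κ ∘ Prod.map e.e id) B := by
    rw [continuousOn_iff_continuous_domRestrict]
    let f : B → conePart e W := fun q => (hconeB q.1 q.2).choose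
    have hf : ∀ q, (f q).1 = (c (polarProj e q.1), q.1.1, q.1.2) := fun q =>
      (hconeB q.1 q.2).choose_spec.1
    have hfc : Continuous f := by
      rw [continuous_induced_rng]
      have h1 : Continuous fun q : B => c (polarProj e q.1) :=
        hcont.comp_continuous (continuous_polarProj.comp continuous_subtype_val) fun q => q.2.2
      refine (h1.prodMk continuous_subtype_val).congr fun q => ?_
      exact (hf q).symm
    refine (continuous_ofCone.comp hfc).congr fun q => ?_
    have h2 : stRho e W (ofCone (f q)) = Prod.map e.e id q.1 := by
      rw [stRho_ofCone, hf]; rfl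
    change ofCone (f q) = κ (Prod.map e.e id q.1)
    rw [← h2, hκ]
    exact (ofCone_mem_collarRegion_iff hW hO.bd_subset).2 (hconeB q.1 q.2).choose_spec.2
  have himg : stRho e W '' collarRegion e W O = trivialPart e ∪ Prod.map e.e id '' B := by
    ext q
    constructor
    · rintro ⟨z, hz, rfl⟩
      rcases collarRegion_cases hW hO.bd_subset hz with ⟨a, rfl⟩ | ⟨b, hb, hbO, rfl⟩
      · exact Or.inl a.2
      · exact Or.inr ⟨b.1.2, ⟨conePart_norm_sq_le hW b, ⟨_, hbO, conePart_rho b⟩⟩, rfl⟩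
    · rintro (h | ⟨q, hq, rfl⟩)
      · exact ⟨ofTrivial ⟨q, h⟩, ofTrivial_mem_collarRegion O _, rfl⟩
      · obtain ⟨b, hb, hbO⟩ := hconeB q hq
        refine ⟨ofCone b, (ofCone_mem_collarRegion_iff hW hO.bd_subset).2 hbO, ?_⟩
        rw [stRho_ofCone, hb]; rfl
  have hcA : ContinuousOn κ (trivialPart e) := by
    rw [continuousOn_iff_continuous_domRestrict]
    refine continuous_ofTrivial.congr fun a => ?_
    exact (hκ _ (ofTrivial_mem_collarRegion O a)).symm
  have hcB' : ContinuousOn κ (Prod.map e.e id '' B) := by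
    rintro _ ⟨q, hq, rfl⟩
    have := hcB q hq
    rw [ContinuousWithinAt, Function.comp_apply] at this
    rwa [ContinuousWithinAt, ← hemb.map_nhdsWithin_eq, tendsto_map'_iff]
  rw [himg]
  intro q hq
  rw [continuousWithinAt_union]
  constructor
  · by_cases h : q ∈ trivialPart e
    · exact hcA q h
    · rw [ContinuousWithinAt, notMem_closure_iff_nhdsWithin_eq_bot.1
        (by rwa [isClosed_trivialPart.closure_eq])]
      exact tendsto_bot
  · by_cases h : q ∈ Prod.map e.e id '' B
    · exact hcB' q h
    · have hqt : q ∈ trivialPart e := hq.resolve_right h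
      have h1 : q ∉ Prod.map e.e id '' unitBall e := by
        rintro ⟨q', hq', rfl⟩
        obtain ⟨w, hw, hwr⟩ := exists_bd_of_trivial hW hq' (hqt.2 q'.1 rfl)
        exact h ⟨q', ⟨hq', w, hO.bd_subset hw, hwr⟩, rfl⟩
      have h2 : IsClosed (Prod.map e.e id '' unitBall e) :=
        (isCompact_unitBall.image (e.continuous_e.prodMap continuous_id)).isClosed
      have h3 : q ∉ closure (Prod.map e.e id '' B) := fun hc =>
        h1 (h2.closure_subset_iff.2 (image_mono inter_subset_left) hc)
      rw [ContinuousWithinAt, notMem_closure_iff_nhdsWithin_eq_bot.1 h3]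
      exact tendsto_bot

end CollarRegion

/-! ### Polar coordinates on a cobordism -/

namespace PreCob

variable {n : ℕ} {M : GMfd.{u} G n} {W : PreCob M}

/-- Near `w`, the functions `(u, h)` are coordinates, with `u` invariant under the reflection. -/
structure IsPolarCoord (W : PreCob M) {a : ℕ} (u : W.X → Eu a) (w : W.X) : Prop where
  nhds_le : 𝓝 (u w, W.h w) ≤ map (fun w' => (u w', W.h w')) (𝓝 w)
  smoothAt : W.SmoothAt 𝓘(ℝ, Eu a) u w
  flip : ∀ᶠ w' in 𝓝 w, u (W.flip w') = u w'
  smoothVia : ∀ (d : ℕ) (g : W.X → Eu d), W.SmoothAt 𝓘(ℝ, Eu d) g w →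
    SmoothVia 𝓘(ℝ, Eu a × ℝ) (fun w' => (u w', W.h w')) 𝓘(ℝ, Eu d) g w
  smoothVia_r : SmoothVia 𝓘(ℝ, Eu a × ℝ) (fun w' => (u w', W.h w')) (quadModel n) W.r w

end PreCob

section Mirror

variable {n : ℕ} {M : GMfd.{u} G n} {W : PreCob M}
  {E' H' Z' : Type*} [NormedAddCommGroup E'] [NormedSpace ℝ E'] [TopologicalSpace H']
  [TopologicalSpace Z'] [ChartedSpace H' Z'] {J' : ModelWithCorners ℝ E' H'}
  {β : OpenPartialHomeomorph W.X (Eu n × ℝ)}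

theorem IsMirrorCoord.contMDiffAt_comp_symm (hW : W.IsEncasedMirror) (hβ : IsMirrorCoord W β)
    {w : W.X} (hw : w ∈ β.source) {g : W.X → Z'} (hg : W.SmoothAt J' g w) :
    ContMDiffAt 𝓘(ℝ, Eu n × ℝ) J' ∞ (g ∘ β.symm) (β w) := by
  obtain ⟨φ, hφ, hwφ⟩ := hW.covers w
  refine (hg φ hφ hwφ).contMDiffAt_comp (β.left_inv hw)
    (β.continuousAt_symm (β.map_source hw)) ?_
  refine (hβ.smooth_symm φ hφ).contMDiffAt (inter_mem (β.open_target.mem_nhds (β.map_source hw)) ?_)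
  refine β.continuousAt_symm (β.map_source hw) ?_
  rw [β.left_inv hw]
  exact φ.open_source.mem_nhds hwφ

theorem IsMirrorCoord.smoothAt (hβ : IsMirrorCoord W β) {w : W.X} (hw : w ∈ β.source) :
    W.SmoothAt 𝓘(ℝ, Eu n × ℝ) β w := by
  intro φ hφ hwφ
  rw [smoothVia_chart_iff hwφ]
  refine (hβ.smooth φ hφ).contMDiffAt (inter_mem (φ.open_target.mem_nhds (φ.map_source hwφ)) ?_)
  refine φ.continuousAt_symm (φ.map_source hwφ) ?_
  rw [φ.left_inv hwφ]
  exact β.open_source.mem_nhds hw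

theorem IsMirrorCoord.smoothVia (hW : W.IsEncasedMirror) (hβ : IsMirrorCoord W β)
    {w : W.X} (hw : w ∈ β.source) {g : W.X → Z'} (hg : W.SmoothAt J' g w) :
    SmoothVia 𝓘(ℝ, Eu n × ℝ) β J' g w := by
  refine ⟨β.source, β.open_source.mem_nhds hw, g ∘ β.symm,
    (hβ.contMDiffAt_comp_symm hW hw hg).contMDiffWithinAt, fun y hy => ?_⟩
  rw [Function.comp_apply, β.left_inv hy]

/-- This is the source of polar coordinates near the top, away from the sides. -/
theorem IsMirrorCoord.isPolarCoord (hW : W.IsEncasedMirror) (hβ : IsMirrorCoord W β)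
    {w : W.X} (hw : w ∈ β.source) : W.IsPolarCoord (fun w' => (β w').1) w := by
  have heq : ∀ᶠ w' in 𝓝 w, β w' = ((β w').1, W.h w') := by
    filter_upwards [β.open_source.mem_nhds hw] with w' hw'
    exact Prod.ext rfl (hβ.snd_eq w' hw')
  refine ⟨?_, ?_, ?_, fun d g hg => ?_, ?_⟩
  · rw [← heq.self_of_nhds, ← Filter.map_congr heq, β.map_nhds_eq hw]
  · exact fun φ hφ hwφ => (hβ.smoothAt hw φ hφ hwφ).comp_contDiffAt contDiffAt_fst
  · filter_upwards [β.open_source.mem_nhds hw] with w' hw' using hβ.flip_fst w' hw'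
  · exact (hβ.smoothVia hW hw hg).congr_left heq
  · exact (hβ.smoothVia hW hw (hW.smoothAt_r w)).congr_left heq

end Mirror

/-! ### Polar coordinates in a collar neighbourhood -/

section Collar

variable {n : ℕ} {M : GMfd.{u} G n} {W : PreCob M} {O : Set W.X}
  {E' H' Z' : Type*} [NormedAddCommGroup E'] [NormedSpace ℝ E'] [TopologicalSpace H']
  [TopologicalSpace Z'] [ChartedSpace H' Z'] {J' : ModelWithCorners ℝ E' H'}

/-- In a collar neighbourhood, every smooth function is a smooth function of the encasing
function. -/
theorem PreCob.IsCollarNhd.smoothVia_rho (hW : W.IsEncasedMirror) (hO : W.IsCollarNhd O) {w : W.X}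
    (hw : w ∈ O) {g : W.X → Z'} (hg : W.SmoothAt J' g w) :
    SmoothVia ((quadModel n).prod 𝓘(ℝ, ℝ)) W.rho J' g w := by
  obtain ⟨c, hc, hcont, hs⟩ := hO.inverse
  obtain ⟨φ, hφ, hwφ⟩ := hW.covers w
  have hwO : W.rho w ∈ W.rho '' O := mem_image_of_mem _ hw
  refine ⟨O, hO.isOpen.mem_nhds hw, g ∘ c, ?_, fun y hy => by rw [Function.comp_apply, hc y hy]⟩
  refine (hg φ hφ hwφ).contMDiffWithinAt_comp (hc w hw) (hcont _ hwO) ?_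
  refine (contMDiffWithinAt_inter' ?_).1 (hs φ hφ (W.rho w) ⟨hwO, by rwa [mem_preimage, hc w hw]⟩)
  refine hcont _ hwO ?_
  rw [hc w hw]
  exact φ.open_source.mem_nhds hwφ

theorem PreCob.IsCollarNhd.interior_of_notMem (hW : W.IsEncasedMirror) (hO : W.IsCollarNhd O)
    {w : W.X} (hw : w ∈ O) (hbd : w ∉ W.bd) :
    W.r w ∉ M.bdry ∧ W.h w ∈ Ioo (-1 : ℝ) 1 := by
  rw [hO.mem_bd_iff hw (hW.h_mem w)] at hbd
  push Not at hbd
  have := hW.h_mem w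
  exact ⟨hbd.1, lt_of_le_of_ne this.1 (Ne.symm hbd.2.1), lt_of_le_of_ne this.2 hbd.2.2⟩

/-- Off the boundary the height is strictly between -1 and 1, so the image of the collar
neighbourhood is a full neighbourhood and the collar is a continuous local inverse. -/
theorem PreCob.IsCollarNhd.nhds_rho_le (hW : W.IsEncasedMirror) (hO : W.IsCollarNhd O) {w : W.X}
    (hw : w ∈ O) (hbd : w ∉ W.bd) : 𝓝 (W.rho w) ≤ map W.rho (𝓝 w) := by
  obtain ⟨V, hV, hVO⟩ := hO.image_open
  obtain ⟨c, hc, hcont, -⟩ := hO.inverse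
  have hwO : W.rho w ∈ W.rho '' O := mem_image_of_mem _ hw
  have hnhd : W.rho '' O ∈ 𝓝 (W.rho w) := by
    have h1 := (hO.interior_of_notMem hW hw hbd).2
    rw [hVO] at hwO ⊢
    refine inter_mem (hV.mem_nhds hwO.1) ?_
    exact mem_of_superset ((isOpen_Ioo.preimage continuous_snd).mem_nhds h1)
      fun q hq => ⟨mem_univ _, Ioo_subset_Icc_self hq⟩
  intro N hN
  rw [mem_map] at hN
  have h2 : ContinuousAt c (W.rho w) := (hcont _ hwO).continuousAt hnhd
  rw [ContinuousAt, hc w hw] at h2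
  filter_upwards [h2 hN, hnhd] with q hq hqO
  obtain ⟨w', hw', rfl⟩ := hqO
  rwa [mem_preimage, hc w' hw'] at hq

/-- A chart of M composed with r is automatically invariant under the reflection. It serves at all
heights, in particular where the top meets a collar neighbourhood. -/
theorem PreCob.IsCollarNhd.isPolarCoord (hW : W.IsEncasedMirror) (hO : W.IsCollarNhd O) {w : W.X}
    (hw : w ∈ O) (hbd : w ∉ W.bd) :
    W.IsPolarCoord (fun w' => extChartAt (quadModel n) (W.r w) (W.r w')) w := by
  set X := extChartAt (quadModel n) (W.r w) with hX
  have hint := (notMem_bdry_iff M).1 (hO.interior_of_notMem hW hw hbd).1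
  have hXr : ContMDiffAt (quadModel n) 𝓘(ℝ, Eu n) ∞ X (W.r w) :=
    contMDiffAt_extChartAt
  have htar : X.target ∈ 𝓝 (X (W.r w)) :=
    mem_of_superset (isOpen_interior.mem_nhds
      ((chartAt (Quad n) (W.r w)).mem_interior_extend_target (mem_chart_target _ _) hint))
        interior_subset
  have hsrc : ∀ᶠ w' in 𝓝 w, W.r w' ∈ X.source :=
    hW.continuous_r.continuousAt (extChartAt_source_mem_nhds (I := quadModel n) (W.r w))
  have hr : SmoothVia 𝓘(ℝ, Eu n × ℝ) (fun w' => (X (W.r w'), W.h w')) (quadModel n) W.r w := by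
    have h1 : SmoothVia 𝓘(ℝ, Eu n × ℝ) (fun w' => (X (W.r w'), W.h w')) 𝓘(ℝ, Eu n)
        (fun w' => X (W.r w')) w :=
      (SmoothVia.refl _ _ _).comp_contDiffAt contDiffAt_fst
    refine (h1.comp (T := X.symm) ((contMDiffOn_extChartAt_symm (W.r w)).contMDiffAt htar)).congr ?_
    filter_upwards [hsrc] with w' hw' using X.left_inv hw'
  refine ⟨?_, ?_, ?_, fun d g hg => ?_, hr⟩
  · have h1 : map (Prod.map X id : M × ℝ → Eu n × ℝ) (𝓝 (W.rho w)) = 𝓝 (X (W.r w), W.h w) := by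
      rw [PreCob.rho, nhds_prod_eq, ← Filter.prod_map_map_eq', map_id,
        hX, map_extChartAt_nhds (I := quadModel n),
        nhdsWithin_eq_nhds.2 (mem_of_superset htar (extChartAt_target_subset_range _)),
        ← nhds_prod_eq]
    rw [← h1]
    exact map_mono (hO.nhds_rho_le hW hw hbd)
  · exact fun φ hφ hwφ => (hW.smoothAt_r w φ hφ hwφ).comp hXr
  · exact Eventually.of_forall fun w' => by rw [hW.r_flip]
  · refine SmoothVia.trans (hr.prodMk ?_) (hO.smoothVia_rho hW hw hg)
    exact (SmoothVia.refl _ _ _).comp_contDiffAt contDiffAt_snd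

end Collar

/-! ### Coordinates on the nontrivial part -/

section Coord

variable {n m : ℕ} {M : GMfd.{u} G n} {M' : GMfd.{u} G m} {e : RoundTub M M'} {W : PreCob M}
  {E H Z : Type*} [NormedAddCommGroup E] [NormedSpace ℝ E] [TopologicalSpace H]
  [TopologicalSpace Z] [ChartedSpace H Z] {J : ModelWithCorners ℝ E H}
  {E' H' Z' : Type*} [NormedAddCommGroup E'] [NormedSpace ℝ E'] [TopologicalSpace H']
  [TopologicalSpace Z'] [ChartedSpace H' Z'] {J' : ModelWithCorners ℝ E' H'}
  {c : conePart e W → Z} {b : conePart e W}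

/-- The mechanism behind all coordinates on the nontrivial part: w has coordinates u and h, and h is
the negative radius of (v, t). If the height is nonzero, then the radius is smooth; if it is zero,
then g is even in the height and Whitney's theorem replaces smoothness of the radius. Openness of
(u, h) turns smoothness on the set of values into smoothness on a neighbourhood. -/
theorem smoothVia_of_polar (hW : W.IsEncasedMirror) {a k : ℕ} {u : W.X → Eu a}
    {v : conePart e W → Eu k} {F : Type} [NormedAddCommGroup F] [NormedSpace ℝ F]
    [FiniteDimensional ℝ F] {HG : Type*} [TopologicalSpace HG] {JG : ModelWithCorners ℝ F HG}
    {ZG : Type*} [TopologicalSpace ZG] [ChartedSpace HG ZG] {g : W.X → ZG}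
    (hu : SmoothVia J c 𝓘(ℝ, Eu a) (fun b' => u b'.1.1) b)
    (hv : SmoothVia J c 𝓘(ℝ, Eu k) v b) (hnorm : ∀ᶠ b' in 𝓝 b, ‖v b'‖ = e.nrm b'.1.2.1)
    (ht : SmoothVia J c 𝓘(ℝ, ℝ) (fun b' => b'.1.2.2) b)
    (hopen : 𝓝 (u b.1.1, W.h b.1.1) ≤ map (fun w' => (u w', W.h w')) (𝓝 b.1.1))
    (huflip : ∀ᶠ w' in 𝓝 b.1.1, u (W.flip w') = u w')
    (hg : SmoothVia 𝓘(ℝ, Eu a × ℝ) (fun w' => (u w', W.h w')) JG g b.1.1)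
    (hgflip : W.h b.1.1 = 0 → ∀ᶠ w' in 𝓝 b.1.1, g (W.flip w') = g w') :
    SmoothVia J c JG (fun b' => g b'.1.1) b := by
  obtain ⟨Ω, hΩ, T, hT, hTg⟩ := hg
  have hT' : ContMDiffAt 𝓘(ℝ, Eu a × ℝ) JG ∞ T (u b.1.1, W.h b.1.1) :=
    hT.contMDiffAt (hopen (image_mem_map hΩ))
  have hcont : ContinuousAt (fun b' : conePart e W => b'.1.1) b :=
    continuous_conePart_fst.continuousAt
  have hTpolar : ∀ᶠ b' in 𝓝 b, T (u b'.1.1, -√(‖v b'‖ ^ 2 + b'.1.2.2 ^ 2)) = g b'.1.1 := by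
    filter_upwards [hnorm, hcont hΩ] with b' hb' hb'Ω
    rw [hb', ← conePart_h]
    exact hTg _ hb'Ω
  have hvb := hnorm.self_of_nhds
  by_cases h0 : W.h b.1.1 = 0
  · have hsq := b.2.2.2
    rw [h0] at hsq hT' hopen
    have hv0 : v b = 0 := by
      rw [← norm_eq_zero, hvb]
      nlinarith [sq_nonneg (e.nrm b.1.2.1), sq_nonneg b.1.2.2]
    have ht0 : b.1.2.2 = 0 := by nlinarith [sq_nonneg (e.nrm b.1.2.1), sq_nonneg b.1.2.2]
    refine (SmoothVia.of_even hu hv ht hv0 ht0 hT' ?_).congr hTpolar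
    have hfl : Tendsto W.flip (𝓝 b.1.1) (𝓝 b.1.1) := by
      have := hW.continuous_flip.continuousAt (x := b.1.1)
      rwa [ContinuousAt, (hW.flip_fixed b.1.1).2 h0] at this
    -- The reflection fixes this point, so nearby points and their mirror images are both in the
    -- domain of the representation. There invariance of u and g says exactly that `T` is even.
    have hgood : ∀ᶠ w' in 𝓝 b.1.1, w' ∈ Ω ∧ W.flip w' ∈ Ω ∧ u (W.flip w') = u w' ∧
        g (W.flip w') = g w' :=
      (eventually_mem_set.2 hΩ).and ((hfl.eventually (eventually_mem_set.2 hΩ)).and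
        (huflip.and (hgflip h0)))
    filter_upwards [hopen (image_mem_map hgood)]
    rintro _ ⟨w', ⟨h1, h2, h3, h4⟩, rfl⟩
    have h5 := hTg _ h2
    dsimp only at h5
    rw [h3, hW.h_flip, h4] at h5
    exact h5.trans (hTg _ h1).symm
  · have hneg : ‖v b‖ ^ 2 + b.1.2.2 ^ 2 ≠ 0 := by
      rw [hvb, ← b.2.2.2]
      exact pow_ne_zero 2 h0
    have h1 := hu.prodMk_space ((hv.norm_sq_add_sq ht).neg_sqrt hneg)
    refine SmoothVia.congr (SmoothVia.comp h1 (T := T) ?_) hTpolar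
    rw [hvb, ← conePart_h]
    exact hT'

section CoordVia

variable {S : Type*} [TopologicalSpace S] {c : S → Z} {B : S → conePart e W} {s : S}

/-- Near `s`, the map `B` to the nontrivial part is a smooth function of `c`: the components `x` and
`t` are smooth functions of `c`, and so is every smooth function on the cobordism, provided that it
is invariant under the reflection if `B s` is on the cone locus. -/
structure CoordVia (J : ModelWithCorners ℝ E H) (c : S → Z) (B : S → conePart e W) (s : S) :
    Prop where
  x : SmoothVia J c (quadModel m) (fun s' => (B s').1.2.1) s
  t : SmoothVia J c 𝓘(ℝ, ℝ) (fun s' => (B s').1.2.2) s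
  inner : ∀ (d : ℕ) (g : W.X → Eu d), W.SmoothAt 𝓘(ℝ, Eu d) g (B s).1.1 →
    (W.h (B s).1.1 = 0 → ∀ᶠ w in 𝓝 (B s).1.1, g (W.flip w) = g w) →
    SmoothVia J c 𝓘(ℝ, Eu d) (fun s' => g (B s').1.1) s

theorem CoordVia.mono {c' : S → Z'} (h : CoordVia J c B s) (hc : SmoothVia J' c' J c s) :
    CoordVia J' c' B s :=
  ⟨hc.trans h.x, hc.trans h.t, fun d g hg hgf => hc.trans (h.inner d g hg hgf)⟩

theorem CoordVia.chart (h : CoordVia J c B s) (hW : W.IsEncasedMirror)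
    {ψ : OpenPartialHomeomorph W.X (Quad (n + 1))} (hψ : ψ ∈ W.atlas) (hb : (B s).1.1 ∈ ψ.source)
    (hh : W.h (B s).1.1 < 0) :
    SmoothVia J c (quadModel (n + 1)) (fun s' => ψ (B s').1.1) s :=
  smoothVia_quad_iff.2 (h.inner _ _ (fun φ hφ hbφ =>
    smoothVia_quad_iff.1 (hW.smoothAt_chart hψ hb φ hφ hbφ)) fun h0 => absurd h0 hh.ne)

theorem CoordVia.polar (h : CoordVia J c B s) {a : ℕ} {u : W.X → Eu a}
    (hu : W.IsPolarCoord u (B s).1.1) : SmoothVia J c 𝓘(ℝ, Eu a) (fun s' => u (B s').1.1) s :=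
  h.inner _ _ hu.smoothAt fun _ => hu.flip

theorem CoordVia.fiber (h : CoordVia J c B s) (τ : RoundTriv M e.D e.p e.nrm e.k)
    (hb : e.p (B s).1.2.1 ∈ τ.base) :
    SmoothVia J c 𝓘(ℝ, Eu e.k) (fun s' => τ.coord (B s').1.2.1) s :=
  h.x.comp (T := τ.coord) (τ.contMDiffAt_coord e.continuous_p hb)

theorem CoordVia.rho (h : CoordVia J c B s) :
    SmoothVia J c ((quadModel m).prod 𝓘(ℝ, ℝ)) (fun s' => (e.e (B s').1.2.1, (B s').1.2.2)) s :=
  (h.x.comp (T := e.e) (e.e_smooth _)).prodMk h.t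

/-- The charts of the stabilization are smooth functions of any coordinates. -/
theorem CoordVia.smoothVia_chart (h : CoordVia J c B s) (hW : W.IsEncasedMirror)
    (hB : ContinuousAt B s) {φ : OpenPartialHomeomorph (StSpace e W) (Quad (m + 1))}
    (hφ : φ ∈ stAtlas e W) (hb : ofCone (B s) ∈ φ.source) :
    SmoothVia J c (quadModel (m + 1)) (fun s' => φ (ofCone (B s'))) s := by
  have hcont : ContinuousAt (fun s' => (ofCone (B s') : StSpace e W)) s :=
    continuous_ofCone.continuousAt.comp hB
  -- Each of the three descriptions makes the chart a smooth function of a coordinate system that is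
  -- built from quantities controlled by `CoordVia`.
  rcases hφ _ hb with ⟨O, hO, Ω, hΩ, hbΩ, hsub, hsm⟩ |
    ⟨ψ, hψ, Ω, hΩ, hbΩ, hsub, c', hc, hsm⟩ | ⟨β, hβ, τ, Ω, hΩ, hbΩ, hsub, c', hc, hsm⟩
  · exact h.rho.trans ((SmoothVia.of_smoothCoord hsm (hΩ.mem_nhds hbΩ) hb).2.comp_left
      (f := fun s' => (ofCone (B s') : StSpace e W)) rfl hcont)
  · obtain ⟨w, hw, hwψ, -, hwh⟩ := hsub _ hbΩ
    rw [assoc_ofCone_iff hW] at hw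
    subst hw
    refine (((h.chart hW hψ hwψ hwh).prodMk (h.x.prodMk h.t)).congr ?_).trans
      ((SmoothVia.of_smoothCoord hsm (hΩ.mem_nhds hbΩ) hb).2.comp_left (f := fun s' => (ofCone (B s') : StSpace e W)) rfl hcont)
    filter_upwards [hcont (hΩ.mem_nhds hbΩ)] with b' hb' using (hc _ hb').symm
  · obtain ⟨w, hw, hwβ, -, hwτ⟩ := hsub _ hbΩ
    rw [assoc_ofCone_iff hW] at hw
    subst hw
    refine (((h.polar (hβ.isPolarCoord hW hwβ)).prodMk_space
      ((h.fiber τ (by rwa [← (B s).2.2.1])).prodMk_space h.t)).congr ?_).trans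
      ((SmoothVia.of_smoothCoord hsm (hΩ.mem_nhds hbΩ) hb).2.comp_left (f := fun s' => (ofCone (B s') : StSpace e W)) rfl hcont)
    filter_upwards [hcont (hΩ.mem_nhds hbΩ)] with b' hb' using (hc _ hb').symm

end CoordVia

/-- Near `b`, the functions `c` are coordinates for the smooth structure of the stabilization. -/
abbrev IsCoord (J : ModelWithCorners ℝ E H) (c : conePart e W → Z) (b : conePart e W) : Prop :=
  CoordVia J c (fun b' => b') b

theorem eventually_mem_base (hW : W.IsEncasedMirror) (τ : RoundTriv M e.D e.p e.nrm e.k)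
    (hb : W.r b.1.1 ∈ τ.base) : ∀ᶠ b' : conePart e W in 𝓝 b, W.r b'.1.1 ∈ τ.base :=
  ((τ.isOpen_base.preimage hW.continuous_r).preimage continuous_conePart_fst).mem_nhds hb

theorem norm_coord_conePart (τ : RoundTriv M e.D e.p e.nrm e.k) {b : conePart e W}
    (hb : W.r b.1.1 ∈ τ.base) : ‖τ.coord b.1.2.1‖ = e.nrm b.1.2.1 :=
  τ.norm_coord _ (by rwa [← b.2.2.1])

/-- It is enough to control u, v and t. The map r is invariant under the reflection, so it is smooth
in these coordinates even at the cone locus, and x is recovered from r(w) and v by the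
trivialization. -/
theorem IsCoord.of_polar (hW : W.IsEncasedMirror) {a : ℕ} {u : W.X → Eu a}
    (hu : W.IsPolarCoord u b.1.1) (τ : RoundTriv M e.D e.p e.nrm e.k)
    (hb : W.r b.1.1 ∈ τ.base) (hcu : SmoothVia J c 𝓘(ℝ, Eu a) (fun b' => u b'.1.1) b)
    (hcv : SmoothVia J c 𝓘(ℝ, Eu e.k) (fun b' => τ.coord b'.1.2.1) b)
    (hct : SmoothVia J c 𝓘(ℝ, ℝ) (fun b' => b'.1.2.2) b) : IsCoord J c b := by
  have hbase := eventually_mem_base hW τ hb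
  have hnorm : ∀ᶠ b' : conePart e W in 𝓝 b, ‖τ.coord b'.1.2.1‖ = e.nrm b'.1.2.1 :=
    hbase.mono fun b' hb' => norm_coord_conePart τ hb'
  have hr : SmoothVia J c (quadModel n) (fun b' => W.r b'.1.1) b :=
    smoothVia_of_polar hW hcu hcv hnorm hct hu.nhds_le hu.flip hu.smoothVia_r
      fun _ => Eventually.of_forall hW.r_flip
  refine ⟨?_, hct, fun d g hg hgf => ?_⟩
  · refine (τ.smoothVia_toFun hr hcv hbase ?_).congr ?_
    · filter_upwards [hbase] with b' hb'
      exact τ.norm_coord_le (by rwa [← b'.2.2.1])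
    · filter_upwards [hbase] with b' hb'
      have := b'.2.2.1
      rw [this]
      exact τ.toFun_coord _ (by rwa [← this])
  · exact smoothVia_of_polar hW hcu hcv hnorm hct hu.nhds_le hu.flip (hu.smoothVia d g hg) hgf

theorem isCoord_cone (hW : W.IsEncasedMirror) {β : OpenPartialHomeomorph W.X (Eu n × ℝ)}
    (hβ : IsMirrorCoord W β) (τ : RoundTriv M e.D e.p e.nrm e.k) (hb : b.1.1 ∈ β.source)
    (hbτ : W.r b.1.1 ∈ τ.base) : IsCoord 𝓘(ℝ, Eu n × (Eu e.k × ℝ))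
      (fun b' : conePart e W => ((β b'.1.1).1, (τ.coord b'.1.2.1, b'.1.2.2))) b := by
  have h := SmoothVia.refl 𝓘(ℝ, Eu n × (Eu e.k × ℝ))
    (fun b' : conePart e W => ((β b'.1.1).1, (τ.coord b'.1.2.1, b'.1.2.2))) b
  exact IsCoord.of_polar hW (hβ.isPolarCoord hW hb) τ hbτ (h.comp_contDiffAt contDiffAt_fst)
    (h.comp_contDiffAt (T := fun q => q.2.1) (contDiff_snd.fst.contDiffAt))
    (h.comp_contDiffAt (T := fun q => q.2.2) (contDiff_snd.snd.contDiffAt))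

/-- No evenness enters here: a chart of the cobordism is among the coordinates, so all smooth
functions of w are available. -/
theorem isCoord_regular {ψ : OpenPartialHomeomorph W.X (Quad (n + 1))}
    (hψ : ψ ∈ W.atlas) (hb : b.1.1 ∈ ψ.source) :
    IsCoord ((quadModel (n + 1)).prod ((quadModel m).prod 𝓘(ℝ, ℝ)))
      (fun b' : conePart e W => (ψ b'.1.1, b'.1.2)) b := by
  have h := SmoothVia.refl ((quadModel (n + 1)).prod ((quadModel m).prod 𝓘(ℝ, ℝ)))
    (fun b' : conePart e W => (ψ b'.1.1, b'.1.2)) b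
  exact ⟨h.snd.fst, h.snd.snd, fun d g hg _ =>
    h.fst.trans ((hg ψ hψ hb).comp_left rfl continuous_conePart_fst.continuousAt)⟩

/-- The embedding has a smooth inverse on its image, which recovers x. Then r(w) = p(x) gives the
polar coordinate of w in the collar. -/
theorem isCoord_rho (hW : W.IsEncasedMirror) {O : Set W.X} (hO : W.IsCollarNhd O)
    (hb : b.1.1 ∈ O) (hbd : b.1.1 ∉ W.bd) : IsCoord ((quadModel m).prod 𝓘(ℝ, ℝ))
      (fun b' : conePart e W => (e.e b'.1.2.1, b'.1.2.2)) b := by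
  obtain ⟨τ, hτ⟩ := e.locally_trivial (e.p b.1.2.1)
  have h := SmoothVia.refl ((quadModel m).prod 𝓘(ℝ, ℝ))
    (fun b' : conePart e W => (e.e b'.1.2.1, b'.1.2.2)) b
  have hx : SmoothVia ((quadModel m).prod 𝓘(ℝ, ℝ))
      (fun b' : conePart e W => (e.e b'.1.2.1, b'.1.2.2)) (quadModel m) (fun b' => b'.1.2.1) b :=
    h.fst.trans ((e.smoothVia_e b.1.2.1).comp_left (f := fun b' : conePart e W => b'.1.2.1) rfl
      continuous_conePart_x.continuousAt)
  refine IsCoord.of_polar hW (hO.isPolarCoord hW hb hbd) τ (by rwa [b.2.2.1]) ?_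
    (hx.comp (T := τ.coord) (τ.contMDiffAt_coord e.continuous_p hτ)) h.snd
  have h1 : SmoothVia ((quadModel m).prod 𝓘(ℝ, ℝ))
      (fun b' : conePart e W => (e.e b'.1.2.1, b'.1.2.2)) (quadModel n)
      (fun b' => W.r b'.1.1) b :=
    (hx.comp (e.p_smooth b.1.2.1)).congr (Eventually.of_forall fun b' => b'.2.2.1.symm)
  exact h1.comp (T := extChartAt (quadModel n) (W.r b.1.1)) contMDiffAt_extChartAt

/-- The charts of the stabilization are coordinates. -/
theorem isCoord_of_mem_stAtlas (hW : W.IsEncasedMirror)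
    {φ : OpenPartialHomeomorph (StSpace e W) (Quad (m + 1))} (hφ : φ ∈ stAtlas e W)
    (hb : ofCone b ∈ φ.source) (hbd : b.1.1 ∉ W.bd) :
    IsCoord (quadModel (m + 1)) (fun b' => φ (ofCone b')) b := by
  have hcont : ContinuousAt (ofCone : conePart e W → StSpace e W) b :=
    continuous_ofCone.continuousAt
  rcases hφ _ hb with ⟨O, hO, Ω, hΩ, hbΩ, hsub, hsm⟩ |
    ⟨ψ, hψ, Ω, hΩ, hbΩ, hsub, c, hc, hsm⟩ | ⟨β, hβ, τ, Ω, hΩ, hbΩ, hsub, c, hc, hsm⟩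
  · have h1 := (SmoothVia.of_smoothCoord hsm (hΩ.mem_nhds hbΩ) hb).1.comp_left rfl hcont
    exact (isCoord_rho hW hO ((ofCone_mem_collarRegion_iff hW hO.bd_subset).1 (hsub hbΩ)) hbd).mono h1
  · have h1 := (SmoothVia.of_smoothCoord hsm (hΩ.mem_nhds hbΩ) hb).1.comp_left rfl hcont
    obtain ⟨w, hw, hwψ, -, hwh⟩ := hsub _ hbΩ
    rw [assoc_ofCone_iff hW] at hw
    subst hw
    refine (isCoord_regular hψ hwψ).mono (h1.congr ?_)
    filter_upwards [hcont (hΩ.mem_nhds hbΩ)] with b' hb' using hc b' hb'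
  · have h1 := (SmoothVia.of_smoothCoord hsm (hΩ.mem_nhds hbΩ) hb).1.comp_left rfl hcont
    obtain ⟨w, hw, hwβ, -, hwτ⟩ := hsub _ hbΩ
    rw [assoc_ofCone_iff hW] at hw
    subst hw
    refine (isCoord_cone hW hβ τ hwβ hwτ).mono (h1.congr ?_)
    filter_upwards [hcont (hΩ.mem_nhds hbΩ)] with b' hb' using hc b' hb'

/-- Near a point of the collar region, charts are equivalent to the encasing function. -/
theorem smoothVia_stRho_chart (hW : W.IsEncasedMirror) {O : Set W.X} (hO : W.IsCollarNhd O)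
    {φ : OpenPartialHomeomorph (StSpace e W) (Quad (m + 1))} (hφ : φ ∈ stAtlas e W)
    {z : StSpace e W} (hz : z ∈ φ.source) (hzO : z ∈ collarRegion e W O) :
    SmoothVia ((quadModel m).prod 𝓘(ℝ, ℝ)) (stRho e W) (quadModel (m + 1)) φ z := by
  rcases collarRegion_cases hW hO.bd_subset hzO with ⟨a, rfl⟩ | ⟨b, hb, hbO, rfl⟩
  · have hno : ∀ w, w ∉ W.bd → ¬ Assoc e W (ofTrivial a) w := by
      rintro w hw ⟨b, hba, rfl⟩
      exact hw (mem_bd_of_ofTrivial_eq hba.symm)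
    rcases hφ _ hz with ⟨O', hO', Ω, hΩ, hbΩ, hsub, hsm⟩ |
      ⟨ψ, hψ, Ω, hΩ, hbΩ, hsub, -⟩ | ⟨β, hβ, τ, Ω, hΩ, hbΩ, hsub, -⟩
    · exact (SmoothVia.of_smoothCoord hsm (hΩ.mem_nhds hbΩ) hz).2
    · obtain ⟨w, hw, -, hw', -⟩ := hsub _ hbΩ
      exact absurd hw (hno w hw')
    · obtain ⟨w, hw, -, hw', -⟩ := hsub _ hbΩ
      exact absurd hw (hno w hw')
  · exact SmoothVia.of_comp_left (nhds_ofCone_le hW hb)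
      ((isCoord_rho hW hO hbO hb).smoothVia_chart hW continuousAt_id hφ hz)

/-- No collar neighbourhood is needed in this direction: at unglued points the coordinate property
of the chart makes e(x) and t smooth. -/
theorem smoothVia_chart_stRho (hW : W.IsEncasedMirror)
    {φ : OpenPartialHomeomorph (StSpace e W) (Quad (m + 1))} (hφ : φ ∈ stAtlas e W)
    {z : StSpace e W} (hz : z ∈ φ.source) :
    SmoothVia (quadModel (m + 1)) φ ((quadModel m).prod 𝓘(ℝ, ℝ)) (stRho e W) z := by
  rcases trivial_or_inner hW z with ⟨a, rfl⟩ | ⟨b, hb, rfl⟩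
  · have hno : ∀ w, w ∉ W.bd → ¬ Assoc e W (ofTrivial a) w := by
      rintro w hw ⟨b, hba, rfl⟩
      exact hw (mem_bd_of_ofTrivial_eq hba.symm)
    rcases hφ _ hz with ⟨O', hO', Ω, hΩ, hbΩ, hsub, hsm⟩ |
      ⟨ψ, hψ, Ω, hΩ, hbΩ, hsub, -⟩ | ⟨β, hβ, τ, Ω, hΩ, hbΩ, hsub, -⟩
    · exact (SmoothVia.of_smoothCoord hsm (hΩ.mem_nhds hbΩ) hz).1
    · obtain ⟨w, hw, -, hw', -⟩ := hsub _ hbΩ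
      exact absurd hw (hno w hw')
    · obtain ⟨w, hw, -, hw', -⟩ := hsub _ hbΩ
      exact absurd hw (hno w hw')
  · exact SmoothVia.of_comp_left (nhds_ofCone_le hW hb) (isCoord_of_mem_stAtlas hW hφ hz hb).rho

/-- Charts are smoothly compatible. -/
theorem smoothVia_stAtlas (hW : W.IsEncasedMirror)
    {φ φ' : OpenPartialHomeomorph (StSpace e W) (Quad (m + 1))} (hφ : φ ∈ stAtlas e W)
    (hφ' : φ' ∈ stAtlas e W) {z : StSpace e W} (hz : z ∈ φ.source) (hz' : z ∈ φ'.source) :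
    SmoothVia (quadModel (m + 1)) φ (quadModel (m + 1)) φ' z := by
  rcases trivial_or_inner hW z with ⟨a, rfl⟩ | ⟨b, hb, rfl⟩
  · obtain ⟨O, hO⟩ := hW.collar
    exact (smoothVia_chart_stRho hW hφ hz).trans
      (smoothVia_stRho_chart hW hO hφ' hz' (ofTrivial_mem_collarRegion O a))
  · exact SmoothVia.of_comp_left (nhds_ofCone_le hW hb)
      ((isCoord_of_mem_stAtlas hW hφ hz hb).smoothVia_chart hW continuousAt_id hφ' hz')

end Coord

/-! ### Existence of mirror coordinates -/

section MirrorEuclidean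

/-- An involution that reverses a submersion and fixes its zero set is the identity to first order
along the kernel. -/
theorem fderiv_apply_of_fixed {F : Type*} [NormedAddCommGroup F] [NormedSpace ℝ F]
    [FiniteDimensional ℝ F] {s : F → F} {η : F → ℝ} {q₀ : F} {L : F →L[ℝ] ℝ}
    (hη : HasStrictFDerivAt η L q₀) (hL : L ≠ 0) (h0 : η q₀ = 0) (hs : DifferentiableAt ℝ s q₀)
    (hfix : ∀ᶠ q in 𝓝 q₀, η q = 0 → s q = q) {ξ : F} (hξ : L ξ = 0) : fderiv ℝ s q₀ ξ = ξ := by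
  have hc : CompleteSpace F := FiniteDimensional.complete ℝ F
  have hsurj : L.range = ⊤ := by
    refine LinearMap.range_eq_top.2 (LinearMap.surjective (f := (L : F →ₗ[ℝ] ℝ)) fun h => hL ?_)
    ext x
    exact DFunLike.congr_fun h x
  -- The implicit function parametrizes the zero set by the kernel. The involution fixes the zero
  -- set, so s ∘ γ = γ, and its derivative is the claim.
  let γ := hη.implicitFunction η L hsurj 0
  have hγ : HasStrictFDerivAt γ L.ker.subtypeL 0 := by
    have := hη.to_implicitFunction hsurj
    rwa [h0] at this
  have hγ0 : γ 0 = q₀ := by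
    have := hη.implicitFunction_apply_image hsurj
    have h1 := hη.eq_implicitFunction hsurj
    have h2 := h1.self_of_nhds
    simpa [h0, γ] using h2
  have hcur : ∀ᶠ κ in 𝓝 (0 : L.ker), s (γ κ) = γ κ := by
    have h1 := hη.map_implicitFunction_eq hsurj
    have h2 : Tendsto (fun κ : L.ker => ((0 : ℝ), κ)) (𝓝 0) (𝓝 (η q₀, 0)) := by
      rw [h0]
      exact (Continuous.prodMk_right (0 : ℝ)).tendsto 0
    have h3 : Tendsto γ (𝓝 0) (𝓝 q₀) := by
      have := hγ.hasFDerivAt.continuousAt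
      rwa [ContinuousAt, hγ0] at this
    filter_upwards [h2.eventually h1, h3.eventually hfix] with κ hκ hκ'
    exact hκ' hκ
  have h1 : HasFDerivAt (s ∘ γ) ((fderiv ℝ s q₀).comp L.ker.subtypeL) 0 := by
    refine HasFDerivAt.comp (g := s) 0 ?_ hγ.hasFDerivAt
    rw [hγ0]
    exact hs.hasFDerivAt
  have h2 := h1.unique (hγ.hasFDerivAt.congr_of_eventuallyEq hcur)
  exact DFunLike.congr_fun h2 (⟨ξ, hξ⟩ : L.ker)

/-- Near a point, an involution that reverses a submersion and fixes its zero set is a reflection in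
suitable coordinates. -/
theorem exists_mirror_homeomorph {n : ℕ} {s : Eu (n + 1) → Eu (n + 1)} {η : Eu (n + 1) → ℝ}
    {q₀ : Eu (n + 1)} {U : Set (Eu (n + 1))} (hU : IsOpen U) (hq₀ : q₀ ∈ U)
    (hs : ContDiffOn ℝ ∞ s U) (hη : ContDiffOn ℝ ∞ η U) (h0 : η q₀ = 0) (hL : fderiv ℝ η q₀ ≠ 0)
    (hfix : ∀ q ∈ U, η q = 0 → s q = q) (hsU : MapsTo s U U) (hss : ∀ q ∈ U, s (s q) = q) :
    ∃ Θ : OpenPartialHomeomorph (Eu (n + 1)) (Eu n × ℝ), q₀ ∈ Θ.source ∧ Θ.source ⊆ U ∧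
      ContDiffOn ℝ ∞ Θ Θ.source ∧ ContDiffOn ℝ ∞ Θ.symm Θ.target ∧ MapsTo s Θ.source Θ.source ∧
      (∀ q ∈ Θ.source, (Θ (s q)).1 = (Θ q).1) ∧ ∀ q ∈ Θ.source, (Θ q).2 = η q := by
  set L := fderiv ℝ η q₀ with hLdef
  set S := fderiv ℝ s q₀ with hSdef
  have hηat := hη.contDiffAt (hU.mem_nhds hq₀)
  have hsat := hs.contDiffAt (hU.mem_nhds hq₀)
  have hηs' : HasStrictFDerivAt η L q₀ := hηat.hasStrictFDerivAt (by simp)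
  have hS : ∀ ξ, L ξ = 0 → S ξ = ξ := fun ξ hξ =>
    fderiv_apply_of_fixed hηs' hL h0 (hsat.differentiableAt (by simp))
      (by filter_upwards [hU.mem_nhds hq₀] with q hq using hfix q hq) hξ
  obtain ⟨ν, hν⟩ : ∃ ν, L ν = 1 := by
    have : Function.Surjective (L : Eu (n + 1) →ₗ[ℝ] ℝ) :=
      LinearMap.surjective fun h => hL (by ext x; exact DFunLike.congr_fun h x)
    exact this 1
  have hker : Module.finrank ℝ (L : Eu (n + 1) →ₗ[ℝ] ℝ).ker = Module.finrank ℝ (Eu n) := by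
    have h1 := (L : Eu (n + 1) →ₗ[ℝ] ℝ).finrank_range_add_finrank_ker
    have h2 : (L : Eu (n + 1) →ₗ[ℝ] ℝ).range = ⊤ :=
      LinearMap.range_eq_top.2 (LinearMap.surjective fun h => hL (by
        ext x; exact DFunLike.congr_fun h x))
    rw [h2, finrank_top, Module.finrank_self, finrank_euclideanSpace_fin] at h1
    rw [finrank_euclideanSpace_fin]
    omega
  let K : (L : Eu (n + 1) →ₗ[ℝ] ℝ).ker ≃ₗ[ℝ] Eu n := LinearEquiv.ofFinrankEq _ _ hker
  let π : Eu (n + 1) →ₗ[ℝ] (L : Eu (n + 1) →ₗ[ℝ] ℝ).ker :=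
    (LinearMap.id - (L : Eu (n + 1) →ₗ[ℝ] ℝ).smulRight ν).codRestrict _ (fun ξ => by
      simp [hν])
  let P : Eu (n + 1) →L[ℝ] Eu n := LinearMap.toContinuousLinearMap (K.toLinearMap ∘ₗ π)
  have hP : ∀ ξ, L ξ = 0 → P ξ = 0 → ξ = 0 := by
    intro ξ hξ hPξ
    have h1 : π ξ = 0 := K.injective (by rw [map_zero]; exact hPξ)
    have h2 := congrArg Subtype.val h1
    change ξ - L ξ • ν = 0 at h2
    simpa [hξ] using h2
  -- Averaging over the involution makes the first component invariant. On the kernel of the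
  -- differential of η the averaged map still has the identity as derivative, so θ is a local
  -- diffeomorphism.
  let θ : Eu (n + 1) → Eu n × ℝ := fun q => (P ((1 / 2 : ℝ) • (q + s q)), η q)
  have hθ : ContDiffOn ℝ ∞ θ U :=
    (P.contDiff.comp_contDiffOn ((contDiffOn_id.add hs).const_smul _)).prodMk hη
  let A : Eu (n + 1) →L[ℝ] Eu n × ℝ :=
    (P.comp ((1 / 2 : ℝ) • (ContinuousLinearMap.id ℝ _ + S))).prod L
  have hA : HasFDerivAt θ A q₀ := by
    refine HasFDerivAt.prodMk (P.hasFDerivAt.comp q₀ ?_) hηs'.hasFDerivAt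
    exact ((hasFDerivAt_id q₀).add (hsat.differentiableAt (by simp)).hasFDerivAt).const_smul
      (1 / 2 : ℝ)
  have hAinj : Function.Injective A := by
    rw [injective_iff_map_eq_zero]
    intro ξ hξ
    have h1 : L ξ = 0 := congrArg Prod.snd hξ
    refine hP ξ h1 ?_
    have h2 : P ((1 / 2 : ℝ) • (ξ + S ξ)) = 0 := congrArg Prod.fst hξ
    rwa [hS ξ h1, ← two_smul ℝ ξ, smul_smul, one_div, inv_mul_cancel₀ two_ne_zero, one_smul] at h2
  have hfr : Module.finrank ℝ (Eu (n + 1)) = Module.finrank ℝ (Eu n × ℝ) := by simp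
  let A' : Eu (n + 1) ≃L[ℝ] Eu n × ℝ :=
    (LinearEquiv.ofInjectiveOfFinrankEq (A : Eu (n + 1) →ₗ[ℝ] Eu n × ℝ) hAinj
      hfr).toContinuousLinearEquiv
  have hA' : (A' : Eu (n + 1) →L[ℝ] Eu n × ℝ) = A := by ext1 x; rfl
  have hθat := hθ.contDiffAt (hU.mem_nhds hq₀)
  have hstr : HasStrictFDerivAt θ (A' : Eu (n + 1) →L[ℝ] Eu n × ℝ) q₀ :=
    hθat.hasStrictFDerivAt' (by rwa [hA']) (by simp)
  let Θ₀ := hstr.toOpenPartialHomeomorph θ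
  have hΘ₀ : q₀ ∈ Θ₀.source := hstr.mem_toOpenPartialHomeomorph_source
  have hcd : ContinuousOn (fderiv ℝ θ) U := hθ.continuousOn_fderiv_of_isOpen hU (by simp)
  -- Invertibility of the derivative on the whole domain is needed to make the inverse smooth on the
  -- whole target.
  let N : Set (Eu (n + 1)) := U ∩ fderiv ℝ θ ⁻¹'
    range ((↑) : (Eu (n + 1) ≃L[ℝ] Eu n × ℝ) → Eu (n + 1) →L[ℝ] Eu n × ℝ)
  have hN : IsOpen N := hcd.isOpen_inter_preimage hU ContinuousLinearEquiv.isOpen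
  have hqN : q₀ ∈ N := ⟨hq₀, A', by rw [hA', hA.fderiv]⟩
  let N₁ := N ∩ Θ₀.source
  have hN₁ : IsOpen N₁ := hN.inter Θ₀.open_source
  -- The domain has to be invariant under the involution, so it is intersected with its mirror
  -- image.
  let N₂ := U ∩ s ⁻¹' N₁
  have hN₂ : IsOpen N₂ := hs.continuousOn.isOpen_inter_preimage hU hN₁
  have hN₂' : IsOpen (N₁ ∩ N₂) := hN₁.inter hN₂
  have hsq : s q₀ = q₀ := hfix q₀ hq₀ h0
  have hsrc : (Θ₀.restrOpen _ hN₂').source = N₁ ∩ N₂ := by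
    rw [OpenPartialHomeomorph.restrOpen_source]
    exact inter_eq_right.2 fun q hq => hq.1.2
  refine ⟨Θ₀.restrOpen _ hN₂', ?_, ?_, ?_, ?_, ?_, ?_, ?_⟩
  · rw [hsrc]
    exact ⟨⟨hqN, hΘ₀⟩, hq₀, by rw [mem_preimage, hsq]; exact ⟨hqN, hΘ₀⟩⟩
  · rw [hsrc]; exact fun q hq => hq.1.1.1
  · rw [hsrc]
    exact hθ.mono fun q hq => hq.1.1.1
  · intro y hy
    have hy' : y ∈ Θ₀.target := hy.1
    have hmem := (Θ₀.restrOpen _ hN₂').map_target hy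
    rw [hsrc] at hmem
    obtain ⟨⟨⟨hyU, B, hB⟩, -⟩, -⟩ := hmem
    have hyθ := hθ.contDiffAt (hU.mem_nhds hyU)
    have := Θ₀.contDiffAt_symm (f₀' := B) (n := ∞) hy' (by
      rw [hB]
      exact (hyθ.differentiableAt (by simp)).hasFDerivAt) hyθ
    exact this.contDiffWithinAt
  · rw [hsrc]
    rintro q ⟨h1, h2, h3⟩
    refine ⟨h3, hsU h2, ?_⟩
    rw [mem_preimage, hss q h2]
    exact h1
  · rw [hsrc]
    rintro q ⟨h1, h2, h3⟩
    change P ((1 / 2 : ℝ) • (s q + s (s q))) = P ((1 / 2 : ℝ) • (q + s q))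
    rw [hss q h2, add_comm (s q) q]
  · exact fun q _ => rfl

end MirrorEuclidean

section Mirror

variable {n : ℕ} {M : GMfd.{u} G n} {W : PreCob M}

/-- At a point of the top off the boundary, a chart takes values in the interior of the quadrant. So
the reflection and the height become an involution and a submersion on an open subset of Euclidean
space. -/
theorem exists_mirrorCoord (hW : W.IsEncasedMirror) {w : W.X} (hh : W.h w = 0) (hbd : w ∉ W.bd) :
    ∃ β : OpenPartialHomeomorph W.X (Eu n × ℝ), IsMirrorCoord W β ∧ w ∈ β.source := by
  obtain ⟨φ, hφ, hwφ⟩ := hW.covers w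
  let ψ := φ.trans (quadInterior (n + 1))
  have hpos : ∀ i, 0 < (φ w).1 i := by
    intro i
    refine lt_of_le_of_ne ((φ w).2 i) fun h => hbd ?_
    rw [hW.bd_eq]
    exact ⟨φ, hφ, hwφ, i, h.symm⟩
  have hwψ : w ∈ ψ.source := ⟨hwφ, hpos⟩
  have hflip := hW.continuous_flip
  have hψsm : ∀ x ∈ ψ.source, W.SmoothAt 𝓘(ℝ, Eu (n + 1)) ψ x := fun x hx =>
    hW.smoothAt_of_chart hφ hx.1 (smoothVia_quad_iff.1 (SmoothVia.refl _ _ _))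
  have hψsymm : ∀ y ∈ ψ.target, ContMDiffAt 𝓘(ℝ, Eu (n + 1)) (quadModel (n + 1)) ∞
      (φ ∘ ψ.symm) y := by
    intro y hy
    refine (contMDiffOn_quadInterior_symm.contMDiffAt
      ((quadInterior (n + 1)).open_target.mem_nhds hy.1)).congr_of_eventuallyEq ?_
    filter_upwards [ψ.open_target.mem_nhds hy] with y' hy'
    exact φ.right_inv hy'.2
  have hψvia : ∀ x ∈ ψ.source, ∀ {d : ℕ} {g : W.X → Eu d}, W.SmoothAt 𝓘(ℝ, Eu d) g x →
      ContDiffAt ℝ ∞ (g ∘ ψ.symm) (ψ x) := by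
    intro x hx d g hg
    rw [← contMDiffAt_iff_contDiffAt]
    exact (hg φ hφ hx.1).contMDiffAt_comp (ψ.left_inv hx)
      (ψ.continuousAt_symm (ψ.map_source hx)) (hψsymm _ (ψ.map_source hx))
  let s : Eu (n + 1) → Eu (n + 1) := fun q => ψ (W.flip (ψ.symm q))
  let η : Eu (n + 1) → ℝ := fun q => W.h (ψ.symm q)
  let U : Set (Eu (n + 1)) := ψ.target ∩ ψ.symm ⁻¹' (W.flip ⁻¹' ψ.source)
  have hU : IsOpen U := ψ.symm.isOpen_inter_preimage (ψ.open_source.preimage hflip)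
  have hUs : ∀ q ∈ U, ψ.symm (s q) = W.flip (ψ.symm q) := fun q hq => ψ.left_inv hq.2
  have hw0 : W.flip w = w := (hW.flip_fixed w).2 hh
  have hη : ContDiffOn ℝ ∞ η U := by
    intro q hq
    have h1 := (hW.smoothAt_h (ψ.symm q) φ hφ (ψ.map_target hq.1).1).contMDiffAt_comp rfl
      (ψ.continuousAt_symm hq.1) (hψsymm q hq.1)
    exact (contMDiffAt_iff_contDiffAt.1 h1).contDiffWithinAt
  have hwU : ψ w ∈ U := ⟨ψ.map_source hwψ, by
    rw [mem_preimage, ψ.left_inv hwψ, mem_preimage, hw0]; exact hwψ⟩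
  have hs : ContDiffOn ℝ ∞ s U := by
    intro q hq
    have hqs := ψ.map_target hq.1
    have h8 := hψvia _ hqs (g := fun x => ψ (W.flip x))
      (hW.smoothAt_comp hW.flip_smooth (hψsm _ hq.2))
    rw [ψ.right_inv hq.1] at h8
    exact h8.contDiffWithinAt
  have h0 : η (ψ w) = 0 := by
    simp only [η, ψ.left_inv hwψ, hh]
  -- The rank condition is stated in charts with values in the quadrant; restriction to its interior
  -- transports it to an ordinary derivative.
  have hL : fderiv ℝ η (ψ w) ≠ 0 := by
    intro h8
    refine hW.h_rank w hh φ hφ hwφ ?_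
    have h9 : W.h ∘ φ.symm =ᶠ[𝓝 (φ w)] η ∘ (quadInterior (n + 1)) := by
      filter_upwards [(quadInterior (n + 1)).open_source.mem_nhds hpos] with q hq
      exact congrArg (W.h ∘ φ.symm) ((quadInterior (n + 1)).left_inv hq).symm
    rw [h9.mfderiv_eq]
    have h10 : MDifferentiableAt (quadModel (n + 1)) 𝓘(ℝ, Eu (n + 1)) (quadInterior (n + 1))
        (φ w) := (quadModel (n + 1)).contMDiff.contMDiffAt.mdifferentiableAt
          (n := ∞) (by simp)
    have h11 : DifferentiableAt ℝ η (ψ w) :=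
      (hη.contDiffAt (hU.mem_nhds hwU)).differentiableAt (by simp)
    have h12 := mfderiv_comp (φ w) (g := η) (f := quadInterior (n + 1)) (I := quadModel (n + 1))
      (I' := 𝓘(ℝ, Eu (n + 1))) (I'' := 𝓘(ℝ, ℝ)) h11.mdifferentiableAt h10
    rw [h12]
    change (mfderiv 𝓘(ℝ, Eu (n + 1)) 𝓘(ℝ, ℝ) η (ψ w)).comp _ = 0
    rw [mfderiv_eq_fderiv, h8]
    exact ContinuousLinearMap.zero_comp _
  have hfix : ∀ q ∈ U, η q = 0 → s q = q := by
    intro q hq hq0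
    change ψ (W.flip (ψ.symm q)) = q
    rw [(hW.flip_fixed _).2 hq0, ψ.right_inv hq.1]
  have hsU : MapsTo s U U := by
    intro q hq
    refine ⟨ψ.map_source hq.2, ?_⟩
    rw [mem_preimage, hUs q hq, mem_preimage, hW.flip_flip]
    exact ψ.map_target hq.1
  have hss : ∀ q ∈ U, s (s q) = q := by
    intro q hq
    change ψ (W.flip (ψ.symm (s q))) = q
    rw [hUs q hq, hW.flip_flip, ψ.right_inv hq.1]
  obtain ⟨Θ, h1, h2, h3, h4, h5, h6, h7⟩ :=
    exists_mirror_homeomorph hU hwU hs hη h0 hL hfix hsU hss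
  refine ⟨ψ.trans Θ, ⟨?_, ?_, ?_, ?_, ?_⟩, hwψ, h1⟩
  · rintro φ' hφ' y ⟨hy, hyβ⟩
    have h8 : SmoothVia (quadModel (n + 1)) φ' 𝓘(ℝ, Eu n × ℝ) (fun x => Θ (ψ x)) (φ'.symm y) :=
      (hψsm _ hyβ.1 φ' hφ' (φ'.map_target hy)).comp_contDiffAt
        (h3.contDiffAt (Θ.open_source.mem_nhds hyβ.2))
    rw [smoothVia_chart_iff (φ'.map_target hy), φ'.right_inv hy] at h8
    exact h8.contMDiffWithinAt
  · rintro φ' hφ' y ⟨hy, hyφ'⟩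
    have hy' : Θ.symm y ∈ ψ.target := hy.2
    have hsrc := ψ.map_target hy'
    have h8 := (hW.smoothVia_chart hφ hφ' hsrc.1 hyφ').contMDiffAt_comp rfl
      (ψ.continuousAt_symm hy') (hψsymm _ hy')
    have h9 : ContMDiffAt 𝓘(ℝ, Eu n × ℝ) 𝓘(ℝ, Eu (n + 1)) ∞ Θ.symm y :=
      (h4.contDiffAt (Θ.open_target.mem_nhds hy.1)).contMDiffAt
    exact (ContMDiffAt.comp (g := φ' ∘ ψ.symm) y h8 h9).contMDiffWithinAt
  · intro x hx
    have hx' : x ∈ ψ.source ∧ ψ x ∈ Θ.source := hx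
    have hxl : ψ.symm (ψ x) = x := ψ.left_inv hx'.1
    have hxU : W.flip (ψ.symm (ψ x)) ∈ ψ.source := (h2 hx'.2).2
    have h8 : ψ (W.flip (ψ.symm (ψ x))) ∈ Θ.source := h5 hx'.2
    rw [hxl] at hxU h8
    exact ⟨hxU, h8⟩
  · intro x hx
    have hx' : x ∈ ψ.source ∧ ψ x ∈ Θ.source := hx
    have h8 : (Θ (ψ (W.flip (ψ.symm (ψ x))))).1 = (Θ (ψ x)).1 := h6 _ hx'.2
    rwa [ψ.left_inv hx'.1] at h8
  · intro x hx
    have hx' : x ∈ ψ.source ∧ ψ x ∈ Θ.source := hx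
    have h8 : (Θ (ψ x)).2 = W.h (ψ.symm (ψ x)) := h7 _ hx'.2
    rwa [ψ.left_inv hx'.1] at h8

end Mirror

/-! ### Charts at interior points of the nontrivial part -/

/-- A partial homeomorphism from maps that are inverse to each other where both are defined. -/
def partialHomeoOfInverse {X Y : Type*} [TopologicalSpace X] [TopologicalSpace Y] (f : X → Y)
    (g : Y → X) (U : Set X) (V : Set Y) (hU : IsOpen U) (hV : IsOpen V) (hf : ContinuousOn f U)
    (hg : ContinuousOn g V) (hgf : ∀ x ∈ U, f x ∈ V → g (f x) = x)
    (hfg : ∀ y ∈ V, g y ∈ U → f (g y) = y) : OpenPartialHomeomorph X Y where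
  toFun := f
  invFun := g
  source := U ∩ f ⁻¹' V
  target := V ∩ g ⁻¹' U
  map_source' x hx := ⟨hx.2, by rw [mem_preimage, hgf x hx.1 hx.2]; exact hx.1⟩
  map_target' y hy := ⟨hy.2, by rw [mem_preimage, hfg y hy.1 hy.2]; exact hy.1⟩
  left_inv' x hx := hgf x hx.1 hx.2
  right_inv' y hy := hfg y hy.1 hy.2
  open_source := hf.isOpen_inter_preimage hU hV
  open_target := hg.isOpen_inter_preimage hV hU
  continuousOn_toFun := hf.mono inter_subset_left
  continuousOn_invFun := hg.mono inter_subset_left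

/-- A finite-dimensional space as a Euclidean space. -/
def euEquiv {E₀ : Type*} [NormedAddCommGroup E₀] [NormedSpace ℝ E₀] [FiniteDimensional ℝ E₀] {d : ℕ}
    (hE : Module.finrank ℝ E₀ = d) : E₀ ≃L[ℝ] Eu d :=
  ContinuousLinearEquiv.ofFinrankEq (hE.trans finrank_euclideanSpace_fin.symm)

section ConeCharts

variable {n m : ℕ} {M : GMfd.{u} G n} {M' : GMfd.{u} G m} {e : RoundTub M M'} {W : PreCob M}
  {E H Z : Type*} [NormedAddCommGroup E] [NormedSpace ℝ E] [TopologicalSpace H]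
  [TopologicalSpace Z] [ChartedSpace H Z] {J : ModelWithCorners ℝ E H}

variable (e) in
/-- The map from the nontrivial part to the stabilization, away from the boundary of the
cobordism. -/
def coneHomeo [Nonempty (conePart e W)] (hW : W.IsEncasedMirror) :
    OpenPartialHomeomorph (conePart e W) (StSpace e W) :=
  OpenPartialHomeomorph.ofContinuousOpenRestrict
    ((ofCone_injective hW).injOn.toPartialEquiv ofCone {b | b.1.1 ∉ W.bd})
    continuous_ofCone.continuousOn
    (by
      intro N hN
      obtain ⟨N', hN', rfl⟩ := isOpen_induced_iff.1 hN
      have hopen : IsOpen {b : conePart e W | b.1.1 ∉ W.bd} :=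
        hW.isClosed_bd.isOpen_compl.preimage continuous_conePart_fst
      have : ({b : conePart e W | b.1.1 ∉ W.bd}.domRestrict (ofCone : _ → StSpace e W)) ''
          (Subtype.val ⁻¹' N') = ofCone '' (N' ∩ {b | b.1.1 ∉ W.bd}) := by
        ext z
        constructor
        · rintro ⟨b, hb, rfl⟩
          exact ⟨b.1, ⟨hb, b.2⟩, rfl⟩
        · rintro ⟨b, hb, rfl⟩
          exact ⟨⟨b, hb.2⟩, hb.1, rfl⟩
      have h2 := isOpen_image_ofCone hW (hN'.inter hopen) fun b hb => hb.2
      rw [← this] at h2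
      exact h2)
    (hW.isClosed_bd.isOpen_compl.preimage continuous_conePart_fst)

variable {E₀ : Type*} [NormedAddCommGroup E₀] [NormedSpace ℝ E₀] [FiniteDimensional ℝ E₀]

/-- A chart of the nontrivial part, away from the boundary of the cobordism, as a chart of the
stabilization with values in the interior of the quadrant. -/
def coneChart [Nonempty (conePart e W)] (hW : W.IsEncasedMirror)
    (hE : Module.finrank ℝ E₀ = m + 1) (χ : OpenPartialHomeomorph (conePart e W) E₀) :
    OpenPartialHomeomorph (StSpace e W) (Quad (m + 1)) :=
  (coneHomeo e hW).symm ≫ₕ χ ≫ₕ (euEquiv hE).toHomeomorph.toOpenPartialHomeomorph ≫ₕ expQuad (m + 1)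

variable [Nonempty (conePart e W)] (hW : W.IsEncasedMirror)
  (hE : Module.finrank ℝ E₀ = m + 1) (χ : OpenPartialHomeomorph (conePart e W) E₀)

theorem coneChart_ofCone {b : conePart e W} (hb : b.1.1 ∉ W.bd) :
    coneChart hW hE χ (ofCone b) = expQuad (m + 1) (euEquiv hE (χ b)) := by
  have h1 : (coneHomeo e hW).symm (ofCone b) = b := (coneHomeo e hW).left_inv hb
  simp only [coneChart, OpenPartialHomeomorph.coe_trans, Function.comp_apply, h1]
  rfl

theorem coneChart_source (hbd : ∀ b ∈ χ.source, b.1.1 ∉ W.bd) :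
    (coneChart hW hE χ).source = ofCone '' χ.source := by
  ext z
  simp only [coneChart, OpenPartialHomeomorph.trans_source, mem_inter_iff, mem_preimage,
    Homeomorph.toOpenPartialHomeomorph_source, expQuad_source, mem_univ, and_true]
  constructor
  · rintro ⟨⟨b, hb, rfl⟩, h⟩
    have h1 : (coneHomeo e hW).symm (ofCone b) = b := (coneHomeo e hW).left_inv hb
    rw [h1] at h
    exact ⟨b, h, rfl⟩
  · rintro ⟨b, hb, rfl⟩
    have h1 : (coneHomeo e hW).symm (ofCone b) = b := (coneHomeo e hW).left_inv (hbd b hb)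
    exact ⟨⟨b, hbd b hb, rfl⟩, by rw [h1]; exact hb⟩

theorem coneChart_pos (hbd : ∀ b ∈ χ.source, b.1.1 ∉ W.bd) {z : StSpace e W}
    (hz : z ∈ (coneChart hW hE χ).source) (i : Fin (m + 1)) : 0 < (coneChart hW hE χ z).1 i := by
  rw [coneChart_source hW hE χ hbd] at hz
  obtain ⟨b, hb, rfl⟩ := hz
  rw [coneChart_ofCone hW hE χ (hbd b hb)]
  exact expQuad_pos _ i

/-- The exponential that moves values into the interior of the quadrant has a smooth inverse, so it
does not affect the smooth structure. -/
theorem smoothVia_coneChart {b : conePart e W} (hb : b.1.1 ∉ W.bd) :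
    SmoothVia (quadModel (m + 1)) (fun b' => coneChart hW hE χ (ofCone b')) 𝓘(ℝ, E₀) χ b := by
  set A := euEquiv hE
  have h1 : ContMDiffAt (quadModel (m + 1)) 𝓘(ℝ, Eu (m + 1)) ∞ (expQuad (m + 1)).symm
      (coneChart hW hE χ (ofCone b)) := by
    refine contMDiffOn_expQuad_symm.contMDiffAt ((expQuad (m + 1)).open_target.mem_nhds ?_)
    rw [coneChart_ofCone hW hE χ hb]
    exact (expQuad (m + 1)).map_source (by rw [expQuad_source]; trivial)
  have h2 := ((SmoothVia.refl (quadModel (m + 1)) (fun b' => coneChart hW hE χ (ofCone b')) b).comp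
    h1).comp_contDiffAt (T := A.symm) A.symm.contDiff.contDiffAt
  refine h2.congr ?_
  filter_upwards [eventually_notMem_bd hW hb] with b' hb'
  rw [coneChart_ofCone hW hE χ hb', (expQuad (m + 1)).left_inv (by rw [expQuad_source]; trivial)]
  exact A.symm_apply_apply _

/-- This certifies a constructed chart. The coordinates, given on the nontrivial part, are extended
to the stabilization with an irrelevant value elsewhere; the function `F₀` expresses the chart in
these coordinates. -/
theorem smoothCoord_coneChart (hbd : ∀ b ∈ χ.source, b.1.1 ∉ W.bd) {c₀ : conePart e W → Z}
    (hc₀ : ∀ b ∈ χ.source, SmoothVia 𝓘(ℝ, E₀) χ J c₀ b) {F₀ : Z → E₀}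
    (hF₀ : ContMDiffOn J 𝓘(ℝ, E₀) ∞ F₀ (c₀ '' χ.source)) (hF : ∀ b ∈ χ.source, F₀ (c₀ b) = χ b) :
    ∃ c : StSpace e W → Z, (∀ b, c (ofCone b) = c₀ b) ∧
      SmoothCoord (coneChart hW hE χ) J c (coneChart hW hE χ).source := by
  obtain ⟨b₀⟩ := ‹Nonempty (conePart e W)›
  have hc : ∀ b, Function.extend ofCone c₀ (fun _ => c₀ b₀) (ofCone b : StSpace e W) = c₀ b :=
    fun b => (ofCone_injective hW).extend_apply _ _ _
  have hsrc := coneChart_source hW hE χ hbd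
  refine ⟨_, hc, ?_, fun q => expQuad (m + 1) (euEquiv hE (F₀ q)), ?_, ?_⟩
  · intro y hy
    have hz := (coneChart hW hE χ).map_target hy.1
    have hy' := (coneChart hW hE χ).right_inv hy.1
    have hz' := hz
    rw [hsrc] at hz'
    obtain ⟨b, hb, hbz⟩ := hz'
    rw [← hbz] at hz hy'
    have h1 : SmoothVia (quadModel (m + 1)) (coneChart hW hE χ) J
        (Function.extend ofCone c₀ (fun _ => c₀ b₀)) (ofCone b) := by
      refine SmoothVia.of_comp_left (nhds_ofCone_le hW (hbd b hb)) ?_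
      simp only [hc]
      exact (smoothVia_coneChart hW hE χ (hbd b hb)).trans (hc₀ b hb)
    rw [smoothVia_chart_iff hz, hy'] at h1
    exact h1.contMDiffWithinAt
  · have h1 : Function.extend ofCone c₀ (fun _ => c₀ b₀) ''
        ((coneChart hW hE χ).source ∩ (coneChart hW hE χ).source) = c₀ '' χ.source := by
      rw [inter_self, hsrc, image_image]
      exact image_congr fun b _ => hc b
    rw [h1]
    exact (contMDiff_expQuad.comp (ContinuousLinearEquiv.contDiff _).contMDiff).comp_contMDiffOn hF₀
  · rintro z ⟨hz, -⟩
    rw [hsrc] at hz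
    obtain ⟨b, hb, rfl⟩ := hz
    change expQuad (m + 1) (euEquiv hE (F₀ _)) = _
    rw [hc, hF b hb, coneChart_ofCone hW hE χ (hbd b hb)]

end ConeCharts

/-! ### Parametrization of the nontrivial part around the cone locus -/

section ConeLocus

variable {n m : ℕ} {M : GMfd.{u} G n} {M' : GMfd.{u} G m} {e : RoundTub M M'} {W : PreCob M}

/-- The inverse is written as a map to the ambient product, which is convenient for continuity. The
point `b₀` is only a default value where it leaves the nontrivial part. -/
theorem exists_partialHomeo_conePart {E₀ : Type*} [TopologicalSpace E₀] {f : conePart e W → E₀}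
    {R : E₀ → W.X × e.D × ℝ} {U : Set (conePart e W)} {V : Set E₀} (b₀ : conePart e W)
    (hU : IsOpen U) (hV : IsOpen V) (hf : ContinuousOn f U) (hRc : ContinuousOn R V)
    (hR : ∀ q ∈ V, R q ∈ conePart e W) (hRf : ∀ b ∈ U, f b ∈ V → R (f b) = b.1)
    (hfR : ∀ q ∈ V, ∀ b : conePart e W, b.1 = R q → b ∈ U → f b = q) :
    ∃ χ : OpenPartialHomeomorph (conePart e W) E₀, χ.source = U ∩ f ⁻¹' V ∧ ∀ b, χ b = f b := by
  classical
  let g : E₀ → conePart e W := fun q => if h : R q ∈ conePart e W then ⟨R q, h⟩ else b₀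
  have hg : ∀ q ∈ V, (g q).1 = R q := fun q hq => by simp only [g, dif_pos (hR q hq)]
  have hgc : ContinuousOn g V := by
    rw [continuousOn_iff_continuous_domRestrict, continuous_induced_rng]
    exact continuousOn_iff_continuous_domRestrict.1 (hRc.congr hg)
  exact ⟨partialHomeoOfInverse f g U V hU hV hf hgc
    (fun b hb hbV => Subtype.ext ((hg _ hbV).trans (hRf b hb hbV)))
    (fun q hq hqU => hfR q hq _ (hg q hq) hqU), rfl, fun b => rfl⟩

/-- Given (u, v, t), the height must be the negative radius of (v, t). The mirror coordinates then
determine w, and the trivialization over r(w) determines x. The nontrivial part is a manifold here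
although the radius is not smooth. -/
theorem exists_coneLocus_homeo (hW : W.IsEncasedMirror) {β : OpenPartialHomeomorph W.X (Eu n × ℝ)}
    (hβ : IsMirrorCoord W β) (τ : RoundTriv M e.D e.p e.nrm e.k) (b₀ : conePart e W) :
    ∃ χ : OpenPartialHomeomorph (conePart e W) (Eu n × (Eu e.k × ℝ)),
      (∀ b, b ∈ χ.source ↔ b.1.1 ∈ β.source ∧ b.1.1 ∉ W.bd ∧ W.r b.1.1 ∈ τ.base) ∧
      ∀ b, χ b = ((β b.1.1).1, (τ.coord b.1.2.1, b.1.2.2)) := by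
  let f : conePart e W → Eu n × (Eu e.k × ℝ) := fun b =>
    ((β b.1.1).1, (τ.coord b.1.2.1, b.1.2.2))
  let i : Eu n × (Eu e.k × ℝ) → W.X := fun q => β.symm (q.1, -√(‖q.2.1‖ ^ 2 + q.2.2 ^ 2))
  let R : Eu n × (Eu e.k × ℝ) → W.X × e.D × ℝ := fun q => (i q, τ.toFun (W.r (i q), q.2.1), q.2.2)
  let V₁ : Set (Eu n × (Eu e.k × ℝ)) :=
    (fun q => (q.1, -√(‖q.2.1‖ ^ 2 + q.2.2 ^ 2))) ⁻¹' β.target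
  have hV₁ : IsOpen V₁ := β.open_target.preimage (by fun_prop)
  have hi : ContinuousOn i V₁ := β.continuousOn_symm.comp (by fun_prop) fun q hq => hq
  let V : Set (Eu n × (Eu e.k × ℝ)) := V₁ ∩ (fun q => W.r (i q)) ⁻¹' τ.base
  have hV : IsOpen V :=
    (hW.continuous_r.comp_continuousOn hi).isOpen_inter_preimage hV₁ τ.isOpen_base
  have hih : ∀ q ∈ V, W.h (i q) = -√(‖q.2.1‖ ^ 2 + q.2.2 ^ 2) := by
    intro q hq
    rw [← hβ.snd_eq _ (β.map_target hq.1), β.right_inv hq.1]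
  -- The height of the double is at least -1, so v automatically stays in the unit ball of the
  -- fibre.
  have hle : ∀ q ∈ V, ‖q.2.1‖ ≤ 1 := by
    intro q hq
    have h1 := (hW.h_mem (i q)).1
    rw [hih q hq] at h1
    have h2 : √(‖q.2.1‖ ^ 2 + q.2.2 ^ 2) ≤ 1 := by linarith
    rw [Real.sqrt_le_one] at h2
    nlinarith [sq_nonneg q.2.2, norm_nonneg q.2.1]
  have hR : ∀ q ∈ V, R q ∈ conePart e W := by
    intro q hq
    refine ⟨?_, (τ.p_toFun _ hq.2 _ (hle q hq)).symm, ?_⟩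
    · change W.h (i q) ≤ 0
      rw [hih q hq]
      exact neg_nonpos.2 (Real.sqrt_nonneg _)
    · change W.h (i q) ^ 2 = e.nrm (τ.toFun (W.r (i q), q.2.1)) ^ 2 + q.2.2 ^ 2
      rw [hih q hq, τ.nrm_toFun hq.2 (hle q hq), neg_sq, Real.sq_sqrt (by positivity)]
  let U : Set (conePart e W) := {b | b.1.1 ∈ β.source ∧ b.1.1 ∉ W.bd ∧ W.r b.1.1 ∈ τ.base}
  have hU : IsOpen U :=
    (β.open_source.preimage continuous_conePart_fst).inter
      ((hW.isClosed_bd.isOpen_compl.preimage continuous_conePart_fst).inter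
        (τ.isOpen_base.preimage (hW.continuous_r.comp continuous_conePart_fst)))
  have hcoord : ∀ b ∈ U, ContinuousAt (fun b' : conePart e W => τ.coord b'.1.2.1) b := by
    intro b hb
    have hpb : e.p b.1.2.1 ∈ τ.base := by rw [← b.2.2.1]; exact hb.2.2
    exact ContinuousAt.comp (g := τ.coord) (f := fun b' : conePart e W => b'.1.2.1) (τ.contMDiffAt_coord e.continuous_p hpb).continuousAt
      continuous_conePart_x.continuousAt
  have hf : ContinuousOn f U := by
    intro b hb
    refine ContinuousAt.continuousWithinAt ?_
    have h1 : ContinuousAt (fun b' : conePart e W => (β b'.1.1).1) b :=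
      (ContinuousAt.comp (g := β) (f := fun b' : conePart e W => b'.1.1) (β.continuousAt hb.1)
        continuous_conePart_fst.continuousAt).fst
    exact h1.prodMk ((hcoord b hb).prodMk continuous_conePart_t.continuousAt)
  have hRc : ContinuousOn R V := by
    have h1 : ContinuousOn i V := hi.mono inter_subset_left
    refine h1.prodMk (ContinuousOn.prodMk ?_ (by fun_prop))
    refine τ.continuousOn_toFun.comp ((hW.continuous_r.comp_continuousOn h1).prodMk (by fun_prop)) ?_
    intro q hq
    exact ⟨hq.2, by simpa using hle q hq⟩
  have hfi : ∀ b ∈ U, i (f b) = b.1.1 := by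
    intro b hb
    have h1 : (((β b.1.1).1, -√(‖τ.coord b.1.2.1‖ ^ 2 + b.1.2.2 ^ 2)) : Eu n × ℝ) = β b.1.1 := by
      refine Prod.ext rfl ?_
      rw [hβ.snd_eq _ hb.1, norm_coord_conePart τ hb.2.2, conePart_h]
    change β.symm _ = _
    rw [h1, β.left_inv hb.1]
  have hRf : ∀ b ∈ U, f b ∈ V → R (f b) = b.1 := by
    intro b hb hbV
    refine Prod.ext (hfi b hb) (Prod.ext ?_ rfl)
    change τ.toFun (W.r (i (f b)), τ.coord b.1.2.1) = b.1.2.1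
    rw [hfi b hb, b.2.2.1]
    exact τ.toFun_coord _ (by rw [← b.2.2.1]; exact hb.2.2)
  have hfR : ∀ q ∈ V, ∀ b : conePart e W, b.1 = R q → b ∈ U → f b = q := by
    intro q hq b hb _
    simp only [f, hb, R]
    refine Prod.ext ?_ (Prod.ext (τ.coord_toFun _ hq.2 _ (hle q hq)) rfl)
    simp only [i]
    rw [β.right_inv hq.1]
  obtain ⟨χ, hχs, hχ⟩ := exists_partialHomeo_conePart b₀ hU hV hf hRc hR hRf hfR
  refine ⟨χ, fun b => ?_, hχ⟩
  rw [hχs]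
  refine ⟨fun h => h.1, fun h => ⟨h, ?_, ?_⟩⟩
  · change (((β b.1.1).1, -√(‖τ.coord b.1.2.1‖ ^ 2 + b.1.2.2 ^ 2)) : Eu n × ℝ) ∈ β.target
    rw [norm_coord_conePart τ h.2.2, ← conePart_h, ← hβ.snd_eq _ h.1]
    exact β.map_source h.1
  · change W.r (i (f b)) ∈ τ.base
    rw [hfi b h]
    exact h.2.2

end ConeLocus

/-! ### Charts away from the cone locus -/

section Perp

variable {V : Type*} [NormedAddCommGroup V] [InnerProductSpace ℝ V] {e₁ : V}

/-- The orthogonal projection to the complement of a vector. -/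
def perpProj (e₁ : V) : V →L[ℝ] (ℝ ∙ e₁)ᗮ := (ℝ ∙ e₁)ᗮ.orthogonalProjectionOnto

theorem perpProj_coe (h : ‖e₁‖ = 1) (Y : V) : (perpProj e₁ Y : V) = Y - ⟪e₁, Y⟫_ℝ • e₁ := by
  have := Submodule.starProjection_orthogonal_val (K := (ℝ ∙ e₁)) Y
  rw [Submodule.starProjection_unit_singleton ℝ h] at this
  exact this

theorem perpProj_add_smul (h : ‖e₁‖ = 1) (y : (ℝ ∙ e₁)ᗮ) (c : ℝ) :
    perpProj e₁ (y + c • e₁) = y := by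
  have hy : ⟪e₁, (y : V)⟫_ℝ = 0 := Submodule.mem_orthogonal_singleton_iff_inner_right.1 y.2
  refine Subtype.ext ?_
  rw [perpProj_coe h, inner_add_right, hy, inner_smul_right, real_inner_self_eq_norm_sq, h]
  simp

theorem norm_sq_add_smul (h : ‖e₁‖ = 1) (y : (ℝ ∙ e₁)ᗮ) (c : ℝ) :
    ‖(y : V) + c • e₁‖ ^ 2 = ‖y‖ ^ 2 + c ^ 2 := by
  have hy : ⟪(y : V), e₁⟫_ℝ = 0 := Submodule.mem_orthogonal_singleton_iff_inner_left.1 y.2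
  rw [norm_add_sq_real, inner_smul_right, hy, norm_smul, h]
  simp

theorem norm_sq_perpProj (h : ‖e₁‖ = 1) (Y : V) :
    ‖Y‖ ^ 2 = ‖perpProj e₁ Y‖ ^ 2 + ⟪e₁, Y⟫_ℝ ^ 2 := by
  rw [← norm_sq_add_smul h, perpProj_coe h, sub_add_cancel]

/-- Positivity of the component along `e₁` selects the root, so a vector is determined by its
projection and its length. -/
theorem eq_perpProj_add (h : ‖e₁‖ = 1) {Y : V} (h0 : 0 < ⟪e₁, Y⟫_ℝ) :
    perpProj e₁ Y + √(‖Y‖ ^ 2 - ‖perpProj e₁ Y‖ ^ 2) • e₁ = Y := by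
  rw [norm_sq_perpProj h, add_sub_cancel_left, Real.sqrt_sq h0.le, perpProj_coe h, sub_add_cancel]

end Perp

/-- The fibre of `D(ν × ℝ)`, with its inner product. -/
abbrev Fib (k : ℕ) : Type := WithLp 2 (Eu k × ℝ)

/-- The identification of the fibre of `D(ν × ℝ)` with a product. -/
def toFib (k : ℕ) : (Eu k × ℝ) ≃L[ℝ] Fib k := (WithLp.prodContinuousLinearEquiv 2 ℝ (Eu k) ℝ).symm

theorem norm_sq_toFib {k : ℕ} (q : Eu k × ℝ) : ‖toFib k q‖ ^ 2 = ‖q.1‖ ^ 2 + q.2 ^ 2 := by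
  have h := WithLp.prod_norm_sq_eq_of_L2 (toFib k q)
  rw [h]
  change ‖q.1‖ ^ 2 + ‖q.2‖ ^ 2 = _
  rw [Real.norm_eq_abs, sq_abs]

theorem inner_toFib {k : ℕ} (Y : Fib k) (q : Eu k × ℝ) :
    ⟪Y, toFib k q⟫_ℝ = ⟪((toFib k).symm Y).1, q.1⟫_ℝ + ((toFib k).symm Y).2 * q.2 := by
  rw [WithLp.prod_inner_apply, mul_comm]
  rfl

theorem finrank_perp {n k m : ℕ} (hm : m = n + k) {e₁ : Fib k} (h : ‖e₁‖ = 1) :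
    Module.finrank ℝ (Eu (n + 1) × (ℝ ∙ e₁)ᗮ) = m + 1 := by
  have hfact : Fact (Module.finrank ℝ (Fib k) = k + 1) := ⟨by
    rw [← (toFib k).toLinearEquiv.finrank_eq]; simp⟩
  have h0 : e₁ ≠ 0 := by
    rintro rfl
    simp at h
  rw [Module.finrank_prod, Submodule.finrank_orthogonal_span_singleton (n := k) h0,
    finrank_euclideanSpace_fin]
  omega

section Regular

variable {n m : ℕ} {M : GMfd.{u} G n} {M' : GMfd.{u} G m} {e : RoundTub M M'} {W : PreCob M}

/-- The fibre coordinate of a point of the nontrivial part. -/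
def fibCoord (τ : RoundTriv M e.D e.p e.nrm e.k) (b : conePart e W) : Fib e.k :=
  toFib e.k (τ.coord b.1.2.1, b.1.2.2)

theorem norm_sq_fibCoord {τ : RoundTriv M e.D e.p e.nrm e.k} {b : conePart e W}
    (hb : W.r b.1.1 ∈ τ.base) : ‖fibCoord τ b‖ ^ 2 = W.h b.1.1 ^ 2 := by
  rw [fibCoord, norm_sq_toFib, norm_coord_conePart τ hb, b.2.2.2]

theorem continuousAt_fibCoord {τ : RoundTriv M e.D e.p e.nrm e.k} {b : conePart e W}
    (hb : W.r b.1.1 ∈ τ.base) : ContinuousAt (fibCoord τ : conePart e W → Fib e.k) b := by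
  have hpb : e.p b.1.2.1 ∈ τ.base := by rwa [← b.2.2.1]
  have h1 : ContinuousAt (fun b' : conePart e W => τ.coord b'.1.2.1) b :=
    ContinuousAt.comp (g := τ.coord) (f := fun b' : conePart e W => b'.1.2.1)
      (τ.contMDiffAt_coord e.continuous_p hpb).continuousAt continuous_conePart_x.continuousAt
  exact (toFib e.k).continuous.continuousAt.comp
    (h1.prodMk continuous_conePart_t.continuousAt)

theorem pos_of_notMem_bd (hW : W.IsEncasedMirror) {ψ : OpenPartialHomeomorph W.X (Quad (n + 1))}
    (hψ : ψ ∈ W.atlas) {w : W.X} (hw : w ∈ ψ.source) (hbd : w ∉ W.bd) (i : Fin (n + 1)) :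
    0 < (ψ w).1 i := by
  refine lt_of_le_of_ne ((ψ w).2 i) fun h => hbd ?_
  rw [hW.bd_eq]
  exact ⟨ψ, hψ, hw, i, h.symm⟩

/-- Over w the fibre is the sphere of radius |h(w)|, or a part of it. Where the component along a
unit vector `e₁` is positive, the sphere is a graph over the complement of `e₁`, and this component
is √(h(w)² - |y|²). -/
theorem exists_regular_homeo (hW : W.IsEncasedMirror) {ψ : OpenPartialHomeomorph W.X (Quad (n + 1))}
    (hψ : ψ ∈ W.atlas) (τ : RoundTriv M e.D e.p e.nrm e.k) {e₁ : Fib e.k} (h1 : ‖e₁‖ = 1)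
    (b₀ : conePart e W) :
    ∃ χ : OpenPartialHomeomorph (conePart e W) (Eu (n + 1) × (ℝ ∙ e₁)ᗮ),
      (∀ b, b ∈ χ.source ↔ b.1.1 ∈ ψ.source ∧ b.1.1 ∉ W.bd ∧ W.h b.1.1 < 0 ∧
        W.r b.1.1 ∈ τ.base ∧ 0 < ⟪e₁, fibCoord τ b⟫_ℝ) ∧
      ∀ b, χ b = ((ψ b.1.1).1, perpProj e₁ (fibCoord τ b)) := by
  let ψ' := ψ.trans (quadInterior (n + 1))
  let f : conePart e W → Eu (n + 1) × (ℝ ∙ e₁)ᗮ := fun b =>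
    ((ψ b.1.1).1, perpProj e₁ (fibCoord τ b))
  let i : Eu (n + 1) × (ℝ ∙ e₁)ᗮ → W.X := fun q => ψ'.symm q.1
  let Y : Eu (n + 1) × (ℝ ∙ e₁)ᗮ → Fib e.k := fun q =>
    q.2 + √(W.h (i q) ^ 2 - ‖q.2‖ ^ 2) • e₁
  let y : Eu (n + 1) × (ℝ ∙ e₁)ᗮ → Eu e.k × ℝ := fun q => (toFib e.k).symm (Y q)
  let R : Eu (n + 1) × (ℝ ∙ e₁)ᗮ → W.X × e.D × ℝ := fun q =>
    (i q, τ.toFun (W.r (i q), (y q).1), (y q).2)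
  let V₁ : Set (Eu (n + 1) × (ℝ ∙ e₁)ᗮ) := Prod.fst ⁻¹' ψ'.target
  have hV₁ : IsOpen V₁ := ψ'.open_target.preimage continuous_fst
  have hi : ContinuousOn i V₁ := ψ'.continuousOn_symm.comp continuous_fst.continuousOn fun q hq => hq
  have hih : ContinuousOn (fun q => W.h (i q)) V₁ := hW.continuous_h.comp_continuousOn hi
  let V₂ := V₁ ∩ (fun q => W.r (i q)) ⁻¹' τ.base
  have hV₂ : IsOpen V₂ :=
    (hW.continuous_r.comp_continuousOn hi).isOpen_inter_preimage hV₁ τ.isOpen_base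
  let V := V₂ ∩ (fun q => (W.h (i q), W.h (i q) ^ 2 - ‖q.2‖ ^ 2)) ⁻¹' (Iio 0 ×ˢ Ioi 0)
  have hV : IsOpen V := by
    have h2 : ContinuousOn (fun q => (W.h (i q), W.h (i q) ^ 2 - ‖q.2‖ ^ 2)) V₂ := by
      have := hih.mono (inter_subset_left : V₂ ⊆ V₁)
      fun_prop
    exact h2.isOpen_inter_preimage hV₂ (isOpen_Iio.prod isOpen_Ioi)
  have hnorm : ∀ q ∈ V, ‖(y q).1‖ ^ 2 + (y q).2 ^ 2 = W.h (i q) ^ 2 := by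
    intro q hq
    rw [← norm_sq_toFib, ContinuousLinearEquiv.apply_symm_apply, norm_sq_add_smul h1,
      Real.sq_sqrt (le_of_lt hq.2.2), add_sub_cancel]
  have hle : ∀ q ∈ V, ‖(y q).1‖ ≤ 1 := by
    intro q hq
    have h2 := hnorm q hq
    have h3 := hW.h_mem (i q)
    have h4 : W.h (i q) ^ 2 ≤ 1 := by nlinarith [h3.1, h3.2]
    nlinarith [sq_nonneg (y q).2, norm_nonneg (y q).1]
  have hR : ∀ q ∈ V, R q ∈ conePart e W := by
    intro q hq
    refine ⟨le_of_lt hq.2.1, (τ.p_toFun _ hq.1.2 _ (hle q hq)).symm, ?_⟩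
    change W.h (i q) ^ 2 = e.nrm (τ.toFun (W.r (i q), (y q).1)) ^ 2 + (y q).2 ^ 2
    rw [τ.nrm_toFun hq.1.2 (hle q hq), hnorm q hq]
  let U : Set (conePart e W) := {b | b.1.1 ∈ ψ.source ∧ b.1.1 ∉ W.bd ∧ W.h b.1.1 < 0 ∧
        W.r b.1.1 ∈ τ.base ∧ 0 < ⟪e₁, fibCoord τ b⟫_ℝ}
  have hinner : ∀ b : conePart e W, W.r b.1.1 ∈ τ.base →
      ContinuousAt (fun b' : conePart e W => ⟪e₁, fibCoord τ b'⟫_ℝ) b := fun b hb =>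
    continuousAt_const.inner (continuousAt_fibCoord hb)
  have hU : IsOpen U := by
    rw [isOpen_iff_mem_nhds]
    rintro b ⟨h2, h3, h4, h5, h6⟩
    filter_upwards [(ψ.open_source.preimage continuous_conePart_fst).mem_nhds h2,
      eventually_notMem_bd hW h3,
      (isOpen_Iio.preimage (hW.continuous_h.comp continuous_conePart_fst)).mem_nhds h4,
      eventually_mem_base hW τ h5, (hinner b h5).eventually (lt_mem_nhds h6)]
      with b' h2' h3' h4' h5' h6'
    exact ⟨h2', h3', h4', h5', h6'⟩
  have hf : ContinuousOn f U := by
    rintro b ⟨h2, h3, h4, h5, h6⟩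
    refine ContinuousAt.continuousWithinAt ?_
    refine ContinuousAt.prodMk ?_ ((perpProj e₁).continuous.continuousAt.comp
      (continuousAt_fibCoord h5))
    exact continuous_subtype_val.continuousAt.comp (ContinuousAt.comp (g := ψ)
      (f := fun b' : conePart e W => b'.1.1) (ψ.continuousAt h2)
      continuous_conePart_fst.continuousAt)
  have hψU : ∀ b ∈ U, b.1.1 ∈ ψ'.source := fun b hb =>
    ⟨hb.1, pos_of_notMem_bd hW hψ hb.1 hb.2.1⟩
  have hfi : ∀ b ∈ U, i (f b) = b.1.1 := fun b hb => ψ'.left_inv (hψU b hb)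
  have hfV : ∀ b ∈ U, f b ∈ V := by
    intro b hb
    refine ⟨⟨ψ'.map_source (hψU b hb), ?_⟩, ?_, ?_⟩
    · rw [mem_preimage, hfi b hb]; exact hb.2.2.2.1
    · change W.h (i (f b)) < 0
      rw [hfi b hb]; exact hb.2.2.1
    · change 0 < W.h (i (f b)) ^ 2 - ‖perpProj e₁ (fibCoord τ b)‖ ^ 2
      rw [hfi b hb, ← norm_sq_fibCoord hb.2.2.2.1, norm_sq_perpProj h1, add_sub_cancel_left]
      exact pow_pos hb.2.2.2.2 2
  have hRc : ContinuousOn R V := by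
    have h2 : ContinuousOn i V := hi.mono fun q hq => hq.1.1
    have h3 : ContinuousOn Y V := by
      have := hW.continuous_h.comp_continuousOn h2
      simp only [Y]
      fun_prop
    have h4 : ContinuousOn y V := (toFib e.k).symm.continuous.comp_continuousOn h3
    refine h2.prodMk (ContinuousOn.prodMk ?_ h4.snd)
    refine τ.continuousOn_toFun.comp ((hW.continuous_r.comp_continuousOn h2).prodMk h4.fst) ?_
    intro q hq
    exact ⟨hq.1.2, by simpa using hle q hq⟩
  have hRf : ∀ b ∈ U, f b ∈ V → R (f b) = b.1 := by
    intro b hb _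
    have h2 : y (f b) = (τ.coord b.1.2.1, b.1.2.2) := by
      simp only [y, Y]
      rw [hfi b hb, ← norm_sq_fibCoord hb.2.2.2.1]
      rw [ContinuousLinearEquiv.symm_apply_eq]
      exact eq_perpProj_add h1 hb.2.2.2.2
    refine Prod.ext (hfi b hb) (Prod.ext ?_ ?_)
    · change τ.toFun (W.r (i (f b)), (y (f b)).1) = b.1.2.1
      rw [hfi b hb, h2, b.2.2.1]
      exact τ.toFun_coord _ (by rw [← b.2.2.1]; exact hb.2.2.2.1)
    · change (y (f b)).2 = _
      rw [h2]
  have hfR : ∀ q ∈ V, ∀ b : conePart e W, b.1 = R q → b ∈ U → f b = q := by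
    intro q hq b hb _
    simp only [f, fibCoord, hb, R]
    refine Prod.ext ?_ ?_
    · exact ψ'.right_inv hq.1.1
    · change perpProj e₁ (toFib e.k (τ.coord (τ.toFun (W.r (i q), (y q).1)), (y q).2)) = q.2
      rw [τ.coord_toFun _ hq.1.2 _ (hle q hq), Prod.mk.eta, ContinuousLinearEquiv.apply_symm_apply]
      exact perpProj_add_smul h1 _ _
  obtain ⟨χ, hχs, hχ⟩ := exists_partialHomeo_conePart b₀ hU hV hf hRc hR hRf hfR
  refine ⟨χ, fun b => ?_, hχ⟩
  rw [hχs]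
  exact ⟨fun h => h.1, fun h => ⟨h, hfV b h⟩⟩

/-- On the chosen part of the sphere the radicand is nonzero, so the missing component is smooth;
then v, t and x are smooth functions of the chart. -/
theorem isCoord_regular_homeo (hW : W.IsEncasedMirror)
    {ψ : OpenPartialHomeomorph W.X (Quad (n + 1))}
    (hψ : ψ ∈ W.atlas) (τ : RoundTriv M e.D e.p e.nrm e.k) {e₁ : Fib e.k} (h1 : ‖e₁‖ = 1)
    {b : conePart e W} (hbψ : b.1.1 ∈ ψ.source) (hbτ : W.r b.1.1 ∈ τ.base)
    (hpos : 0 < ⟪e₁, fibCoord τ b⟫_ℝ) :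
    IsCoord 𝓘(ℝ, Eu (n + 1) × (ℝ ∙ e₁)ᗮ)
      (fun b' : conePart e W => ((ψ b'.1.1).1, perpProj e₁ (fibCoord τ b'))) b := by
  set c : conePart e W → Eu (n + 1) × (ℝ ∙ e₁)ᗮ :=
    fun b' => ((ψ b'.1.1).1, perpProj e₁ (fibCoord τ b'))
  have hc := SmoothVia.refl 𝓘(ℝ, Eu (n + 1) × (ℝ ∙ e₁)ᗮ) c b
  have hq : SmoothVia 𝓘(ℝ, Eu (n + 1) × (ℝ ∙ e₁)ᗮ) c (quadModel (n + 1)) (fun b' => ψ b'.1.1) b :=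
    smoothVia_quad_iff.2 (hc.comp_contDiffAt contDiffAt_fst)
  have hh : SmoothVia 𝓘(ℝ, Eu (n + 1) × (ℝ ∙ e₁)ᗮ) c 𝓘(ℝ, ℝ) (fun b' => W.h b'.1.1) b :=
    hq.trans ((hW.smoothAt_h _ ψ hψ hbψ).comp_left (f := fun b' : conePart e W => b'.1.1) rfl
      continuous_conePart_fst.continuousAt)
  have hr : SmoothVia 𝓘(ℝ, Eu (n + 1) × (ℝ ∙ e₁)ᗮ) c (quadModel n) (fun b' => W.r b'.1.1) b :=
    hq.trans ((hW.smoothAt_r _ ψ hψ hbψ).comp_left (f := fun b' : conePart e W => b'.1.1) rfl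
      continuous_conePart_fst.continuousAt)
  have hbase := eventually_mem_base hW τ hbτ
  have hY : SmoothVia 𝓘(ℝ, Eu (n + 1) × (ℝ ∙ e₁)ᗮ) c 𝓘(ℝ, Fib e.k) (fibCoord τ) b := by
    have hp : SmoothVia 𝓘(ℝ, Eu (n + 1) × (ℝ ∙ e₁)ᗮ) c 𝓘(ℝ, (ℝ ∙ e₁)ᗮ)
        (fun b' => perpProj e₁ (fibCoord τ b')) b := hc.comp_contDiffAt contDiffAt_snd
    have h3 := (hh.prodMk_space hp).comp_contDiffAt
      (T := fun q : ℝ × (ℝ ∙ e₁)ᗮ => (q.2 : Fib e.k) + √(q.1 ^ 2 - ‖q.2‖ ^ 2) • e₁) (by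
        have h4 : ContDiffAt ℝ ∞ (fun q : ℝ × (ℝ ∙ e₁)ᗮ => q.1 ^ 2 - ‖q.2‖ ^ 2)
            (W.h b.1.1, perpProj e₁ (fibCoord τ b)) :=
          ((contDiff_fst.pow 2).sub (contDiff_snd.norm_sq ℝ)).contDiffAt
        have h5 : W.h b.1.1 ^ 2 - ‖perpProj e₁ (fibCoord τ b)‖ ^ 2 ≠ 0 := by
          rw [← norm_sq_fibCoord hbτ, norm_sq_perpProj h1, add_sub_cancel_left]
          exact (pow_pos hpos 2).ne'
        exact (((ℝ ∙ e₁)ᗮ.subtypeL.contDiff.comp contDiff_snd).contDiffAt).add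
          ((h4.sqrt h5).smul contDiffAt_const))
    refine h3.congr ?_
    filter_upwards [hbase, (continuousAt_const.inner (𝕜 := ℝ) (continuousAt_fibCoord hbτ)).eventually
      (lt_mem_nhds hpos)] with b' hb' hb'pos
    rw [← norm_sq_fibCoord hb']
    exact eq_perpProj_add h1 hb'pos
  have hvt := hY.comp_contDiffAt (T := (toFib e.k).symm) (toFib e.k).symm.contDiff.contDiffAt
  have hsymm : ∀ b' : conePart e W, (toFib e.k).symm (fibCoord τ b') =
    (τ.coord b'.1.2.1, b'.1.2.2) := fun b' => (toFib e.k).symm_apply_apply _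
  have hv : SmoothVia 𝓘(ℝ, Eu (n + 1) × (ℝ ∙ e₁)ᗮ) c 𝓘(ℝ, Eu e.k)
      (fun b' => τ.coord b'.1.2.1) b := by
    refine (hvt.comp_contDiffAt (T := Prod.fst) contDiffAt_fst).congr
      (Eventually.of_forall fun b' => congrArg Prod.fst (hsymm b'))
  have ht : SmoothVia 𝓘(ℝ, Eu (n + 1) × (ℝ ∙ e₁)ᗮ) c 𝓘(ℝ, ℝ) (fun b' => b'.1.2.2) b := by
    refine (hvt.comp_contDiffAt (T := Prod.snd) contDiffAt_snd).congr
      (Eventually.of_forall fun b' => congrArg Prod.snd (hsymm b'))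
  have hx : SmoothVia 𝓘(ℝ, Eu (n + 1) × (ℝ ∙ e₁)ᗮ) c (quadModel m) (fun b' => b'.1.2.1) b := by
    refine (τ.smoothVia_toFun hr hv hbase ?_).congr ?_
    · filter_upwards [hbase] with b' hb'
      exact τ.norm_coord_le (by rwa [← b'.2.2.1])
    · filter_upwards [hbase] with b' hb'
      have := b'.2.2.1
      rw [this]
      exact τ.toFun_coord _ (by rwa [← this])
  exact (isCoord_regular hψ hbψ).mono (hq.prodMk (hx.prodMk ht))

end Regular

/-! ### The atlas of the stabilization -/

theorem mem_contDiffGroupoid_of_contMDiffOn {d : ℕ} {T : OpenPartialHomeomorph (Quad d) (Quad d)}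
    (h : ContMDiffOn (quadModel d) (quadModel d) ∞ T T.source)
    (h' : ContMDiffOn (quadModel d) (quadModel d) ∞ T.symm T.target) :
    T ∈ contDiffGroupoid ∞ (quadModel d) := by
  simp only [contDiffGroupoid, mem_groupoid_of_pregroupoid, contDiffPregroupoid,
    ← contMDiffOn_iff_contDiffOn]
  constructor
  · exact (quadModel d).contMDiff.comp_contMDiffOn
      (h.comp ((quadModel d).contMDiffOn_symm.mono inter_subset_right) fun q hq => hq.1)
  · exact (quadModel d).contMDiff.comp_contMDiffOn
      (h'.comp ((quadModel d).contMDiffOn_symm.mono inter_subset_right) fun q hq => hq.1)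

/-! ### Splitting off the first coordinate of a quadrant -/

section Cons

/-- Prepending a coordinate. -/
def consEu {m : ℕ} (s : ℝ) (q : Eu m) : Eu (m + 1) := WithLp.toLp 2 (Fin.cons s q)

theorem contDiff_consEu {m : ℕ} : ContDiff ℝ ∞ fun p : ℝ × Eu m => consEu p.1 p.2 := by
  rw [contDiff_euclidean]
  intro i
  induction i using Fin.cases with
  | zero => exact contDiff_fst
  | succ i => exact contDiff_euclidean.1 contDiff_snd i

/-- Forgetting the first coordinate. -/
def tailQuad {m : ℕ} (q : Quad (m + 1)) : Quad m :=
  ⟨WithLp.toLp 2 fun i => q.1 i.succ, fun i => q.2 i.succ⟩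

theorem continuous_tailQuad {m : ℕ} : Continuous (tailQuad : Quad (m + 1) → Quad m) := by
  rw [continuous_induced_rng]
  exact (PiLp.continuous_toLp 2 _).comp (continuous_pi fun i => by
    have : Continuous fun q : Quad (m + 1) => q.1 := continuous_subtype_val
    fun_prop)

theorem smoothVia_tailQuad {m : ℕ} (q : Quad (m + 1)) :
    ContMDiffAt (quadModel (m + 1)) (quadModel m) ∞ tailQuad q := by
  have h1 : SmoothVia (quadModel (m + 1)) (fun q : Quad (m + 1) => q) (quadModel m) tailQuad q := by
    rw [smoothVia_quad_iff]
    refine SmoothVia.comp_contDiffAt (T := fun x : Eu (m + 1) =>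
      (WithLp.toLp 2 fun i : Fin m => x i.succ : Eu m))
      (smoothVia_quad_iff.1 (SmoothVia.refl (quadModel (m + 1)) (fun q : Quad (m + 1) => q) q)) ?_
    refine ContDiff.contDiffAt ?_
    rw [contDiff_euclidean]
    exact fun i => contDiff_euclidean.1 contDiff_id i.succ
  exact h1.contMDiffAt_comp (q := id) rfl continuousAt_id contMDiffAt_id

end Cons

section Atlas

variable {n m : ℕ} {M : GMfd.{u} G n} {M' : GMfd.{u} G m} {e : RoundTub M M'} {W : PreCob M}

/-- Either the height is negative and the fibre product is a graph, or it is zero and mirror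
coordinates exist. The exponential gives strictly positive chart values, as required at points off
the boundary. -/
theorem exists_inner_chart (hW : W.IsEncasedMirror) {b₀ : conePart e W} (hbd : b₀.1.1 ∉ W.bd) :
    ∃ φ ∈ stAtlas e W, ofCone b₀ ∈ φ.source ∧ ∀ z ∈ φ.source, ∀ i, 0 < (φ z).1 i := by
  have : Nonempty (conePart e W) := ⟨b₀⟩
  obtain ⟨τ, hτ⟩ := e.locally_trivial (W.r b₀.1.1)
  have hm := e.dim_eq b₀.1.2.1
  rcases b₀.2.1.lt_or_eq with hh | hh
  · obtain ⟨ψ, hψ, hbψ⟩ := hW.covers b₀.1.1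
    have hn : ‖fibCoord τ b₀‖ ≠ 0 := by
      have h1 := norm_sq_fibCoord (e := e) hτ
      intro h2
      rw [h2] at h1
      have : W.h b₀.1.1 = 0 := by
        rw [← sq_eq_zero_iff, ← h1]; ring
      exact hh.ne this
    -- The direction of the fibre coordinate itself is used; this coordinate is nonzero because its
    -- length is |h(w)|.
    set e₁ : Fib e.k := ‖fibCoord τ b₀‖⁻¹ • fibCoord τ b₀ with he₁
    have h1 : ‖e₁‖ = 1 := by
      rw [he₁, norm_smul, norm_inv, norm_norm, inv_mul_cancel₀ hn]
    have hpos : 0 < ⟪e₁, fibCoord τ b₀⟫_ℝ := by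
      rw [he₁, real_inner_smul_left, real_inner_self_eq_norm_sq]
      have := lt_of_le_of_ne (norm_nonneg _) hn.symm
      positivity
    obtain ⟨χ, hχs, hχ⟩ := exists_regular_homeo hW hψ τ h1 b₀
    have hχbd : ∀ b ∈ χ.source, b.1.1 ∉ W.bd := fun b hb => ((hχs b).1 hb).2.1
    have hχe : (χ : conePart e W → _) = fun b =>
      ((ψ b.1.1).1, perpProj e₁ (fibCoord τ b)) := funext hχ
    have hE := finrank_perp hm h1
    obtain ⟨c, hc, hsm⟩ := smoothCoord_coneChart hW hE χ hχbd
      (J := (quadModel (n + 1)).prod ((quadModel m).prod 𝓘(ℝ, ℝ)))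
      (c₀ := fun b : conePart e W => (ψ b.1.1, b.1.2))
      (F₀ := fun q : Quad (n + 1) × (e.D × ℝ) =>
        (q.1.1, perpProj e₁ (toFib e.k (τ.coord q.2.1, q.2.2))))
      (by
        intro b hb
        obtain ⟨g1, -, g3, g4, g5⟩ := (hχs b).1 hb
        have h2 := isCoord_regular_homeo hW hψ τ h1 g1 g4 g5
        rw [hχe]
        exact (h2.chart hW hψ g1 g3).prodMk (h2.x.prodMk h2.t))
      (by
        rintro _ ⟨b, hb, rfl⟩
        obtain ⟨g1, -, g3, g4, g5⟩ := (hχs b).1 hb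
        have hpb : e.p b.1.2.1 ∈ τ.base := by rwa [← b.2.2.1]
        refine ContMDiffAt.contMDiffWithinAt ?_
        have g6 := SmoothVia.refl ((quadModel (n + 1)).prod ((quadModel m).prod 𝓘(ℝ, ℝ)))
          (fun q : Quad (n + 1) × (e.D × ℝ) => q) (ψ b.1.1, b.1.2)
        have g7 := (smoothVia_quad_iff.1 g6.fst).prodMk_space
          (((g6.snd.fst.comp (T := τ.coord) (τ.contMDiffAt_coord e.continuous_p hpb)).prodMk_space
            g6.snd.snd).comp_contDiffAt (T := fun q => perpProj e₁ (toFib e.k q))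
            ((perpProj e₁).contDiff.comp (toFib e.k).contDiff).contDiffAt)
        exact g7.contMDiffAt_comp (q := id) rfl continuousAt_id contMDiffAt_id)
      (by
        intro b hb
        rw [hχ]; rfl)
    have hsrc := coneChart_source hW hE χ hχbd
    have hb₀ : ofCone b₀ ∈ (coneChart hW hE χ).source := by
      rw [hsrc]
      exact ⟨b₀, (hχs b₀).2 ⟨hbψ, hbd, hh, hτ, hpos⟩, rfl⟩
    refine ⟨coneChart hW hE χ, fun z hz => Or.inr (Or.inl ?_), hb₀,
      fun z hz i => coneChart_pos hW hE χ hχbd hz i⟩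
    refine ⟨ψ, hψ, _, (coneChart hW hE χ).open_source, hz, ?_, c, fun b _ => hc b, hsm⟩
    intro y hy
    rw [hsrc] at hy
    obtain ⟨b, hb, rfl⟩ := hy
    obtain ⟨g1, g2, g3, -⟩ := (hχs b).1 hb
    exact ⟨b.1.1, ⟨b, rfl, rfl⟩, g1, g2, g3⟩
  · obtain ⟨β, hβ, hbβ⟩ := exists_mirrorCoord hW hh hbd
    obtain ⟨χ, hχs, hχ⟩ := exists_coneLocus_homeo hW hβ τ b₀
    have hχbd : ∀ b ∈ χ.source, b.1.1 ∉ W.bd := fun b hb => ((hχs b).1 hb).2.1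
    have hχe : (χ : conePart e W → _) = fun b =>
      ((β b.1.1).1, (τ.coord b.1.2.1, b.1.2.2)) := funext hχ
    have hE : Module.finrank ℝ (Eu n × (Eu e.k × ℝ)) = m + 1 := by
      rw [Module.finrank_prod, Module.finrank_prod, Module.finrank_self,
        finrank_euclideanSpace_fin, finrank_euclideanSpace_fin]
      omega
    obtain ⟨c, hc, hsm⟩ := smoothCoord_coneChart hW hE χ hχbd
      (J := 𝓘(ℝ, Eu n × (Eu e.k × ℝ)))
      (c₀ := fun b : conePart e W => ((β b.1.1).1, (τ.coord b.1.2.1, b.1.2.2)))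
      (F₀ := id) (by
        intro b hb
        rw [hχe]
        exact SmoothVia.refl _ _ _) contMDiffOn_id (fun b hb => (hχ b).symm)
    have hsrc := coneChart_source hW hE χ hχbd
    have hb₀ : ofCone b₀ ∈ (coneChart hW hE χ).source := by
      rw [hsrc]
      exact ⟨b₀, (hχs b₀).2 ⟨hbβ, hbd, hτ⟩, rfl⟩
    refine ⟨coneChart hW hE χ, fun z hz => Or.inr (Or.inr ?_), hb₀,
      fun z hz i => coneChart_pos hW hE χ hχbd hz i⟩
    refine ⟨β, hβ, τ, _, (coneChart hW hE χ).open_source, hz, ?_, c, fun b _ => hc b, hsm⟩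
    intro y hy
    rw [hsrc] at hy
    obtain ⟨b, hb, rfl⟩ := hy
    obtain ⟨g1, g2, g3⟩ := (hχs b).1 hb
    exact ⟨b.1.1, ⟨b, rfl, rfl⟩, g1, g2, g3⟩

theorem stH_mem (hW : W.IsEncasedMirror) (z : StSpace e W) : stH e W z ∈ Icc (-1 : ℝ) 1 := by
  induction z using StSpace.ind with
  | ht a => exact a.2.1
  | hc b => exact conePart_t_mem hW b

/-- In the collar region, the boundary is seen by the encasing function. -/
theorem mem_stBd_iff (hW : W.IsEncasedMirror) {O : Set W.X} (hO : W.IsCollarNhd O)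
    {z : StSpace e W} (hz : z ∈ collarRegion e W O) :
    z ∈ stBd e W ↔ stR e W z ∈ M'.bdry ∨ stH e W z = -1 ∨ stH e W z = 1 := by
  rcases collarRegion_cases hW hO.bd_subset hz with ⟨a, rfl⟩ | ⟨b, hb, hbO, rfl⟩
  · constructor
    · rintro ⟨a', ha', h⟩
      rw [ofTrivial_injective ha'] at h
      exact h
    · exact fun h => ⟨a, rfl, h⟩
  · constructor
    · rintro ⟨a', ha', -⟩
      exact absurd (mem_bd_of_ofTrivial_eq ha') hb
    · intro h
      exfalso
      obtain ⟨h1, h2⟩ := hO.interior_of_notMem hW hbO hb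
      have h3 := b.2.2.2
      have h4 : W.h b.1.1 ^ 2 < 1 := by nlinarith [h2.1, h2.2]
      have h5 : e.nrm b.1.2.1 ^ 2 + b.1.2.2 ^ 2 < 1 := by linarith
      have h6 : b.1.2.1 ∉ e.D.bdry := by
        rw [e.mem_bdry_iff, ← b.2.2.1]
        rintro (h7 | h7)
        · exact h1 h7
        · rw [h7] at h5
          nlinarith [sq_nonneg b.1.2.2]
      rcases h with h | h | h
      · exact e.notMem_bdry_e h6 h
      · have h7 : b.1.2.2 = -1 := h
        rw [h7] at h5
        nlinarith [sq_nonneg (e.nrm b.1.2.1)]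
      · have h7 : b.1.2.2 = 1 := h
        rw [h7] at h5
        nlinarith [sq_nonneg (e.nrm b.1.2.1)]

theorem isOpen_collarRegion (hW : W.IsEncasedMirror) {O : Set W.X} (hO : W.IsCollarNhd O) :
    IsOpen (collarRegion e W O) := isOpen_trivial_union hW hO.isOpen hO.bd_subset

/-- In the collar region the encasing function is a homeomorphism onto a relatively open set, so a
chart of M' and the distance of the height from one end of [-1, 1] form a chart. -/
theorem exists_collar_chart (hW : W.IsEncasedMirror) (a : trivialPart e) :
    ∃ φ ∈ stAtlas e W, ofTrivial a ∈ φ.source ∧ ∀ z ∈ φ.source,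
      ((∃ i, (φ z).1 i = 0) ↔ z ∈ stBd e W) := by
  obtain ⟨O, hO⟩ := hW.collar
  obtain ⟨V', hV', hVO⟩ := exists_isOpen_stRho_image (e := e) hW hO
  obtain ⟨k, hk, hkc⟩ := exists_collar_inverse (e := e) hW hO
  set κ := chartAt (Quad m) a.1.1 with hκ
  -- The sign chooses the end of the interval: the first coordinate 1 + σh vanishes at height -σ,
  -- and the condition σh < 1 keeps the chart away from the other end.
  obtain ⟨σ, hσ, hσa⟩ : ∃ σ : ℝ, (σ = 1 ∨ σ = -1) ∧ σ * a.1.2 < 1 := by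
    by_cases h : a.1.2 < 1
    · exact ⟨1, Or.inl rfl, by linarith⟩
    · exact ⟨-1, Or.inr rfl, by linarith⟩
  have hσσ : ∀ x, σ * (σ * x) = x := by
    intro x
    rcases hσ with h | h <;> rw [h] <;> ring
  have hσle : ∀ z : StSpace e W, 0 ≤ 1 + σ * stH e W z := by
    intro z
    have := stH_mem hW z
    rcases hσ with h | h <;> rw [h] <;> linarith [this.1, this.2]
  let f : StSpace e W → Quad (m + 1) := fun z =>
    ⟨consEu (1 + σ * stH e W z) (κ (stR e W z)).1, fun i => by
      induction i using Fin.cases with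
      | zero => exact hσle z
      | succ i => exact (κ (stR e W z)).2 i⟩
  let j : Quad (m + 1) → M' × ℝ := fun q => (κ.symm (tailQuad q), σ * (q.1 0 - 1))
  let g : Quad (m + 1) → StSpace e W := fun q => k (j q)
  let U : Set (StSpace e W) :=
    collarRegion e W O ∩ {z | stR e W z ∈ κ.source ∧ σ * stH e W z < 1}
  have hU : IsOpen U := by
    refine (isOpen_collarRegion hW hO).inter ?_
    have h1 : IsOpen {z : StSpace e W | stR e W z ∈ κ.source} :=
      κ.open_source.preimage continuous_stR
    have h2 : IsOpen {z : StSpace e W | σ * stH e W z < 1} :=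
      isOpen_lt (continuous_const.mul continuous_stH) continuous_const
    exact h1.inter h2
  have hq0 : Continuous fun q : Quad (m + 1) => q.1 0 := by
    have : Continuous fun q : Quad (m + 1) => q.1 := continuous_subtype_val
    fun_prop
  let V₁ : Set (Quad (m + 1)) := {q | tailQuad q ∈ κ.target ∧ q.1 0 < 2}
  have hV₁ : IsOpen V₁ := by
    have h1 : IsOpen {q : Quad (m + 1) | tailQuad q ∈ κ.target} :=
      κ.open_target.preimage continuous_tailQuad
    have h2 : IsOpen {q : Quad (m + 1) | q.1 0 < 2} := isOpen_lt hq0 continuous_const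
    exact h1.inter h2
  have hj : ContinuousOn j V₁ :=
    (κ.continuousOn_symm.comp continuous_tailQuad.continuousOn fun q hq => hq.1).prodMk
      (continuous_const.mul (hq0.sub continuous_const)).continuousOn
  let V : Set (Quad (m + 1)) := V₁ ∩ j ⁻¹' V'
  have hV : IsOpen V := hj.isOpen_inter_preimage hV₁ hV'
  have hjV : ∀ q ∈ V, j q ∈ stRho e W '' collarRegion e W O := by
    intro q hq
    rw [hVO]
    refine ⟨hq.2, mem_univ _, ?_⟩
    have h1 := q.2 0
    have h2 : q.1 0 < 2 := hq.1.2
    change σ * (q.1 0 - 1) ∈ Icc (-1 : ℝ) 1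
    rcases hσ with h | h <;> rw [h] <;> constructor <;> linarith
  have hf : ContinuousOn f U := by
    have h1 : ContinuousOn (fun z => (f z).1) U := by
      refine contDiff_consEu.continuous.comp_continuousOn (ContinuousOn.prodMk
        (continuous_const.add (continuous_const.mul continuous_stH)).continuousOn ?_)
      exact continuous_subtype_val.comp_continuousOn
        (κ.continuousOn.comp continuous_stR.continuousOn fun z hz => hz.2.1)
    rw [continuousOn_iff_continuous_domRestrict, continuous_induced_rng]
    exact continuousOn_iff_continuous_domRestrict.1 h1
  have hgc : ContinuousOn g V := hkc.comp (hj.mono inter_subset_left) hjV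
  have hjf : ∀ z ∈ U, j (f z) = stRho e W z := by
    intro z hz
    refine Prod.ext ?_ ?_
    · exact κ.left_inv hz.2.1
    · change σ * ((1 + σ * stH e W z) - 1) = stH e W z
      rw [add_sub_cancel_left, hσσ]
  have hgf : ∀ z ∈ U, f z ∈ V → g (f z) = z := by
    intro z hz _
    change k (j (f z)) = z
    rw [hjf z hz, hk z hz.1]
  have hρg : ∀ q ∈ V, stRho e W (g q) = j q := by
    intro q hq
    obtain ⟨z, hz, hzq⟩ := hjV q hq
    change stRho e W (k (j q)) = j q
    rw [← hzq, hk z hz]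
  have hfg : ∀ q ∈ V, g q ∈ U → f (g q) = q := by
    intro q hq _
    have h1 : stR e W (g q) = κ.symm (tailQuad q) := congrArg Prod.fst (hρg q hq)
    have h2 : stH e W (g q) = σ * (q.1 0 - 1) := congrArg Prod.snd (hρg q hq)
    refine Subtype.ext ?_
    change consEu (1 + σ * stH e W (g q)) (κ (stR e W (g q))).1 = q.1
    rw [h1, h2, hσσ, κ.right_inv hq.1.1]
    ext i
    induction i using Fin.cases with
    | zero => change 1 + (q.1 0 - 1) = q.1 0; ring
    | succ i => rfl
  have hfV : ∀ z ∈ U, f z ∈ V := by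
    intro z hz
    refine ⟨⟨κ.map_source hz.2.1, ?_⟩, ?_⟩
    · change 1 + σ * stH e W z < 2
      linarith [hz.2.2]
    · rw [mem_preimage, hjf z hz]
      have : stRho e W z ∈ stRho e W '' collarRegion e W O := mem_image_of_mem _ hz.1
      rw [hVO] at this
      exact this.1
  let φ := partialHomeoOfInverse f g U V hU hV hf hgc hgf hfg
  have hφs : φ.source ⊆ U := inter_subset_left
  refine ⟨φ, ?_, ?_, ?_⟩
  · intro z hz
    refine Or.inl ⟨O, hO, φ.source, φ.open_source, hz, fun y hy => (hφs hy).1, ?_, ?_⟩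
    · rintro q ⟨hq, -⟩
      have hqV : q ∈ V := hq.1
      have h1 : ContMDiffAt (quadModel (m + 1)) ((quadModel m).prod 𝓘(ℝ, ℝ)) ∞ j q := by
        refine ContMDiffAt.prodMk ?_ ?_
        · have h2 : ContMDiffAt (quadModel m) (quadModel m) ∞ κ.symm (tailQuad q) :=
            (contMDiffOn_chart_symm (I := quadModel m) (x := a.1.1)).contMDiffAt
              (κ.open_target.mem_nhds hqV.1.1)
          exact h2.comp q (smoothVia_tailQuad q)
        · have h2 : ContDiff ℝ ∞ fun x : Eu (m + 1) => σ * (x 0 - 1) :=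
            contDiff_const.mul ((contDiff_euclidean.1 contDiff_id 0).sub contDiff_const)
          exact h2.contMDiff.contMDiffAt.comp q (quadModel (m + 1)).contMDiff.contMDiffAt
      refine (h1.congr_of_eventuallyEq ?_).contMDiffWithinAt
      filter_upwards [hV.mem_nhds hqV] with q' hq' using hρg q' hq'
    · refine ⟨fun p => (quadModel (m + 1)).symm (consEu (1 + σ * p.2) (κ p.1).1), ?_, ?_⟩
      · rintro _ ⟨y, hy, rfl⟩
        have hyU := hφs hy.1
        have hl : ∀ y' : StSpace e W, consEu (1 + σ * (stRho e W y').2) (κ (stRho e W y').1).1 ∈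
            range (quadModel (m + 1)) := fun y' => ⟨f y', rfl⟩
        refine ContMDiffWithinAt.comp (t := range (quadModel (m + 1))) _
          ((quadModel (m + 1)).contMDiffOn_symm _ (hl y)) ?_ ?_
        · have h2 := SmoothVia.refl ((quadModel m).prod 𝓘(ℝ, ℝ)) (fun p : M' × ℝ => p)
            (stRho e W y)
          have h3 : ContMDiffAt (quadModel m) (quadModel m) ∞ κ (stR e W y) :=
            (contMDiffOn_chart (I := quadModel m) (x := a.1.1)).contMDiffAt
              (κ.open_source.mem_nhds hyU.2.1)
          have h4 := ((h2.snd.comp_contDiffAt (T := fun s => 1 + σ * s)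
            (contDiff_const.add (contDiff_const.mul contDiff_id)).contDiffAt).prodMk_space
              (smoothVia_quad_iff.1 (h2.fst.comp (T := κ) h3))).comp_contDiffAt
                (T := fun p : ℝ × Eu m => consEu p.1 p.2) contDiff_consEu.contDiffAt
          exact (h4.contMDiffAt_comp (q := id) rfl continuousAt_id
            contMDiffAt_id).contMDiffWithinAt
        · rintro _ ⟨y', -, rfl⟩
          exact hl y'
      · rintro y hy
        exact (quadModel (m + 1)).left_inv (f y)
  · have haU : ofTrivial a ∈ U :=
      ⟨ofTrivial_mem_collarRegion O a, mem_chart_source (Quad m) a.1.1, hσa⟩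
    exact ⟨haU, hfV _ haU⟩
  · intro z hz
    have hzU := hφs hz
    rw [mem_stBd_iff hW hO hzU.1, mem_bdry_iff_chart M' (chart_mem_atlas (Quad m) a.1.1) hzU.2.1]
    have h1 : (∃ i, (φ z).1 i = 0) ↔ 1 + σ * stH e W z = 0 ∨ ∃ i, (κ (stR e W z)).1 i = 0 := by
      constructor
      · rintro ⟨i, hi⟩
        induction i using Fin.cases with
        | zero => exact Or.inl hi
        | succ i => exact Or.inr ⟨i, hi⟩
      · rintro (h | ⟨i, hi⟩)
        · exact ⟨0, h⟩
        · exact ⟨i.succ, hi⟩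
    rw [h1, or_comm]
    refine or_congr_right ?_
    have h2 := hzU.2.2
    rcases hσ with h | h <;> rw [h] at h2 ⊢ <;> constructor <;> intro h3
    · exact Or.inl (by linarith)
    · rcases h3 with h3 | h3 <;> linarith
    · exact Or.inr (by linarith)
    · rcases h3 with h3 | h3 <;> linarith

theorem stAtlas_covers (hW : W.IsEncasedMirror) (z : StSpace e W) :
    ∃ φ ∈ stAtlas e W, z ∈ φ.source := by
  rcases trivial_or_inner hW z with ⟨a, rfl⟩ | ⟨b, hb, rfl⟩
  · obtain ⟨φ, hφ, h, -⟩ := exists_collar_chart (e := e) hW a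
    exact ⟨φ, hφ, h⟩
  · obtain ⟨φ, hφ, h, -⟩ := exists_inner_chart hW hb
    exact ⟨φ, hφ, h⟩

/-- Transition maps are locally inverse to each other, so they preserve interior points of the
quadrant. -/
theorem pos_of_stAtlas (hW : W.IsEncasedMirror)
    {φ φ' : OpenPartialHomeomorph (StSpace e W) (Quad (m + 1))} (hφ : φ ∈ stAtlas e W)
    (hφ' : φ' ∈ stAtlas e W) {z : StSpace e W} (hz : z ∈ φ.source) (hz' : z ∈ φ'.source)
    (hpos : ∀ i, 0 < (φ z).1 i) : ∀ i, 0 < (φ' z).1 i := by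
  rw [← isInteriorPoint_quad_iff] at hpos ⊢
  have h1 := (smoothVia_chart_iff hz).1 (smoothVia_stAtlas hW hφ hφ' hz hz')
  have h2 := (smoothVia_chart_iff hz').1 (smoothVia_stAtlas hW hφ' hφ hz' hz)
  refine isInteriorPoint_of_section (f := φ' ∘ φ.symm) (g := φ ∘ φ'.symm) (a := φ z) ?_
    (h1.mdifferentiableAt (by simp)) (h2.mdifferentiableAt (by simp)) ?_ hpos
  · simp [φ'.left_inv hz']
  · have h3 : ∀ᶠ y in 𝓝 (φ' z), φ'.symm y ∈ φ.source := by
      refine (φ'.continuousAt_symm (φ'.map_source hz')).eventually ?_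
      rw [φ'.left_inv hz']
      exact φ.open_source.mem_nhds hz
    filter_upwards [h3, φ'.open_target.mem_nhds (φ'.map_source hz')] with y hy hy'
    simp [φ.left_inv hy, φ'.right_inv hy']

/-- By invariance of positivity under change of charts, it suffices to know the vanishing
coordinates in the constructed charts. -/
theorem stBd_eq (hW : W.IsEncasedMirror) :
    stBd e W = {z | ∃ φ ∈ stAtlas e W, z ∈ φ.source ∧ ∃ i, (φ z).1 i = 0} := by
  ext z
  constructor
  · intro hz
    obtain ⟨a, rfl, -⟩ := id hz
    obtain ⟨φ, hφ, h, h'⟩ := exists_collar_chart (e := e) hW a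
    exact ⟨φ, hφ, h, (h' _ h).2 hz⟩
  · rintro ⟨φ, hφ, hz, i, hi⟩
    rcases trivial_or_inner hW z with ⟨a, rfl⟩ | ⟨b, hb, rfl⟩
    · obtain ⟨φ', hφ', h, h'⟩ := exists_collar_chart (e := e) hW a
      rw [← h' _ h]
      by_contra hcon
      push Not at hcon
      exact (pos_of_stAtlas hW hφ' hφ h hz
        (fun i => lt_of_le_of_ne ((φ' _).2 i) (hcon i).symm) i).ne' hi
    · obtain ⟨φ', hφ', h, h'⟩ := exists_inner_chart hW hb
      exact absurd hi (pos_of_stAtlas hW hφ' hφ h hz (h' _ h) i).ne'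

theorem stAtlas_compatible (hW : W.IsEncasedMirror)
    {φ φ' : OpenPartialHomeomorph (StSpace e W) (Quad (m + 1))} (hφ : φ ∈ stAtlas e W)
    (hφ' : φ' ∈ stAtlas e W) : φ.symm ≫ₕ φ' ∈ contDiffGroupoid ∞ (quadModel (m + 1)) := by
  have key : ∀ {φ φ' : OpenPartialHomeomorph (StSpace e W) (Quad (m + 1))}, φ ∈ stAtlas e W →
      φ' ∈ stAtlas e W → ContMDiffOn (quadModel (m + 1)) (quadModel (m + 1)) ∞ (φ.symm ≫ₕ φ')
        (φ.symm ≫ₕ φ').source := by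
    intro φ φ' hφ hφ' q hq
    have hq' : q ∈ φ.target ∧ φ.symm q ∈ φ'.source := hq
    have h1 := (smoothVia_chart_iff (φ.map_target hq'.1)).1
      (smoothVia_stAtlas hW hφ hφ' (φ.map_target hq'.1) hq'.2)
    rw [φ.right_inv hq'.1] at h1
    exact h1.contMDiffWithinAt
  refine mem_contDiffGroupoid_of_contMDiffOn (key hφ hφ') ?_
  have h2 : (φ.symm ≫ₕ φ').symm = φ'.symm ≫ₕ φ := by
    rw [OpenPartialHomeomorph.trans_symm_eq_symm_trans_symm, OpenPartialHomeomorph.symm_symm]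
  have h3 : (φ.symm ≫ₕ φ').target = (φ'.symm ≫ₕ φ).source := by rw [← h2]; rfl
  rw [h2, h3]
  exact key hφ' hφ

end Atlas

/-! ### Coordinates near the top of the stabilization -/

section FlipRetraction

variable {n m : ℕ} {M : GMfd.{u} G n} {M' : GMfd.{u} G m} {e : RoundTub M M'} {W : PreCob M}

/-- Near a point of the top of the stabilization, with fibre coordinates `v` and coordinates `g` on
the cobordism: a retraction `R` from the space of values of `(g, v, t)`, that commutes with the
reflection. -/
structure FlipRetraction {a : ℕ} (b : conePart e W) (τ : RoundTriv M e.D e.p e.nrm e.k)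
    (g : W.X → Eu a) (R : (Eu a × Eu e.k) × ℝ → conePart e W) : Prop where
  base : W.r b.1.1 ∈ τ.base
  smoothAt : W.SmoothAt 𝓘(ℝ, Eu a) g b.1.1
  flip : W.h b.1.1 = 0 → ∀ᶠ w in 𝓝 b.1.1, g (W.flip w) = g w
  continuousAt : ContinuousAt R ((g b.1.1, τ.coord b.1.2.1), 0)
  retract : ∀ᶠ b' in 𝓝 b, R ((g b'.1.1, τ.coord b'.1.2.1), b'.1.2.2) = b'
  height : ∀ᶠ p in 𝓝 (((g b.1.1, τ.coord b.1.2.1), 0) : (Eu a × Eu e.k) × ℝ), (R p).1.2.2 = p.2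
  equivariant : ∀ᶠ p in 𝓝 (((g b.1.1, τ.coord b.1.2.1), 0) : (Eu a × Eu e.k) × ℝ),
    R (p.1, -p.2) = flipCone e W (R p)
  smooth : ∀ φ ∈ stAtlas e W, ofCone b ∈ φ.source →
    ContMDiffAt 𝓘(ℝ, (Eu a × Eu e.k) × ℝ) (quadModel (m + 1)) ∞ (fun p => φ (ofCone (R p)))
      ((g b.1.1, τ.coord b.1.2.1), 0)

theorem FlipRetraction.apply {a : ℕ} {b : conePart e W} {τ : RoundTriv M e.D e.p e.nrm e.k}
    {g : W.X → Eu a} {R : (Eu a × Eu e.k) × ℝ → conePart e W} (h : FlipRetraction b τ g R)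
    (ht : b.1.2.2 = 0) : R ((g b.1.1, τ.coord b.1.2.1), 0) = b := by
  have := h.retract.self_of_nhds
  rwa [ht] at this

/-- A chart χ that depends on (g, v, t) through a smooth map Λ gives the retraction χ⁻¹ ∘ Λ. The
last hypothesis says that Λ retains the height and is compatible with the reflection. -/
theorem flipRetraction_of_homeo (hW : W.IsEncasedMirror) {a : ℕ} {b : conePart e W}
    {τ : RoundTriv M e.D e.p e.nrm e.k} {g : W.X → Eu a} {E₀ : Type*} [NormedAddCommGroup E₀]
    [NormedSpace ℝ E₀] (χ : OpenPartialHomeomorph (conePart e W) E₀)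
    (Λ : (Eu a × Eu e.k) × ℝ → E₀) (hΛ : ContDiff ℝ ∞ Λ) (base : W.r b.1.1 ∈ τ.base)
    (smoothAt : W.SmoothAt 𝓘(ℝ, Eu a) g b.1.1)
    (flip : W.h b.1.1 = 0 → ∀ᶠ w in 𝓝 b.1.1, g (W.flip w) = g w)
    (ht : b.1.2.2 = 0) (hb : b ∈ χ.source) (hχ : IsCoord 𝓘(ℝ, E₀) χ b)
    (hχΛ : ∀ b', χ b' = Λ ((g b'.1.1, τ.coord b'.1.2.1), b'.1.2.2))
    (hflip : ∀ b' ∈ χ.source, flipCone e W b' ∈ χ.source)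
    (heq : ∀ b' p, χ b' = Λ p → b'.1.2.2 = p.2 ∧ χ (flipCone e W b') = Λ (p.1, -p.2)) :
    FlipRetraction b τ g (χ.symm ∘ Λ) := by
  have h0 : Λ ((g b.1.1, τ.coord b.1.2.1), 0) = χ b := by rw [hχΛ, ht]
  have hcont : ContinuousAt (χ.symm ∘ Λ) ((g b.1.1, τ.coord b.1.2.1), 0) := by
    refine ContinuousAt.comp ?_ hΛ.continuous.continuousAt
    rw [h0]
    exact χ.continuousAt_symm (χ.map_source hb)
  have htar : ∀ᶠ p in 𝓝 (((g b.1.1, τ.coord b.1.2.1), 0) : (Eu a × Eu e.k) × ℝ),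
      Λ p ∈ χ.target := by
    refine hΛ.continuous.continuousAt.eventually ?_
    rw [h0]
    exact χ.open_target.mem_nhds (χ.map_source hb)
  have hΛ' : ∀ p, Λ p ∈ χ.target → χ (χ.symm (Λ p)) = Λ p := fun p hp => χ.right_inv hp
  refine ⟨base, smoothAt, flip, hcont, ?_, ?_, ?_, fun φ hφ hbφ => ?_⟩
  · filter_upwards [χ.open_source.mem_nhds hb] with b' hb'
    rw [Function.comp_apply, ← hχΛ, χ.left_inv hb']
  · filter_upwards [htar] with p hp
    exact (heq _ p (hΛ' p hp)).1
  · filter_upwards [htar] with p hp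
    rw [Function.comp_apply, Function.comp_apply, ← (heq _ p (hΛ' p hp)).2,
      χ.left_inv (hflip _ (χ.map_target hp))]
  · refine (hχ.smoothVia_chart hW continuousAt_id hφ hbφ).contMDiffAt_comp
      (q := χ.symm ∘ Λ) ?_ hcont ?_
    · rw [Function.comp_apply, h0, χ.left_inv hb]
    · refine hΛ.contMDiff.contMDiffAt.congr_of_eventuallyEq ?_
      filter_upwards [htar] with p hp using hΛ' p hp

/-- The charts constructed before are reused; only their behaviour under the reflection has to be
checked. In the regular case Λ forgets one fibre direction, hence a retraction rather than an
inverse. -/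
theorem exists_flipRetraction (hW : W.IsEncasedMirror) {b : conePart e W} (hbd : b.1.1 ∉ W.bd)
    (ht : b.1.2.2 = 0) : ∃ (a : ℕ) (τ : RoundTriv M e.D e.p e.nrm e.k) (g : W.X → Eu a)
      (R : (Eu a × Eu e.k) × ℝ → conePart e W), FlipRetraction b τ g R := by
  obtain ⟨τ, hτ⟩ := e.locally_trivial (W.r b.1.1)
  rcases b.2.1.lt_or_eq with hh | hh
  · obtain ⟨ψ, hψ, hbψ⟩ := hW.covers b.1.1
    have hn : ‖fibCoord τ b‖ ≠ 0 := by
      have h1 := norm_sq_fibCoord (e := e) hτ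
      intro h2
      rw [h2] at h1
      have : W.h b.1.1 = 0 := by
        rw [← sq_eq_zero_iff, ← h1]; ring
      exact hh.ne this
    set e₁ : Fib e.k := ‖fibCoord τ b‖⁻¹ • fibCoord τ b with he₁
    have h1 : ‖e₁‖ = 1 := by
      rw [he₁, norm_smul, norm_inv, norm_norm, inv_mul_cancel₀ hn]
    -- On the top t = 0, so `e₁` has no component in the ℝ-direction. Projection along `e₁`
    -- therefore preserves t and commutes with the change of its sign.
    have he0 : ((toFib e.k).symm e₁).2 = 0 := by
      rw [he₁, map_smul, fibCoord, ContinuousLinearEquiv.symm_apply_apply]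
      change _ * b.1.2.2 = 0
      rw [ht, mul_zero]
    have hpos : 0 < ⟪e₁, fibCoord τ b⟫_ℝ := by
      rw [he₁, real_inner_smul_left, real_inner_self_eq_norm_sq]
      have := lt_of_le_of_ne (norm_nonneg _) hn.symm
      positivity
    obtain ⟨χ, hχs, hχ⟩ := exists_regular_homeo hW hψ τ h1 b
    have hχe : (χ : conePart e W → _) = fun b =>
      ((ψ b.1.1).1, perpProj e₁ (fibCoord τ b)) := funext hχ
    refine ⟨n + 1, τ, fun w => (ψ w).1, _, flipRetraction_of_homeo hW χ
      (fun p => (p.1.1, perpProj e₁ (toFib e.k (p.1.2, p.2)))) ?_ hτ ?_ ?_ ht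
      ((hχs b).2 ⟨hbψ, hbd, hh, hτ, hpos⟩) ?_ ?_ ?_ ?_⟩
    · exact contDiff_fst.fst.prodMk ((perpProj e₁).contDiff.comp
        ((toFib e.k).contDiff.comp (contDiff_fst.snd.prodMk contDiff_snd)))
    · exact fun φ hφ hbφ => smoothVia_quad_iff.1 (hW.smoothAt_chart hψ hbψ φ hφ hbφ)
    · exact fun h0 => absurd h0 hh.ne
    · rw [hχe]
      exact isCoord_regular_homeo hW hψ τ h1 hbψ hτ hpos
    · exact fun b' => hχ b'
    · intro b' hb'
      obtain ⟨g1, g2, g3, g4, g5⟩ := (hχs b').1 hb'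
      refine (hχs _).2 ⟨g1, g2, g3, g4, ?_⟩
      rw [fibCoord, inner_toFib, he0, zero_mul, add_zero] at g5 ⊢
      exact g5
    · intro b' p hp
      rw [hχ] at hp
      have h2 : perpProj e₁ (fibCoord τ b') = perpProj e₁ (toFib e.k (p.1.2, p.2)) :=
        congrArg Prod.snd hp
      have h3 := congrArg Subtype.val h2
      rw [perpProj_coe h1, perpProj_coe h1, inner_toFib, fibCoord, inner_toFib, he0, zero_mul,
        zero_mul, add_zero, add_zero] at h3
      have h4 := congrArg (fun Y => (toFib e.k).symm Y) h3
      simp only [map_sub, map_smul, ContinuousLinearEquiv.symm_apply_apply] at h4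
      have h5 : b'.1.2.2 = p.2 := by
        have := congrArg Prod.snd h4
        simpa [he0] using this
      refine ⟨h5, ?_⟩
      rw [hχ]
      have h6 := congrArg Prod.fst hp
      refine Prod.ext h6 (Subtype.ext ?_)
      change (perpProj e₁ (toFib e.k (τ.coord b'.1.2.1, -b'.1.2.2)) : Fib e.k) =
        perpProj e₁ (toFib e.k (p.1.2, -p.2))
      rw [perpProj_coe h1, perpProj_coe h1, inner_toFib, inner_toFib, he0, zero_mul,
        zero_mul, add_zero, add_zero]
      apply (toFib e.k).symm.injective
      simp only [map_sub, map_smul, ContinuousLinearEquiv.symm_apply_apply]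
      have h7 := congrArg Prod.fst h4
      refine Prod.ext h7 ?_
      simp [he0, h5]
  · obtain ⟨β, hβ, hbβ⟩ := exists_mirrorCoord hW hh hbd
    obtain ⟨χ, hχs, hχ⟩ := exists_coneLocus_homeo hW hβ τ b
    have hχe : (χ : conePart e W → _) = fun b =>
      ((β b.1.1).1, (τ.coord b.1.2.1, b.1.2.2)) := funext hχ
    have hu := hβ.isPolarCoord hW hbβ
    refine ⟨n, τ, fun w => (β w).1, _, flipRetraction_of_homeo hW χ
      (fun p => (p.1.1, (p.1.2, p.2))) ?_ hτ hu.smoothAt (fun _ => hu.flip) ht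
      ((hχs b).2 ⟨hbβ, hbd, hτ⟩) ?_ ?_ ?_ ?_⟩
    · exact contDiff_fst.fst.prodMk (contDiff_fst.snd.prodMk contDiff_snd)
    · rw [hχe]
      exact isCoord_cone hW hβ τ hbβ hτ
    · exact fun b' => hχ b'
    · exact fun b' hb' => (hχs _).2 ((hχs b').1 hb')
    · intro b' p hp
      rw [hχ] at hp ⊢
      have h2 : b'.1.2.2 = p.2 := congrArg (fun q => q.2.2) hp
      have h3 := congrArg Prod.fst hp
      refine ⟨h2, Prod.ext h3 (Prod.ext ?_ (congrArg Neg.neg h2))⟩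
      exact congrArg (fun q => q.2.1) hp

end FlipRetraction

/-! ### Smooth maps between stabilizations -/

section Maps

variable {n m : ℕ} {M : GMfd.{u} G n} {M' : GMfd.{u} G m} {e : RoundTub M M'} {W W' : PreCob M}

/-- One statement covers the group action, the reflection and induced maps. At trivial points the
map is read through the encasing function. At the others the coordinate condition is pulled back;
commutation with the reflections keeps invariant functions invariant at the cone locus. -/
theorem isSmooth_st (hW : W.IsEncasedMirror) (hW' : W'.IsEncasedMirror)
    {F : StSpace e W → StSpace e W'} {f : W.X → W'.X} {δ : e.D → e.D} {γ : M' → M'} {ε : ℝ}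
    (hFt : ∀ a : trivialPart e, ∃ a' : trivialPart e, F (ofTrivial a) = ofTrivial a')
    (hFr : ∀ z, stR e W' (F z) = γ (stR e W z)) (hFh : ∀ z, stH e W' (F z) = ε * stH e W z)
    (hFc : ∀ b : conePart e W, ∃ b' : conePart e W', F (ofCone b) = ofCone b' ∧
      b'.1 = (f b.1.1, δ b.1.2.1, ε * b.1.2.2))
    (hf : W.IsSmooth W' f) (hδ : ContMDiff (quadModel m) (quadModel m) ∞ δ)
    (hγ : ContMDiff (quadModel m) (quadModel m) ∞ γ) (hfh : ∀ w, W'.h (f w) = W.h w)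
    (hff : ∀ w, f (W.flip w) = W'.flip (f w)) :
    (St e W).IsSmooth (St e W') F := by
  choose A hA using hFt
  choose B hB hB' using hFc
  have hBc : Continuous B := by
    rw [continuous_induced_rng]
    have : Continuous fun b : conePart e W => (f b.1.1, δ b.1.2.1, ε * b.1.2.2) :=
      (hf.1.comp continuous_conePart_fst).prodMk ((hδ.continuous.comp continuous_conePart_x).prodMk
        (continuous_const.mul continuous_conePart_t))
    exact this.congr fun b => (hB' b).symm
  have hAc : Continuous A := by
    rw [continuous_induced_rng]
    have : Continuous fun a : trivialPart e => (γ a.1.1, ε * a.1.2) := by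
      have := hγ.continuous
      fun_prop
    refine this.congr fun a => Prod.ext ?_ ?_
    · have := hFr (ofTrivial a)
      rw [hA] at this
      exact this.symm
    · have := hFh (ofTrivial a)
      rw [hA] at this
      exact this.symm
  have hFcont : Continuous F := continuous_st_iff.2
    ⟨(continuous_ofTrivial.comp hAc).congr fun a => (hA a).symm,
      (continuous_ofCone.comp hBc).congr fun b => (hB b).symm⟩
  refine PreCob.isSmooth_iff.2 ⟨hFcont, fun z φ' hφ' hz' φ hφ hz => ?_⟩
  rcases trivial_or_inner hW z with ⟨a, rfl⟩ | ⟨b, hb, rfl⟩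
  · obtain ⟨O', hO'⟩ := hW'.collar
    have h1 := smoothVia_chart_stRho hW hφ hz
    have h2 : SmoothVia (quadModel (m + 1)) φ ((quadModel m).prod 𝓘(ℝ, ℝ))
        (fun y => stRho e W' (F y)) (ofTrivial a) := by
      refine (((h1.fst.comp (T := γ) (hγ _)).prodMk (h1.snd.comp_contDiffAt
        (T := fun s => ε * s) (contDiff_const.mul contDiff_id).contDiffAt))).congr
          (Eventually.of_forall fun y => ?_)
      exact (Prod.ext (hFr y) (hFh y)).symm
    refine h2.trans ((smoothVia_stRho_chart hW' hO' hφ' hz' ?_).comp_left (f := F) rfl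
      hFcont.continuousAt)
    rw [hA]
    exact ofTrivial_mem_collarRegion O' _
  · refine SmoothVia.of_comp_left (nhds_ofCone_le hW hb) ?_
    have h1 := isCoord_of_mem_stAtlas hW hφ hz hb
    have h2 : CoordVia (quadModel (m + 1)) (fun b' => φ (ofCone b')) B b := by
      refine ⟨?_, ?_, fun d g hg hgf => ?_⟩
      · exact (h1.x.comp (T := δ) (hδ _)).congr
          (Eventually.of_forall fun b' => congrArg (fun q => q.2.1) (hB' b').symm)
      · exact (h1.t.comp_contDiffAt (T := fun s => ε * s)
          (contDiff_const.mul contDiff_id).contDiffAt).congr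
          (Eventually.of_forall fun b' => congrArg (fun q => q.2.2) (hB' b').symm)
      · have h3 : ∀ b', (B b').1.1 = f b'.1.1 := fun b' => congrArg Prod.fst (hB' b')
        simp only [h3] at hg hgf ⊢
        refine h1.inner d (fun w => g (f w)) (hW'.smoothAt_comp hf hg) fun h0 => ?_
        have h4 := hf.1.continuousAt.eventually (hgf (by rw [hfh]; exact h0))
        filter_upwards [h4] with w hw
        rw [hff, hw]
    have h3 : ofCone (B b) ∈ φ'.source := by rw [← hB]; exact hz'
    refine (h2.smoothVia_chart hW' hBc.continuousAt hφ' h3).congr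
      (Eventually.of_forall fun b' => congrArg φ' (hB b').symm)

end Maps

/-! ### Collar neighbourhoods and encased diffeomorphisms -/

section Collar

variable {n : ℕ} {M : GMfd.{u} G n} {W W' : PreCob M}

/-- Collar neighbourhoods may be shrunk: the continuous inverse turns openness upstairs into
relative openness of the image. -/
theorem PreCob.IsCollarNhd.inter {O U : Set W.X} (hO : W.IsCollarNhd O) (hU : IsOpen U)
    (hbd : W.bd ⊆ U) : W.IsCollarNhd (O ∩ U) := by
  obtain ⟨c, hc, hcont, hsm⟩ := hO.inverse
  refine ⟨hO.isOpen.inter hU, subset_inter hO.bd_subset hbd, hO.injOn.mono inter_subset_left, ?_,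
    hO.image_bd, c, fun x hx => hc x hx.1, hcont.mono (image_mono inter_subset_left),
    fun φ hφ => (hsm φ hφ).mono (inter_subset_inter_left _ (image_mono inter_subset_left))⟩
  obtain ⟨V, hV, hVO⟩ := hO.image_open
  obtain ⟨V', hV', hVU⟩ := (continuousOn_iff'.1 hcont) U hU
  refine ⟨V ∩ V', hV.inter hV', ?_⟩
  have h1 : W.rho '' (O ∩ U) = c ⁻¹' U ∩ W.rho '' O := by
    ext q
    constructor
    · rintro ⟨x, hx, rfl⟩
      refine ⟨?_, mem_image_of_mem _ hx.1⟩
      rw [mem_preimage, hc x hx.1]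
      exact hx.2
    · rintro ⟨h1, x, hx, rfl⟩
      rw [mem_preimage, hc x hx] at h1
      exact ⟨x, ⟨hx, h1⟩, rfl⟩
  rw [h1, hVU, hVO]
  ext q
  simp only [mem_inter_iff]
  tauto

/-- The condition on collar germs is automatic, since the preimage of a collar neighbourhood is an
open neighbourhood of the boundary. -/
theorem PreHom.isEncasedDiffeo (hW : W.IsEncasedMirror) (f : PreHom W W')
    (smul : ∀ (g : G) x, f (g • x) = g • f x) (flip : ∀ x, f (W.flip x) = W'.flip (f x))
    (smooth : W.IsSmooth W' f)
    (inverse : ∃ f' : W'.X → W.X, Function.LeftInverse f' f ∧ Function.RightInverse f' f ∧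
      W'.IsSmooth W f') : f.IsEncasedDiffeo := by
  refine ⟨smul, flip, smooth, inverse, fun O' hO' => ?_⟩
  obtain ⟨O, hO⟩ := hW.collar
  exact ⟨O ∩ f ⁻¹' O', hO.inter (hO'.isOpen.preimage smooth.1)
    fun x hx => hO'.bd_subset (f.map_bd x hx), fun x hx => hx.2⟩

theorem PreCob.isSmooth_id (hW : W.IsEncasedMirror) : W.IsSmooth W id :=
  PreCob.isSmooth_iff.2 ⟨continuous_id, fun _ _ hψ hw => hW.smoothAt_chart hψ hw⟩

/-- The inverse of a bijection that commutes with the encasing functions. -/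
def PreHom.inv (hW : W.IsEncasedMirror) (hW' : W'.IsEncasedMirror) (f : PreHom W W')
    {f' : W'.X → W.X} (hl : Function.LeftInverse f' f) (hr : Function.RightInverse f' f) :
    PreHom W' W where
  toFun := f'
  map_r := fun x => by rw [← f.map_r, hr]
  map_h := fun x => by rw [← f.map_h, hr]
  map_bd := fun x hx => by
    -- The boundary point of the source with the encasing value of x must be sent to x, as the
    -- encasing function is injective on the boundary.
    obtain ⟨w, hw, hwx⟩ := hW.exists_bd (q := W'.rho x) (hW'.h_mem x) (hW'.bd_cases hx)
    have h1 : f w = x := by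
      refine hW'.rho_injOn_bd (f.map_bd w hw) hx ?_
      rw [PreCob.rho, f.map_r, f.map_h]
      exact hwx
    rw [← h1, hl]
    exact hw

end Collar

/-! ### The stabilization is an encased mirror cobordism -/

section Main

variable {n m : ℕ} {M : GMfd.{u} G n} {M' : GMfd.{u} G m} {e : RoundTub M M'} {W W' : PreCob M}

/-- Charts are smooth functions of the encasing function in the collar region, and along its inverse
the encasing function is the identity. -/
theorem contMDiffOn_collar_inverse (hW : W.IsEncasedMirror) {O : Set W.X} (hO : W.IsCollarNhd O)
    {κ : M' × ℝ → StSpace e W} (hκ : ∀ z ∈ collarRegion e W O, κ (stRho e W z) = z)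
    (hκc : ContinuousOn κ (stRho e W '' collarRegion e W O))
    {φ : OpenPartialHomeomorph (StSpace e W) (Quad (m + 1))} (hφ : φ ∈ stAtlas e W) :
    ContMDiffOn ((quadModel m).prod 𝓘(ℝ, ℝ)) (quadModel (m + 1)) ∞ (φ ∘ κ)
      (stRho e W '' collarRegion e W O ∩ κ ⁻¹' φ.source) := by
  rintro _ ⟨⟨z, hz, rfl⟩, hzφ⟩
  rw [mem_preimage, hκ z hz] at hzφ
  refine (smoothVia_stRho_chart hW hO hφ hzφ hz).contMDiffWithinAt_comp (hκ z hz)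
    ((hκc _ (mem_image_of_mem _ hz)).mono inter_subset_left) ?_
  have h1 : ∀ q ∈ stRho e W '' collarRegion e W O, (stRho e W ∘ κ) q = q := by
    rintro _ ⟨y, hy, rfl⟩
    rw [Function.comp_apply, hκ y hy]
  exact contMDiffWithinAt_id.congr (fun q hq => h1 q hq.1) (h1 _ (mem_image_of_mem _ hz))

/-- Through each point of the top there is a curve on which the height is the parameter. -/
theorem exists_height_curve (hW : W.IsEncasedMirror) {z : StSpace e W} (hz : stH e W z = 0) :
    ∃ q : ℝ → StSpace e W, q 0 = z ∧ ContinuousAt q 0 ∧ (∀ᶠ s in 𝓝 0, stH e W (q s) = s) ∧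
      ∀ φ ∈ stAtlas e W, z ∈ φ.source →
        ContMDiffAt 𝓘(ℝ, ℝ) (quadModel (m + 1)) ∞ (fun s => φ (q s)) 0 := by
  rcases trivial_or_inner hW z with ⟨a, rfl⟩ | ⟨b, hb, rfl⟩
  · change a.1.2 = 0 at hz
    obtain ⟨O, hO⟩ := hW.collar
    obtain ⟨V, hV, hVO⟩ := exists_isOpen_stRho_image (e := e) hW hO
    obtain ⟨κ, hκ, hκc⟩ := exists_collar_inverse (e := e) hW hO
    have ha := ofTrivial_mem_collarRegion (W := W) O a
    have hι : Continuous fun s : ℝ => (a.1.1, s) := continuous_const.prodMk continuous_id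
    have ha0 : (a.1.1, (0 : ℝ)) = stRho e W (ofTrivial a) := Prod.ext rfl hz.symm
    have hev : ∀ᶠ s : ℝ in 𝓝 0, (a.1.1, s) ∈ stRho e W '' collarRegion e W O := by
      have h1 : ∀ᶠ s : ℝ in 𝓝 0, (a.1.1, s) ∈ V := by
        refine (hι.tendsto 0).eventually (hV.mem_nhds ?_)
        have h2 : stRho e W (ofTrivial a) ∈ stRho e W '' collarRegion e W O :=
          mem_image_of_mem _ ha
        rw [hVO] at h2
        rw [ha0]
        exact h2.1
      filter_upwards [h1, Icc_mem_nhds (a := (-1 : ℝ)) (b := 1) (by norm_num) (by norm_num)]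
        with s hs hs'
      rw [hVO]
      exact ⟨hs, mem_univ _, hs'⟩
    have h0 : κ (a.1.1, 0) = ofTrivial a := by rw [ha0, hκ _ ha]
    have hcont : ContinuousAt (fun s : ℝ => κ (a.1.1, s)) 0 := by
      have h1 : ContinuousWithinAt κ (stRho e W '' collarRegion e W O) (a.1.1, 0) :=
        hκc _ hev.self_of_nhds
      have h2 : ContinuousWithinAt (κ ∘ fun s : ℝ => (a.1.1, s))
          ((fun s : ℝ => (a.1.1, s)) ⁻¹' (stRho e W '' collarRegion e W O)) 0 :=
        h1.comp hι.continuousWithinAt (mapsTo_preimage _ _)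
      exact h2.continuousAt hev
    refine ⟨fun s => κ (a.1.1, s), h0, hcont, ?_, fun φ hφ hz' => ?_⟩
    · filter_upwards [hev] with s hs
      obtain ⟨y, hy, hys⟩ := hs
      rw [← hys, hκ y hy]
      exact congrArg Prod.snd hys
    · have h1 := contMDiffOn_collar_inverse hW hO hκ hκc hφ (a.1.1, 0)
        ⟨hev.self_of_nhds, by rw [mem_preimage, h0]; exact hz'⟩
      have h2 : ContMDiffAt 𝓘(ℝ, ℝ) ((quadModel m).prod 𝓘(ℝ, ℝ)) ∞
          (fun s : ℝ => (a.1.1, s)) 0 := contMDiffAt_const.prodMk contMDiffAt_id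
      have h3 := h1.comp (t := stRho e W '' collarRegion e W O ∩ κ ⁻¹' φ.source) 0
        h2.contMDiffWithinAt (mapsTo_preimage _ _)
      refine h3.contMDiffAt ?_
      have h4 : ∀ᶠ s : ℝ in 𝓝 0, κ (a.1.1, s) ∈ φ.source :=
        hcont.eventually (φ.open_source.mem_nhds (by change κ (a.1.1, 0) ∈ _; rwa [h0]))
      exact hev.and h4
  · change b.1.2.2 = 0 at hz
    -- The curve fixes the values of g and v and varies only the last variable of the retraction.
    obtain ⟨a, τ, g, R, hR⟩ := exists_flipRetraction hW hb hz
    have hι : Continuous fun s : ℝ => ((g b.1.1, τ.coord b.1.2.1), s) :=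
      continuous_const.prodMk continuous_id
    refine ⟨fun s => ofCone (R ((g b.1.1, τ.coord b.1.2.1), s)), ?_, ?_, ?_, fun φ hφ hz' => ?_⟩
    · exact congrArg ofCone (hR.apply hz)
    · exact continuous_ofCone.continuousAt.comp
        (ContinuousAt.comp (f := fun s : ℝ => ((g b.1.1, τ.coord b.1.2.1), s)) hR.continuousAt
          hι.continuousAt)
    · exact (hι.tendsto 0).eventually hR.height
    · have h2 : ContMDiffAt 𝓘(ℝ, ℝ) 𝓘(ℝ, (Eu a × Eu e.k) × ℝ) ∞
          (fun s : ℝ => ((g b.1.1, τ.coord b.1.2.1), s)) 0 :=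
        (contDiff_const.prodMk contDiff_id).contMDiff.contMDiffAt
      exact ContMDiffAt.comp (f := fun s : ℝ => ((g b.1.1, τ.coord b.1.2.1), s)) 0
        (hR.smooth φ hφ hz') h2

/-- Collar neighbourhoods of the cobordism induce collar neighbourhoods of the stabilization, so the
construction can be iterated. -/
theorem isCollarNhd_collarRegion (hW : W.IsEncasedMirror) {O : Set W.X} (hO : W.IsCollarNhd O) :
    (St e W).IsCollarNhd (collarRegion e W O) := by
  obtain ⟨κ, hκ, hκc⟩ := exists_collar_inverse (e := e) hW hO
  refine ⟨isOpen_collarRegion hW hO, ?_, injOn_stRho_collarRegion hW hO,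
    exists_isOpen_stRho_image hW hO, ?_, κ, hκ, hκc,
    fun φ hφ => contMDiffOn_collar_inverse hW hO hκ hκc hφ⟩
  · rintro _ ⟨a, rfl, -⟩
    exact ofTrivial_mem_collarRegion O a
  · ext q
    constructor
    · rintro ⟨_, ⟨a, rfl, ha⟩, rfl⟩
      exact ⟨a.2.1, ha⟩
    · rintro ⟨h1, h2⟩
      refine ⟨ofTrivial ⟨q, h1, fun x hx => ?_⟩, ⟨_, rfl, h2⟩, rfl⟩
      rcases h2 with h2 | h2 | h2
      · by_contra hcon
        push Not at hcon
        exact e.notMem_bdry_e hcon.1 (hx ▸ h2)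
      · right
        rw [h2]
        nlinarith [sq_nonneg (e.nrm x)]
      · right
        rw [h2]
        nlinarith [sq_nonneg (e.nrm x)]

theorem isEncasedMirror_st (hW : W.IsEncasedMirror) : (St e W).IsEncasedMirror where
  compact := compactSpace_st hW
  t2 := t2Space_st hW
  covers := stAtlas_covers hW
  compatible := fun _ hφ _ hφ' => stAtlas_compatible hW hφ hφ'
  bd_eq := stBd_eq hW
  smul_smooth := fun g => isSmooth_st hW hW (f := fun x => g • x) (δ := fun x => g • x)
    (γ := fun x => g • x) (ε := 1) (fun a => ⟨smulTrivial e g a, rfl⟩)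
    (fun z => (St e W).r_smul g z) (fun z => ((St e W).h_smul g z).trans (one_mul _).symm)
    (fun b => ⟨smulCone e W g b, rfl, Prod.ext rfl (Prod.ext rfl (one_mul _).symm)⟩)
    (hW.smul_smooth g) (e.D.smul_smooth g) (M'.smul_smooth g) (W.h_smul g)
    (fun w => (hW.flip_smul g w).symm)
  flip_smooth := isSmooth_st hW hW (f := id) (δ := id) (γ := id) (ε := -1)
    (fun a => ⟨flipTrivial e a, rfl⟩) (StSpace.ind (fun _ => rfl) (fun _ => rfl))
    (StSpace.ind (fun _ => (neg_one_mul _).symm) (fun _ => (neg_one_mul _).symm))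
    (fun b => ⟨flipCone e W b, rfl, Prod.ext rfl (Prod.ext rfl (neg_one_mul _).symm)⟩)
    (PreCob.isSmooth_id hW) contMDiff_id contMDiff_id (fun _ => rfl) (fun _ => rfl)
  flip_flip := StSpace.ind
    (fun a => congrArg ofTrivial (Subtype.ext (Prod.ext rfl (neg_neg a.1.2))))
    (fun b => congrArg ofCone (Subtype.ext (Prod.ext rfl (Prod.ext rfl (neg_neg b.1.2.2)))))
  flip_smul := fun _ => StSpace.ind (fun _ => rfl) (fun _ => rfl)
  r_smooth := fun φ hφ q hq => by
    have h := (smoothVia_chart_iff (φ.map_target hq)).1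
      (smoothVia_chart_stRho hW hφ (φ.map_target hq)).fst
    rw [φ.right_inv hq] at h
    exact h.contMDiffWithinAt
  h_smooth := fun φ hφ q hq => by
    have h := (smoothVia_chart_iff (φ.map_target hq)).1
      (smoothVia_chart_stRho hW hφ (φ.map_target hq)).snd
    rw [φ.right_inv hq] at h
    exact h.contMDiffWithinAt
  r_flip := StSpace.ind (fun _ => rfl) (fun _ => rfl)
  h_flip := StSpace.ind (fun _ => rfl) (fun _ => rfl)
  h_mem := stH_mem hW
  flip_fixed := fun z => by
    constructor
    · intro h
      have h1 : stH e W (stFlip e W z) = -stH e W z := by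
        induction z using StSpace.ind <;> rfl
      have h2 := congrArg (stH e W) h
      have h3 : -stH e W z = stH e W z := h1.symm.trans h2
      change stH e W z = 0
      linarith
    · intro h
      induction z using StSpace.ind with
      | ht a => exact congrArg ofTrivial (Subtype.ext (Prod.ext rfl
          (show -a.1.2 = a.1.2 by rw [show a.1.2 = 0 from h, neg_zero])))
      | hc b => exact congrArg ofCone (Subtype.ext (Prod.ext rfl (Prod.ext rfl
          (show -b.1.2.2 = b.1.2.2 by rw [show b.1.2.2 = 0 from h, neg_zero]))))
  h_rank := fun z hz φ hφ hzφ h0 => by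
    -- The height is the parameter along this curve, so its derivative takes the value 1 and cannot
    -- vanish.
    obtain ⟨q, hq0, hqc, hqh, hqs⟩ := exists_height_curve hW hz
    have h1 := (smoothVia_chart_iff hzφ).1 (smoothVia_chart_stRho hW hφ hzφ).snd
    have h2 := mfderiv_comp_section (f := (St e W).h ∘ φ.symm) (g := fun s => φ (q s))
      (a := φ z) (b := (0 : ℝ)) (by rw [hq0]) (h1.mdifferentiableAt (by simp))
      ((hqs φ hφ hzφ).mdifferentiableAt (by simp)) (by
        have h3 : ∀ᶠ s in 𝓝 0, q s ∈ φ.source :=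
          hqc.eventually (φ.open_source.mem_nhds (by rw [hq0]; exact hzφ))
        filter_upwards [hqh, h3] with s hs hs'
        rw [Function.comp_apply, φ.left_inv hs']
        exact hs) (1 : ℝ)
    rw [h0] at h2
    exact zero_ne_one (α := ℝ) h2
  collar := hW.collar.elim fun _ hO => ⟨_, isCollarNhd_collarRegion hW hO⟩

/-- The inverse also commutes with encasing functions and reflections, so it can be stabilized; the
two induced maps are inverse to each other on each part. -/
theorem isEncasedDiffeo_stab (hW : W.IsEncasedMirror) (hW' : W'.IsEncasedMirror)
    {f : PreHom W W'} (hf : f.IsEncasedDiffeo) : (f.stab e).IsEncasedDiffeo := by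
  have smooth : ∀ {V V' : PreCob M} (_ : V.IsEncasedMirror) (_ : V'.IsEncasedMirror)
      (f : PreHom V V') (_ : V.IsSmooth V' f) (_ : ∀ x, f (V.flip x) = V'.flip (f x)),
      (St e V).IsSmooth (St e V') (f.stab e) := fun hV hV' f hfs hff =>
    isSmooth_st hV hV' (f := f) (δ := id) (γ := id) (ε := 1) (fun a => ⟨a, rfl⟩)
      (f.stab e).map_r (fun z => ((f.stab e).map_h z).trans (one_mul _).symm)
      (fun b => ⟨f.mapCone e b, rfl, Prod.ext rfl (Prod.ext rfl (one_mul _).symm)⟩)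
      hfs contMDiff_id contMDiff_id f.map_h hff
  obtain ⟨f', hl, hr, hf's⟩ := hf.inverse
  have hflip : ∀ x, f' (W'.flip x) = W.flip (f' x) := fun x => by
    apply hl.injective
    rw [hr, hf.flip, hr]
  refine PreHom.isEncasedDiffeo (isEncasedMirror_st hW) _ (fun g => StSpace.ind (fun _ => rfl)
    fun b => congrArg ofCone (Subtype.ext (Prod.ext (hf.smul g _) rfl)))
    (StSpace.ind (fun _ => rfl) (fun _ => rfl))
    (smooth hW hW' f hf.smooth hf.flip)
    ⟨(f.inv hW hW' hl hr).stab e, fun z => ?_, fun z => ?_,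
      smooth hW' hW (f.inv hW hW' hl hr) hf's hflip⟩
  · induction z using StSpace.ind with
    | ht a => rfl
    | hc b => exact congrArg ofCone (Subtype.ext (Prod.ext (hl b.1.1) rfl))
  · induction z using StSpace.ind with
    | ht a => rfl
    | hc b => exact congrArg ofCone (Subtype.ext (Prod.ext (hr b.1.1) rfl))

end Main

section Canonical

variable {n₀ n₁ n₂ : ℕ} {M₀ : GMfd.{u} G n₀} {M₁ : GMfd.{u} G n₁} {M₂ : GMfd.{u} G n₂}
  {e₀₁ : RoundTub M₀ M₁} {e₁₂ : RoundTub M₁ M₂} {e₀₂ : RoundTub M₀ M₂} {W : PreCob M₀}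

/-! ### Round composites -/

namespace IsRoundComposite

variable (hc : IsRoundComposite e₀₁ e₁₂ e₀₂)

/-- The pair provided by the definition is the only possible one, because both embeddings are
injective. -/
theorem eq_of_e_eq (hc : IsRoundComposite e₀₁ e₁₂ e₀₂) {z : e₀₂.D} {x : e₀₁.D} {x' : e₁₂.D} (hz : e₀₂.e z = e₁₂.e x')
    (hx : e₁₂.p x' = e₀₁.e x) :
    e₀₂.p z = e₀₁.p x ∧ e₀₂.nrm z ^ 2 = e₀₁.nrm x ^ 2 + e₁₂.nrm x' ^ 2 := by
  obtain ⟨y, y', h1, h2, h3, h4⟩ := hc.1 z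
  obtain rfl : y' = x' := e₁₂.e_embedding.injective (h2.symm.trans hz)
  obtain rfl : y = x := e₀₁.e_embedding.injective (h1.symm.trans hx)
  exact ⟨h3, h4⟩

/-- The component in `D₀₁` of a point of the round composite. -/
def left (z : e₀₂.D) : e₀₁.D := (hc.1 z).choose

/-- The component in `D₁₂` of a point of the round composite. -/
def right (z : e₀₂.D) : e₁₂.D := (hc.1 z).choose_spec.choose

theorem p_right (z : e₀₂.D) : e₁₂.p (hc.right z) = e₀₁.e (hc.left z) :=
  (hc.1 z).choose_spec.choose_spec.1

theorem e_right (z : e₀₂.D) : e₁₂.e (hc.right z) = e₀₂.e z :=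
  (hc.1 z).choose_spec.choose_spec.2.1.symm

theorem p_left (z : e₀₂.D) : e₀₁.p (hc.left z) = e₀₂.p z :=
  (hc.1 z).choose_spec.choose_spec.2.2.1.symm

theorem nrm_sq (z : e₀₂.D) :
    e₀₂.nrm z ^ 2 = e₀₁.nrm (hc.left z) ^ 2 + e₁₂.nrm (hc.right z) ^ 2 :=
  (hc.1 z).choose_spec.choose_spec.2.2.2

theorem continuous_right : Continuous hc.right :=
  e₁₂.e_embedding.continuous_iff.2 (e₀₂.continuous_e.congr fun z => (hc.e_right z).symm)

theorem continuous_left : Continuous hc.left :=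
  e₀₁.e_embedding.continuous_iff.2
    ((e₁₂.continuous_p.comp hc.continuous_right).congr fun z => hc.p_right z)

theorem range_subset (hc : IsRoundComposite e₀₁ e₁₂ e₀₂) : range e₀₂.e ⊆ range e₁₂.e := by
  rintro _ ⟨z, rfl⟩
  exact ⟨hc.right z, hc.e_right z⟩

/-- The norm of the composite dominates that of its second component. For boundary points the
inclusion of the images is used: an interior point of the smaller bundle is interior in the larger
one. -/
theorem trivialPart_subset (hc : IsRoundComposite e₀₁ e₁₂ e₀₂) : trivialPart e₁₂ ⊆ trivialPart e₀₂ := by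
  rintro ⟨y, s⟩ ⟨hs, h⟩
  refine ⟨hs, fun z hz => ?_⟩
  rcases h (hc.right z) ((hc.e_right z).trans hz) with h1 | h1
  · left
    by_contra hzb
    exact e₁₂.notMem_bdry_of_e_eq e₀₂ hc.range_subset hzb (hc.e_right z).symm h1
  · right
    rw [hc.nrm_sq]
    have := sq_nonneg (e₀₁.nrm (hc.left z))
    change 1 ≤ _ + s ^ 2
    change 1 ≤ _ + s ^ 2 at h1
    linarith

/-- The point of the first stabilization over a point of the nontrivial part of the stabilization
along the round composite. -/
def splitFst (c : conePart e₀₂ W) : conePart e₀₁ W :=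
  ⟨(c.1.1, hc.left c.1.2.1, -√(e₁₂.nrm (hc.right c.1.2.1) ^ 2 + c.1.2.2 ^ 2)), c.2.1,
    c.2.2.1.trans (hc.p_left _).symm, by
      have h := c.2.2.2
      have h2 := hc.nrm_sq c.1.2.1
      have h3 := Real.sq_sqrt (add_nonneg (sq_nonneg (e₁₂.nrm (hc.right c.1.2.1)))
        (sq_nonneg c.1.2.2))
      change W.h c.1.1 ^ 2 = e₀₁.nrm (hc.left c.1.2.1) ^ 2 + (-√_) ^ 2
      rw [neg_sq]
      linarith⟩

/-- The point of the iterated stabilization over a point of the nontrivial part of the stabilization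
along the round composite. -/
def split (c : conePart e₀₂ W) : conePart e₁₂ (St e₀₁ W) :=
  ⟨(ofCone (hc.splitFst c), hc.right c.1.2.1, c.1.2.2), neg_nonpos.2 (Real.sqrt_nonneg _),
    (hc.p_right _).symm, by
      change (-√_) ^ 2 = _
      rw [neg_sq, Real.sq_sqrt (add_nonneg (sq_nonneg _) (sq_nonneg _))]⟩

theorem continuous_splitFst : Continuous (hc.splitFst : conePart e₀₂ W → conePart e₀₁ W) := by
  rw [continuous_induced_rng]
  have h1 := hc.continuous_right.comp (continuous_conePart_x (e := e₀₂) (W := W))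
  have h2 := hc.continuous_left.comp (continuous_conePart_x (e := e₀₂) (W := W))
  have h3 := continuous_conePart_t (e := e₀₂) (W := W)
  exact continuous_conePart_fst.prodMk (h2.prodMk
    (((e₁₂.continuous_nrm.comp h1).pow 2).add (h3.pow 2)).sqrt.neg)

theorem continuous_split : Continuous (hc.split : conePart e₀₂ W → conePart e₁₂ (St e₀₁ W)) := by
  rw [continuous_induced_rng]
  exact (continuous_ofCone.comp hc.continuous_splitFst).prodMk
    ((hc.continuous_right.comp continuous_conePart_x).prodMk continuous_conePart_t)

theorem stRho_split (c : conePart e₀₂ W) :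
    stRho e₁₂ (St e₀₁ W) (ofCone (hc.split c)) = stRho e₀₂ W (ofCone c) :=
  Prod.ext (hc.e_right _) rfl

/-- The squared norms of x and x' have sum at most one, since the height of w is at least -1. So
they form a point of the round composite, and the intermediate height is forced to be the negative
radius of (x', t). -/
theorem exists_split (hW : W.IsEncasedMirror) (B : conePart e₁₂ (St e₀₁ W)) (b : conePart e₀₁ W)
    (hB : B.1.1 = ofCone b) : ∃ c : conePart e₀₂ W, hc.split c = B ∧ c.1.1 = b.1.1 := by
  obtain ⟨⟨w₁, x', t'⟩, h1, h2, h3⟩ := B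
  change w₁ = ofCone b at hB
  subst hB
  change b.1.2.2 ≤ 0 at h1
  change e₀₁.e b.1.2.1 = e₁₂.p x' at h2
  change b.1.2.2 ^ 2 = e₁₂.nrm x' ^ 2 + t' ^ 2 at h3
  have h4 := conePart_norm_sq_le hW b
  obtain ⟨z, hz⟩ := hc.2 b.1.2.1 x' h2.symm (by nlinarith [sq_nonneg t'])
  obtain ⟨h5, h6⟩ := hc.eq_of_e_eq hz h2.symm
  have h7 := b.2.2.2
  let c : conePart e₀₂ W := ⟨(b.1.1, z, t'), b.2.1, b.2.2.1.trans h5.symm, by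
    change W.h b.1.1 ^ 2 = e₀₂.nrm z ^ 2 + t' ^ 2
    linarith⟩
  have h8 : hc.right z = x' := e₁₂.e_embedding.injective ((hc.e_right z).trans hz)
  have h9 : hc.left z = b.1.2.1 := e₀₁.e_embedding.injective (by rw [← hc.p_right, h8, h2])
  have h10 : hc.splitFst c = b := by
    refine Subtype.ext (Prod.ext rfl (Prod.ext h9 ?_))
    change -√(e₁₂.nrm (hc.right z) ^ 2 + t' ^ 2) = b.1.2.2
    rw [h8, ← h3, Real.sqrt_sq_eq_abs, abs_of_nonpos h1, neg_neg]
  refine ⟨c, Subtype.ext (Prod.ext ?_ (Prod.ext h8 rfl)), rfl⟩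
  change ofCone (hc.splitFst c) = ofCone b
  rw [h10]

end IsRoundComposite

/-! ### The canonical map -/

/-- Points of the iterated stabilization without associated point in the interior of the
cobordism. -/
def IsOuter (e₀₁ : RoundTub M₀ M₁) (e₁₂ : RoundTub M₁ M₂) (W : PreCob M₀)
    (z : StSpace e₁₂ (St e₀₁ W)) : Prop :=
  (∃ a : trivialPart e₁₂, ofTrivial a = z) ∨
    ∃ (B : conePart e₁₂ (St e₀₁ W)) (a : trivialPart e₀₁), ofCone B = z ∧ B.1.1 = ofTrivial a

/-- The points that the canonical map identifies. -/
def Corresponds (z : StSpace e₁₂ (St e₀₁ W)) (z' : StSpace e₀₂ W) : Prop :=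
  stRho e₀₂ W z' = stRho e₁₂ (St e₀₁ W) z ∧
    ∀ w, Assoc e₀₂ W z' w ↔ ∃ w₁, Assoc e₁₂ (St e₀₁ W) z w₁ ∧ Assoc e₀₁ W w₁ w

/-- A point of the iterated stabilization has an associated point off the boundary exactly when
neither stage stops at a trivial point; all such points come from the splitting. -/
theorem outer_or_split (hc : IsRoundComposite e₀₁ e₁₂ e₀₂) (hW : W.IsEncasedMirror)
    (z : StSpace e₁₂ (St e₀₁ W)) :
    IsOuter e₀₁ e₁₂ W z ∨ ∃ c : conePart e₀₂ W, c.1.1 ∉ W.bd ∧ ofCone (hc.split c) = z := by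
  induction z using StSpace.ind with
  | ht a => exact Or.inl (Or.inl ⟨a, rfl⟩)
  | hc B =>
    rcases trivial_or_inner hW B.1.1 with ⟨a, ha⟩ | ⟨b, hb, hbB⟩
    · exact Or.inl (Or.inr ⟨B, a, rfl, ha.symm⟩)
    · obtain ⟨c, hcB, hcb⟩ := hc.exists_split hW B b hbB.symm
      exact Or.inr ⟨c, by rwa [hcb], by rw [hcB]⟩

theorem assoc_split_iff (hc : IsRoundComposite e₀₁ e₁₂ e₀₂) (hW : W.IsEncasedMirror)
    (c : conePart e₀₂ W) (w : W.X) :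
    (∃ w₁, Assoc e₁₂ (St e₀₁ W) (ofCone (hc.split c)) w₁ ∧ Assoc e₀₁ W w₁ w) ↔ c.1.1 = w := by
  constructor
  · rintro ⟨w₁, h1, h2⟩
    rw [assoc_ofCone_iff (isEncasedMirror_st hW)] at h1
    subst h1
    exact (assoc_ofCone_iff hW (b := hc.splitFst c)).1 h2
  · rintro rfl
    exact ⟨_, ⟨_, rfl, rfl⟩, hc.splitFst c, rfl, rfl⟩

/-- Outer points lie in every iterated collar region, so their encasing values determine them. -/
theorem IsOuter.mem_collarRegion {z : StSpace e₁₂ (St e₀₁ W)} (hz : IsOuter e₀₁ e₁₂ W z)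
    (O : Set W.X) : z ∈ collarRegion e₁₂ (St e₀₁ W) (collarRegion e₀₁ W O) := by
  rcases hz with ⟨a, rfl⟩ | ⟨B, a, rfl, ha⟩
  · exact Or.inl ⟨a, rfl⟩
  · exact Or.inr ⟨_, Or.inl ⟨a, ha.symm⟩, B, rfl, rfl⟩

theorem split_mem_collarRegion (hc : IsRoundComposite e₀₁ e₁₂ e₀₂) {O : Set W.X}
    {c : conePart e₀₂ W} (hcO : c.1.1 ∈ O) :
    ofCone (hc.split c) ∈ collarRegion e₁₂ (St e₀₁ W) (collarRegion e₀₁ W O) :=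
  Or.inr ⟨_, Or.inr ⟨_, hcO, hc.splitFst c, rfl, rfl⟩, _, rfl, rfl⟩

/-- For a point over a trivial point of the first stabilization, the trivial condition there
involves |x|² + s², which equals |x|² + |x'|² + t², the quantity in the condition for the composite.
-/
theorem IsOuter.stRho_mem (hc : IsRoundComposite e₀₁ e₁₂ e₀₂) (hW : W.IsEncasedMirror)
    {z : StSpace e₁₂ (St e₀₁ W)} (hz : IsOuter e₀₁ e₁₂ W z) :
    stRho e₁₂ (St e₀₁ W) z ∈ trivialPart e₀₂ := by
  rcases hz with ⟨a, rfl⟩ | ⟨B, a, rfl, ha⟩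
  · exact hc.trivialPart_subset a.2
  · refine ⟨conePart_t_mem (isEncasedMirror_st hW) B, fun z hz => ?_⟩
    change e₀₂.e z = e₁₂.e B.1.2.1 at hz
    have h1 : hc.right z = B.1.2.1 := e₁₂.e_embedding.injective ((hc.e_right z).trans hz)
    have h2 : a.1.1 = e₁₂.p B.1.2.1 := by
      rw [← B.2.2.1, ha]; rfl
    have h3 : a.1.2 ^ 2 = e₁₂.nrm B.1.2.1 ^ 2 + B.1.2.2 ^ 2 := by
      rw [← B.2.2.2, ha]; rfl
    have h4 := hc.nrm_sq z
    rw [h1] at h4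
    change z ∈ e₀₂.D.bdry ∨ 1 ≤ e₀₂.nrm z ^ 2 + B.1.2.2 ^ 2
    rw [e₀₂.mem_bdry_iff, ← hc.p_left]
    rcases a.2.2 (hc.left z) (by rw [← hc.p_right, h1, h2]) with h5 | h5
    · rcases (e₀₁.mem_bdry_iff _).1 h5 with h6 | h6
      · exact Or.inl (Or.inl h6)
      · right
        rw [h6] at h4
        nlinarith [sq_nonneg (e₁₂.nrm B.1.2.1), sq_nonneg B.1.2.2]
    · right
      linarith

theorem corresponds_split (hc : IsRoundComposite e₀₁ e₁₂ e₀₂) (hW : W.IsEncasedMirror)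
    (c : conePart e₀₂ W) : Corresponds (ofCone (hc.split c)) (ofCone c) :=
  ⟨(hc.stRho_split c).symm, fun w => by
    rw [assoc_split_iff hc hW, assoc_ofCone_iff hW]⟩

/-- Outer and trivial points may still have associated points, through the gluing, but then these
lie on the boundary. Both sides are therefore in collar regions, where equality can be checked on
encasing values. -/
theorem IsOuter.corresponds (hc : IsRoundComposite e₀₁ e₁₂ e₀₂) (hW : W.IsEncasedMirror)
    {z : StSpace e₁₂ (St e₀₁ W)} (hz : IsOuter e₀₁ e₁₂ W z) {a : trivialPart e₀₂}
    (ha : a.1 = stRho e₁₂ (St e₀₁ W) z) : Corresponds z (ofTrivial a) := by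
  have hW₁ := isEncasedMirror_st (e := e₀₁) hW
  obtain ⟨O, hO⟩ := hW.collar
  have hO₁ := isCollarNhd_collarRegion (e := e₀₁) hW hO
  refine ⟨ha, fun w => ⟨?_, ?_⟩⟩
  · rintro ⟨c, hca, rfl⟩
    have h1 : ofCone (hc.split c) = z := by
      refine injOn_stRho_collarRegion hW₁ hO₁
        (split_mem_collarRegion hc (hO.bd_subset (mem_bd_of_ofTrivial_eq hca.symm)))
        (hz.mem_collarRegion O) ?_
      rw [hc.stRho_split, hca]
      exact ha
    rw [← h1, assoc_split_iff hc hW]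
  · rintro ⟨_, ⟨B, rfl, rfl⟩, b, hb, rfl⟩
    obtain ⟨c, hcB, hcb⟩ := hc.exists_split hW B b hb.symm
    have hbd : b.1.1 ∈ W.bd := by
      rcases hz with ⟨a', ha'⟩ | ⟨B', a', hB', ha'⟩
      · obtain ⟨a₁, ha₁, -⟩ := mem_bd_of_ofTrivial_eq ha'
        exact mem_bd_of_ofTrivial_eq (ha₁.trans hb.symm)
      · rw [ofCone_injective hW₁ hB'] at ha'
        exact mem_bd_of_ofTrivial_eq (ha'.symm.trans hb.symm)
    refine ⟨c, ?_, hcb⟩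
    refine injOn_stRho_collarRegion hW hO ((ofCone_mem_collarRegion_iff hW hO.bd_subset).2 ?_)
      (ofTrivial_mem_collarRegion O a) ?_
    · rw [hcb]
      exact hO.bd_subset hbd
    · rw [← hc.stRho_split, hcB]
      exact ha.symm

theorem exists_corresponds (hc : IsRoundComposite e₀₁ e₁₂ e₀₂) (hW : W.IsEncasedMirror)
    (z : StSpace e₁₂ (St e₀₁ W)) : ∃ z' : StSpace e₀₂ W, Corresponds z z' := by
  rcases outer_or_split hc hW z with hz | ⟨c, -, rfl⟩
  · exact ⟨ofTrivial ⟨_, hz.stRho_mem hc hW⟩, hz.corresponds hc hW rfl⟩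
  · exact ⟨_, corresponds_split hc hW c⟩

/-- If the point is not trivial for the second bundle, it lies over some x' with |x'|² + s² < 1. The
first-stage point over p(x') with height minus the root of this number is then trivial for the first
bundle. -/
theorem exists_outer (hc : IsRoundComposite e₀₁ e₁₂ e₀₂) (W : PreCob M₀) (a : trivialPart e₀₂) :
    ∃ z, IsOuter e₀₁ e₁₂ W z ∧ stRho e₁₂ (St e₀₁ W) z = a.1 := by
  by_cases ha : a.1 ∈ trivialPart e₁₂
  · exact ⟨ofTrivial ⟨a.1, ha⟩, Or.inl ⟨_, rfl⟩, rfl⟩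
  · have h1 : ∃ x' : e₁₂.D, e₁₂.e x' = a.1.1 ∧ e₁₂.nrm x' ^ 2 + a.1.2 ^ 2 < 1 := by
      by_contra hcon
      push Not at hcon
      exact ha ⟨a.2.1, fun x' hx' => Or.inr (hcon x' hx')⟩
    obtain ⟨x', hx', hlt⟩ := h1
    have hnn : 0 ≤ e₁₂.nrm x' ^ 2 + a.1.2 ^ 2 := by positivity
    have hsq := Real.sq_sqrt hnn
    have hle : √(e₁₂.nrm x' ^ 2 + a.1.2 ^ 2) ≤ 1 := Real.sqrt_le_one.2 hlt.le
    have h0 := Real.sqrt_nonneg (e₁₂.nrm x' ^ 2 + a.1.2 ^ 2)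
    let a₁ : trivialPart e₀₁ := ⟨(e₁₂.p x', -√(e₁₂.nrm x' ^ 2 + a.1.2 ^ 2)),
      ⟨neg_le_neg hle, by change -_ ≤ _; linarith⟩, fun x hx => by
        change x ∈ e₀₁.D.bdry ∨ 1 ≤ e₀₁.nrm x ^ 2 + (-√_) ^ 2
        rw [neg_sq, hsq]
        -- Pairs in the round composite inherit the trivial condition from `a`; all other pairs
        -- already have squared norm greater than one.
        by_cases h2 : e₀₁.nrm x ^ 2 + e₁₂.nrm x' ^ 2 ≤ 1
        · obtain ⟨z, hz⟩ := hc.2 x x' hx.symm h2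
          obtain ⟨h3, h4⟩ := hc.eq_of_e_eq hz hx.symm
          rcases a.2.2 z (hz.trans hx') with h5 | h5
          · rcases (e₀₂.mem_bdry_iff _).1 h5 with h6 | h6
            · left
              rw [e₀₁.mem_bdry_iff, ← h3]
              exact Or.inl h6
            · right
              rw [h6] at h4
              nlinarith [sq_nonneg a.1.2]
          · right
            linarith
        · right
          nlinarith [sq_nonneg a.1.2]⟩
    let B : conePart e₁₂ (St e₀₁ W) := ⟨(ofTrivial a₁, x', a.1.2), neg_nonpos.2 h0, rfl, by
      change (-√_) ^ 2 = _
      rw [neg_sq, hsq]⟩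
    exact ⟨ofCone B, Or.inr ⟨B, a₁, rfl, rfl⟩, Prod.ext hx' rfl⟩

theorem exists_corresponds' (hc : IsRoundComposite e₀₁ e₁₂ e₀₂) (hW : W.IsEncasedMirror)
    (z' : StSpace e₀₂ W) : ∃ z : StSpace e₁₂ (St e₀₁ W), Corresponds z z' := by
  induction z' using StSpace.ind with
  | ht a =>
    obtain ⟨z, hz, hza⟩ := exists_outer hc W a
    exact ⟨z, hz.corresponds hc hW hza.symm⟩
  | hc c => exact ⟨_, corresponds_split hc hW c⟩

theorem Corresponds.right_unique (hW : W.IsEncasedMirror) {z : StSpace e₁₂ (St e₀₁ W)}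
    {y y' : StSpace e₀₂ W} (h : Corresponds z y) (h' : Corresponds z y') : y = y' :=
  st_ext hW (h.1.trans h'.1.symm) fun w => (h.2 w).trans (h'.2 w).symm

/-- Outer points correspond to trivial points and unglued split points to unglued points, so the
types cannot mix. Within each type, encasing values or triples determine the point. -/
theorem Corresponds.left_unique (hc : IsRoundComposite e₀₁ e₁₂ e₀₂) (hW : W.IsEncasedMirror)
    {y y' : StSpace e₁₂ (St e₀₁ W)} {z : StSpace e₀₂ W} (h : Corresponds y z)
    (h' : Corresponds y' z) : y = y' := by
  have key : ∀ {y : StSpace e₁₂ (St e₀₁ W)} {c : conePart e₀₂ W}, IsOuter e₀₁ e₁₂ W y →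
      c.1.1 ∉ W.bd → Corresponds y z → ¬ Corresponds (ofCone (hc.split c)) z := by
    intro y c hy hcb h h'
    have h1 := h.right_unique hW (hy.corresponds hc hW (a := ⟨_, hy.stRho_mem hc hW⟩) rfl)
    have h2 := h'.right_unique hW (corresponds_split hc hW c)
    exact hcb (mem_bd_of_ofTrivial_eq (h1.symm.trans h2))
  rcases outer_or_split hc hW y with hy | ⟨c, hcb, rfl⟩ <;>
    rcases outer_or_split hc hW y' with hy' | ⟨c', hcb', rfl⟩
  · obtain ⟨O, hO⟩ := hW.collar
    exact injOn_stRho_collarRegion (isEncasedMirror_st hW) (isCollarNhd_collarRegion hW hO)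
      (hy.mem_collarRegion O) (hy'.mem_collarRegion O) (h.1.symm.trans h'.1)
  · exact absurd h' (key hy hcb' h)
  · exact absurd h (key hy' hcb h')
  · have h1 := h.right_unique hW (corresponds_split hc hW c)
    have h2 := h'.right_unique hW (corresponds_split hc hW c')
    rw [ofCone_injective hW (h1.symm.trans h2)]

/-- The inverse of the canonical map. -/
def canonicalInv (hc : IsRoundComposite e₀₁ e₁₂ e₀₂) (hW : W.IsEncasedMirror)
    (z' : StSpace e₀₂ W) : StSpace e₁₂ (St e₀₁ W) := (exists_corresponds' hc hW z').choose

theorem corresponds_canonicalInv (hc : IsRoundComposite e₀₁ e₁₂ e₀₂) (hW : W.IsEncasedMirror)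
    (z' : StSpace e₀₂ W) : Corresponds (canonicalInv hc hW z') z' :=
  (exists_corresponds' hc hW z').choose_spec

theorem canonicalInv_ofCone (hc : IsRoundComposite e₀₁ e₁₂ e₀₂) (hW : W.IsEncasedMirror)
    (c : conePart e₀₂ W) : canonicalInv hc hW (ofCone c) = ofCone (hc.split c) :=
  (corresponds_canonicalInv hc hW _).left_unique hc hW (corresponds_split hc hW c)

theorem isOuter_canonicalInv (hc : IsRoundComposite e₀₁ e₁₂ e₀₂) (hW : W.IsEncasedMirror)
    (a : trivialPart e₀₂) : IsOuter e₀₁ e₁₂ W (canonicalInv hc hW (ofTrivial a)) := by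
  obtain ⟨z, hz, hza⟩ := exists_outer hc W a
  rwa [(corresponds_canonicalInv hc hW _).left_unique hc hW (hz.corresponds hc hW hza.symm)]

/-- The inverse is easier than the map: its source is a single pushout, on whose parts it is the
collar inverse and the splitting. -/
theorem continuous_canonicalInv (hc : IsRoundComposite e₀₁ e₁₂ e₀₂) (hW : W.IsEncasedMirror) :
    Continuous (canonicalInv hc hW) := by
  refine continuous_st_iff.2 ⟨?_, ?_⟩
  · obtain ⟨O, hO⟩ := hW.collar
    obtain ⟨κ, hκ, hκc⟩ := exists_collar_inverse (e := e₁₂) (isEncasedMirror_st (e := e₀₁) hW)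
      (isCollarNhd_collarRegion hW hO)
    have h1 : ∀ a : trivialPart e₀₂, canonicalInv hc hW (ofTrivial a) ∈
        collarRegion e₁₂ (St e₀₁ W) (collarRegion e₀₁ W O) := fun a =>
      (isOuter_canonicalInv hc hW a).mem_collarRegion O
    have h2 : ∀ a : trivialPart e₀₂,
        stRho e₁₂ (St e₀₁ W) (canonicalInv hc hW (ofTrivial a)) = a.1 := fun a =>
      (corresponds_canonicalInv hc hW _).1.symm
    have h3 : Continuous fun a : trivialPart e₀₂ => κ a.1 :=
      hκc.comp_continuous continuous_subtype_val fun a => ⟨_, h1 a, h2 a⟩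
    refine h3.congr fun a => ?_
    rw [← hκ _ (h1 a), h2]
  · exact (continuous_ofCone.comp hc.continuous_split).congr
      fun c => (canonicalInv_ofCone hc hW c).symm

/-- The canonical map, as a homeomorphism. -/
theorem exists_canonicalHomeo (hc : IsRoundComposite e₀₁ e₁₂ e₀₂) (hW : W.IsEncasedMirror) :
    ∃ Φ : StSpace e₁₂ (St e₀₁ W) ≃ₜ StSpace e₀₂ W, ∀ z, Corresponds z (Φ z) := by
  have := compactSpace_st (e := e₀₂) hW
  have := t2Space_st (e := e₁₂) (isEncasedMirror_st (e := e₀₁) hW)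
  choose F hF using exists_corresponds (W := W) hc hW
  let E : StSpace e₀₂ W ≃ StSpace e₁₂ (St e₀₁ W) :=
    { toFun := canonicalInv hc hW
      invFun := F
      left_inv := fun z' => (hF _).right_unique hW (corresponds_canonicalInv hc hW z')
      right_inv := fun z => (corresponds_canonicalInv hc hW _).left_unique hc hW (hF z) }
  have hE : Continuous E := continuous_canonicalInv hc hW
  -- Compactness of the single stabilization and the Hausdorff property of the iterated one give
  -- continuity of the map itself.
  exact ⟨hE.homeoOfEquivCompactToT2.symm, hF⟩

end Canonical

/-! ### Smoothness of the canonical map -/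

section SmoothCanonical

variable {E H Z : Type*} [NormedAddCommGroup E] [NormedSpace ℝ E] [TopologicalSpace H]
  [TopologicalSpace Z] [ChartedSpace H Z] {J : ModelWithCorners ℝ E H}
  {S S' : Type*} [TopologicalSpace S] [TopologicalSpace S']

/-- Smoothness of a continuous map to D may be tested after the embedding. -/
theorem RoundTub.smoothVia_of_e {n m : ℕ} {M : GMfd.{u} G n} {M' : GMfd.{u} G m} (e : RoundTub M M')
    {c : S → Z} {x : S → e.D} {s : S} (h : SmoothVia J c (quadModel m) (fun s' => e.e (x s')) s)
    (hx : ContinuousAt x s) : SmoothVia J c (quadModel m) x s :=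
  h.trans ((e.smoothVia_e (x s)).comp_left (f := x) rfl hx)

theorem CoordVia.comp_left {n m : ℕ} {M : GMfd.{u} G n} {M' : GMfd.{u} G m} {e : RoundTub M M'}
    {W : PreCob M} {c : S → Z} {B : S → conePart e W} {f : S' → S} {s : S'}
    (h : CoordVia J c B (f s)) (hf : ContinuousAt f s) :
    CoordVia J (fun s' => c (f s')) (fun s' => B (f s')) s :=
  ⟨h.x.comp_left rfl hf, h.t.comp_left rfl hf, fun d g hg hgf => (h.inner d g hg hgf).comp_left rfl hf⟩

variable {n₀ n₁ n₂ : ℕ} {M₀ : GMfd.{u} G n₀} {M₁ : GMfd.{u} G n₁} {M₂ : GMfd.{u} G n₂}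
  {e₀₁ : RoundTub M₀ M₁} {e₁₂ : RoundTub M₁ M₂} {e₀₂ : RoundTub M₀ M₂} {W : PreCob M₀}

/-- The components x and x' are smooth because the embeddings have smooth inverses on their images.
The problem is the intermediate height, the negative radius of (x', t). Where it is nonzero it is
smooth. Where it vanishes, only functions invariant under the reflection of the first stabilization
have to be controlled, and these are even in this height. -/
theorem coordVia_split (hc : IsRoundComposite e₀₁ e₁₂ e₀₂) (hW : W.IsEncasedMirror)
    {c : conePart e₀₂ W} (hb : c.1.1 ∉ W.bd) {C : conePart e₀₂ W → Z} (h : IsCoord J C c) :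
    CoordVia J C (hc.split (W := W)) c := by
  have hr : SmoothVia J C (quadModel n₂) (fun c' => hc.right c'.1.2.1) c := by
    refine e₁₂.smoothVia_of_e ?_ (hc.continuous_right.comp continuous_conePart_x).continuousAt
    exact (h.x.comp (T := e₀₂.e) (e₀₂.e_smooth _)).congr
      (Eventually.of_forall fun c' => (hc.e_right _).symm)
  have hl : SmoothVia J C (quadModel n₁) (fun c' => hc.left c'.1.2.1) c := by
    refine e₀₁.smoothVia_of_e ?_ (hc.continuous_left.comp continuous_conePart_x).continuousAt
    exact (hr.comp (T := e₁₂.p) (e₁₂.p_smooth _)).congr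
      (Eventually.of_forall fun c' => hc.p_right _)
  obtain ⟨τ, hτ⟩ := e₁₂.locally_trivial (e₁₂.p (hc.right c.1.2.1))
  have hv : SmoothVia J C 𝓘(ℝ, Eu e₁₂.k) (fun c' => τ.coord (hc.right c'.1.2.1)) c :=
    hr.comp (T := τ.coord) (τ.contMDiffAt_coord e₁₂.continuous_p hτ)
  have hbase : ∀ᶠ c' : conePart e₀₂ W in 𝓝 c, e₁₂.p (hc.right c'.1.2.1) ∈ τ.base :=
    (e₁₂.continuous_p.comp (hc.continuous_right.comp continuous_conePart_x)).continuousAt.eventually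
      (τ.isOpen_base.mem_nhds hτ)
  have hnorm : ∀ᶠ c' : conePart e₀₂ W in 𝓝 c,
      -√(‖τ.coord (hc.right c'.1.2.1)‖ ^ 2 + c'.1.2.2 ^ 2) = (hc.splitFst c').1.2.2 := by
    filter_upwards [hbase] with c' hc'
    rw [τ.norm_coord _ hc']
    rfl
  have hW₁ := isEncasedMirror_st (e := e₀₁) hW
  refine ⟨hr, h.t, fun d g₁ hg₁ hgf₁ => ?_⟩
  change SmoothVia J C 𝓘(ℝ, Eu d) (fun c' => g₁ (ofCone (hc.splitFst c'))) c
  obtain ⟨φ, hφ, hφc⟩ := hW₁.covers (ofCone (hc.splitFst c))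
  by_cases h0 : (hc.splitFst c).1.2.2 = 0
  · have hz : ‖τ.coord (hc.right c.1.2.1)‖ ^ 2 + c.1.2.2 ^ 2 = 0 := by
      have h1 := hnorm.self_of_nhds
      rw [h0, neg_eq_zero] at h1
      exact (Real.sqrt_eq_zero (by positivity)).1 h1
    have hv0 : τ.coord (hc.right c.1.2.1) = 0 := by
      rw [← norm_eq_zero, ← sq_eq_zero_iff]
      nlinarith [sq_nonneg ‖τ.coord (hc.right c.1.2.1)‖, sq_nonneg c.1.2.2]
    have ht0 : c.1.2.2 = 0 := by
      rw [← sq_eq_zero_iff]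
      nlinarith [sq_nonneg ‖τ.coord (hc.right c.1.2.1)‖, sq_nonneg c.1.2.2]
    obtain ⟨a, σ, g, R, hR⟩ := exists_flipRetraction hW (b := hc.splitFst c) hb h0
    set P : Eu a × Eu e₀₁.k := (g c.1.1, σ.coord (hc.left c.1.2.1)) with hP
    have hRP : R (P, 0) = hc.splitFst c := hR.apply h0
    have hRc : ContinuousAt (fun p => (ofCone (R p) : StSpace e₀₁ W)) (P, 0) :=
      continuous_ofCone.continuousAt.comp hR.continuousAt
    -- The parameters (g, v) are flattened to one Euclidean space, the form in which Whitney's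
    -- theorem is applied.
    let A : (Eu a × Eu e₀₁.k) ≃L[ℝ] Eu (Module.finrank ℝ (Eu a × Eu e₀₁.k)) := euEquiv rfl
    let L : Eu (Module.finrank ℝ (Eu a × Eu e₀₁.k)) × ℝ → (Eu a × Eu e₀₁.k) × ℝ :=
      fun q => (A.symm q.1, q.2)
    have hL : ContDiff ℝ ∞ L := (A.symm.contDiff.comp contDiff_fst).prodMk contDiff_snd
    have hLP : L (A P, 0) = (P, 0) := Prod.ext (A.symm_apply_apply P) rfl
    have hu : SmoothVia J C 𝓘(ℝ, Eu (Module.finrank ℝ (Eu a × Eu e₀₁.k)))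
        (fun c' => A (g c'.1.1, σ.coord (hc.left c'.1.2.1))) c := by
      refine SmoothVia.comp_contDiffAt (T := A) ((h.inner a g hR.smoothAt hR.flip).prodMk_space
        (hl.comp (T := σ.coord) (σ.contMDiffAt_coord e₀₁.continuous_p ?_))) A.contDiff.contDiffAt
      rw [hc.p_left, ← c.2.2.1]
      exact hR.base
    have hT : ContMDiffAt 𝓘(ℝ, Eu (Module.finrank ℝ (Eu a × Eu e₀₁.k)) × ℝ) 𝓘(ℝ, Eu d) ∞
        (fun q => g₁ (ofCone (R (L q)))) (A P, 0) := by
      have h1 := (hg₁ φ hφ hφc).contMDiffAt_comp (q := fun p => ofCone (R p)) (a := (P, 0))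
        (congrArg ofCone hRP) hRc (hR.smooth φ hφ hφc)
      rw [← hLP] at h1
      exact h1.comp (f := L) _ hL.contMDiff.contMDiffAt
    -- The retraction commutes with the reflection, which converts invariance of `g₁` into evenness.
    have heven : ∀ᶠ q in 𝓝 (A P, (0 : ℝ)), g₁ (ofCone (R (L (q.1, -q.2)))) =
        g₁ (ofCone (R (L q))) := by
      have h1 : ∀ᶠ w in 𝓝 (ofCone (hc.splitFst c) : StSpace e₀₁ W),
          g₁ (stFlip e₀₁ W w) = g₁ w := hgf₁ h0
      have hRc' := hRc
      rw [ContinuousAt, hRP] at hRc'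
      have h2 : ∀ᶠ p in 𝓝 (P, (0 : ℝ)), g₁ (ofCone (R (p.1, -p.2))) = g₁ (ofCone (R p)) := by
        filter_upwards [hR.equivariant, hRc'.eventually h1] with p hp hp'
        rw [hp]
        exact hp'
      rw [← hLP] at h2
      exact hL.continuous.continuousAt.eventually h2
    refine (SmoothVia.of_even hu hv h.t hv0 ht0 hT heven).congr ?_
    filter_upwards [hnorm, hc.continuous_splitFst.continuousAt.eventually hR.retract]
      with c' h1 h2
    have h3 : L (A (g c'.1.1, σ.coord (hc.left c'.1.2.1)),
        -√(‖τ.coord (hc.right c'.1.2.1)‖ ^ 2 + c'.1.2.2 ^ 2)) =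
        ((g c'.1.1, σ.coord (hc.left c'.1.2.1)), (hc.splitFst c').1.2.2) :=
      Prod.ext (A.symm_apply_apply _) h1
    change g₁ (ofCone (R (L _))) = _
    rw [h3]
    exact congrArg (fun b => g₁ (ofCone b)) h2
  · have hne : ‖τ.coord (hc.right c.1.2.1)‖ ^ 2 + c.1.2.2 ^ 2 ≠ 0 := by
      intro h1
      apply h0
      rw [← hnorm.self_of_nhds, h1, Real.sqrt_zero, neg_zero]
    have h1 : CoordVia J C (hc.splitFst (W := W)) c :=
      ⟨hl, ((hv.norm_sq_add_sq h.t).neg_sqrt hne).congr hnorm, h.inner⟩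
    have h2 := h1.smoothVia_chart hW hc.continuous_splitFst.continuousAt hφ hφc
    exact h2.trans ((hg₁ φ hφ hφc).comp_left
      (f := fun c' => (ofCone (hc.splitFst c') : StSpace e₀₁ W)) rfl
      (continuous_ofCone.comp hc.continuous_splitFst).continuousAt)

/-- A function of the original associated point lifts to the first stabilization, and the lift is
invariant under its reflection, which does not move associated points. So the coordinate condition
of the iterated stabilization applies to the lift at every height. -/
theorem isCoord_of_split (hc : IsRoundComposite e₀₁ e₁₂ e₀₂) (hW : W.IsEncasedMirror)
    {c : conePart e₀₂ W} (hb : c.1.1 ∉ W.bd) {C : conePart e₀₂ W → Z}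
    (h : CoordVia J C (hc.split (W := W)) c) : IsCoord J C c := by
  refine ⟨?_, h.t, fun d g hg hgf => ?_⟩
  · refine e₀₂.smoothVia_of_e ?_ continuous_conePart_x.continuousAt
    exact (h.x.comp (T := e₁₂.e) (e₁₂.e_smooth _)).congr
      (Eventually.of_forall fun c' => hc.e_right _)
  · let g₁ : StSpace e₀₁ W → Eu d := Function.extend ofCone (fun b => g b.1.1) 0
    have hg₁ : ∀ b, g₁ (ofCone b) = g b.1.1 := (ofCone_injective hW).extend_apply _ _
    have h1 := h.inner d g₁ (fun φ hφ hφc => ?_) fun _ => ?_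
    · exact h1.congr (Eventually.of_forall fun c' => hg₁ (hc.splitFst c'))
    · refine SmoothVia.of_comp_left (f := ofCone) (z' := hc.splitFst c) (nhds_ofCone_le hW hb) ?_
      exact ((isCoord_of_mem_stAtlas hW hφ hφc hb).inner d g hg hgf).congr
        (Eventually.of_forall fun b => (hg₁ b).symm)
    · refine nhds_ofCone_le hW (b := hc.splitFst c) hb (mem_map.2 (Eventually.of_forall fun b => ?_))
      exact (hg₁ (flipCone e₀₁ W b)).trans (hg₁ b).symm

/-- At outer points both charts are equivalent to the encasing function, which the map preserves. At
the others the map is inverse to the splitting, and the coordinate conditions on both sides imply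
each other. -/
theorem smoothVia_canonical (hc : IsRoundComposite e₀₁ e₁₂ e₀₂) (hW : W.IsEncasedMirror)
    (Φ : StSpace e₁₂ (St e₀₁ W) ≃ₜ StSpace e₀₂ W) (hΦ : ∀ z, Corresponds z (Φ z))
    {φ : OpenPartialHomeomorph (StSpace e₁₂ (St e₀₁ W)) (Quad (n₂ + 1))}
    (hφ : φ ∈ stAtlas e₁₂ (St e₀₁ W))
    {φ' : OpenPartialHomeomorph (StSpace e₀₂ W) (Quad (n₂ + 1))} (hφ' : φ' ∈ stAtlas e₀₂ W)
    {z : StSpace e₁₂ (St e₀₁ W)} (hz : z ∈ φ.source) (hz' : Φ z ∈ φ'.source) :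
    SmoothVia (quadModel (n₂ + 1)) φ (quadModel (n₂ + 1)) (fun y => φ' (Φ y)) z ∧
      SmoothVia (quadModel (n₂ + 1)) (fun y => φ' (Φ y)) (quadModel (n₂ + 1)) φ z := by
  have hW₁ := isEncasedMirror_st (e := e₀₁) hW
  have hΦr : ∀ y, stRho e₀₂ W (Φ y) = stRho e₁₂ (St e₀₁ W) y := fun y => (hΦ y).1
  rcases outer_or_split hc hW z with hout | ⟨c, hb, rfl⟩
  · obtain ⟨O, hO⟩ := hW.collar
    have hΦz : Φ z ∈ collarRegion e₀₂ W O := by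
      rw [(hΦ z).right_unique hW (hout.corresponds hc hW (a := ⟨_, hout.stRho_mem hc hW⟩) rfl)]
      exact ofTrivial_mem_collarRegion O _
    have hcont := Φ.continuous.continuousAt (x := z)
    constructor
    · refine ((smoothVia_chart_stRho hW₁ hφ hz).congr
        (Eventually.of_forall fun y => (hΦr y).symm)).trans ?_
      exact (smoothVia_stRho_chart hW hO hφ' hz' hΦz).comp_left rfl hcont
    · refine (((smoothVia_chart_stRho hW hφ' hz').comp_left (f := Φ) rfl hcont).congr
        (Eventually.of_forall hΦr)).trans ?_
      exact smoothVia_stRho_chart hW₁ (isCollarNhd_collarRegion hW hO) hφ hz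
        (hout.mem_collarRegion O)
  · have hΦs : ∀ c', Φ (ofCone (hc.split c')) = ofCone c' := fun c' =>
      (hΦ _).right_unique hW (corresponds_split hc hW c')
    have hf : 𝓝 (ofCone (hc.split c)) ≤ map (fun c' => ofCone (hc.split c')) (𝓝 c) := by
      have h1 : (fun c' : conePart e₀₂ W => ofCone (hc.split c')) = Φ.symm ∘ ofCone :=
        funext fun c' => by rw [Function.comp_apply, ← hΦs, Φ.symm_apply_apply]
      rw [h1, ← map_map, ← Φ.symm_apply_apply (ofCone (hc.split c)), ← Φ.symm.map_nhds_eq, hΦs]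
      exact map_mono (nhds_ofCone_le hW hb)
    have hb₁ : (hc.split c).1.1 ∉ (St e₀₁ W).bd := by
      rintro ⟨a, ha, -⟩
      exact hb (mem_bd_of_ofTrivial_eq (b := hc.splitFst c) ha)
    rw [hΦs] at hz'
    have hev : (fun c' => φ' (ofCone c')) =ᶠ[𝓝 c] fun c' => φ' (Φ (ofCone (hc.split c'))) :=
      Eventually.of_forall fun c' => congrArg φ' (hΦs c').symm
    constructor
    · refine SmoothVia.of_comp_left (f := fun c' => ofCone (hc.split c')) hf ?_
      have h1 := isCoord_of_split hc hW hb ((isCoord_of_mem_stAtlas hW₁ hφ hz hb₁).comp_left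
        hc.continuous_split.continuousAt)
      exact (h1.smoothVia_chart hW continuousAt_id hφ' hz').congr hev
    · refine SmoothVia.of_comp_left (f := fun c' => ofCone (hc.split c')) hf ?_
      have h1 := coordVia_split hc hW hb (isCoord_of_mem_stAtlas hW hφ' hz' hb)
      exact (h1.smoothVia_chart hW₁ hc.continuous_split.continuousAt hφ hz).congr_left hev

theorem isSmooth_canonical (hc : IsRoundComposite e₀₁ e₁₂ e₀₂) (hW : W.IsEncasedMirror)
    (Φ : StSpace e₁₂ (St e₀₁ W) ≃ₜ StSpace e₀₂ W) (hΦ : ∀ z, Corresponds z (Φ z)) :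
    (St e₁₂ (St e₀₁ W)).IsSmooth (St e₀₂ W) Φ ∧ (St e₀₂ W).IsSmooth (St e₁₂ (St e₀₁ W)) Φ.symm := by
  refine ⟨PreCob.isSmooth_iff.2 ⟨Φ.continuous, fun z φ' hφ' hz' φ hφ hz =>
    (smoothVia_canonical hc hW Φ hΦ hφ hφ' hz hz').1⟩,
    PreCob.isSmooth_iff.2 ⟨Φ.symm.continuous, fun y φ hφ hz φ' hφ' hz' => ?_⟩⟩
  have hz'' : Φ (Φ.symm y) ∈ φ'.source :=
    mem_of_eq_of_mem (Φ.apply_symm_apply y) hz'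
  exact ((smoothVia_canonical hc hW Φ hΦ hφ hφ' hz hz'').2.comp_left rfl
    Φ.symm.continuous.continuousAt).congr_left
      (Eventually.of_forall fun y' => congrArg φ' (Φ.apply_symm_apply y'))

end SmoothCanonical

/-! ### Associated points -/

section Associated

variable {n m : ℕ} {M : GMfd.{u} G n} {M' : GMfd.{u} G m} {e : RoundTub M M'} {W W' : PreCob M}

theorem assoc_smul_iff (g : G) {z : StSpace e W} {w : W.X} :
    Assoc e W (g • z) (g • w) ↔ Assoc e W z w := by
  have key : ∀ (g : G) (z : StSpace e W) (w : W.X), Assoc e W z w → Assoc e W (g • z) (g • w) := by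
    rintro g _ _ ⟨b, rfl, rfl⟩
    exact ⟨smulCone e W g b, rfl, rfl⟩
  refine ⟨fun h => ?_, key g z w⟩
  have h1 := key g⁻¹ _ _ h
  rwa [inv_smul_smul, inv_smul_smul] at h1

theorem assoc_flip_iff {z : StSpace e W} {w : W.X} :
    Assoc e W (stFlip e W z) w ↔ Assoc e W z w := by
  have key : ∀ (z : StSpace e W), Assoc e W z w → Assoc e W (stFlip e W z) w := by
    rintro _ ⟨b, rfl, rfl⟩
    exact ⟨flipCone e W b, rfl, rfl⟩
  have hff : stFlip e W (stFlip e W z) = z := by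
    induction z using StSpace.ind with
    | ht a => exact congrArg ofTrivial (Subtype.ext (Prod.ext rfl (neg_neg a.1.2)))
    | hc b => exact congrArg ofCone (Subtype.ext (Prod.ext rfl (Prod.ext rfl (neg_neg b.1.2.2))))
  refine ⟨fun h => ?_, key z⟩
  have h1 := key _ h
  rwa [hff] at h1

/-- The case that needs an argument is a trivial point glued to a point of the second nontrivial
part. Its associated point is on the boundary, and the boundary point of the first cobordism with
the same encasing value is a preimage. -/
theorem assoc_stab_iff (hW : W.IsEncasedMirror) (hW' : W'.IsEncasedMirror) (f : PreHom W W')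
    (z : StSpace e W) (w' : W'.X) :
    Assoc e W' (f.stab e z) w' ↔ ∃ w, f w = w' ∧ Assoc e W z w := by
  constructor
  · intro h
    induction z using StSpace.ind with
    | ht a =>
      obtain ⟨b', hb', rfl⟩ := h
      have hbd : b'.1.1 ∈ W'.bd := mem_bd_of_ofTrivial_eq (a := a) hb'.symm
      obtain ⟨w, hw, hwb⟩ := hW.exists_bd (q := W'.rho b'.1.1) (hW'.h_mem _) (hW'.bd_cases hbd)
      have hr : W.r w = W'.r b'.1.1 := congrArg Prod.fst hwb
      have hh : W.h w = W'.h b'.1.1 := congrArg Prod.snd hwb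
      have hfw : f w = b'.1.1 := hW'.rho_injOn_bd (f.map_bd w hw) hbd
        (Prod.ext ((f.map_r w).trans hr) ((f.map_h w).trans hh))
      have h1 : stRho e W' (ofCone b') = a.1 := congrArg (stRho e W') hb'
      let b : conePart e W := ⟨(w, b'.1.2), hh.trans_le b'.2.1, hr.trans b'.2.2.1,
        (congrArg (· ^ 2) hh).trans b'.2.2.2⟩
      exact ⟨w, hfw, b, (Quot.sound (Glue.glue a b hw (congrArg Prod.fst h1)
        (congrArg Prod.snd h1))).symm, rfl⟩
    | hc b =>
      exact ⟨b.1.1, (assoc_ofCone_iff hW' (b := f.mapCone e b)).1 h, b, rfl, rfl⟩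
  · rintro ⟨_, rfl, b, rfl, rfl⟩
    exact ⟨f.mapCone e b, rfl, rfl⟩

end Associated

/-! ### Existence, naturality and associativity of the canonical map -/

section Canonical

variable {n₀ n₁ n₂ n₃ : ℕ} {M₀ : GMfd.{u} G n₀} {M₁ : GMfd.{u} G n₁} {M₂ : GMfd.{u} G n₂}
  {M₃ : GMfd.{u} G n₃} {e₀₁ : RoundTub M₀ M₁} {e₁₂ : RoundTub M₁ M₂} {e₂₃ : RoundTub M₂ M₃}
  {e₀₂ : RoundTub M₀ M₂} {e₁₃ : RoundTub M₁ M₃} {e₀₃ : RoundTub M₀ M₃} {W W' : PreCob M₀}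

theorem isCanonical_iff {F : (St e₁₂ (St e₀₁ W)).X → (St e₀₂ W).X} :
    IsCanonical e₀₁ e₁₂ e₀₂ W F ↔ ∀ z, Corresponds z (F z) :=
  ⟨fun h z => ⟨Prod.ext (h.map_r z) (h.map_h z), h.map_assoc z⟩,
    fun h => ⟨fun z => congrArg Prod.fst (h z).1, fun z => congrArg Prod.snd (h z).1,
      fun z => (h z).2⟩⟩

theorem IsCanonical.unique (hW : W.IsEncasedMirror)
    {F F' : (St e₁₂ (St e₀₁ W)).X → (St e₀₂ W).X} (h : IsCanonical e₀₁ e₁₂ e₀₂ W F)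
    (h' : IsCanonical e₀₁ e₁₂ e₀₂ W F') : F = F' :=
  funext fun z => (isCanonical_iff.1 h z).right_unique hW (isCanonical_iff.1 h' z)

/-- With uniqueness of the corresponding point, this makes the canonical map equivariant. -/
theorem Corresponds.smul (g : G) {z : StSpace e₁₂ (St e₀₁ W)} {z' : StSpace e₀₂ W}
    (h : Corresponds z z') : Corresponds (g • z) (g • z') := by
  refine ⟨Prod.ext ?_ ?_, fun w => ?_⟩
  · exact ((St e₀₂ W).r_smul g z').trans ((congrArg (fun q => g • q.1) h.1).trans
      ((St e₁₂ (St e₀₁ W)).r_smul g z).symm)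
  · exact ((St e₀₂ W).h_smul g z').trans ((congrArg Prod.snd h.1).trans
      ((St e₁₂ (St e₀₁ W)).h_smul g z).symm)
  · have h1 := h.2 (g⁻¹ • w)
    rw [← assoc_smul_iff g, smul_inv_smul] at h1
    refine h1.trans ⟨?_, ?_⟩
    · rintro ⟨w₁, h2, h3⟩
      refine ⟨g • w₁, (assoc_smul_iff g).2 h2, ?_⟩
      have h4 := (assoc_smul_iff g).2 h3
      rwa [smul_inv_smul] at h4
    · rintro ⟨w₁, h2, h3⟩
      refine ⟨g⁻¹ • w₁, ?_, (assoc_smul_iff g⁻¹).2 h3⟩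
      have h4 := (assoc_smul_iff g⁻¹).2 h2
      rwa [inv_smul_smul] at h4

theorem Corresponds.flip {z : StSpace e₁₂ (St e₀₁ W)} {z' : StSpace e₀₂ W}
    (h : Corresponds z z') : Corresponds (stFlip e₁₂ (St e₀₁ W) z) (stFlip e₀₂ W z') := by
  have key : ∀ {n m : ℕ} {M : GMfd.{u} G n} {M' : GMfd.{u} G m} (e : RoundTub M M') (V : PreCob M)
      (z : StSpace e V), stRho e V (stFlip e V z) = (stR e V z, -stH e V z) := by
    intro n m M M' e V z
    induction z using StSpace.ind <;> rfl
  refine ⟨?_, fun w => ?_⟩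
  · rw [key, key]
    exact congrArg (fun q => (q.1, -q.2)) h.1
  · simp only [assoc_flip_iff]
    exact h.2 w

theorem exists_canonical (hc : IsRoundComposite e₀₁ e₁₂ e₀₂) (hW : W.IsEncasedMirror) :
    ∃ Φ : PreHom (St e₁₂ (St e₀₁ W)) (St e₀₂ W), IsCanonical e₀₁ e₁₂ e₀₂ W Φ ∧
      IsHomeomorph Φ ∧ Φ.IsEncasedDiffeo := by
  obtain ⟨F, hF⟩ := exists_canonicalHomeo hc hW
  let Φ : PreHom (St e₁₂ (St e₀₁ W)) (St e₀₂ W) :=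
    { toFun := F
      map_r := fun z => congrArg Prod.fst (hF z).1
      map_h := fun z => congrArg Prod.snd (hF z).1
      map_bd := by
        rintro _ ⟨a, rfl, h⟩
        have hout : IsOuter e₀₁ e₁₂ W (ofTrivial a) := Or.inl ⟨a, rfl⟩
        exact ⟨⟨_, hout.stRho_mem hc hW⟩,
          (hout.corresponds hc hW rfl).right_unique hW (hF _), h⟩ }
  refine ⟨Φ, isCanonical_iff.2 hF, F.isHomeomorph, ?_⟩
  obtain ⟨h1, h2⟩ := isSmooth_canonical hc hW F hF
  exact PreHom.isEncasedDiffeo (isEncasedMirror_st (isEncasedMirror_st hW)) Φ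
    (fun g z => (hF (g • z)).right_unique hW ((hF z).smul g))
    (fun z => (hF (stFlip e₁₂ (St e₀₁ W) z)).right_unique hW (hF z).flip) h1
    ⟨F.symm, F.symm_apply_apply, F.apply_symm_apply, h2⟩

/-- Both composites preserve encasing values and send an associated point to its image under f; such
data determine a point. -/
theorem canonical_natural (hW : W.IsEncasedMirror) (hW' : W'.IsEncasedMirror) (f : PreHom W W')
    {Φ : (St e₁₂ (St e₀₁ W)).X → (St e₀₂ W).X} {Φ' : (St e₁₂ (St e₀₁ W')).X → (St e₀₂ W').X}
    (hΦ : IsCanonical e₀₁ e₁₂ e₀₂ W Φ) (hΦ' : IsCanonical e₀₁ e₁₂ e₀₂ W' Φ')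
    (z : (St e₁₂ (St e₀₁ W)).X) :
    Φ' (((f.stab e₀₁).stab e₁₂) z) = (f.stab e₀₂) (Φ z) := by
  have hW₁ := isEncasedMirror_st (e := e₀₁) hW
  have hW₁' := isEncasedMirror_st (e := e₀₁) hW'
  refine st_ext hW' (Prod.ext ?_ ?_) fun w' => ?_
  · exact (hΦ'.map_r _).trans ((((f.stab e₀₁).stab e₁₂).map_r z).trans
      ((hΦ.map_r z).symm.trans ((f.stab e₀₂).map_r _).symm))
  · exact (hΦ'.map_h _).trans ((((f.stab e₀₁).stab e₁₂).map_h z).trans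
      ((hΦ.map_h z).symm.trans ((f.stab e₀₂).map_h _).symm))
  · refine (hΦ'.map_assoc _ w').trans (Iff.trans ?_ (assoc_stab_iff hW hW' f (Φ z) w').symm)
    constructor
    · rintro ⟨w₁', h1, h2⟩
      obtain ⟨w₁, rfl, h3⟩ := (assoc_stab_iff hW₁ hW₁' (f.stab e₀₁) z w₁').1 h1
      obtain ⟨w, rfl, h4⟩ := (assoc_stab_iff hW hW' f w₁ w').1 h2
      exact ⟨w, rfl, (hΦ.map_assoc z w).2 ⟨w₁, h3, h4⟩⟩
    · rintro ⟨w, rfl, h1⟩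
      obtain ⟨w₁, h2, h3⟩ := (hΦ.map_assoc z w).1 h1
      exact ⟨_, (assoc_stab_iff hW₁ hW₁' (f.stab e₀₁) z _).2 ⟨w₁, rfl, h2⟩,
        (assoc_stab_iff hW hW' f w₁ _).2 ⟨w, rfl, h3⟩⟩

/-- Both bracketings describe triples with |x|² + |x'|² + |x''|² ≤ 1, and each partial sum needed
for an intermediate composite is bounded by the full one. -/
theorem IsRoundComposite.assoc (h₀₁₂ : IsRoundComposite e₀₁ e₁₂ e₀₂)
    (h₁₂₃ : IsRoundComposite e₁₂ e₂₃ e₁₃) (h₀₂₃ : IsRoundComposite e₀₂ e₂₃ e₀₃) :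
    IsRoundComposite e₀₁ e₁₃ e₀₃ := by
  constructor
  · intro z
    have h1 := h₀₂₃.nrm_sq z
    have h2 := h₀₁₂.nrm_sq (h₀₂₃.left z)
    have h3 : e₂₃.p (h₀₂₃.right z) = e₁₂.e (h₀₁₂.right (h₀₂₃.left z)) := by
      rw [h₀₂₃.p_right, h₀₁₂.e_right]
    have h4 : e₀₃.nrm z ^ 2 ≤ 1 := pow_le_one₀ (e₀₃.nrm_nonneg z) (e₀₃.nrm_le_one z)
    obtain ⟨y, hy⟩ := h₁₂₃.2 _ _ h3 (by nlinarith [sq_nonneg (e₀₁.nrm (h₀₁₂.left (h₀₂₃.left z)))])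
    obtain ⟨h5, h6⟩ := h₁₂₃.eq_of_e_eq hy h3
    refine ⟨h₀₁₂.left (h₀₂₃.left z), y, ?_, ?_, ?_, by linarith⟩
    · rw [h5, h₀₁₂.p_right]
    · rw [hy, h₀₂₃.e_right]
    · rw [h₀₁₂.p_left, h₀₂₃.p_left]
  · intro x y hxy hle
    have h1 := h₁₂₃.nrm_sq y
    have h2 : e₁₂.p (h₁₂₃.left y) = e₀₁.e x := by rw [h₁₂₃.p_left, hxy]
    obtain ⟨x₂, hx₂⟩ := h₀₁₂.2 x (h₁₂₃.left y) h2
      (by nlinarith [sq_nonneg (e₂₃.nrm (h₁₂₃.right y))])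
    obtain ⟨-, h4⟩ := h₀₁₂.eq_of_e_eq hx₂ h2
    obtain ⟨z, hz⟩ := h₀₂₃.2 x₂ (h₁₂₃.right y) (by rw [h₁₂₃.p_right, hx₂]) (by linarith)
    exact ⟨z, by rw [hz, h₁₂₃.e_right]⟩

/-- Along both routes the point associated in the original cobordism is reached by the same chain of
three associated points, and encasing values never change. -/
theorem canonical_assoc (hW : W.IsEncasedMirror)
    {a : PreHom (St e₁₂ (St e₀₁ W)) (St e₀₂ W)} {b c d}
    (ha : IsCanonical e₀₁ e₁₂ e₀₂ W a) (hb : IsCanonical e₀₂ e₂₃ e₀₃ W b)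
    (hc : IsCanonical e₁₂ e₂₃ e₁₃ (St e₀₁ W) c) (hd : IsCanonical e₀₁ e₁₃ e₀₃ W d)
    (z : (St e₂₃ (St e₁₂ (St e₀₁ W))).X) : b ((a.stab e₂₃) z) = d (c z) := by
  have hW₁ := isEncasedMirror_st (e := e₁₂) (isEncasedMirror_st (e := e₀₁) hW)
  have hW₂ := isEncasedMirror_st (e := e₀₂) hW
  refine st_ext hW (Prod.ext ?_ ?_) fun w => ?_
  · exact (hb.map_r _).trans (((a.stab e₂₃).map_r z).trans
      ((hc.map_r z).symm.trans (hd.map_r _).symm))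
  · exact (hb.map_h _).trans (((a.stab e₂₃).map_h z).trans
      ((hc.map_h z).symm.trans (hd.map_h _).symm))
  · refine (hb.map_assoc _ w).trans (Iff.trans ?_ (hd.map_assoc _ w).symm)
    constructor
    · rintro ⟨w₂, h1, h2⟩
      obtain ⟨w₁, rfl, h3⟩ := (assoc_stab_iff hW₁ hW₂ a z w₂).1 h1
      obtain ⟨v, h4, h5⟩ := (ha.map_assoc w₁ w).1 h2
      exact ⟨v, (hc.map_assoc z v).2 ⟨w₁, h3, h4⟩, h5⟩
    · rintro ⟨v, h1, h2⟩
      obtain ⟨w₁, h3, h4⟩ := (hc.map_assoc z v).1 h1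
      exact ⟨a w₁, (assoc_stab_iff hW₁ hW₂ a z _).2 ⟨w₁, rfl, h3⟩,
        (ha.map_assoc w₁ w).2 ⟨v, h4, h2⟩⟩

end Canonical

end

end PolarStab

theorem mainTheorem4 (G : Type v) [Group G] [Finite G] :
    -- the stabilization of an encased mirror cobordism is an encased mirror cobordism, and
    -- stabilization preserves encased diffeomorphisms
    (∀ {n m : ℕ} {M : PolarStab.GMfd.{u} G n} {M' : PolarStab.GMfd.{u} G m}
      (e : PolarStab.RoundTub M M') (W : PolarStab.PreCob M), W.IsEncasedMirror →
      (PolarStab.St e W).IsEncasedMirror ∧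
      ∀ (W' : PolarStab.PreCob M), W'.IsEncasedMirror → ∀ f : PolarStab.PreHom W W',
        f.IsEncasedDiffeo → (f.stab e).IsEncasedDiffeo) ∧
    -- the canonical map exists, is unique, and is a homeomorphism and an encased diffeomorphism
    (∀ {n₀ n₁ n₂ : ℕ} {M₀ : PolarStab.GMfd.{u} G n₀} {M₁ : PolarStab.GMfd.{u} G n₁}
      {M₂ : PolarStab.GMfd.{u} G n₂} (e₀₁ : PolarStab.RoundTub M₀ M₁)
      (e₁₂ : PolarStab.RoundTub M₁ M₂) (e₀₂ : PolarStab.RoundTub M₀ M₂),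
      PolarStab.IsRoundComposite e₀₁ e₁₂ e₀₂ →
      ∀ W : PolarStab.PreCob M₀, W.IsEncasedMirror →
      ∃ Φ : PolarStab.PreHom (PolarStab.St e₁₂ (PolarStab.St e₀₁ W)) (PolarStab.St e₀₂ W),
        PolarStab.IsCanonical e₀₁ e₁₂ e₀₂ W Φ ∧
        (∀ F, PolarStab.IsCanonical e₀₁ e₁₂ e₀₂ W F → F = Φ) ∧
        IsHomeomorph Φ ∧ Φ.IsEncasedDiffeo) ∧
    -- naturality in encased diffeomorphisms
    (∀ {n₀ n₁ n₂ : ℕ} {M₀ : PolarStab.GMfd.{u} G n₀} {M₁ : PolarStab.GMfd.{u} G n₁}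
      {M₂ : PolarStab.GMfd.{u} G n₂} (e₀₁ : PolarStab.RoundTub M₀ M₁)
      (e₁₂ : PolarStab.RoundTub M₁ M₂) (e₀₂ : PolarStab.RoundTub M₀ M₂),
      PolarStab.IsRoundComposite e₀₁ e₁₂ e₀₂ →
      ∀ W W' : PolarStab.PreCob M₀, W.IsEncasedMirror → W'.IsEncasedMirror →
      ∀ f : PolarStab.PreHom W W', f.IsEncasedDiffeo →
      ∀ Φ Φ', PolarStab.IsCanonical e₀₁ e₁₂ e₀₂ W Φ → PolarStab.IsCanonical e₀₁ e₁₂ e₀₂ W' Φ' →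
      ∀ z, Φ' (((f.stab e₀₁).stab e₁₂) z) = (f.stab e₀₂) (Φ z)) ∧
    -- associativity
    (∀ {n₀ n₁ n₂ n₃ : ℕ} {M₀ : PolarStab.GMfd.{u} G n₀} {M₁ : PolarStab.GMfd.{u} G n₁}
      {M₂ : PolarStab.GMfd.{u} G n₂} {M₃ : PolarStab.GMfd.{u} G n₃}
      (e₀₁ : PolarStab.RoundTub M₀ M₁) (e₁₂ : PolarStab.RoundTub M₁ M₂)
      (e₂₃ : PolarStab.RoundTub M₂ M₃) (e₀₂ : PolarStab.RoundTub M₀ M₂)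
      (e₁₃ : PolarStab.RoundTub M₁ M₃) (e₀₃ : PolarStab.RoundTub M₀ M₃),
      PolarStab.IsRoundComposite e₀₁ e₁₂ e₀₂ → PolarStab.IsRoundComposite e₁₂ e₂₃ e₁₃ →
      PolarStab.IsRoundComposite e₀₂ e₂₃ e₀₃ →
      PolarStab.IsRoundComposite e₀₁ e₁₃ e₀₃ ∧
      ∀ W : PolarStab.PreCob M₀, W.IsEncasedMirror →
      ∀ (a : PolarStab.PreHom (PolarStab.St e₁₂ (PolarStab.St e₀₁ W)) (PolarStab.St e₀₂ W)) (b c d),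
        PolarStab.IsCanonical e₀₁ e₁₂ e₀₂ W a → PolarStab.IsCanonical e₀₂ e₂₃ e₀₃ W b →
        PolarStab.IsCanonical e₁₂ e₂₃ e₁₃ (PolarStab.St e₀₁ W) c →
        PolarStab.IsCanonical e₀₁ e₁₃ e₀₃ W d →
        ∀ z, b ((a.stab e₂₃) z) = d (c z)) := by
  refine ⟨fun e W hW => ⟨PolarStab.isEncasedMirror_st hW, fun W' hW' f hf =>
      PolarStab.isEncasedDiffeo_stab hW hW' hf⟩, fun e₀₁ e₁₂ e₀₂ hc W hW => ?_,
    fun e₀₁ e₁₂ e₀₂ _ W W' hW hW' f _ Φ Φ' hΦ hΦ' z =>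
      PolarStab.canonical_natural hW hW' f hΦ hΦ' z,
    fun e₀₁ e₁₂ e₂₃ e₀₂ e₁₃ e₀₃ h₀₁₂ h₁₂₃ h₀₂₃ => ⟨h₀₁₂.assoc h₁₂₃ h₀₂₃,
      fun W hW a b c d ha hb hc hd z => PolarStab.canonical_assoc hW ha hb hc hd z⟩⟩
  obtain ⟨Φ, hΦ, hhomeo, hdiffeo⟩ := PolarStab.exists_canonical hc hW
  exact ⟨Φ, hΦ, fun F hF => hF.unique hW hΦ, hhomeo, hdiffeo⟩
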